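/- Let $k$ be a field, $S$ a smooth $k$-scheme, $n \ge r \ge 1$ integers, and $\mathcal H$ a vector bundle of rank $n$ on $S$. Let $p, q : S \to \mathrm{Fl}(\mathcal H)$ be sections of the complete flag bundle, i.e. complete flags $0 = p_0 \subset p_1 \subset \cdots \subset p_n = \mathcal H$ and $0 = q_0 \subset \cdots \subset q_n = \mathcal H$ of subbundles with $\operatorname{rank} p_m = \operatorname{rank} q_m = m$. Assume that $p, q$ are \emph{versal}: the morphism $\Phi_{p,q} : \mathrm{Fr}(\mathcal H) \to \mathrm{Fl}(k^n) \times_k \mathrm{Fl}(k^n)$ from the frame bundle of $\mathcal H$, sending a frame $e : k^n \xrightarrow{\sim} \mathcal H_x$ to $(e^{-1}(p_x), e^{-1}(q_x))$, is smooth. Let $\lambda, \lambda'$ be $\mathrm{Gr}(r,n)$-admissible partitions, i.e. $n - r \ge \lambda_1 \ge \cdots \ge \lambda_r \ge 0$, and likewise for $\lambda'$. Write $\lambda = (\mu_1^{i_1}, \dots, \mu_j^{i_j})$ with $n-r \ge \mu_1 > \cdots > \mu_j \ge 0$, all $i_s \ge 1$ and $\sum_s i_s = r$, and put $a_s = i_1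 + \cdots + i_s$, so that $a_j = r$. Define \[ X_\lambda(p) = \{(x, V \subseteq \mathcal H_x) : \dim V \cap (p_x)_{n-r+i-\lambda_i} \ge i \text{ for } 1 \le i \le r\} \subseteq \mathrm{Gr}(r, \mathcal H), \] with the determinantal closed subscheme structure (the map $V \to \mathcal H/p_{n-r+i-\lambda_i}$ on the tautological subbundle $V$ has rank at most $r-i$), and \[ Z_\lambda(p) = \{(x, V_1 \subset \cdots \subset V_j) : \dim V_s = a_s,\ V_s \subseteq (p_x)_{n-r+a_s-\lambda_{a_s}} \text{ for } 1 \le s \le j\} \subseteq \mathrm{Fl}(a_1, \dots, a_j; \mathcal H), \] the closed subscheme where each $V_s \to \mathcal H/p_{n-r+a_s-\lambda_{a_s}}$ vanishes, which maps to $\mathrm{Gr}(r, \mathcal H)$ by $(x, V_\bullet) \mapsto (x, V_j)$. Define $X_{\lambda'}(q)$ and $Z_{\lambda'}(q)$ in the same way. Then the bundles $\mathrm{Gr}(r,\mathcal H)$ and the partial flag bundles containing $Z_\lambda(p)$ and $Z_{\lambda'}(q)$ exist as schemes (representing the usual functors of flags of subbundles), and: \begin{enumerate} \item the scheme $Z_\lambda(p)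 \times_{\mathrm{Gr}(r,\mathcal H)} Z_{\lambda'}(q)$ is smooth over $k$; \item the projection $Z_\lambda(p) \times_{\mathrm{Gr}(r,\mathcal H)} Z_{\lambda'}(q) \to \mathrm{Gr}(r,\mathcal H)$ factors through the scheme-theoretic intersection $X_\lambda(p) \cap X_{\lambda'}(q)$, and the resulting morphism \[ Z_\lambda(p) \times_{\mathrm{Gr}(r,\mathcal H)} Z_{\lambda'}(q) \to X_\lambda(p) \cap X_{\lambda'}(q) \] is proper and birational, meaning that it restricts to an isomorphism over a dense open subscheme of the target whose preimage is dense in the source. \end{enumerate} Hence $Z_\lambda(p) \times_{\mathrm{Gr}(r,\mathcal H)} Z_{\lambda'}(q)$ is a resolution of singularities of the relative Grassmannian Richardson variety $X_\lambda(p) \cap X_{\lambda'}(q)$. -/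

import Mathlib

open CategoryTheory AlgebraicGeometry

universe u

namespace RelGrass

noncomputable section

/-! ### Sections, local frames, vector bundles -/

/-- Restriction of sections of a sheaf of modules to a smaller open. -/
def res {X : Scheme.{u}} (M : X.Modules) {W U : X.Opens} (h : W ≤ U) (x : Γ(M, U)) : Γ(M, W) :=
  M.presheaf.map (homOfLE h).op x

/-- Sections `e i` of `M` over `U` form a frame if they identify `M|_U` with `𝒪_U^ι`. -/
def IsFrame {X : Scheme.{u}} (M : X.Modules) {ι : Type} [Fintype ι] (U : X.Opens)
    (e : ι → Γ(M, U)) : Prop :=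
  ∀ (W : X.Opens) (h : W ≤ U),
    Function.Bijective (fun c : ι → Γ(X, W) => ∑ i, c i • res M h (e i))

/-- `M` is a vector bundle (locally free sheaf) of rank `n`. -/
def IsVectorBundle {X : Scheme.{u}} (M : X.Modules) (n : ℕ) : Prop :=
  ∀ x : X, ∃ U : X.Opens, x ∈ U ∧ ∃ e : Fin n → Γ(M, U), IsFrame M U e

/-! ### Subsheaves of modules and subbundles -/

/-- An `𝒪_X`-submodule sheaf of `M`. -/
@[ext]
structure Subsheaf {X : Scheme.{u}} (M : X.Modules) where
  /-- the sections over an open -/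
  sec : ∀ U : X.Opens, Submodule Γ(X, U) Γ(M, U)
  res_mem : ∀ {W U : X.Opens} (h : W ≤ U) {x : Γ(M, U)}, x ∈ sec U → res M h x ∈ sec W
  of_local : ∀ {U : X.Opens} (x : Γ(M, U)),
    (∀ t ∈ U, ∃ (W : X.Opens) (h : W ≤ U), t ∈ W ∧ res M h x ∈ sec W) → x ∈ sec U

namespace Subsheaf

variable {X : Scheme.{u}} {M N : X.Modules}

instance : LE (Subsheaf M) := ⟨fun A B => ∀ U, A.sec U ≤ B.sec U⟩

/-- `A` is a subbundle of rank `d` of `M`: locally on `X` there is a frame of `M` whose first `d`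
members span `A`. (Equivalently, `A` and `M / A` are locally free, `A` of rank `d`, whenever `M` is
a vector bundle.) -/
def IsSubbundle (A : Subsheaf M) (d : ℕ) : Prop :=
  ∀ x : X, ∃ U : X.Opens, x ∈ U ∧ ∃ (m : ℕ) (e : Fin d ⊕ Fin m → Γ(M, U)), IsFrame M U e ∧
    ∀ (W : X.Opens) (h : W ≤ U),
      A.sec W = Submodule.span Γ(X, W) (Set.range fun i : Fin d => res M h (e (Sum.inl i)))

end Subsheaf

theorem res_res {X : Scheme.{u}} (M : X.Modules) {W V U : X.Opens} (h : W ≤ V) (h' : V ≤ U)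
    (x : Γ(M, U)) : res M h (res M h' x) = res M (h.trans h') x := by
  unfold res
  rw [← ConcreteCategory.comp_apply, ← Functor.map_comp]
  rfl

theorem res_self {X : Scheme.{u}} (M : X.Modules) {U : X.Opens} (h : U ≤ U)
    (x : Γ(M, U)) : res M h x = x := by
  unfold res
  have : (homOfLE h).op = 𝟙 (Opposite.op U) := rfl
  rw [this, M.presheaf.map_id]
  rfl

theorem res_add {X : Scheme.{u}} (M : X.Modules) {W U : X.Opens} (h : W ≤ U)
    (x y : Γ(M, U)) : res M h (x + y) = res M h x + res M h y := map_add _ _ _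

theorem res_zero {X : Scheme.{u}} (M : X.Modules) {W U : X.Opens} (h : W ≤ U) :
    res M h (0 : Γ(M, U)) = 0 := map_zero _

theorem res_smul {X : Scheme.{u}} (M : X.Modules) {W U : X.Opens} (h : W ≤ U)
    (r : Γ(X, U)) (x : Γ(M, U)) :
    res M h (r • x) = X.presheaf.map (homOfLE h).op r • res M h x :=
  Scheme.Modules.map_smul M (homOfLE h) r x

theorem res_app {X : Scheme.{u}} {M N : X.Modules} (φ : M ⟶ N) {W U : X.Opens} (h : W ≤ U)
    (x : Γ(M, U)) : res N h (φ.app U x) = φ.app W (res M h x) :=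
  (ConcreteCategory.congr_hom (φ.mapPresheaf.naturality (homOfLE h).op) x).symm

/-- The sections over `W` that are restrictions of the given sections `𝒮`. -/
def restrictions {X : Scheme.{u}} {M : X.Modules} (𝒮 : ∀ U : X.Opens, Set Γ(M, U))
    (W : X.Opens) : Set Γ(M, W) :=
  {y | ∃ (U : X.Opens) (h : W ≤ U), ∃ s ∈ 𝒮 U, y = res M h s}

theorem res_mem_span {X : Scheme.{u}} {M : X.Modules} (𝒮 : ∀ U : X.Opens, Set Γ(M, U))
    {W U : X.Opens} (h : W ≤ U) {x : Γ(M, U)}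
    (hx : x ∈ Submodule.span Γ(X, U) (restrictions 𝒮 U)) :
    res M h x ∈ Submodule.span Γ(X, W) (restrictions 𝒮 W) := by
  induction hx using Submodule.span_induction with
  | mem x hx =>
    obtain ⟨U', h', s, hs, rfl⟩ := hx
    exact Submodule.subset_span ⟨U', h.trans h', s, hs, res_res M h h' s⟩
  | zero => rw [res_zero]; exact zero_mem _
  | add x y _ _ hx hy => rw [res_add]; exact add_mem hx hy
  | smul r x _ hx => rw [res_smul]; exact Submodule.smul_mem _ _ hx

/-- The subsheaf of modules of `M` generated by a family of local sections: the sections that are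
locally linear combinations of (restrictions of) the given ones. -/
def Subsheaf.generatedBy {X : Scheme.{u}} {M : X.Modules} (𝒮 : ∀ U : X.Opens, Set Γ(M, U)) :
    Subsheaf M where
  sec U :=
    { carrier := {x | ∀ t ∈ U, ∃ (W : X.Opens) (h : W ≤ U), t ∈ W ∧
        res M h x ∈ Submodule.span Γ(X, W) (restrictions 𝒮 W)}
      zero_mem' := fun t ht => ⟨U, le_rfl, ht, by rw [res_zero]; exact zero_mem _⟩
      add_mem' := by
        intro x y hx hy t ht
        obtain ⟨W, h, htW, hW⟩ := hx t ht
        obtain ⟨W', h', htW', hW'⟩ := hy t ht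
        refine ⟨W ⊓ W', inf_le_left.trans h, ⟨htW, htW'⟩, ?_⟩
        have h1 := res_mem_span 𝒮 (inf_le_left : W ⊓ W' ≤ W) hW
        have h2 := res_mem_span 𝒮 (inf_le_right : W ⊓ W' ≤ W') hW'
        rw [res_res] at h1 h2
        rw [res_add]
        exact add_mem h1 h2
      smul_mem' := by
        intro r x hx t ht
        obtain ⟨W, h, htW, hW⟩ := hx t ht
        exact ⟨W, h, htW, by rw [res_smul]; exact Submodule.smul_mem _ _ hW⟩ }
  res_mem := by
    intro W U h x hx t ht
    obtain ⟨W', h', htW', hW'⟩ := hx t (h ht)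
    refine ⟨W ⊓ W', inf_le_left, ⟨ht, htW'⟩, ?_⟩
    have h1 := res_mem_span 𝒮 (inf_le_right : W ⊓ W' ≤ W') hW'
    rw [res_res] at h1 ⊢
    exact h1
  of_local := by
    intro U x hx t ht
    obtain ⟨W, h, htW, hW⟩ := hx t ht
    obtain ⟨W', h', htW', hW'⟩ := hW t htW
    exact ⟨W', h'.trans h, htW', by rwa [res_res] at hW'⟩

/-- The preimage of a subsheaf under a morphism of sheaves of modules. -/
def Subsheaf.comap {X : Scheme.{u}} {M N : X.Modules} (φ : M ⟶ N) (A : Subsheaf N) :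
    Subsheaf M where
  sec U :=
    { carrier := {x | φ.app U x ∈ A.sec U}
      zero_mem' := by
        change φ.app U 0 ∈ A.sec U
        rw [map_zero]; exact zero_mem _
      add_mem' := by
        intro x y hx hy
        change φ.app U (x + y) ∈ A.sec U
        rw [map_add]; exact add_mem hx hy
      smul_mem' := by
        intro r x hx
        change φ.app U (r • x) ∈ A.sec U
        rw [Scheme.Modules.Hom.app_smul]; exact Submodule.smul_mem _ _ hx }
  res_mem := by
    intro W U h x hx
    change φ.app W (res M h x) ∈ A.sec W
    rw [← res_app]
    exact A.res_mem h hx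
  of_local := by
    intro U x hx
    refine A.of_local _ fun t ht => ?_
    obtain ⟨W, h, htW, hW⟩ := hx t ht
    refine ⟨W, h, htW, ?_⟩
    rw [res_app]
    exact hW

/-! ### Pullback of sections and of subsheaves -/

/-- The pullback `g^* x` of a section along `g : T ⟶ Y`. -/
def pullSec {T Y : Scheme.{u}} (g : T ⟶ Y) (M : Y.Modules) {U : Y.Opens} (x : Γ(M, U)) :
    Γ((Scheme.Modules.pullback g).obj M, g ⁻¹ᵁ U) :=
  ((Scheme.Modules.pullbackPushforwardAdjunction g).unit.app M).app U x

/-- The canonical isomorphism `g^* π^* H ≅ f^* H` when `g ≫ π = f`. -/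
def pullIso {T Y S : Scheme.{u}} {g : T ⟶ Y} {π : Y ⟶ S} {f : T ⟶ S} (w : g ≫ π = f)
    (H : S.Modules) :
    (Scheme.Modules.pullback g).obj ((Scheme.Modules.pullback π).obj H) ≅
      (Scheme.Modules.pullback f).obj H :=
  (Scheme.Modules.pullbackComp g π).app H ≪≫ (Scheme.Modules.pullbackCongr w).app H

/-- The pullback along the `S`-morphism `g : T ⟶ Y` of a section of `π^* H`, as a section of
`f^* H`. -/
def pullSecOver {T Y S : Scheme.{u}} {g : T ⟶ Y} {π : Y ⟶ S} {f : T ⟶ S} (w : g ≫ π = f)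
    (H : S.Modules) {U : Y.Opens} (x : Γ((Scheme.Modules.pullback π).obj H, U)) :
    Γ((Scheme.Modules.pullback f).obj H, g ⁻¹ᵁ U) :=
  (pullIso w H).hom.app (g ⁻¹ᵁ U) (pullSec g _ x)

/-- The subsheaf of `g^* M` generated by the pullbacks of the sections of a subsheaf of `M`,
i.e. the image of `g^* A ⟶ g^* M`. -/
def Subsheaf.pullback {T Y : Scheme.{u}} (g : T ⟶ Y) {M : Y.Modules} (A : Subsheaf M) :
    Subsheaf ((Scheme.Modules.pullback g).obj M) :=
  Subsheaf.generatedBy fun W =>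
    {y | ∃ (U : Y.Opens) (h : W = g ⁻¹ᵁ U), ∃ x ∈ A.sec U, y = res _ h.le (pullSec g M x)}

/-- The pullback along the `S`-morphism `g : T ⟶ Y` of a subsheaf of `π^* H`, as a subsheaf of
`f^* H`. -/
def Subsheaf.pullbackOver {T Y S : Scheme.{u}} {g : T ⟶ Y} {π : Y ⟶ S} {f : T ⟶ S}
    (w : g ≫ π = f) {H : S.Modules} (A : Subsheaf ((Scheme.Modules.pullback π).obj H)) :
    Subsheaf ((Scheme.Modules.pullback f).obj H) :=
  (A.pullback g).comap (pullIso w H).inv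

/-! ### Flags of subbundles, flag bundles, frame bundles -/

/-- A flag of subbundles of `M` with set of ranks `D`. -/
@[ext]
structure BundleFlag {X : Scheme.{u}} (M : X.Modules) (D : Finset ℕ) where
  /-- the member of rank `d` -/
  sub : D → Subsheaf M
  isSubbundle : ∀ d : D, (sub d).IsSubbundle d
  le : ∀ d d' : D, d ≤ d' → sub d ≤ sub d'

/-- A complete flag `0 = p₀ ⊂ p₁ ⊂ ⋯ ⊂ pₙ = H` of subbundles of a vector bundle `H` of rank `n`;
equivalently, a section of the complete flag bundle of `H`. -/
abbrev CompleteFlag {X : Scheme.{u}} (H : X.Modules) (n : ℕ) := BundleFlag H (Finset.range (n + 1))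

/-- The flag bundle of `H` with set of ranks `D`, that is, a scheme `π : Y ⟶ S` with a flag of
subbundles of `π^* H` that is universal among flags with set of ranks `D` on the pullbacks `f^* H`
along all `f : T ⟶ S`. -/
structure FlagBundle {S : Scheme.{u}} (H : S.Modules) (D : Finset ℕ) where
  /-- the total space -/
  scheme : Scheme.{u}
  /-- the structure morphism -/
  π : scheme ⟶ S
  /-- the tautological flag -/
  taut : BundleFlag ((Scheme.Modules.pullback π).obj H) D
  existsUnique : ∀ {T : Scheme.{u}} (f : T ⟶ S)
    (V : BundleFlag ((Scheme.Modules.pullback f).obj H) D),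
    ∃! g : T ⟶ scheme, ∃ w : g ≫ π = f, ∀ d : D, (taut.sub d).pullbackOver w = V.sub d

/-- The Grassmannian bundle `Gr(r, H)` of rank `r` subbundles. -/
abbrev GrassmannianBundle {S : Scheme.{u}} (H : S.Modules) (r : ℕ) := FlagBundle H {r}

/-- The frame bundle of a vector bundle `H` of rank `n`: a scheme `π : Y ⟶ S` with a universal
frame (isomorphism `𝒪^n ≅ π^* H`). -/
structure FrameBundle {S : Scheme.{u}} (H : S.Modules) (n : ℕ) where
  /-- the total space -/
  scheme : Scheme.{u}
  /-- the structure morphism -/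
  π : scheme ⟶ S
  /-- the tautological frame -/
  frame : Fin n → Γ((Scheme.Modules.pullback π).obj H, ⊤)
  isFrame : IsFrame _ ⊤ frame
  existsUnique : ∀ {T : Scheme.{u}} (f : T ⟶ S)
    (e : Fin n → Γ((Scheme.Modules.pullback f).obj H, ⊤)), IsFrame _ ⊤ e →
    ∃! g : T ⟶ scheme, ∃ w : g ≫ π = f, ∀ i, pullSecOver w H (frame i) = e i

/-! ### Versality -/

/-- The structure sheaf as a module over itself. -/
def structureModule (X : Scheme.{u}) : X.Modules := SheafOfModules.unit X.ringCatSheaf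

/-- The trivial bundle `𝒪_X^n`. -/
def trivialBundle (X : Scheme.{u}) (n : ℕ) : X.Modules := ∐ fun _ : Fin n => structureModule X

/-- The standard frame of the trivial bundle. -/
def standardFrame (X : Scheme.{u}) (n : ℕ) (i : Fin n) : Γ(trivialBundle X n, ⊤) :=
  (Limits.Sigma.ι (fun _ : Fin n => structureModule X) i).app ⊤ (1 : Γ(X, ⊤))

/-- The morphism `φ : F ⟶ Fl(k^n)` from the frame bundle `F` of `H` is the one induced by the
complete flag `p` of `H`: it sends a frame `e : k^n ≅ H_x` to the flag `e⁻¹(p_x)` of `k^n`. -/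
def IsInducedBy {B S : Scheme.{u}} (s : S ⟶ B) {n : ℕ} {H : S.Modules} (p : CompleteFlag H n)
    (F : FrameBundle H n) (Fl : FlagBundle (trivialBundle B n) (Finset.range (n + 1)))
    (φ : F.scheme ⟶ Fl.scheme) : Prop :=
  ∃ w : φ ≫ Fl.π = F.π ≫ s, ∀ (d : Finset.range (n + 1)) (U : F.scheme.Opens)
    (c : Fin n → Γ(F.scheme, U)),
    ∑ i, c i • res _ (le_top : U ≤ (F.π ≫ s) ⁻¹ᵁ ⊤) (pullSec (F.π ≫ s) _ (standardFrame B n i)) ∈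
        ((Fl.taut.sub d).pullbackOver w).sec U ↔
      ∑ i, c i • res _ (le_top : U ≤ ⊤) (F.frame i) ∈ ((p.sub d).pullback F.π).sec U

/-- Two complete flags `p`, `q` of a vector bundle `H` of rank `n` on a `B`-scheme `S` are versal
if the induced morphism `Fr(H) ⟶ Fl(n) ×_B Fl(n)` is smooth. -/
def IsVersal {B S : Scheme.{u}} (s : S ⟶ B) {n : ℕ} {H : S.Modules} (p q : CompleteFlag H n) :
    Prop :=
  ∀ (F : FrameBundle H n) (Fl : FlagBundle (trivialBundle B n) (Finset.range (n + 1)))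
    (φ ψ : F.scheme ⟶ Fl.scheme) (_ : IsInducedBy s p F Fl φ) (_ : IsInducedBy s q F Fl ψ)
    (h : φ ≫ Fl.π = ψ ≫ Fl.π),
    Smooth (Limits.pullback.lift φ ψ h : F.scheme ⟶ Limits.pullback Fl.π Fl.π)

/-! ### Determinantal loci -/

/-- The ideal sheaf of the locus where `A ⟶ M / P` has rank at most `d`, generated by the
`(d + 1) × (d + 1)` minors `det (φ_i (v_j))`, with `v_j` in `A` and `φ_i` functionals on `M`
vanishing on `P`. -/
def degeneracyIdeal {X : Scheme.{u}} {M : X.Modules} (A P : Subsheaf M) (d : ℕ) :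
    X.IdealSheafData :=
  Scheme.IdealSheafData.ofIdeals fun U =>
    Ideal.span {x : Γ(X, U.1) | ∃ (v : Fin (d + 1) → Γ(M, U.1))
      (φ : Fin (d + 1) → Γ(M, U.1) →ₗ[Γ(X, U.1)] Γ(X, U.1)),
      (∀ i, v i ∈ A.sec U.1) ∧ (∀ i, ∀ y ∈ P.sec U.1, φ i y = 0) ∧
      x = (Matrix.of fun i j => φ i (v j)).det}

/-! ### Partitions, Schubert varieties and their resolutions -/

/-- A `Gr(r, n)`-admissible partition `n - r ≥ part 1 ≥ ⋯ ≥ part r ≥ 0`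
(values of `part` outside `1, …, r` are irrelevant). -/
structure AdmissiblePartition (r n : ℕ) where
  /-- the parts -/
  part : ℕ → ℕ
  part_le : ∀ i, 1 ≤ i → i ≤ r → part i ≤ n - r
  antitone : ∀ i j, 1 ≤ i → i ≤ j → j ≤ r → part j ≤ part i

namespace AdmissiblePartition

variable {r n : ℕ} (lam : AdmissiblePartition r n)

/-- The partial sums `a₁ < ⋯ < a_j = r` of the multiplicities when the partition is written as
`(μ₁^{i₁}, …, μ_j^{i_j})` with `μ₁ > ⋯ > μ_j`: the positions where a block of equal parts ends. -/
def corners : Finset ℕ := {a ∈ Finset.Icc 1 r | a = r ∨ lam.part (a + 1) ≠ lam.part a}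

theorem corners_subset {a : ℕ} (ha : a ∈ lam.corners) : a ∈ Finset.Icc 1 r :=
  (Finset.mem_filter.mp ha).1

theorem self_mem_corners (hr : 1 ≤ r) : r ∈ lam.corners :=
  Finset.mem_filter.mpr ⟨Finset.mem_Icc.mpr ⟨hr, le_rfl⟩, Or.inl rfl⟩

/-- The index `n - r + i - part i` of the member of the reference flag in the `i`-th condition. -/
def index (i : ℕ) : ℕ := n - r + i - lam.part i

theorem index_mem (hrn : r ≤ n) {i : ℕ} (hi : i ∈ Finset.Icc 1 r) :
    lam.index i ∈ Finset.range (n + 1) := by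
  have h2 := (Finset.mem_Icc.mp hi).2
  rw [Finset.mem_range, index]
  omega

end AdmissiblePartition

section Schubert

variable {S : Scheme.{u}} {H : S.Modules} {r n : ℕ}

/-- The ideal sheaf in `Gr(r, H)` of the relative Grassmannian Schubert variety
`X_λ(p) = {(x, V) : dim V ∩ (p_x)_{n - r + i - λ_i} ≥ i for 1 ≤ i ≤ r}`, the `i`-th condition
meaning that `V ⟶ H / p_{n - r + i - λ_i}` has rank at most `r - i`. -/
def schubertIdeal (hrn : r ≤ n) (p : CompleteFlag H n) (lam : AdmissiblePartition r n)
    (G : GrassmannianBundle H r) : G.scheme.IdealSheafData :=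
  ⨆ i : Finset.Icc 1 r,
    degeneracyIdeal (G.taut.sub ⟨r, Finset.mem_singleton_self r⟩)
      ((p.sub ⟨lam.index i, lam.index_mem hrn i.2⟩).pullback G.π) (r - i)

/-- The relative Grassmannian Richardson variety: the scheme-theoretic intersection
`X_λ(p) ∩ X_λ'(q)` in `Gr(r, H)`. -/
def richardsonIdeal (hrn : r ≤ n) (p q : CompleteFlag H n) (lam lam' : AdmissiblePartition r n)
    (G : GrassmannianBundle H r) : G.scheme.IdealSheafData :=
  schubertIdeal hrn p lam G ⊔ schubertIdeal hrn q lam' G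

/-- The ideal sheaf in `Fl(a₁, …, a_j; H)` of
`Z_λ(p) = {(x, V₁ ⊂ ⋯ ⊂ V_j) : V_s ⊆ (p_x)_{n - r + a_s - λ_{a_s}} for 1 ≤ s ≤ j}`. -/
def resolutionIdeal (hrn : r ≤ n) (p : CompleteFlag H n) (lam : AdmissiblePartition r n)
    (W : FlagBundle H lam.corners) : W.scheme.IdealSheafData :=
  ⨆ a : lam.corners,
    degeneracyIdeal (W.taut.sub a)
      ((p.sub ⟨lam.index a, lam.index_mem hrn (lam.corners_subset a.2)⟩).pullback W.π) 0

/-- The forgetful morphism from a flag bundle to the Grassmannian bundle, remembering the member of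
rank `r` only. -/
def FlagBundle.toGrassmannian {D : Finset ℕ} (W : FlagBundle H D) (hD : r ∈ D)
    (G : GrassmannianBundle H r) : W.scheme ⟶ G.scheme :=
  (G.existsUnique W.π
    { sub := fun _ => W.taut.sub ⟨r, hD⟩
      isSubbundle := fun d => by
        have hd : (d : ℕ) = r := Finset.mem_singleton.mp d.2
        rw [hd]
        exact W.taut.isSubbundle ⟨r, hD⟩
      le := fun _ _ _ _ => le_rfl }).choose

/-- The relative Bott–Samelson resolution `Z_λ(p)`, a closed subscheme of
`Fl(a₁, …, a_j; H)`. -/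
def Resolution (hrn : r ≤ n) (p : CompleteFlag H n) (lam : AdmissiblePartition r n)
    (W : FlagBundle H lam.corners) : Scheme.{u} :=
  (resolutionIdeal hrn p lam W).subscheme

/-- The morphism `Z_λ(p) ⟶ Gr(r, H)`, `(x, V₁ ⊂ ⋯ ⊂ V_j) ↦ (x, V_j)`. -/
def Resolution.toGrassmannian (hr : 1 ≤ r) (hrn : r ≤ n) (p : CompleteFlag H n)
    (lam : AdmissiblePartition r n) (W : FlagBundle H lam.corners) (G : GrassmannianBundle H r) :
    Resolution hrn p lam W ⟶ G.scheme :=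
  (resolutionIdeal hrn p lam W).subschemeι ≫ W.toGrassmannian (lam.self_mem_corners hr) G

/-- The fiber product `Z_λ(p) ×_{Gr(r, H)} Z_λ'(q)`. -/
abbrev ResolutionProduct (hr : 1 ≤ r) (hrn : r ≤ n) (p q : CompleteFlag H n)
    (lam lam' : AdmissiblePartition r n) (W : FlagBundle H lam.corners)
    (W' : FlagBundle H lam'.corners) (G : GrassmannianBundle H r) : Scheme.{u} :=
  Limits.pullback (Resolution.toGrassmannian hr hrn p lam W G)
    (Resolution.toGrassmannian hr hrn q lam' W' G)

/-- The projection `Z_λ(p) ×_{Gr(r, H)} Z_λ'(q) ⟶ Gr(r, H)`. -/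
def ResolutionProduct.toGrassmannian (hr : 1 ≤ r) (hrn : r ≤ n) (p q : CompleteFlag H n)
    (lam lam' : AdmissiblePartition r n) (W : FlagBundle H lam.corners)
    (W' : FlagBundle H lam'.corners) (G : GrassmannianBundle H r) :
    ResolutionProduct hr hrn p q lam lam' W W' G ⟶ G.scheme :=
  Limits.pullback.fst _ _ ≫ Resolution.toGrassmannian hr hrn p lam W G

end Schubert

/-- A morphism is birational if it restricts to an isomorphism over a dense open of the target whose
preimage is dense in the source. -/
def IsBirational {Z X : Scheme.{u}} (f : Z ⟶ X) : Prop :=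
  ∃ U : X.Opens, Dense (U : Set X) ∧ Dense ((f ⁻¹ᵁ U : Z.Opens) : Set Z) ∧ IsIso (f ∣_ U)

/-- A morphism `f : Z ⟶ X` of `B`-schemes, with `Z` having structure morphism `z`, is a resolution of
singularities of `X` if `Z` is smooth over `B` and `f` is proper and birational. -/
structure IsResolution {B Z X : Scheme.{u}} (z : Z ⟶ B) (f : Z ⟶ X) : Prop where
  smooth : Smooth z
  proper : IsProper f
  birational : IsBirational f

end

end RelGrass

namespace RelGrass

noncomputable section

/-! ### Frames and coordinates -/

/-! The geometry is reduced to matrices. In a local frame of `H` a subbundle of rank `d` is the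
solution set `cutMod y d` of the equations `(y c)_i = 0`, `i ≥ d`, with `y` invertible; the first
`d` columns of `y⁻¹` span it. Pullback is base change of `y`. The inclusion of `cutMod y a` in
`cutMod y' b` is the vanishing of the block of `y' y⁻¹` with rows `≥ b` and columns `< a`
(`cutMod_le_iff`), and a degeneracy ideal is generated by the minors of that block
(`degeneracyIdeal_ideal`). Over a local ring one matrix describes a whole flag (`exists_adapted`).

Existence: flags and frames form Zariski sheaves over `S`. Grassmannian and frame bundles are glued
from explicit charts. Flag bundles are closed in iterated fibre products of Grassmannian bundles,
which are proper by the valuative criterion. The fibre product `P` of the two resolutions then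
represents pairs of flags, lying in `p` and in `q` at the prescribed positions, with a common member
of rank `r` (`exists_universal_flagPair`).

Smoothness: it is enough to lift local-ring-valued points along square-zero thickenings. Over a
local ring a point of `P` is a quadruple of matrices for the two flags and for `p`, `q`, and the
conditions on it say that entries of transition matrices vanish. Hence the quadruple lifts, provided
that the reference flags may move (`IsAdapted.exists_lift`). Versality compensates for the motion:
the moved reference flags define a point of `Fl × Fl` over the thickening, and pulling back the
smooth morphism from the frame bundle gives a smooth `Y` over the thickening. On `Y` there is a
frame in which `p` and `q` have exactly the prescribed matrices, so `Y` maps to `P`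
(`exists_smooth_family`). A section of `Y` through the given point gives the lift.

Factorization: over a local ring the incidence conditions at the corners produce a block of zeros
large enough to kill every Schubert minor (`minorIdeal_eq_bot_of_zero_block`), so the map to the
Grassmannian bundle factors scheme-theoretically through the Richardson variety. Properness follows
from that of flag bundles.

Birationality: let `Ω` be the open locus of subspaces `V` for which, at each corner `a < r`, the
minors of size `r - a` do not all vanish, for both reference flags. On the Richardson variety over
`Ω` the intersections of `V` with the relevant reference subspaces have constant rank `a`, hence are
subbundles. They are the only possible members of the two flags, so the projection is an isomorphism
there.

Density: given a point `z` of `P`, deform over the power series ring of its residue field by adding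
the variable `t` at entries which the incidence conditions leave free. The relevant minors become
characteristic polynomials evaluated at `t`, hence nonzero (`exists_generic_deformation`). Versality
again realizes the deformation by a smooth family; flatness provides a point over the generic point
whose image specializes to `z`. So the preimage of `Ω` is dense. Over a field the Schubert
conditions allow a compatible basis to be chosen, so the projection is surjective, and density in
the target follows. -/

/-- Restriction of functions to a smaller open. -/
def rmap {X : Scheme.{u}} {W U : X.Opens} (h : W ≤ U) : Γ(X, U) →+* Γ(X, W) :=
  (X.presheaf.map (homOfLE h).op).hom

theorem rmap_rmap {X : Scheme.{u}} {W V U : X.Opens} (h : W ≤ V) (h' : V ≤ U) (x : Γ(X, U)) :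
    rmap h (rmap h' x) = rmap (h.trans h') x := by
  unfold rmap
  rw [← CommRingCat.comp_apply, ← Functor.map_comp]
  rfl

theorem rmap_comp {X : Scheme.{u}} {W V U : X.Opens} (h : W ≤ V) (h' : V ≤ U) :
    (rmap h).comp (rmap h') = rmap (h.trans h') := RingHom.ext (rmap_rmap h h')

theorem rmap_self {X : Scheme.{u}} {U : X.Opens} (h : U ≤ U) : rmap h = RingHom.id _ := by
  ext x
  have : (homOfLE h).op = 𝟙 (Opposite.op U) := rfl
  unfold rmap
  rw [this, X.presheaf.map_id]
  rfl

section

variable {X : Scheme.{u}} {M N : X.Modules} {ι : Type} [Fintype ι]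

theorem res_smul' {W U : X.Opens} (h : W ≤ U) (r : Γ(X, U)) (x : Γ(M, U)) :
    res M h (r • x) = rmap h r • res M h x := res_smul M h r x

theorem res_sum {W U : X.Opens} (h : W ≤ U) {κ : Type*} (s : Finset κ) (x : κ → Γ(M, U)) :
    res M h (∑ i ∈ s, x i) = ∑ i ∈ s, res M h (x i) :=
  map_sum (M.presheaf.map (homOfLE h).op).hom x s

/-- The linear combination of (restrictions of) sections `e i` with coefficients `c`. -/
def lin {U : X.Opens} (e : ι → Γ(M, U)) {W : X.Opens} (h : W ≤ U) :
    (ι → Γ(X, W)) →ₗ[Γ(X, W)] Γ(M, W) :=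
  Fintype.linearCombination _ fun i => res M h (e i)

theorem lin_apply {U : X.Opens} (e : ι → Γ(M, U)) {W : X.Opens} (h : W ≤ U) (c : ι → Γ(X, W)) :
    lin e h c = ∑ i, c i • res M h (e i) := rfl

theorem res_lin {U : X.Opens} (e : ι → Γ(M, U)) {V W : X.Opens} (h' : V ≤ W) (h : W ≤ U)
    (c : ι → Γ(X, W)) : res M h' (lin e h c) = lin e (h'.trans h) (rmap h' ∘ c) := by
  simp only [lin_apply, res_sum, res_smul', res_res, Function.comp]

theorem lin_res {U V : X.Opens} (e : ι → Γ(M, U)) (k : V ≤ U) {W : X.Opens} (h : W ≤ V) :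
    lin (fun i => res M k (e i)) h = lin e (h.trans k) := by
  ext c
  simp only [lin_apply, res_res]

theorem lin_single [DecidableEq ι] {U : X.Opens} (e : ι → Γ(M, U)) {W : X.Opens} (h : W ≤ U)
    (i : ι) : lin e h (Pi.single i 1) = res M h (e i) := by
  rw [lin, Fintype.linearCombination_apply_single, one_smul]

theorem IsFrame.bijective {U : X.Opens} {e : ι → Γ(M, U)} (he : IsFrame M U e) {W : X.Opens}
    (h : W ≤ U) : Function.Bijective (lin e h) := he W h

theorem IsFrame.res {U V : X.Opens} {e : ι → Γ(M, U)} (he : IsFrame M U e) (k : V ≤ U) :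
    IsFrame M V (fun i => res M k (e i)) := by
  intro W h
  have := he.bijective (h.trans k)
  rw [← lin_res e k h] at this
  exact this

/-- Coordinates of a section in a frame. -/
def IsFrame.coord {U : X.Opens} {e : ι → Γ(M, U)} (he : IsFrame M U e) {W : X.Opens}
    (h : W ≤ U) : Γ(M, W) ≃ₗ[Γ(X, W)] (ι → Γ(X, W)) :=
  (LinearEquiv.ofBijective (lin e h) (he.bijective h)).symm

@[simp] theorem IsFrame.lin_coord {U : X.Opens} {e : ι → Γ(M, U)} (he : IsFrame M U e)
    {W : X.Opens} (h : W ≤ U) (x : Γ(M, W)) : lin e h (he.coord h x) = x :=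
  (LinearEquiv.ofBijective (lin e h) (he.bijective h)).apply_symm_apply x

@[simp] theorem IsFrame.coord_lin {U : X.Opens} {e : ι → Γ(M, U)} (he : IsFrame M U e)
    {W : X.Opens} (h : W ≤ U) (c : ι → Γ(X, W)) : he.coord h (lin e h c) = c :=
  (LinearEquiv.ofBijective (lin e h) (he.bijective h)).symm_apply_apply c

theorem IsFrame.coord_res {U : X.Opens} {e : ι → Γ(M, U)} (he : IsFrame M U e)
    {V W : X.Opens} (h' : V ≤ W) (h : W ≤ U) (x : Γ(M, W)) :
    he.coord (h'.trans h) (RelGrass.res M h' x) = rmap h' ∘ he.coord h x := by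
  conv_lhs => rw [← he.lin_coord h x, res_lin, he.coord_lin]

/-! ### Locality of sections -/

theorem sec_ext {U : X.Opens} {x y : Γ(M, U)}
    (H : ∀ t ∈ U, ∃ (W : X.Opens) (h : W ≤ U), t ∈ W ∧ res M h x = res M h y) : x = y := by
  choose W h ht hW using H
  refine TopCat.Sheaf.eq_of_locally_eq' ⟨M.presheaf, M.isSheaf⟩ (fun t : U => W t.1 t.2) U
    (fun t => homOfLE (h t.1 t.2)) ?_ x y fun t => hW t.1 t.2
  intro t ht'
  exact TopologicalSpace.Opens.mem_iSup.mpr ⟨⟨t, ht'⟩, ht t ht'⟩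

theorem fun_ext {U : X.Opens} {x y : Γ(X, U)}
    (H : ∀ t ∈ U, ∃ (W : X.Opens) (h : W ≤ U), t ∈ W ∧ rmap h x = rmap h y) : x = y := by
  choose W h ht hW using H
  refine TopCat.Sheaf.eq_of_locally_eq' X.sheaf (fun t : U => W t.1 t.2) U
    (fun t => homOfLE (h t.1 t.2)) ?_ x y fun t => hW t.1 t.2
  intro t ht'
  exact TopologicalSpace.Opens.mem_iSup.mpr ⟨⟨t, ht'⟩, ht t ht'⟩

theorem sec_glue {κ : Type*} (V : κ → X.Opens) (U : X.Opens) (hV : ∀ i, V i ≤ U)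
    (hU : U ≤ iSup V) (s : ∀ i, Γ(M, V i))
    (hs : ∀ i j, res M (inf_le_left : V i ⊓ V j ≤ V i) (s i) = res M inf_le_right (s j)) :
    ∃ x : Γ(M, U), ∀ i, res M (hV i) x = s i :=
  (TopCat.Sheaf.existsUnique_gluing' ⟨M.presheaf, M.isSheaf⟩ V U (fun i => homOfLE (hV i)) hU s
    hs).exists

theorem fun_glue {κ : Type*} (V : κ → X.Opens) (U : X.Opens) (hV : ∀ i, V i ≤ U)
    (hU : U ≤ iSup V) (s : ∀ i, Γ(X, V i))
    (hs : ∀ i j, rmap (inf_le_left : V i ⊓ V j ≤ V i) (s i) = rmap inf_le_right (s j)) :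
    ∃ x : Γ(X, U), ∀ i, rmap (hV i) x = s i :=
  (TopCat.Sheaf.existsUnique_gluing' X.sheaf V U (fun i => homOfLE (hV i)) hU s hs).exists

theorem hom_app_lin (φ : M ⟶ N) {U : X.Opens} (e : ι → Γ(M, U)) {W : X.Opens} (h : W ≤ U)
    (c : ι → Γ(X, W)) : φ.app W (lin e h c) = lin (fun i => φ.app U (e i)) h c := by
  simp only [lin_apply, map_sum, Scheme.Modules.Hom.app_smul, res_app]

theorem hom_ext_of_isFrame {e : ι → Γ(M, ⊤)} (he : IsFrame M ⊤ e) {φ ψ : M ⟶ N}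
    (h : ∀ i, φ.app ⊤ (e i) = ψ.app ⊤ (e i)) : φ = ψ := by
  ext W x
  rw [← he.lin_coord le_top x, hom_app_lin, hom_app_lin]
  simp only [h]

/-- The morphism out of a module with a global frame taking given values on the frame. -/
theorem exists_hom_of_isFrame {e : ι → Γ(M, ⊤)} (he : IsFrame M ⊤ e) (y : ι → Γ(N, ⊤)) :
    ∃ φ : M ⟶ N, ∀ i, φ.app ⊤ (e i) = y i := by
  classical
  let a : M.presheaf ⟶ N.presheaf :=
    { app := fun W => AddCommGrpCat.ofHom
        ((lin y (le_top : W.unop ≤ ⊤)).toAddMonoidHom.comp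
          (he.coord (le_top : W.unop ≤ ⊤)).toLinearMap.toAddMonoidHom)
      naturality := by
        intro W W' f
        ext x
        have := he.coord_res (leOfHom f.unop) le_top x
        change lin y le_top (he.coord le_top (res M (leOfHom f.unop) x)) =
          res N (leOfHom f.unop) (lin y le_top (he.coord le_top x))
        rw [this, res_lin] }
  let φ : M ⟶ N := ⟨PresheafOfModules.homMk a (by
    intro W (r : Γ(X, W.unop)) (x : Γ(M, W.unop))
    have h1 : he.coord le_top (r • x) = r • he.coord le_top x := map_smul _ _ _
    exact (congrArg (lin y le_top) h1).trans (map_smul (lin y le_top) _ _))⟩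
  refine ⟨φ, fun i => ?_⟩
  change lin y le_top (he.coord le_top (e i)) = y i
  have : e i = lin e le_rfl (Pi.single i 1) := by rw [lin_single, res_self]
  rw [this, he.coord_lin, lin_single, res_self]

theorem IsFrame.map_iso {U : X.Opens} {e : ι → Γ(M, U)} (he : IsFrame M U e) (φ : M ≅ N) :
    IsFrame N U fun i => φ.hom.app U (e i) := by
  intro W h
  have hb : Function.Bijective (φ.hom.app W) :=
    (ConcreteCategory.isIso_iff_bijective (φ.hom.app W)).mp inferInstance
  have := hb.comp (he.bijective h)
  convert this using 1
  ext c
  exact (hom_app_lin φ.hom e h c).symm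

end

/-! ### The trivial bundle -/

/-- A finite coproduct in a preadditive category is a biproduct: the projections given by Kronecker
deltas satisfy `∑ p_a ≫ i_a = 𝟙`, which splits the sections over every open into coordinates. -/
theorem isFrame_standardFrame (X : Scheme.{u}) (n : ℕ) :
    IsFrame (trivialBundle X n) ⊤ (standardFrame X n) := by
  classical
  let O := structureModule X
  let i (a : Fin n) : O ⟶ trivialBundle X n := Limits.Sigma.ι (fun _ : Fin n => O) a
  let p (a : Fin n) : trivialBundle X n ⟶ O :=
    Limits.Sigma.desc fun b => if b = a then 𝟙 O else 0
  have hip (a b : Fin n) : i b ≫ p a = if b = a then 𝟙 O else 0 := Limits.Sigma.ι_desc _ _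
  have hsum : ∑ a, p a ≫ i a = 𝟙 _ := by
    refine Limits.Sigma.hom_ext _ _ fun b => ?_
    change i b ≫ _ = i b ≫ _
    rw [Preadditive.comp_sum, Category.comp_id]
    simp only [← Category.assoc, hip]
    rw [Finset.sum_eq_single b]
    · simp
    · intro a _ h
      simp [h.symm]
    · simp
  have hi (W : X.Opens) (a : Fin n) (r : Γ(X, W)) :
      (i a).app W r = r • res _ le_top (standardFrame X n a) := by
    have h1 : (1 : Γ(X, W)) = res O le_top (1 : Γ(X, ⊤)) := (map_one (rmap _)).symm
    have h2 : res O (le_top : W ≤ ⊤) (1 : Γ(X, ⊤)) = (1 : Γ(X, W)) := h1.symm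
    have h3 : r • res O (le_top : W ≤ ⊤) (1 : Γ(X, ⊤)) = r :=
      (congrArg (fun z : Γ(O, W) => r • z) h2).trans (mul_one r)
    have h4 := Scheme.Modules.Hom.app_smul (i a) r (res O (le_top : W ≤ ⊤) (1 : Γ(X, ⊤)))
    rw [h3] at h4
    have h5 : (i a).app W (res O (le_top : W ≤ ⊤) (1 : Γ(X, ⊤))) =
        res _ le_top (standardFrame X n a) := (res_app (i a) le_top (1 : Γ(X, ⊤))).symm
    exact h4.trans (congrArg (fun z => r • z) h5)
  have hpi (W : X.Opens) (a b : Fin n) (r : Γ(X, W)) :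
      (p a).app W ((i b).app W r) = if b = a then r else 0 := by
    change (i b ≫ p a).app W r = _
    rw [hip]
    split_ifs
    · rfl
    · rfl
  have hid (W : X.Opens) (x : Γ(trivialBundle X n, W)) : ∑ a, (i a).app W ((p a).app W x) = x := by
    have h1 : ∀ s : Finset (Fin n), (∑ a ∈ s, p a ≫ i a).app W x =
        ∑ a ∈ s, (i a).app W ((p a).app W x) := by
      intro s
      induction s using Finset.induction_on with
      | empty => rfl
      | insert a s ha ih =>
        rw [Finset.sum_insert ha, Finset.sum_insert ha, Scheme.Modules.Hom.add_app, ← ih]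
        rfl
    rw [← h1, hsum]
    rfl
  intro W h
  have hlin : ∀ c : Fin n → Γ(X, W),
      ∑ a, c a • res (trivialBundle X n) h (standardFrame X n a) = ∑ a, (i a).app W (c a) :=
    fun c => Finset.sum_congr rfl fun a _ => (hi W a (c a)).symm
  refine ⟨fun c c' hcc => ?_, fun x => ⟨fun a => (p a).app W x, ?_⟩⟩
  · have hcc' : ∑ a, (i a).app W (c a) = ∑ a, (i a).app W (c' a) := by
      rw [← hlin, ← hlin]; exact hcc
    ext a
    have h2 := congrArg ((p a).app W) hcc'
    rw [map_sum, map_sum] at h2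
    simp only [hpi] at h2
    have h3 (d : Fin n → Γ(X, W)) : (∑ b, (if b = a then d b else 0 : Γ(O, W))) = d a := by
      rw [Fintype.sum_eq_single a]
      · exact if_pos rfl
      · intro b hb
        exact if_neg hb
    exact (h3 c).symm.trans (h2.trans (h3 c'))
  · exact (hlin _).trans (hid W x)

theorem isVectorBundle_trivialBundle (X : Scheme.{u}) (n : ℕ) :
    IsVectorBundle (trivialBundle X n) n :=
  fun _ => ⟨⊤, trivial, standardFrame X n, isFrame_standardFrame X n⟩

/-! ### Pullback of sections -/

section

variable {T Y : Scheme.{u}} (g : T ⟶ Y) (M : Y.Modules)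

theorem pullSec_add {U : Y.Opens} (x y : Γ(M, U)) :
    pullSec g M (x + y) = pullSec g M x + pullSec g M y := map_add _ _ _

theorem pullSec_smul {U : Y.Opens} (r : Γ(Y, U)) (x : Γ(M, U)) :
    pullSec g M (r • x) = g.app U r • pullSec g M x :=
  Scheme.Modules.Hom.app_smul _ r x

theorem pullSec_res {W U : Y.Opens} (h : W ≤ U) (h' : g ⁻¹ᵁ W ≤ g ⁻¹ᵁ U) (x : Γ(M, U)) :
    pullSec g M (res M h x) = res _ h' (pullSec g M x) :=
  (res_app ((Scheme.Modules.pullbackPushforwardAdjunction g).unit.app M) h x).symm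

/-- The comparison of pullbacks is conjugate to the comparison of pushforwards, so it intertwines
the units of the two adjunctions; `pullSec` is by definition such a unit. -/
theorem pullbackComp_pullSec {S : Scheme.{u}} (π : Y ⟶ S) (H : S.Modules) {U : S.Opens}
    (x : Γ(H, U)) :
    ((Scheme.Modules.pullbackComp g π).hom.app H).app _ (pullSec g _ (pullSec π H x)) =
      pullSec (g ≫ π) H x := by
  have h1 := unit_conjugateEquiv ((Scheme.Modules.pullbackPushforwardAdjunction π).comp
      (Scheme.Modules.pullbackPushforwardAdjunction g))
    (Scheme.Modules.pullbackPushforwardAdjunction (g ≫ π))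
    (Scheme.Modules.pullbackComp g π).inv H
  rw [Scheme.Modules.conjugateEquiv_pullbackComp_inv] at h1
  have h2 := congrArg (fun a => a.app U x) h1
  have h3 : pullSec g _ (pullSec π H x) =
      ((Scheme.Modules.pullbackComp g π).inv.app H).app _ (pullSec (g ≫ π) H x) := h2
  rw [h3]
  exact congrArg (fun a => a.app ((g ≫ π) ⁻¹ᵁ U) (pullSec (g ≫ π) H x))
    ((Scheme.Modules.pullbackComp g π).inv_hom_id_app H)

theorem iso_inv_app_hom_app {X : Scheme.{u}} {M N : X.Modules} (φ : M ≅ N) {U : X.Opens}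
    (x : Γ(M, U)) : φ.inv.app U (φ.hom.app U x) = x :=
  congrArg (fun a => a.app U x) φ.hom_inv_id

theorem pullSecOver_def : @pullSecOver.{u} = fun _ _ _ g _ _ w H U x =>
    (pullIso w H).hom.app (g ⁻¹ᵁ U) (pullSec g _ x) := rfl

variable {g} in
theorem pullSecOver_eq {S : Scheme.{u}} {π : Y ⟶ S} {f : T ⟶ S} (w : g ≫ π = f) {H : S.Modules}
    {U : Y.Opens} (x : Γ((Scheme.Modules.pullback π).obj H, U)) :
    pullSecOver w H x = (pullIso w H).hom.app (g ⁻¹ᵁ U) (pullSec g _ x) := by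
  rw [pullSecOver_def]

variable {g} in
theorem pullSecOver_pullSec {S : Scheme.{u}} {π : Y ⟶ S} {f : T ⟶ S} (w : g ≫ π = f)
    (H : S.Modules) {U : S.Opens} (x : Γ(H, U)) :
    pullSecOver w H (pullSec π H x) = res _ (by rw [← w]; exact le_rfl) (pullSec f H x) := by
  subst w
  have : Scheme.Modules.pullbackCongr (rfl : g ≫ π = g ≫ π) = Iso.refl _ := rfl
  unfold pullSecOver pullIso
  rw [this]
  refine (pullbackComp_pullSec g π H x).trans (res_self _ _ _).symm

/-- For an open immersion, uniqueness of left adjoints identifies pullback with the restriction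
functor. The unit of the latter on `U` is restriction to `g ''ᵁ g ⁻¹ᵁ U`, which is `U` itself when
`U` lies in the range. -/
theorem pullSec_bijective [IsOpenImmersion g] {U : Y.Opens} (hU : U ≤ g.opensRange) :
    Function.Bijective (pullSec g M (U := U)) := by
  have h1 := (Scheme.Modules.restrictAdjunction g).unit_leftAdjointUniq_hom_app
    (Scheme.Modules.pullbackPushforwardAdjunction g) M
  have h2 : pullSec g M (U := U) =
      (((Scheme.Modules.restrictFunctorIsoPullback g).app M).hom.app (g ⁻¹ᵁ U)) ∘
        (M.presheaf.map (homOfLE (g.image_preimage_le U)).op) := by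
    rw [← Scheme.Modules.restrictAdjunction_unit_app_app]
    ext x
    exact (congrArg (fun a => a.app U x) h1).symm
  rw [h2]
  have h3 : Function.Bijective
      (((Scheme.Modules.restrictFunctorIsoPullback g).app M).hom.app (g ⁻¹ᵁ U)) :=
    (ConcreteCategory.isIso_iff_bijective _).mp inferInstance
  refine h3.comp ?_
  have h4 : g ''ᵁ g ⁻¹ᵁ U = U := by
    rw [Scheme.Hom.image_preimage_eq_opensRange_inf, inf_eq_right.mpr hU]
  have : IsIso (homOfLE (g.image_preimage_le U)) := by
    have : homOfLE (g.image_preimage_le U) = eqToHom h4 := rfl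
    rw [this]
    infer_instance
  exact (ConcreteCategory.isIso_iff_bijective
    (M.presheaf.map (homOfLE (g.image_preimage_le U)).op)).mp inferInstance

end

/-! ### Pullback of functions and frames, in particular along open immersions. -/

section

variable {T Y : Scheme.{u}} (g : T ⟶ Y) (M : Y.Modules)

theorem app_bijective [IsOpenImmersion g] {U : Y.Opens} (hU : U ≤ g.opensRange) :
    Function.Bijective (g.app U).hom :=
  have := g.isIso_app U hU
  (ConcreteCategory.isIso_iff_bijective (g.app U)).mp inferInstance

theorem app_rmap {W U : Y.Opens} (h : W ≤ U) (h' : g ⁻¹ᵁ W ≤ g ⁻¹ᵁ U) (r : Γ(Y, U)) :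
    (g.app W).hom (rmap h r) = rmap h' ((g.app U).hom r) :=
  congrArg (fun a => a.hom r) (g.naturality (homOfLE h).op)

theorem preimage_le {W U : Y.Opens} (h : W ≤ U) : g ⁻¹ᵁ W ≤ g ⁻¹ᵁ U := fun _ ht => h ht

variable {g M} in
theorem pullSec_lin {ι : Type} [Fintype ι] {U W : Y.Opens} (e : ι → Γ(M, U)) (h : W ≤ U)
    (c : ι → Γ(Y, W)) :
    pullSec g M (lin e h c) =
      lin (fun i => pullSec g M (e i)) (preimage_le g h) ((g.app W).hom ∘ c) := by
  have hs : ∀ s : Finset ι, pullSec g M (∑ i ∈ s, c i • res M h (e i)) =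
      ∑ i ∈ s, pullSec g M (c i • res M h (e i)) := fun s => map_sum
        (((Scheme.Modules.pullbackPushforwardAdjunction g).unit.app M).app W).hom _ _
  rw [lin_apply, lin_apply, hs]
  refine Finset.sum_congr rfl fun i _ => ?_
  rw [pullSec_smul, pullSec_res]
  rfl

theorem exists_eq_preimage [IsOpenImmersion g] (W : T.Opens) {U : Y.Opens} (h : W ≤ g ⁻¹ᵁ U) :
    ∃ V : Y.Opens, V ≤ U ∧ V ≤ g.opensRange ∧ g ⁻¹ᵁ V = W := by
  refine ⟨g ''ᵁ W, ?_, g.image_le_opensRange _, g.preimage_image_eq W⟩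
  rintro _ ⟨x, hx, rfl⟩
  exact h hx

theorem comp_left_bijective {ι A B : Type*} {f : A → B} (hf : Function.Bijective f) :
    Function.Bijective (fun c : ι → A => f ∘ c) :=
  (Equiv.arrowCongr (Equiv.refl ι) (Equiv.ofBijective f hf)).bijective

theorem IsFrame.pullSec_of_isOpenImmersion [IsOpenImmersion g] {ι : Type} [Fintype ι]
    {U : Y.Opens} {e : ι → Γ(M, U)} (he : IsFrame M U e) :
    IsFrame ((Scheme.Modules.pullback g).obj M) (g ⁻¹ᵁ U) (fun i => pullSec g M (e i)) := by
  intro W h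
  obtain ⟨V, hVU, hV, rfl⟩ := exists_eq_preimage g W h
  have h1 := (pullSec_bijective g M hV).comp (he.bijective hVU)
  have h2 : Function.Bijective (fun c : ι → Γ(Y, V) => (g.app V).hom ∘ c) :=
    comp_left_bijective (app_bijective g hV)
  rw [← Function.Bijective.of_comp_iff _ h2]
  convert h1 using 1
  ext c
  exact (pullSec_lin e hVU c).symm

theorem isFrame_of_pullSec [IsOpenImmersion g] {ι : Type} [Fintype ι]
    {U : Y.Opens} (hU : U ≤ g.opensRange) {e : ι → Γ(M, U)}
    (he : IsFrame ((Scheme.Modules.pullback g).obj M) (g ⁻¹ᵁ U) (fun i => pullSec g M (e i))) :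
    IsFrame M U e := by
  intro W h
  have hW := h.trans hU
  have h1 := he.bijective (preimage_le g h)
  have h2 : Function.Bijective (fun c : ι → Γ(Y, W) => (g.app W).hom ∘ c) :=
    comp_left_bijective (app_bijective g hW)
  have h3 := h1.comp h2
  have h4 : Function.Bijective (pullSec g M ∘ lin e h) := by
    convert h3 using 1
    ext c
    exact pullSec_lin e h c
  exact ((pullSec_bijective g M hW).of_comp_iff' _).mp h4

/-- The pullback is isomorphic to the trivial bundle. One map sends the standard frame to the pulled
back one; the other is adjoint to the map from `M` to the pushforward of the trivial bundle. The
composites are compared on frames, one of them after passing through the adjunction. -/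
theorem IsFrame.pullSec_top {n : ℕ} {e : Fin n → Γ(M, ⊤)} (he : IsFrame M ⊤ e) :
    IsFrame ((Scheme.Modules.pullback g).obj M) ⊤ (fun i => pullSec g M (e i)) := by
  let adj := Scheme.Modules.pullbackPushforwardAdjunction g
  let F := trivialBundle T n
  have hF := isFrame_standardFrame T n
  obtain ⟨a, ha⟩ := exists_hom_of_isFrame (N := (Scheme.Modules.pullback g).obj M) hF
    (fun i => pullSec g M (e i))
  obtain ⟨φ, hφ⟩ := exists_hom_of_isFrame (N := (Scheme.Modules.pushforward g).obj F) he
    (standardFrame T n)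
  let b : (Scheme.Modules.pullback g).obj M ⟶ F := (adj.homEquiv M F).symm φ
  have hb : ∀ i, b.app ⊤ (pullSec g M (e i)) = standardFrame T n i := by
    intro i
    have h1 : adj.unit.app M ≫ (Scheme.Modules.pushforward g).map b = φ :=
      (adj.homEquiv_unit _ _ _).symm.trans ((adj.homEquiv M F).apply_symm_apply φ)
    rw [← hφ i, ← h1]
    rfl
  have hab : a ≫ b = 𝟙 F := by
    refine hom_ext_of_isFrame hF fun i => ?_
    change b.app ⊤ (a.app ⊤ (standardFrame T n i)) = standardFrame T n i
    rw [ha, hb]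
  have hba : b ≫ a = 𝟙 _ := by
    refine (adj.homEquiv _ _).injective ?_
    refine (adj.homEquiv_unit _ _ _).trans (Eq.trans ?_ (adj.homEquiv_unit _ _ _).symm)
    refine hom_ext_of_isFrame he fun i => ?_
    change a.app ⊤ (b.app ⊤ (pullSec g M (e i))) = pullSec g M (e i)
    rw [hb, ha]
  have := hF.map_iso ⟨a, b, hab, hba⟩
  simpa only [ha] using this

theorem isFrame_res_iff {X : Scheme.{u}} {M : X.Modules} {ι : Type} [Fintype ι] {U V : X.Opens}
    (h : V ≤ U) (h' : U ≤ V) (e : ι → Γ(M, U)) :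
    IsFrame M V (fun i => res M h (e i)) ↔ IsFrame M U e := by
  refine ⟨fun he => ?_, fun he => he.res h⟩
  have := he.res h'
  simpa only [res_res, res_self] using this

end

section

variable {T Y S : Scheme.{u}} {g : T ⟶ Y} {π : Y ⟶ S} {f : T ⟶ S} (w : g ≫ π = f) (H : S.Modules)

theorem pullSecOver_res {W U : Y.Opens} (h : W ≤ U) (h' : g ⁻¹ᵁ W ≤ g ⁻¹ᵁ U)
    (x : Γ((Scheme.Modules.pullback π).obj H, U)) :
    pullSecOver w H (res _ h x) = res _ h' (pullSecOver w H x) := by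
  rw [pullSecOver_eq, pullSecOver_eq, pullSec_res g _ h h', res_app]

theorem pullSecOver_lin {ι : Type} [Fintype ι] {U W : Y.Opens}
    (e : ι → Γ((Scheme.Modules.pullback π).obj H, U)) (h : W ≤ U) (c : ι → Γ(Y, W)) :
    pullSecOver w H (lin e h c) =
      lin (fun i => pullSecOver w H (e i)) (preimage_le g h) ((g.app W).hom ∘ c) := by
  simp only [pullSecOver_eq]
  rw [pullSec_lin, hom_app_lin]

theorem pullSecOver_bijective [IsOpenImmersion g] {U : Y.Opens} (hU : U ≤ g.opensRange) :
    Function.Bijective (pullSecOver w H (U := U)) := by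
  have hb : Function.Bijective ((pullIso w H).hom.app (g ⁻¹ᵁ U)) :=
    (ConcreteCategory.isIso_iff_bijective _).mp inferInstance
  exact hb.comp (pullSec_bijective g _ hU)

end

/-- On `U` the frame becomes global, so the global case applies to `g ∣_ U`. The result is carried
back along the open immersion of `g ⁻¹ᵁ U`; the commutative square relating `g ∣_ U` and `g`
identifies the two families of sections. -/
theorem IsFrame.pullSec {T Y : Scheme.{u}} (g : T ⟶ Y) {M : Y.Modules} {n : ℕ} {U : Y.Opens}
    {e : Fin n → Γ(M, U)} (he : IsFrame M U e) :
    IsFrame ((Scheme.Modules.pullback g).obj M) (g ⁻¹ᵁ U) (fun i => pullSec g M (e i)) := by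
  have hU : (⊤ : (U : Scheme).Opens) ≤ U.ι ⁻¹ᵁ U := by rw [Scheme.Opens.ι_preimage_self]
  have h1 := (he.pullSec_of_isOpenImmersion U.ι M).res hU
  have h2 := h1.pullSec_top (g ∣_ U)
  have w1 : (g ∣_ U) ≫ U.ι = (g ⁻¹ᵁ U).ι ≫ g := morphismRestrict_ι g U
  have h3 := h2.map_iso (pullIso w1 M)
  have hgU : (g ⁻¹ᵁ U) ≤ (g ⁻¹ᵁ U).ι.opensRange := by rw [Scheme.Opens.opensRange_ι]
  refine isFrame_of_pullSec (g ⁻¹ᵁ U).ι _ hgU ?_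
  have hU' : (⊤ : (g ⁻¹ᵁ U : Scheme).Opens) ≤ (g ⁻¹ᵁ U).ι ⁻¹ᵁ (g ⁻¹ᵁ U) := by
    rw [Scheme.Opens.ι_preimage_self]
  rw [← isFrame_res_iff hU' le_top]
  have h4 := h3.map_iso (pullIso (rfl : (g ⁻¹ᵁ U).ι ≫ g = _) M).symm
  have hx : ∀ i, (pullIso w1 M).hom.app ⊤ (RelGrass.pullSec (g ∣_ U) _
      (RelGrass.res _ hU (RelGrass.pullSec U.ι M (e i)))) = RelGrass.res _ hU'
      ((pullIso (rfl : (g ⁻¹ᵁ U).ι ≫ g = _) M).hom.app _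
        (RelGrass.pullSec (g ⁻¹ᵁ U).ι _ (RelGrass.pullSec g M (e i)))) := by
    intro i
    have e1 := pullSecOver_res w1 M hU (preimage_le _ hU) (RelGrass.pullSec U.ι M (e i))
    rw [pullSecOver_pullSec w1 M (e i), res_res] at e1
    have e2 := pullSecOver_pullSec (rfl : (g ⁻¹ᵁ U).ι ≫ g = _) M (e i)
    refine e1.trans ?_
    have e3 := congrArg (RelGrass.res _ hU') e2
    rw [res_res] at e3
    exact e3.symm
  convert h4 using 2 with i
  have h5 := congrArg (fun z => (pullIso (rfl : (g ⁻¹ᵁ U).ι ≫ g = _) M).inv.app ⊤ z) (hx i)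
  refine Eq.trans ?_ h5.symm
  change _ = (pullIso (rfl : (g ⁻¹ᵁ U).ι ≫ g = _) M).inv.app ⊤ (RelGrass.res _ hU' _)
  rw [← res_app]
  congr 1
  exact (congrArg (fun a => a.app _ (RelGrass.pullSec (g ⁻¹ᵁ U).ι _ (RelGrass.pullSec g M (e i))))
    (pullIso (rfl : (g ⁻¹ᵁ U).ι ≫ g = _) M).hom_inv_id).symm

/-! ### Submodules cut out by the last coordinates in a basis -/

/-- Invertible `n × n` matrices. -/
abbrev GLn (n : ℕ) (R : Type*) [CommRing R] := Matrix.GeneralLinearGroup (Fin n) R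

/-- Base change of invertible matrices. -/
abbrev gmap {n : ℕ} {R R' : Type*} [CommRing R] [CommRing R'] (φ : R →+* R') (y : GLn n R) :
    GLn n R' := Matrix.GeneralLinearGroup.map φ y

section

open Matrix

variable {n : ℕ} {R R' R'' : Type*} [CommRing R] [CommRing R'] [CommRing R'']

/-- The submodule of the vectors `c` with `(y c)_i = 0` for `i ≥ d`. -/
def cutMod (y : GLn n R) (d : ℕ) : Submodule R (Fin n → R) where
  carrier := {c | ∀ i : Fin n, d ≤ i → (y.1 *ᵥ c) i = 0}
  zero_mem' := fun i _ => by rw [mulVec_zero]; rfl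
  add_mem' := fun ha hb i hi => by rw [mulVec_add, Pi.add_apply, ha i hi, hb i hi, add_zero]
  smul_mem' := fun r c hc i hi => by rw [mulVec_smul, Pi.smul_apply, hc i hi, smul_zero]

theorem mem_cutMod {y : GLn n R} {d : ℕ} {c : Fin n → R} :
    c ∈ cutMod y d ↔ ∀ i : Fin n, d ≤ i → (y.1 *ᵥ c) i = 0 := Iff.rfl

theorem gmap_gmap (ψ : R' →+* R'') (φ : R →+* R') (y : GLn n R) :
    gmap ψ (gmap φ y) = gmap (ψ.comp φ) y := rfl

theorem gmap_id (y : GLn n R) : gmap (RingHom.id R) y = y := by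
  ext; rfl

theorem gmap_coe (φ : R →+* R') (y : GLn n R) : (gmap φ y).1 = y.1.map φ := rfl

theorem gmap_mulVec (φ : R →+* R') (y : GLn n R) (c : Fin n → R) :
    (gmap φ y).1 *ᵥ (φ ∘ c) = φ ∘ (y.1 *ᵥ c) := by
  ext i
  exact (RingHom.map_mulVec φ y.1 c i).symm

theorem inv_mulVec_mulVec (y : GLn n R) (c : Fin n → R) :
    (y⁻¹ : GLn n R).1 *ᵥ (y.1 *ᵥ c) = c := by
  rw [mulVec_mulVec]
  have : (y⁻¹ : GLn n R).1 * y.1 = 1 := by rw [← Units.val_mul, inv_mul_cancel]; rfl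
  rw [this, one_mulVec]

theorem mulVec_inv_mulVec (y : GLn n R) (c : Fin n → R) :
    y.1 *ᵥ ((y⁻¹ : GLn n R).1 *ᵥ c) = c := by
  have := inv_mulVec_mulVec y⁻¹ c
  rwa [inv_inv] at this

theorem comp_mem_cutMod (φ : R →+* R') {y : GLn n R} {d : ℕ} {c : Fin n → R}
    (hc : c ∈ cutMod y d) : φ ∘ c ∈ cutMod (gmap φ y) d := by
  intro i hi
  rw [gmap_mulVec, Function.comp, hc i hi, map_zero]

theorem comp_mem_cutMod_iff {φ : R →+* R'} (hφ : Function.Injective φ) {y : GLn n R} {d : ℕ}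
    {c : Fin n → R} : φ ∘ c ∈ cutMod (gmap φ y) d ↔ c ∈ cutMod y d := by
  refine ⟨fun h i hi => hφ ?_, comp_mem_cutMod φ⟩
  have := h i hi
  rwa [gmap_mulVec, Function.comp, ← map_zero φ] at this

theorem inv_single_mem_cutMod (y : GLn n R) {d : ℕ} (j : Fin n) (hj : (j : ℕ) < d) :
    (y⁻¹ : GLn n R).1 *ᵥ Pi.single j 1 ∈ cutMod y d := by
  intro i hi
  rw [mulVec_inv_mulVec, Pi.single_eq_of_ne]
  rintro rfl
  omega

theorem eq_sum_inv_single (y : GLn n R) (c : Fin n → R) :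
    c = ∑ j, (y.1 *ᵥ c) j • ((y⁻¹ : GLn n R).1 *ᵥ Pi.single j 1) := by
  conv_lhs => rw [← inv_mulVec_mulVec y c, pi_eq_sum_univ' (y.1 *ᵥ c)]
  rw [mulVec_sum]
  refine Finset.sum_congr rfl fun j _ => ?_
  rw [mulVec_smul]

/-- The first `d` columns of `y⁻¹` span `cutMod y d`, so it suffices to test the defining equations
of `cutMod y' d'` on them. This makes every incidence condition below a vanishing of entries. -/
theorem cutMod_le_iff {y y' : GLn n R} {d d' : ℕ} :
    cutMod y d ≤ cutMod y' d' ↔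
      ∀ i j : Fin n, d' ≤ i → (j : ℕ) < d → (y' * y⁻¹).1 i j = 0 := by
  have key : ∀ j, (y' * y⁻¹).1 *ᵥ Pi.single j 1 = y'.1 *ᵥ ((y⁻¹ : GLn n R).1 *ᵥ Pi.single j 1) := by
    intro j
    rw [mulVec_mulVec]; rfl
  constructor
  · intro h i j hi hj
    have := h (inv_single_mem_cutMod y j hj) i hi
    rw [← key, mulVec_single_one] at this
    exact this
  · intro h c hc
    rw [eq_sum_inv_single y c]
    refine Submodule.sum_mem _ fun j _ => ?_
    by_cases hj : (j : ℕ) < d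
    · refine Submodule.smul_mem _ _ fun i hi => ?_
      rw [← key, mulVec_single_one]
      exact h i j hi hj
    · rw [hc j (not_lt.mp hj), zero_smul]
      exact zero_mem _

theorem gmap_inv (φ : R →+* R') (y : GLn n R) : (gmap φ y)⁻¹ = gmap φ y⁻¹ :=
  (map_inv (Matrix.GeneralLinearGroup.map φ) y).symm

theorem gmap_mul (φ : R →+* R') (y y' : GLn n R) : gmap φ (y * y') = gmap φ y * gmap φ y' :=
  map_mul (Matrix.GeneralLinearGroup.map φ) y y'

theorem gmap_mul_inv (φ : R →+* R') (y y' : GLn n R) :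
    gmap φ y' * (gmap φ y)⁻¹ = gmap φ (y' * y⁻¹) := by
  rw [gmap_mul, gmap_inv]

theorem cutMod_gmap_le (φ : R →+* R') {y y' : GLn n R} {d d' : ℕ}
    (h : cutMod y d ≤ cutMod y' d') : cutMod (gmap φ y) d ≤ cutMod (gmap φ y') d' := by
  rw [cutMod_le_iff] at h ⊢
  intro i j hi hj
  rw [gmap_mul_inv, gmap_coe, map_apply, h i j hi hj, map_zero]

/-- The inclusion says that `y' y⁻¹` is block triangular; the inverse of an invertible block
triangular matrix is again block triangular, which is the reverse inclusion. -/
theorem cutMod_eq_of_le {y y' : GLn n R} {d : ℕ} (h : cutMod y d ≤ cutMod y' d) :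
    cutMod y d = cutMod y' d := by
  refine le_antisymm h ?_
  rw [cutMod_le_iff] at h ⊢
  let b : Fin n → ℕ := fun i => if (i : ℕ) < d then 0 else 1
  have hb : (y' * y⁻¹).1.BlockTriangular b := by
    intro i j hij
    by_cases hi : (i : ℕ) < d
    · simp [b, hi] at hij
    · by_cases hj : (j : ℕ) < d
      · exact h i j (not_lt.mp hi) hj
      · simp [b, hi, hj] at hij
  let _ : Invertible (y' * y⁻¹).1 := (y' * y⁻¹).invertible
  have h2 := blockTriangular_inv_of_blockTriangular hb
  intro i j hi hj
  have h3 : (y * y'⁻¹).1 = ((y' * y⁻¹).1)⁻¹ := by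
    rw [← Matrix.coe_units_inv]; simp
  rw [h3]
  refine h2 ?_
  simp [b, hj, not_lt.mpr hi]

end

/-! ### Subsheaves described by matrices in a frame. -/

namespace Subsheaf

variable {X : Scheme.{u}} {M N : X.Modules} {n : ℕ}

theorem le_of_local {A B : Subsheaf M}
    (h : ∀ t : X, ∃ U : X.Opens, t ∈ U ∧ ∀ W ≤ U, A.sec W ≤ B.sec W) : A ≤ B := by
  intro W x hx
  refine B.of_local x fun t _ => ?_
  obtain ⟨U, htU, hU⟩ := h t
  exact ⟨W ⊓ U, inf_le_left, ⟨‹_›, htU⟩, hU _ inf_le_right (A.res_mem _ hx)⟩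

theorem le_antisymm' {A B : Subsheaf M} (h : A ≤ B) (h' : B ≤ A) : A = B := by
  ext U : 2
  exact le_antisymm (h U) (h' U)

theorem eq_of_local {A B : Subsheaf M}
    (h : ∀ t : X, ∃ U : X.Opens, t ∈ U ∧ ∀ W ≤ U, A.sec W = B.sec W) : A = B := by
  refine le_antisymm' (le_of_local fun t => ?_) (le_of_local fun t => ?_)
  · obtain ⟨U, h1, h2⟩ := h t
    exact ⟨U, h1, fun W hW => (h2 W hW).le⟩
  · obtain ⟨U, h1, h2⟩ := h t
    exact ⟨U, h1, fun W hW => (h2 W hW).ge⟩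

/-- In the frame `e` over `U`, the subsheaf `A` consists of the sections whose coordinate vector
lies in the submodule `cutMod y d`. -/
def Cut (A : Subsheaf M) {U : X.Opens} (e : Fin n → Γ(M, U)) (d : ℕ) (y : GLn n Γ(X, U)) : Prop :=
  ∀ ⦃W : X.Opens⦄ (h : W ≤ U) (c : Fin n → Γ(X, W)),
    lin e h c ∈ A.sec W ↔ c ∈ cutMod (gmap (rmap h) y) d

theorem Cut.res {A : Subsheaf M} {U V : X.Opens} {e : Fin n → Γ(M, U)} {d : ℕ} {y : GLn n Γ(X, U)}
    (hA : A.Cut e d y) (k : V ≤ U) :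
    A.Cut (fun i => RelGrass.res M k (e i)) d (gmap (rmap k) y) := by
  intro W h c
  rw [lin_res, hA, gmap_gmap, rmap_comp]

theorem Cut.le_iff {A B : Subsheaf M} {U : X.Opens} {e : Fin n → Γ(M, U)} (he : IsFrame M U e)
    {d d' : ℕ} {y y' : GLn n Γ(X, U)} (hA : A.Cut e d y) (hB : B.Cut e d' y') :
    (∀ W ≤ U, A.sec W ≤ B.sec W) ↔ cutMod y d ≤ cutMod y' d' := by
  constructor
  · intro h c hc
    have h1 := hA le_rfl c
    have h2 := hB le_rfl c
    rw [rmap_self, gmap_id] at h1 h2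
    exact h2.mp (h U le_rfl (h1.mpr hc))
  · intro h W hW x hx
    rw [← he.lin_coord hW x] at hx ⊢
    exact (hB hW _).mpr (cutMod_gmap_le _ h ((hA hW _).mp hx))

theorem Cut.sec_eq_iff {A B : Subsheaf M} {U : X.Opens} {e : Fin n → Γ(M, U)} (he : IsFrame M U e)
    {d d' : ℕ} {y y' : GLn n Γ(X, U)} (hA : A.Cut e d y) (hB : B.Cut e d' y') :
    (∀ W ≤ U, A.sec W = B.sec W) ↔ cutMod y d = cutMod y' d' := by
  simp only [le_antisymm_iff]
  rw [← hA.le_iff he hB, ← hB.le_iff he hA]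
  exact ⟨fun h => ⟨fun W hW => (h W hW).1, fun W hW => (h W hW).2⟩,
    fun h W hW => ⟨h.1 W hW, h.2 W hW⟩⟩

theorem Cut.congr {A : Subsheaf M} {U : X.Opens} {e : Fin n → Γ(M, U)}
    {d d' : ℕ} {y y' : GLn n Γ(X, U)} (hA : A.Cut e d y) (h : cutMod y d = cutMod y' d') :
    A.Cut e d' y' := by
  intro W k c
  rw [hA]
  have : cutMod (gmap (rmap k) y) d = cutMod (gmap (rmap k) y') d' :=
    le_antisymm (cutMod_gmap_le _ h.le) (cutMod_gmap_le _ h.ge)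
  rw [this]

end Subsheaf

/-! ### Transition matrices and the matrices of subbundles. -/

section

open Matrix

variable {X : Scheme.{u}} {M N : X.Modules} {n : ℕ}

/-- The transition matrix between two frames. -/
theorem IsFrame.exists_transition {U : X.Opens} {e e' : Fin n → Γ(M, U)} (he : IsFrame M U e)
    (he' : IsFrame M U e') : ∃ y : GLn n Γ(X, U), ∀ {W : X.Opens} (h : W ≤ U)
      (c : Fin n → Γ(X, W)), lin e h c = lin e' h ((gmap (rmap h) y).1 *ᵥ c) := by
  let L : (Fin n → Γ(X, U)) ≃ₗ[Γ(X, U)] (Fin n → Γ(X, U)) :=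
    (he.coord le_rfl).symm.trans (he'.coord le_rfl)
  let y : GLn n Γ(X, U) :=
    ⟨LinearMap.toMatrix' L.toLinearMap, LinearMap.toMatrix' L.symm.toLinearMap,
      by rw [← LinearMap.toMatrix'_comp]; simp, by rw [← LinearMap.toMatrix'_comp]; simp⟩
  have hy : ∀ c, y.1 *ᵥ c = he'.coord le_rfl (lin e le_rfl c) := fun c => by
    change LinearMap.toMatrix' L.toLinearMap *ᵥ c = _
    rw [← toLin'_apply, toLin'_toMatrix']
    rfl
  refine ⟨y, fun {W} h c => ?_⟩
  have h1 : ∀ j, RelGrass.res M h (e j) = lin e' h ((gmap (rmap h) y).1 *ᵥ Pi.single j 1) := by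
    intro j
    have h2 : e j = lin e' le_rfl (y.1 *ᵥ Pi.single j 1) := by
      rw [hy, he'.lin_coord, lin_single, res_self]
    have h3 : (Pi.single j 1 : Fin n → Γ(X, W)) = rmap h ∘ Pi.single j 1 := by
      ext i
      simp only [Function.comp, Pi.single_apply]
      split_ifs <;> simp
    rw [h2, res_lin, h3, gmap_mulVec]
  conv_rhs => rw [pi_eq_sum_univ' c]
  rw [mulVec_sum, map_sum, lin_apply]
  refine Finset.sum_congr rfl fun j _ => ?_
  rw [mulVec_smul, map_smul, h1]

theorem IsFrame.reindex {ι κ : Type} [Fintype ι] [Fintype κ] {U : X.Opens} {e : ι → Γ(M, U)}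
    (he : IsFrame M U e) (σ : κ ≃ ι) : IsFrame M U (e ∘ σ) := by
  intro W h
  have h1 := (he.bijective h).comp (Equiv.arrowCongr σ (Equiv.refl Γ(X, W))).bijective
  convert h1 using 1
  ext c
  simp only [Function.comp, lin_apply, Equiv.arrowCongr_apply, Equiv.coe_refl, id]
  exact Fintype.sum_equiv σ _ _ (by simp)

theorem span_eq_of_frame {d m : ℕ} {U : X.Opens} {e : Fin d ⊕ Fin m → Γ(M, U)}
    (he : IsFrame M U e) {W : X.Opens} (h : W ≤ U) (c : Fin (d + m) → Γ(X, W)) :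
    lin (e ∘ finSumFinEquiv.symm) h c ∈
      Submodule.span Γ(X, W) (Set.range fun i : Fin d => res M h (e (Sum.inl i))) ↔
      ∀ i : Fin (d + m), d ≤ i → c i = 0 := by
  have hsplit : ∀ c' : Fin (d + m) → Γ(X, W), lin (e ∘ finSumFinEquiv.symm) h c' =
      ∑ i : Fin d, c' (Fin.castAdd m i) • res M h (e (Sum.inl i)) +
        ∑ i : Fin m, c' (Fin.natAdd d i) • res M h (e (Sum.inr i)) := by
    intro c'
    rw [lin_apply, Fin.sum_univ_add]
    simp
  constructor
  · intro hx
    rw [Submodule.mem_span_range_iff_exists_fun] at hx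
    obtain ⟨b, hb⟩ := hx
    have h1 : lin (e ∘ finSumFinEquiv.symm) h (Fin.addCases b 0) =
        lin (e ∘ finSumFinEquiv.symm) h c := by
      rw [← hb, hsplit]
      simp
    have h2 := ((he.reindex finSumFinEquiv.symm).bijective h).injective h1
    intro i hi
    rw [← h2]
    obtain ⟨j, rfl⟩ : ∃ j : Fin m, Fin.natAdd d j = i :=
      ⟨⟨i - d, by omega⟩, by ext; simp; omega⟩
    simp
  · intro hc
    rw [hsplit, Finset.sum_eq_zero (s := (Finset.univ : Finset (Fin m))), add_zero]
    · exact Submodule.sum_mem _ fun i _ => Submodule.smul_mem _ _ (Submodule.subset_span ⟨i, rfl⟩)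
    · intro i _
      rw [hc _ (by simp), zero_smul]

/-- The matrix is the transition from the given frame to a frame whose first `d` members span `A`:
the last coordinates in the latter are the equations of `A`. -/
theorem Subsheaf.IsSubbundle.exists_cut {A : Subsheaf M} {d : ℕ} (hA : A.IsSubbundle d)
    {U : X.Opens} {e : Fin n → Γ(M, U)} (he : IsFrame M U e) {t : X} (ht : t ∈ U) :
    d ≤ n ∧ ∃ (W : X.Opens) (k : W ≤ U) (y : GLn n Γ(X, W)), t ∈ W ∧
      A.Cut (fun i => RelGrass.res M k (e i)) d y := by
  obtain ⟨V, htV, m, e', he', hspan⟩ := hA t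
  let W := U ⊓ V
  have htW : t ∈ W := ⟨ht, htV⟩
  -- A nonempty open has a nonzero ring of functions, so two frames over it have equally many
  -- members.
  have : Nonempty W := ⟨⟨t, htW⟩⟩
  have h1 := he.res (inf_le_left : W ≤ U)
  have h2 := he'.res (inf_le_right : W ≤ V)
  have hcard := card_eq_of_linearEquiv Γ(X, W) ((h1.coord le_rfl).symm.trans (h2.coord le_rfl))
  have hn : n = d + m := by simpa using hcard
  subst hn
  obtain ⟨y, hy⟩ := h1.exists_transition (h2.reindex finSumFinEquiv.symm)
  refine ⟨Nat.le_add_right _ _, W, inf_le_left, y, htW, fun {W'} h c => ?_⟩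
  rw [hy h c, hspan W' (h.trans inf_le_right), mem_cutMod, ← span_eq_of_frame h2 h]
  simp only [res_res]

/-- The columns of `y⁻¹`, read in the frame `e`, form an adapted frame. -/
theorem Subsheaf.isSubbundle_of_cut {A : Subsheaf M} {d : ℕ}
    (h : ∀ t : X, ∃ (m : ℕ) (W : X.Opens) (e : Fin m → Γ(M, W)) (y : GLn m Γ(X, W)), d ≤ m ∧
      t ∈ W ∧ IsFrame M W e ∧ A.Cut e d y) : A.IsSubbundle d := by
  intro t
  obtain ⟨m, W, e, y, hd, htW, he, hA⟩ := h t
  obtain ⟨m, rfl⟩ := Nat.exists_eq_add_of_le hd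
  let e' : Fin (d + m) → Γ(M, W) := fun j => lin e le_rfl ((y⁻¹ : GLn _ _).1 *ᵥ Pi.single j 1)
  have hlin : ∀ {V : X.Opens} (k : V ≤ W) (c : Fin (d + m) → Γ(X, V)),
      lin e' k c = lin e k ((gmap (rmap k) y⁻¹).1 *ᵥ c) := by
    intro V k c
    conv_rhs => rw [pi_eq_sum_univ' c]
    rw [mulVec_sum, map_sum, lin_apply]
    refine Finset.sum_congr rfl fun j _ => ?_
    rw [mulVec_smul, map_smul, res_lin, ← gmap_mulVec]
    congr 4
    ext i
    simp only [Function.comp, Pi.single_apply]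
    split_ifs <;> simp_all
  have he' : IsFrame M W e' := by
    intro V k
    have h1 : Function.Bijective (fun c => (gmap (rmap k) y⁻¹).1 *ᵥ c) := by
      refine Function.bijective_iff_has_inverse.mpr
        ⟨fun c => (gmap (rmap k) y).1 *ᵥ c, fun c => ?_, fun c => ?_⟩
      · have := mulVec_inv_mulVec (gmap (rmap k) y) c
        rwa [gmap_inv] at this
      · have := inv_mulVec_mulVec (gmap (rmap k) y) c
        rwa [gmap_inv] at this
    have h2 := (he.bijective k).comp h1
    convert h2 using 1
    ext c
    exact hlin k c
  have he'' := he'.reindex (finSumFinEquiv (m := d) (n := m))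
  refine ⟨W, htW, m, e' ∘ finSumFinEquiv, he'', fun V k => ?_⟩
  ext x
  have h3 := span_eq_of_frame he'' k (he'.coord k x)
  have h4 : (e' ∘ finSumFinEquiv (m := d) (n := m)) ∘ finSumFinEquiv.symm = e' := by
    ext i; simp
  rw [h4, he'.lin_coord] at h3
  rw [h3]
  have h5 : x = lin e k ((gmap (rmap k) y⁻¹).1 *ᵥ he'.coord k x) := by
    rw [← hlin, he'.lin_coord]
  conv_lhs => rw [h5, hA k, mem_cutMod]
  have h6 := mulVec_inv_mulVec (gmap (rmap k) y) (he'.coord k x)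
  rw [gmap_inv] at h6
  rw [h6]

/-! ### Pullback of subbundles in coordinates -/

/-- Pulled back generators satisfy the pulled back equations, and hence so do their local
combinations. Conversely, the solutions are combinations of the first `d` columns of the inverse
matrix, and these are pullbacks of sections of `A`. -/
theorem Subsheaf.Cut.pullback {T : Scheme.{u}} (g : T ⟶ X) {A : Subsheaf M} {U : X.Opens}
    {e : Fin n → Γ(M, U)} (he : IsFrame M U e) {d : ℕ} {y : GLn n Γ(X, U)} (hA : A.Cut e d y) :
    (A.pullback g).Cut (fun i => pullSec g M (e i)) d (gmap (g.app U).hom y) := by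
  have hê := he.pullSec g
  intro W h c
  constructor
  · intro hx i hi
    refine fun_ext fun t ht => ?_
    obtain ⟨W', h', htW', hspan⟩ := hx t ht
    refine ⟨W', h', htW', ?_⟩
    rw [map_zero]
    have hc : ∀ z ∈ Submodule.span Γ(T, W') (restrictions (fun W => {y | ∃ (U : X.Opens)
        (h : W = g ⁻¹ᵁ U), ∃ x ∈ A.sec U, y = RelGrass.res _ h.le (pullSec g M x)}) W'),
        hê.coord (h'.trans h) z ∈ cutMod (gmap (rmap (h'.trans h)) (gmap (g.app U).hom y)) d := by
      intro z hz
      induction hz using Submodule.span_induction with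
      | zero => rw [map_zero]; exact zero_mem _
      | add x y _ _ hx hy => rw [map_add]; exact add_mem hx hy
      | smul r x _ hx => rw [map_smul]; exact Submodule.smul_mem _ _ hx
      | mem z hz =>
        obtain ⟨V, hV, s, ⟨U', rfl, x, hx, rfl⟩, rfl⟩ := hz
        have k1 : U' ⊓ U ≤ U := inf_le_right
        have k2 : W' ≤ g ⁻¹ᵁ (U' ⊓ U) := fun a ha => ⟨hV ha, h (h' ha)⟩
        have h1 : RelGrass.res _ hV (RelGrass.res _ le_rfl (pullSec g M x)) =
            lin (fun i => pullSec g M (e i)) (h'.trans h)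
              (rmap k2 ∘ ((g.app (U' ⊓ U)).hom ∘
                he.coord k1 (RelGrass.res M inf_le_left x))) := by
          rw [← res_lin _ k2 (preimage_le g k1), ← pullSec_lin _ k1, he.lin_coord,
            pullSec_res g M inf_le_left (preimage_le g inf_le_left), res_res, res_res]
        rw [h1, hê.coord_lin]
        have h2 : he.coord k1 (RelGrass.res M inf_le_left x) ∈ cutMod (gmap (rmap k1) y) d := by
          rw [← hA k1, he.lin_coord]
          exact A.res_mem _ hx
        have h3 := comp_mem_cutMod (rmap k2) (comp_mem_cutMod (g.app (U' ⊓ U)).hom h2)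
        convert h3 using 1
        congr 1
        rw [gmap_gmap, gmap_gmap, gmap_gmap]
        congr 1
        ext r
        change rmap _ ((g.app U).hom r) = rmap k2 ((g.app (U' ⊓ U)).hom (rmap k1 r))
        rw [app_rmap g k1 (preimage_le g k1), rmap_rmap]
    have h1 := hc _ hspan i hi
    rw [res_lin, hê.coord_lin, ← rmap_comp h' h, ← gmap_gmap, gmap_mulVec] at h1
    exact h1
  · intro hc t ht
    refine ⟨W, le_rfl, ht, ?_⟩
    rw [res_self]
    rw [eq_sum_inv_single (gmap (rmap h) (gmap (g.app U).hom y)) c, map_sum]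
    refine Submodule.sum_mem _ fun j _ => ?_
    by_cases hj : (j : ℕ) < d
    · rw [map_smul]
      refine Submodule.smul_mem _ _ (Submodule.subset_span ?_)
      refine ⟨g ⁻¹ᵁ U, h, pullSec g M (lin e le_rfl ((y⁻¹ : GLn _ _).1 *ᵥ Pi.single j 1)),
        ⟨U, rfl, _, ?_, (res_self _ _ _).symm⟩, ?_⟩
      · rw [hA le_rfl, rmap_self, gmap_id]
        exact inv_single_mem_cutMod y j hj
      · rw [pullSec_lin, res_lin, gmap_inv, gmap_inv, ← gmap_mulVec, ← gmap_mulVec]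
        congr 2
        ext i
        simp only [Function.comp, Pi.single_apply]
        split_ifs <;> simp
    · rw [hc j (not_lt.mp hj), zero_smul, map_zero]
      exact zero_mem _

theorem Subsheaf.Cut.comap_iso (φ : M ≅ N) {A : Subsheaf M} {U : X.Opens}
    {e : Fin n → Γ(M, U)} {d : ℕ} {y : GLn n Γ(X, U)} (hA : A.Cut e d y) :
    (A.comap φ.inv).Cut (fun i => φ.hom.app U (e i)) d y := by
  intro W h c
  rw [← hA h c, ← hom_app_lin]
  have : φ.inv.app W (φ.hom.app W (lin e h c)) = lin e h c :=
    congrArg (fun a => a.app W (lin e h c)) φ.hom_inv_id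
  change φ.inv.app W _ ∈ A.sec W ↔ _
  rw [this]

theorem Subsheaf.Cut.pullbackOver {T Y S : Scheme.{u}} {g : T ⟶ Y} {π : Y ⟶ S} {f : T ⟶ S}
    (w : g ≫ π = f) {H : S.Modules} {A : Subsheaf ((Scheme.Modules.pullback π).obj H)}
    {U : Y.Opens} {e : Fin n → Γ((Scheme.Modules.pullback π).obj H, U)} (he : IsFrame _ U e)
    {d : ℕ} {y : GLn n Γ(Y, U)} (hA : A.Cut e d y) :
    (A.pullbackOver w).Cut (fun i => pullSecOver w H (e i)) d (gmap (g.app U).hom y) :=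
  (hA.pullback g he).comap_iso (pullIso w H)

end

/-! ### Subbundles of pullbacks in coordinates -/

section

variable {T Y S : Scheme.{u}} {H : S.Modules} {n : ℕ}

/-- The frame of `f^* H` over `W` induced by a frame of `H`. -/
def fr (f : T ⟶ S) {U : S.Opens} (h : Fin n → Γ(H, U)) {W : T.Opens} (k : W ≤ f ⁻¹ᵁ U) (i : Fin n) :
    Γ((Scheme.Modules.pullback f).obj H, W) := res _ k (pullSec f H (h i))

theorem isFrame_fr (f : T ⟶ S) {U : S.Opens} {h : Fin n → Γ(H, U)} (hh : IsFrame H U h)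
    {W : T.Opens} (k : W ≤ f ⁻¹ᵁ U) : IsFrame _ W (fr f h k) :=
  (hh.pullSec f).res k

theorem res_fr (f : T ⟶ S) {U : S.Opens} (h : Fin n → Γ(H, U)) {V W : T.Opens} (k : W ≤ f ⁻¹ᵁ U)
    (k' : V ≤ W) : (fun i => res _ k' (fr f h k i)) = fr f h (k'.trans k) := by
  ext i
  exact res_res _ _ _ _

variable {g : T ⟶ Y} {π : Y ⟶ S} {f : T ⟶ S} (w : g ≫ π = f)

include w in
theorem preimage_le_of_comp {U : S.Opens} {W : Y.Opens} (k : W ≤ π ⁻¹ᵁ U) :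
    g ⁻¹ᵁ W ≤ f ⁻¹ᵁ U := by
  subst w
  exact preimage_le g k

theorem pullSecOver_fr {U : S.Opens} (h : Fin n → Γ(H, U)) {W : Y.Opens} (k : W ≤ π ⁻¹ᵁ U)
    (i : Fin n) : pullSecOver w H (fr π h k i) = fr f h (preimage_le_of_comp w k) i := by
  unfold fr
  rw [pullSecOver_res w H k (preimage_le g k), pullSecOver_pullSec, res_res]

/-- `A` is given by `cutMod y d` over `W` in the frame induced by a frame of `H`. -/
abbrev Subsheaf.CutAt (A : Subsheaf ((Scheme.Modules.pullback f).obj H)) {U : S.Opens}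
    (h : Fin n → Γ(H, U)) {W : T.Opens} (k : W ≤ f ⁻¹ᵁ U) (d : ℕ) (y : GLn n Γ(T, W)) : Prop :=
  A.Cut (fr f h k) d y

namespace Subsheaf

theorem CutAt.res {A : Subsheaf ((Scheme.Modules.pullback f).obj H)} {U : S.Opens}
    {h : Fin n → Γ(H, U)} {V W : T.Opens} {k : W ≤ f ⁻¹ᵁ U} {d : ℕ} {y : GLn n Γ(T, W)}
    (hA : A.CutAt h k d y) (k' : V ≤ W) : A.CutAt h (k'.trans k) d (gmap (rmap k') y) := by
  have := Cut.res hA k'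
  rwa [res_fr] at this

theorem CutAt.pullbackOver {A : Subsheaf ((Scheme.Modules.pullback π).obj H)} {U : S.Opens}
    {h : Fin n → Γ(H, U)} (hh : IsFrame H U h) {W : Y.Opens} {k : W ≤ π ⁻¹ᵁ U} {d : ℕ}
    {y : GLn n Γ(Y, W)} (hA : A.CutAt h k d y) :
    (A.pullbackOver w).CutAt h (preimage_le_of_comp w k) d (gmap (g.app W).hom y) := by
  have := Cut.pullbackOver w (isFrame_fr π hh k) hA
  simp only [pullSecOver_fr] at this
  exact this

theorem Cut.cutAt_pullback {P : Subsheaf H} {U U' : S.Opens} {h : Fin n → Γ(H, U)}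
    (hh : IsFrame H U h) (k : U' ≤ U) {d : ℕ} {y : GLn n Γ(S, U')}
    (hP : P.Cut (fun i => RelGrass.res H k (h i)) d y) :
    (P.pullback f).CutAt h (preimage_le f k) d (gmap (f.app U').hom y) := by
  have := Cut.pullback f (hh.res k) hP
  simp only [pullSec_res f H k (preimage_le f k)] at this
  exact this

/-- Near every point a subbundle of `f^* H` is given by an invertible matrix. -/
theorem IsSubbundle.exists_cutAt {A : Subsheaf ((Scheme.Modules.pullback f).obj H)} {d : ℕ}
    (hA : A.IsSubbundle d) {U : S.Opens} {h : Fin n → Γ(H, U)} (hh : IsFrame H U h) {t : T}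
    {W : T.Opens} (k : W ≤ f ⁻¹ᵁ U) (ht : t ∈ W) :
    d ≤ n ∧ ∃ (V : T.Opens) (k' : V ≤ W) (y : GLn n Γ(T, V)), t ∈ V ∧
      A.CutAt h (k'.trans k) d y := by
  obtain ⟨hd, V, k', y, htV, hy⟩ := hA.exists_cut (isFrame_fr f hh k) ht
  rw [res_fr] at hy
  exact ⟨hd, V, k', y, htV, hy⟩

theorem isSubbundle_of_cutAt {A : Subsheaf ((Scheme.Modules.pullback f).obj H)} {d : ℕ}
    (hA : ∀ t : T, d ≤ n ∧ ∃ (U : S.Opens) (h : Fin n → Γ(H, U)) (_ : IsFrame H U h) (W : T.Opens)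
      (k : W ≤ f ⁻¹ᵁ U) (y : GLn n Γ(T, W)), t ∈ W ∧ A.CutAt h k d y) : A.IsSubbundle d := by
  refine isSubbundle_of_cut fun t => ?_
  obtain ⟨hd, U, h, hh, W, k, y, htW, hy⟩ := hA t
  exact ⟨n, W, fr f h k, y, hd, htW, isFrame_fr f hh k, hy⟩

theorem IsSubbundle.pullbackOver (hH : IsVectorBundle H n)
    {A : Subsheaf ((Scheme.Modules.pullback π).obj H)} {d : ℕ} (hA : A.IsSubbundle d) :
    (A.pullbackOver w).IsSubbundle d := by
  refine isSubbundle_of_cutAt (n := n) fun t => ?_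
  obtain ⟨U, hU, h, hh⟩ := hH (π (g t))
  obtain ⟨hd, V, k, y, ht, hy⟩ := hA.exists_cutAt (f := π) hh (t := g t) le_rfl hU
  exact ⟨hd, U, h, hh, _, _, _, ht, CutAt.pullbackOver w hh hy⟩

theorem IsSubbundle.pullback (hH : IsVectorBundle H n) (f : T ⟶ S) {P : Subsheaf H} {d : ℕ}
    (hP : P.IsSubbundle d) : (P.pullback f).IsSubbundle d := by
  refine isSubbundle_of_cutAt (n := n) fun t => ?_
  obtain ⟨U, hU, h, hh⟩ := hH (f t)
  obtain ⟨hd, V, k, y, ht, hy⟩ := hP.exists_cut hh hU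
  exact ⟨hd, U, h, hh, _, _, _, ht, Cut.cutAt_pullback hh k hy⟩

theorem pullback_mono (g : T ⟶ Y) {M : Y.Modules} {A B : Subsheaf M} (h : A ≤ B) :
    A.pullback g ≤ B.pullback g := by
  intro W x hx t ht
  obtain ⟨V, k, htV, hV⟩ := hx t ht
  refine ⟨V, k, htV, Submodule.span_mono ?_ hV⟩
  rintro _ ⟨U, hU, s, ⟨U', hU', z, hz, rfl⟩, rfl⟩
  exact ⟨U, hU, _, ⟨U', hU', z, h U' hz, rfl⟩, rfl⟩

theorem pullbackOver_mono {A B : Subsheaf ((Scheme.Modules.pullback π).obj H)} (h : A ≤ B) :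
    A.pullbackOver w ≤ B.pullbackOver w := fun _ _ hx => pullback_mono g h _ hx

/-- Two subbundles given near every point by the same matrix agree. -/
theorem eq_of_cutAt {A B : Subsheaf ((Scheme.Modules.pullback f).obj H)}
    (hAB : ∀ t : T, ∃ (U : S.Opens) (h : Fin n → Γ(H, U)) (_ : IsFrame H U h) (W : T.Opens)
      (k : W ≤ f ⁻¹ᵁ U) (d : ℕ) (y : GLn n Γ(T, W)), t ∈ W ∧ A.CutAt h k d y ∧ B.CutAt h k d y) :
    A = B := by
  refine eq_of_local fun t => ?_
  obtain ⟨U, h, hh, W, k, d, y, htW, hA, hB⟩ := hAB t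
  exact ⟨W, htW, (Cut.sec_eq_iff (isFrame_fr f hh k) hA hB).mpr rfl⟩

theorem pullbackOver_id (hH : IsVectorBundle H n)
    {A : Subsheaf ((Scheme.Modules.pullback π).obj H)} {d : ℕ} (hA : A.IsSubbundle d)
    (w : 𝟙 Y ≫ π = π) : A.pullbackOver w = A := by
  refine eq_of_cutAt (n := n) fun t => ?_
  obtain ⟨U, hU, h, hh⟩ := hH (π t)
  obtain ⟨hd, V, k, y, ht, hy⟩ := hA.exists_cutAt (f := π) hh (t := t) le_rfl hU
  have h1 := CutAt.pullbackOver w hh hy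
  have h2 : gmap ((𝟙 Y : Y ⟶ Y).app V).hom y = y := by
    rw [Scheme.Hom.id_app]
    exact gmap_id y
  refine ⟨U, h, hh, V, k, d, y, ht, ?_, hy⟩
  rw [h2] at h1
  exact h1

/-- In frames coming from `H`, both sides are given by the same base-changed matrix. Functoriality
thus reduces to that of ring maps, and coherence of the pullback isomorphisms is not needed. -/
theorem pullbackOver_comp (hH : IsVectorBundle H n) {T' : Scheme.{u}} {g' : T' ⟶ T}
    {f' : T' ⟶ S} (w' : g' ≫ f = f') (w'' : (g' ≫ g) ≫ π = f')
    {A : Subsheaf ((Scheme.Modules.pullback π).obj H)} {d : ℕ} (hA : A.IsSubbundle d) :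
    (A.pullbackOver w).pullbackOver w' = A.pullbackOver w'' := by
  refine eq_of_cutAt (n := n) fun t => ?_
  obtain ⟨U, hU, h, hh⟩ := hH (π (g (g' t)))
  obtain ⟨hd, V, k, y, ht, hy⟩ := hA.exists_cutAt (f := π) hh (t := g (g' t)) le_rfl hU
  have h1 := CutAt.pullbackOver w' hh (CutAt.pullbackOver w hh hy)
  have h2 := CutAt.pullbackOver w'' hh hy
  have h3 : gmap (g'.app (g ⁻¹ᵁ V)).hom (gmap (g.app V).hom y) = gmap ((g' ≫ g).app V).hom y := by
    rw [Scheme.Hom.comp_app]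
    rfl
  rw [h3] at h1
  exact ⟨U, h, hh, _, preimage_le_of_comp w'' (k.trans le_rfl), d, _, ht, h1, h2⟩

theorem pullback_pullbackOver (hH : IsVectorBundle H n) {P : Subsheaf H} {d : ℕ}
    (hP : P.IsSubbundle d) : (P.pullback π).pullbackOver w = P.pullback f := by
  refine eq_of_cutAt (n := n) fun t => ?_
  obtain ⟨U, hU, h, hh⟩ := hH (π (g t))
  obtain ⟨hd, V, k, y, ht, hy⟩ := hP.exists_cut hh hU
  have h1 := CutAt.pullbackOver w hh (Cut.cutAt_pullback (f := π) hh k hy)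
  subst w
  have h2 := Cut.cutAt_pullback (f := g ≫ π) hh k hy
  rw [Scheme.Hom.comp_app] at h2
  exact ⟨U, h, hh, _, _, d, _, ht, h1, h2⟩

theorem mem_pullbackOver {A : Subsheaf ((Scheme.Modules.pullback π).obj H)} {U : T.Opens}
    {x : Γ((Scheme.Modules.pullback f).obj H, U)} : x ∈ (A.pullbackOver w).sec U ↔
      (pullIso w H).inv.app U x ∈ (A.pullback g).sec U := Iff.rfl

theorem pullSecOver_mem {A : Subsheaf ((Scheme.Modules.pullback π).obj H)} {U : Y.Opens}
    {x : Γ((Scheme.Modules.pullback π).obj H, U)} (hx : x ∈ A.sec U) :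
    pullSecOver w H x ∈ (A.pullbackOver w).sec (g ⁻¹ᵁ U) := by
  rw [mem_pullbackOver, pullSecOver_eq, iso_inv_app_hom_app]
  refine fun t ht => ⟨g ⁻¹ᵁ U, le_rfl, ht, Submodule.subset_span ?_⟩
  exact ⟨_, le_rfl, _, ⟨U, rfl, x, hx, (res_self _ _ _).symm⟩, rfl⟩

/-- Locally both memberships are linear equations on coordinates, and functions on opens inside the
range inject under `g`. -/
theorem pullSecOver_mem_iff [IsOpenImmersion g] (hH : IsVectorBundle H n)
    {A : Subsheaf ((Scheme.Modules.pullback π).obj H)} {d : ℕ} (hA : A.IsSubbundle d)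
    {U : Y.Opens} (hU : U ≤ g.opensRange) {x : Γ((Scheme.Modules.pullback π).obj H, U)} :
    pullSecOver w H x ∈ (A.pullbackOver w).sec (g ⁻¹ᵁ U) ↔ x ∈ A.sec U := by
  refine ⟨fun hx => A.of_local x fun t ht => ?_, pullSecOver_mem w⟩
  obtain ⟨U', hU', h, hh⟩ := hH (π t)
  obtain ⟨hd, V, k, y, htV, hy⟩ := hA.exists_cutAt (f := π) hh (t := t) le_rfl hU'
  refine ⟨U ⊓ V, inf_le_left, ⟨ht, htV⟩, ?_⟩
  have hf := isFrame_fr π hh (k.trans le_rfl)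
  rw [← hf.lin_coord inf_le_right (RelGrass.res _ _ x), hy inf_le_right]
  have h1 := (A.pullbackOver w).res_mem (preimage_le g (inf_le_left : U ⊓ V ≤ U)) hx
  rw [← pullSecOver_res w H inf_le_left, ← hf.lin_coord inf_le_right (RelGrass.res _ _ x),
    pullSecOver_lin] at h1
  simp only [pullSecOver_fr] at h1
  rw [CutAt.pullbackOver w hh hy (preimage_le g inf_le_right)] at h1
  rw [← comp_mem_cutMod_iff (app_bijective g (inf_le_left.trans hU)).injective]
  convert h1 using 2
  rw [gmap_gmap, gmap_gmap]
  congr 1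
  ext r
  exact app_rmap g _ _ r

end Subsheaf

/-- The pullback of a flag. -/
def BundleFlag.pullbackOver (hH : IsVectorBundle H n) {D : Finset ℕ}
    (V : BundleFlag ((Scheme.Modules.pullback π).obj H) D) :
    BundleFlag ((Scheme.Modules.pullback f).obj H) D where
  sub d := (V.sub d).pullbackOver w
  isSubbundle d := (V.isSubbundle d).pullbackOver w hH
  le d d' h := Subsheaf.pullbackOver_mono w (V.le d d' h)

/-- The pullback of a flag of `H`. -/
def BundleFlag.pullback (hH : IsVectorBundle H n) {D : Finset ℕ} (V : BundleFlag H D)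
    (f : T ⟶ S) : BundleFlag ((Scheme.Modules.pullback f).obj H) D where
  sub d := (V.sub d).pullback f
  isSubbundle d := (V.isSubbundle d).pullback hH f
  le d d' h := Subsheaf.pullback_mono f (V.le d d' h)

end

/-! ### Representability of Zariski sheaves over a base scheme -/

/-- A sheaf of sets on the big Zariski site of `S`. -/
structure LocalFunctor (S : Scheme.{u}) where
  /-- the values -/
  obj : ∀ {T : Scheme.{u}}, (T ⟶ S) → Type u
  /-- restriction along a morphism over `S` -/
  map : ∀ {T' T : Scheme.{u}} (g : T' ⟶ T) {f : T ⟶ S} {f' : T' ⟶ S}, g ≫ f = f' → obj f → obj f'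
  map_id : ∀ {T : Scheme.{u}} {f : T ⟶ S} (w : 𝟙 T ≫ f = f) (x : obj f), map (𝟙 T) w x = x
  map_comp : ∀ {T'' T' T : Scheme.{u}} (g' : T'' ⟶ T') (g : T' ⟶ T) {f : T ⟶ S} {f' : T' ⟶ S}
    {f'' : T'' ⟶ S} (w : g ≫ f = f') (w' : g' ≫ f' = f'') (w'' : (g' ≫ g) ≫ f = f'') (x : obj f),
    map g' w' (map g w x) = map (g' ≫ g) w'' x
  ext : ∀ {T : Scheme.{u}} (𝒰 : Scheme.OpenCover.{u + 1} T) (f : T ⟶ S) (x y : obj f),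
    (∀ i, map (𝒰.f i) rfl x = map (𝒰.f i) rfl y) → x = y
  glue : ∀ {T : Scheme.{u}} (𝒰 : Scheme.OpenCover.{u + 1} T) (f : T ⟶ S) (x : ∀ i, obj (𝒰.f i ≫ f)),
    (∀ (i j) (Z : Scheme.{u}) (a : Z ⟶ 𝒰.X i) (b : Z ⟶ 𝒰.X j) (h : a ≫ 𝒰.f i = b ≫ 𝒰.f j),
      map a rfl (x i) = map b (by rw [← Category.assoc, ← h, Category.assoc]) (x j)) →
    ∃ y : obj f, ∀ i, map (𝒰.f i) rfl y = x i

namespace LocalFunctor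

variable {S : Scheme.{u}} (E : LocalFunctor S)

/-- Replaces equality of dependent pairs by an equality over a fixed structure morphism, so that no
transports appear later. -/
theorem map_mk_eq_iff {T' T : Scheme.{u}} (g : T' ⟶ T) {f : T ⟶ S} {f' : T' ⟶ S} {x : E.obj f}
    {x' : E.obj f'} : (⟨g ≫ f, E.map g rfl x⟩ : Σ f : T' ⟶ S, E.obj f) = ⟨f', x'⟩ ↔
      ∃ w : g ≫ f = f', E.map g w x = x' := by
  constructor
  · rintro h
    cases h
    exact ⟨rfl, rfl⟩
  · rintro ⟨w, h⟩
    subst w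
    rw [h]

/-- The underlying presheaf on schemes. -/
def functor : Scheme.{u}ᵒᵖ ⥤ Type u where
  obj T := Σ f : T.unop ⟶ S, E.obj f
  map g := ↾fun x => ⟨g.unop ≫ x.1, E.map g.unop rfl x.2⟩
  map_id T := by
    refine ConcreteCategory.hom_ext _ _ fun x => ?_
    exact (E.map_mk_eq_iff (𝟙 _)).mpr ⟨Category.id_comp _, E.map_id _ _⟩
  map_comp g g' := by
    refine ConcreteCategory.hom_ext _ _ fun x => ?_
    refine (E.map_mk_eq_iff (g'.unop ≫ g.unop)).mpr ⟨Category.assoc _ _ _, ?_⟩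
    exact (E.map_comp _ _ _ _ _ _).symm

theorem isSheaf : Presieve.IsSheaf Scheme.zariskiTopology E.functor := by
  rw [Precoverage.isSheaf_toGrothendieck_iff_of_isStableUnderBaseChange]
  rintro T R hR
  obtain ⟨(𝒰 : Scheme.OpenCover.{u + 1} T), rfl⟩ := Scheme.exists_cover_of_mem_pretopology hR
  rw [Presieve.isSheafFor_arrows_iff]
  intro x hx
  have hc : ∀ (i j) (Z : Scheme.{u}) (a : Z ⟶ 𝒰.X i) (b : Z ⟶ 𝒰.X j), a ≫ 𝒰.f i = b ≫ 𝒰.f j →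
      (⟨a ≫ (x i).1, E.map a rfl (x i).2⟩ : Σ f : Z ⟶ S, E.obj f) =
        ⟨b ≫ (x j).1, E.map b rfl (x j).2⟩ := fun i j Z a b h => hx i j Z a b h
  let f : T ⟶ S := 𝒰.glueMorphisms (fun i => (x i).1) fun i j =>
    congrArg Sigma.fst (hc i j _ _ _ Limits.pullback.condition)
  have hf : ∀ i, 𝒰.f i ≫ f = (x i).1 := fun i => 𝒰.ι_glueMorphisms _ _ i
  have hf' : ∀ i, 𝟙 _ ≫ (x i).1 = 𝒰.f i ≫ f := fun i => by rw [hf, Category.id_comp]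
  -- The structure morphisms have been glued to `f`. Since `(x i).1` agrees with `𝒰.f i ≫ f` only up
  -- to a proof, the local objects are moved there by restriction along identities.
  obtain ⟨y, hy⟩ := E.glue 𝒰 f (fun i => E.map (𝟙 _) (hf' i) (x i).2) (by
    intro i j Z a b h
    have h1 := (E.map_mk_eq_iff _).mp (hc i j Z a b h)
    obtain ⟨w, h1⟩ := h1
    have w1 : a ≫ (x i).1 = a ≫ 𝒰.f i ≫ f := by rw [hf]
    have w2 : b ≫ (x j).1 = a ≫ 𝒰.f i ≫ f := by rw [hf, w]
    rw [E.map_comp _ _ _ _ (by simp [hf]), E.map_comp _ _ _ _ (by simp [hf, w])]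
    have h2 := congrArg (E.map (𝟙 Z) (by simp [hf, w] : 𝟙 Z ≫ b ≫ (x j).1 = a ≫ 𝒰.f i ≫ f)) h1
    rw [E.map_comp _ _ _ _ (by simp [hf]), E.map_comp _ _ _ _ (by simp [hf, w])] at h2
    simp only [Category.comp_id, Category.id_comp] at h2 ⊢
    exact h2)
  have hsig : ∀ i (z : Σ f : T ⟶ S, E.obj f), (E.functor.map (𝒰.f i).op z = x i ↔
      ∃ w : 𝒰.f i ≫ z.1 = (x i).1, E.map (𝒰.f i) w z.2 = (x i).2) := fun i z =>
    E.map_mk_eq_iff (𝒰.f i)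
  refine ⟨⟨f, y⟩, fun i => (hsig i _).mpr ⟨hf i, ?_⟩, ?_⟩
  · have h1 := congrArg (E.map (𝟙 _) (by rw [hf, Category.id_comp] : 𝟙 _ ≫ 𝒰.f i ≫ f = (x i).1))
      (hy i)
    rw [E.map_comp _ _ _ _ (by simp [hf]), E.map_comp _ _ _ _ (by simp)] at h1
    simp only [Category.id_comp] at h1
    rw [h1, E.map_id]
  · rintro ⟨f', y'⟩ hy'
    have hff : f' = f := 𝒰.hom_ext _ _ fun i => by
      obtain ⟨w, -⟩ := (hsig i _).mp (hy' i)
      rw [hf]; exact w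
    subst hff
    congr 1
    refine E.ext 𝒰 f _ _ fun i => ?_
    obtain ⟨w, hw⟩ := (hsig i _).mp (hy' i)
    rw [hy, ← hw, E.map_comp _ _ _ _ (by simp)]
    simp only [Category.id_comp]

/-- The conditions on charts for a sheaf over `S` which make it representable. -/
structure Atlas where
  /-- the index set of the charts -/
  ι : Type u
  /-- the charts -/
  X : ι → Scheme.{u}
  /-- the structure morphisms of the charts -/
  π : ∀ i, X i ⟶ S
  /-- the universal object on a chart -/
  u : ∀ i, E.obj (π i)
  /-- the locus where an object comes from a chart -/
  locus : ∀ {T : Scheme.{u}} (f : T ⟶ S) (_ : E.obj f) (_ : ι), T.Opens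
  locus_iff : ∀ {T : Scheme.{u}} (f : T ⟶ S) (x : E.obj f) (i : ι) {T' : Scheme.{u}} (g : T' ⟶ T),
    (∀ t, g t ∈ locus f x i) ↔ ∃ (a : T' ⟶ X i) (w : a ≫ π i = g ≫ f),
      E.map a w (u i) = E.map g rfl x
  inj : ∀ i {T : Scheme.{u}} (a b : T ⟶ X i) (w : a ≫ π i = b ≫ π i),
    E.map a w (u i) = E.map b rfl (u i) → a = b
  cover : ∀ {T : Scheme.{u}} (f : T ⟶ S) (x : E.obj f) (t : T), ∃ i, t ∈ locus f x i

variable {E}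

/-- A chart as a morphism of presheaves. -/
def Atlas.hom (A : E.Atlas) (i : A.ι) : yoneda.obj (A.X i) ⟶ E.functor :=
  yonedaEquiv.symm ⟨A.π i, A.u i⟩

theorem Atlas.hom_app (A : E.Atlas) (i : A.ι) {T : Scheme.{u}} (a : T ⟶ A.X i) :
    (A.hom i).app (.op T) a = (⟨a ≫ A.π i, E.map a rfl (A.u i)⟩ : Σ f : T ⟶ S, E.obj f) := rfl

/-- The base change of a chart to `T` is the open subscheme `locus`: by `locus_iff`, any `T'`-point
compatible with the chart lands there, and `inj` shows that its lift induces the given point of the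
chart. -/
theorem Atlas.isOpenImmersion_hom (A : E.Atlas) (i : A.ι) :
    MorphismProperty.presheaf @IsOpenImmersion (A.hom i) := by
  refine MorphismProperty.relative.of_exists fun T g => ?_
  obtain ⟨x, hx⟩ : ∃ x : Σ f : T ⟶ S, E.obj f, yonedaEquiv g = x := ⟨_, rfl⟩
  obtain ⟨f, x⟩ := x
  have hg : ∀ {T' : Scheme.{u}} (β : T' ⟶ T), g.app (.op T') β =
      (⟨β ≫ f, E.map β rfl x⟩ : Σ f : T' ⟶ S, E.obj f) := by
    intro T' β
    obtain rfl : g = (yonedaEquiv (X := T) (F := E.functor)).symm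
        (⟨f, x⟩ : Σ f : T ⟶ S, E.obj f) :=
      ((Equiv.symm_apply_eq yonedaEquiv).mpr hx.symm).symm
    rfl
  let V := A.locus f x i
  obtain ⟨a, w, ha⟩ := (A.locus_iff f x i V.ι).mp fun t => t.2
  refine ⟨V, yoneda.map a, V.ι, ?_, inferInstance⟩
  refine IsPullback.of_forall_isPullback_app ?_
  rintro ⟨T'⟩
  rw [Limits.Types.isPullback_iff]
  refine ⟨?_, ?_, ?_⟩
  · ext γ
    change (A.hom i).app (.op T') (γ ≫ a) = g.app (.op T') (γ ≫ V.ι)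
    rw [A.hom_app, hg]
    refine (E.map_mk_eq_iff (γ ≫ a)).mpr ⟨by simp [w], ?_⟩
    have h1 := congrArg (E.map γ (by simp : γ ≫ V.ι ≫ f = (γ ≫ V.ι) ≫ f)) ha
    rwa [E.map_comp _ _ _ _ (by simp [w]), E.map_comp _ _ _ _ (by simp)] at h1
  · rintro (γ : T' ⟶ V) (γ' : T' ⟶ V) ⟨-, (h : γ ≫ V.ι = γ' ≫ V.ι)⟩
    exact (cancel_mono V.ι).mp h
  · intro (α : T' ⟶ A.X i) (β : T' ⟶ T) h
    have h' : (A.hom i).app (.op T') α = g.app (.op T') β := h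
    rw [A.hom_app, hg] at h'
    obtain ⟨w', h'⟩ := (E.map_mk_eq_iff α).mp h'
    have hβ := (A.locus_iff f x i β).mpr ⟨α, w', h'⟩
    have hr : Set.range β ⊆ Set.range V.ι := by
      rintro _ ⟨t, rfl⟩
      rw [Scheme.Opens.range_ι]
      exact hβ t
    refine ⟨IsOpenImmersion.lift V.ι β hr, ?_, IsOpenImmersion.lift_fac V.ι β hr⟩
    change IsOpenImmersion.lift V.ι β hr ≫ a = α
    have h3 := congrArg (E.map (IsOpenImmersion.lift V.ι β hr)
      (by rw [w', ← Category.assoc, IsOpenImmersion.lift_fac] : _ = α ≫ A.π i)) ha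
    rw [E.map_comp _ _ _ _ (by rw [Category.assoc, w, ← Category.assoc,
      IsOpenImmersion.lift_fac, w']), E.map_comp _ _ _ _ (by simp [w'])] at h3
    refine A.inj i _ _ _ (h3.trans ?_)
    simp only [IsOpenImmersion.lift_fac]
    obtain ⟨w'', h''⟩ := (E.map_mk_eq_iff _).mp
      ((E.map_mk_eq_iff α).mpr ⟨w', h'⟩).symm
    exact h''

/-- The charts are relatively representable by open immersions, and `cover` makes them jointly
locally surjective; these are the hypotheses of the gluing criterion for representability. The
universal object corresponds to the identity of the glued scheme. -/
theorem Atlas.exists_universal (A : E.Atlas) : ∃ (Y : Scheme.{u}) (π : Y ⟶ S) (u : E.obj π),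
    ∀ {T : Scheme.{u}} (f : T ⟶ S) (x : E.obj f), ∃! g : T ⟶ Y, ∃ w : g ≫ π = f,
      E.map g w u = x := by
  let F : Sheaf Scheme.zariskiTopology.{u} (Type u) :=
    ⟨E.functor, (isSheaf_iff_isSheaf_of_type _ _).mpr E.isSheaf⟩
  have hsurj : Presheaf.IsLocallySurjective Scheme.zariskiTopology (Limits.Sigma.desc A.hom) := by
    refine ⟨fun {T} s => ?_⟩
    obtain ⟨f, x⟩ : Σ f : T ⟶ S, E.obj f := s
    choose i hi using A.cover f x
    let V : T → T.Opens := fun t => A.locus f x (i t)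
    let 𝒰 : T.OpenCover := T.openCoverOfIsOpenCover V (by
      refine top_le_iff.mp fun t _ => ?_
      exact TopologicalSpace.Opens.mem_iSup.mpr ⟨t, hi t⟩)
    refine GrothendieckTopology.superset_covering _ ?_ (Scheme.Cover.mem_grothendieckTopology 𝒰)
    rw [Sieve.ofArrows, Sieve.generate_le_iff]
    rintro _ _ ⟨t⟩
    obtain ⟨a, w, ha⟩ := (A.locus_iff f x (i t) (V t).ι).mp fun t => t.2
    refine ⟨(Limits.Sigma.ι (fun i => yoneda.obj (A.X i)) (i t)).app _ a, ?_⟩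
    have h1 : Limits.Sigma.ι (fun i => yoneda.obj (A.X i)) (i t) ≫ Limits.Sigma.desc A.hom =
      A.hom (i t) := Limits.Sigma.ι_desc _ _
    refine (congrArg (fun φ => φ.app _ a) h1).trans ?_
    exact (E.map_mk_eq_iff a).mpr ⟨w, ha⟩
  have hrep := Scheme.LocalRepresentability.representableBy (F := F) A.isOpenImmersion_hom
  set Y := (Scheme.LocalRepresentability.glueData (F := F) A.isOpenImmersion_hom).glued
  obtain ⟨⟨π, u⟩, hu⟩ : ∃ u : Σ f : Y ⟶ S, E.obj f, u = hrep.homEquiv (𝟙 Y) := ⟨_, rfl⟩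
  refine ⟨Y, π, u, fun {T} f x => ?_⟩
  have key : ∀ g : T ⟶ Y, hrep.homEquiv g = (⟨f, x⟩ : Σ f : T ⟶ S, E.obj f) ↔
      ∃ w : g ≫ π = f, E.map g w u = x := by
    intro g
    rw [← E.map_mk_eq_iff, hrep.homEquiv_eq, ← hu]
    rfl
  refine ⟨hrep.homEquiv.symm ⟨f, x⟩, (key _).mp (Equiv.apply_symm_apply _ _), fun g hg => ?_⟩
  exact hrep.homEquiv.eq_symm_apply.mpr ((key g).mpr hg)

end LocalFunctor

/-! ### The sheaves of flags and of frames -/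

section

variable {T Y S : Scheme.{u}} {g : T ⟶ Y} {π : Y ⟶ S} {f : T ⟶ S} (w : g ≫ π = f)
  {H : S.Modules} {n : ℕ}

theorem IsFrame.congr {X : Scheme.{u}} {M : X.Modules} {ι : Type} [Fintype ι] {U : X.Opens}
    {e e' : ι → Γ(M, U)} (he : IsFrame M U e) (h : ∀ i, e i = e' i) : IsFrame M U e' := by
  rwa [show e' = e from funext fun i => (h i).symm]

theorem IsFrame.pullSecOver {U : Y.Opens} {e : Fin n → Γ((Scheme.Modules.pullback π).obj H, U)}
    (he : IsFrame _ U e) :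
    IsFrame ((Scheme.Modules.pullback f).obj H) (g ⁻¹ᵁ U) fun i => pullSecOver w H (e i) :=
  (he.pullSec g).map_iso (pullIso w H)

theorem pullSecOver_smul {U : Y.Opens} (r : Γ(Y, U))
    (x : Γ((Scheme.Modules.pullback π).obj H, U)) :
    pullSecOver w H (r • x) = (g.app U).hom r • pullSecOver w H x := by
  rw [pullSecOver_eq, pullSecOver_eq, pullSec_smul, Scheme.Modules.Hom.app_smul]

theorem pullSecOver_add {U : Y.Opens} (x y : Γ((Scheme.Modules.pullback π).obj H, U)) :
    pullSecOver w H (x + y) = pullSecOver w H x + pullSecOver w H y := by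
  simp only [pullSecOver_eq, pullSec_add, map_add]

theorem pullSecOver_zero {U : Y.Opens} :
    pullSecOver w H (0 : Γ((Scheme.Modules.pullback π).obj H, U)) = 0 := by
  have := pullSecOver_smul w (H := H) (0 : Γ(Y, U)) 0
  rwa [zero_smul, map_zero, zero_smul] at this

theorem pullSecOver_congr {g' : T ⟶ Y} (h : g = g') (w' : g' ≫ π = f) {U : Y.Opens}
    (x : Γ((Scheme.Modules.pullback π).obj H, U)) :
    pullSecOver w H x = res _ (by rw [h]) (pullSecOver w' H x) := by
  subst h
  exact (res_self _ _ _).symm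

theorem pullSecOver_id (hH : IsVectorBundle H n) (w : 𝟙 Y ≫ π = π) {U : Y.Opens}
    (x : Γ((Scheme.Modules.pullback π).obj H, U)) : pullSecOver w H x = x := by
  refine sec_ext fun t ht => ?_
  obtain ⟨U', hU', h, hh⟩ := hH (π t)
  let W := U ⊓ π ⁻¹ᵁ U'
  have k : W ≤ U := inf_le_left
  have k' : W ≤ π ⁻¹ᵁ U' := inf_le_right
  refine ⟨W, k, ⟨ht, hU'⟩, ?_⟩
  have h1 := pullSecOver_res w H k (preimage_le (𝟙 Y) k) x
  obtain ⟨c, hc⟩ : ∃ c, lin (fr π h k') le_rfl c = res _ k x :=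
    ⟨_, (isFrame_fr π hh k').lin_coord le_rfl (res _ k x)⟩
  rw [← hc, pullSecOver_lin] at h1
  simp only [pullSecOver_fr] at h1
  refine h1.symm.trans (Eq.trans ?_ hc)
  exact congrArg (lin (fr π h k') le_rfl) (by rw [Scheme.Hom.id_app]; rfl)

theorem lin_fr (f : T ⟶ S) {U : S.Opens} (h : Fin n → Γ(H, U)) {V W : T.Opens}
    (k : W ≤ f ⁻¹ᵁ U) (k' : V ≤ W) (c : Fin n → Γ(T, V)) :
    lin (fun i => fr f h k i) k' c = lin (fr f h (k'.trans k)) le_rfl c := by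
  rw [← res_fr f h k k', lin_res]

theorem preimage_preimage_le {T' : Scheme.{u}} (g' : T' ⟶ T) (g : T ⟶ Y) (U : Y.Opens) :
    g' ⁻¹ᵁ g ⁻¹ᵁ U ≤ (g' ≫ g) ⁻¹ᵁ U := le_rfl

theorem app_comp {T' : Scheme.{u}} (g' : T' ⟶ T) (g : T ⟶ Y) {U : Y.Opens}
    (h : g' ⁻¹ᵁ g ⁻¹ᵁ U ≤ (g' ≫ g) ⁻¹ᵁ U) (r : Γ(Y, U)) :
    rmap h (((g' ≫ g).app U).hom r) = (g'.app (g ⁻¹ᵁ U)).hom ((g.app U).hom r) := by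
  rw [Scheme.Hom.comp_app]
  exact DFunLike.congr_fun (rmap_self le_rfl) _

/-- It suffices to compare coordinates in frames induced from `H`: `pullSecOver` carries such frames
to such frames, and the coefficients pull back functorially. -/
theorem pullSecOver_comp (hH : IsVectorBundle H n) {T' : Scheme.{u}} {g' : T' ⟶ T}
    {f' : T' ⟶ S} (w' : g' ≫ f = f') (w'' : (g' ≫ g) ≫ π = f') {U : Y.Opens}
    (h₀ : g' ⁻¹ᵁ g ⁻¹ᵁ U ≤ (g' ≫ g) ⁻¹ᵁ U) (x : Γ((Scheme.Modules.pullback π).obj H, U)) :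
    pullSecOver w' H (pullSecOver w H x) = res _ h₀ (pullSecOver w'' H x) := by
  refine sec_ext fun t ht => ?_
  obtain ⟨U', hU', h, hh⟩ := hH (π (g (g' t)))
  let W := U ⊓ π ⁻¹ᵁ U'
  have k : W ≤ U := inf_le_left
  have k' : W ≤ π ⁻¹ᵁ U' := inf_le_right
  have h₁ : g' ⁻¹ᵁ g ⁻¹ᵁ W ≤ (g' ≫ g) ⁻¹ᵁ W := le_rfl
  refine ⟨g' ⁻¹ᵁ g ⁻¹ᵁ W, preimage_le _ (preimage_le _ k), ⟨ht, hU'⟩, ?_⟩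
  obtain ⟨c, hc⟩ : ∃ c, lin (fr π h k') le_rfl c = res _ k x :=
    ⟨_, (isFrame_fr π hh k').lin_coord le_rfl (res _ k x)⟩
  have h3 := pullSecOver_res w'' H k (preimage_le (g' ≫ g) k) x
  have h4 := pullSecOver_res w' H (preimage_le g k) (preimage_le g' (preimage_le g k))
    (pullSecOver w H x)
  rw [← pullSecOver_res w H k, ← hc, pullSecOver_lin, pullSecOver_lin] at h4
  rw [← hc, pullSecOver_lin] at h3
  simp only [pullSecOver_fr] at h3 h4
  have h5 := congrArg (res _ h₁) h3
  rw [res_res, res_lin] at h5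
  rw [res_res]
  refine h4.symm.trans (Eq.trans ?_ h5)
  rw [lin_fr, lin_fr]
  congr 1
  ext i
  exact (app_comp g' g h₁ _).symm

/-- A global frame can be detected locally. -/
theorem isFrame_of_local {X : Scheme.{u}} {M : X.Modules} {ι : Type} [Fintype ι]
    {e : ι → Γ(M, ⊤)}
    (he : ∀ t : X, ∃ W : X.Opens, t ∈ W ∧ IsFrame M W fun i => res M le_top (e i)) :
    IsFrame M ⊤ e := by
  choose V hV hf using he
  have hf' : ∀ (t : X) (W : X.Opens) (k : W ≤ V t), Function.Bijective (lin e (le_top : W ≤ ⊤)) :=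
    fun t W k => by
      have := (hf t).bijective k
      rwa [lin_res] at this
  intro W h
  constructor
  · intro c c' hcc
    ext i
    refine fun_ext fun t ht => ⟨W ⊓ V t, inf_le_left, ⟨ht, hV t⟩, ?_⟩
    have h1 : res M (inf_le_left : W ⊓ V t ≤ W) (lin e h c) =
      res M inf_le_left (lin e h c') := congrArg _ hcc
    rw [res_lin, res_lin] at h1
    exact congrFun ((hf' t _ inf_le_right).injective h1) i
  · intro x
    choose c hc using fun t : X =>
      (hf' t (W ⊓ V t) inf_le_right).surjective (res M inf_le_left x)
    have hcomp : ∀ i (t t' : X), rmap (inf_le_left : (W ⊓ V t) ⊓ (W ⊓ V t') ≤ _) (c t i) =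
        rmap inf_le_right (c t' i) := by
      intro i t t'
      have h1 := congrArg (res M (inf_le_left : (W ⊓ V t) ⊓ (W ⊓ V t') ≤ W ⊓ V t)) (hc t)
      have h2 := congrArg (res M (inf_le_right : (W ⊓ V t) ⊓ (W ⊓ V t') ≤ W ⊓ V t')) (hc t')
      rw [res_lin, res_res] at h1 h2
      exact congrFun ((hf' t _ (inf_le_left.trans inf_le_right)).injective (h1.trans h2.symm)) i
    choose b hb using fun i => fun_glue (fun t : X => W ⊓ V t) W (fun t => inf_le_left)
      (fun t ht => TopologicalSpace.Opens.mem_iSup.mpr ⟨t, ht, hV t⟩) (fun t => c t i) (hcomp i)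
    refine ⟨b, sec_ext fun t ht => ⟨W ⊓ V t, inf_le_left, ⟨ht, hV t⟩, ?_⟩⟩
    change res M _ (lin e h b) = _
    rw [res_lin, ← hc t]
    congr 1
    ext i
    exact hb i t

theorem exists_mem_opensRange {T : Scheme.{u}} (𝒰 : T.OpenCover) (t : T) :
    ∃ i, t ∈ (𝒰.f i).opensRange := ⟨_, 𝒰.covers t⟩

theorem Subsheaf.le_of_cover (hH : IsVectorBundle H n) {T : Scheme.{u}} (𝒰 : T.OpenCover)
    (f : T ⟶ S) {A B : Subsheaf ((Scheme.Modules.pullback f).obj H)} {d d' : ℕ}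
    (hA : A.IsSubbundle d) (hB : B.IsSubbundle d')
    (h : ∀ i, A.pullbackOver (rfl : 𝒰.f i ≫ f = _) ≤ B.pullbackOver rfl) : A ≤ B := by
  refine le_of_local fun t => ?_
  obtain ⟨i, hi⟩ := exists_mem_opensRange 𝒰 t
  refine ⟨_, hi, fun W hW x hx => ?_⟩
  rw [← pullSecOver_mem_iff (rfl : 𝒰.f i ≫ f = _) hH hA hW] at hx
  rw [← pullSecOver_mem_iff (rfl : 𝒰.f i ≫ f = _) hH hB hW]
  exact h i _ hx

theorem Subsheaf.eq_of_cover (hH : IsVectorBundle H n) {T : Scheme.{u}} (𝒰 : T.OpenCover)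
    (f : T ⟶ S) {A B : Subsheaf ((Scheme.Modules.pullback f).obj H)} {d d' : ℕ}
    (hA : A.IsSubbundle d) (hB : B.IsSubbundle d')
    (h : ∀ i, A.pullbackOver (rfl : 𝒰.f i ≫ f = _) = B.pullbackOver rfl) : A = B :=
  le_antisymm' (le_of_cover hH 𝒰 f hA hB fun i => (h i) ▸ fun _ _ hx => hx)
    (le_of_cover hH 𝒰 f hB hA fun i => (h i) ▸ fun _ _ hx => hx)

/-- The subsheaf glued from subsheaves on the members of an open cover. -/
def Subsheaf.glue {T : Scheme.{u}} (𝒰 : T.OpenCover) (f : T ⟶ S)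
    (A : ∀ i, Subsheaf ((Scheme.Modules.pullback (𝒰.f i ≫ f)).obj H)) :
    Subsheaf ((Scheme.Modules.pullback f).obj H) where
  sec U :=
    { carrier := {x | ∀ i, RelGrass.pullSecOver (rfl : 𝒰.f i ≫ f = _) H x ∈ (A i).sec _}
      zero_mem' := fun i => by rw [pullSecOver_zero]; exact zero_mem _
      add_mem' := fun hx hy i => by rw [pullSecOver_add]; exact add_mem (hx i) (hy i)
      smul_mem' := fun r x hx i => by
        rw [pullSecOver_smul]; exact Submodule.smul_mem _ _ (hx i) }
  res_mem h x hx i := by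
    rw [pullSecOver_res _ _ h (preimage_le _ h)]
    exact (A i).res_mem _ (hx i)
  of_local x hx i := by
    refine (A i).of_local _ fun t ht => ?_
    obtain ⟨W, h, htW, hW⟩ := hx _ ht
    refine ⟨𝒰.f i ⁻¹ᵁ W, preimage_le _ h, htW, ?_⟩
    rw [← pullSecOver_res _ _ h]
    exact hW i

/-- Passes membership from one member of a cover to another through an overlap `Z`, on which the two
pulled back subsheaves coincide. -/
theorem Subsheaf.pullSecOver_mem_of_comp_eq (hH : IsVectorBundle H n)
    {Z X₁ X₂ : Scheme.{u}} {a : Z ⟶ X₁} {b : Z ⟶ X₂} {f₁ : X₁ ⟶ T} {f₂ : X₂ ⟶ T}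
    (hab : a ≫ f₁ = b ≫ f₂) (wb : b ≫ f₂ ≫ f = a ≫ f₁ ≫ f)
    {A₁ : Subsheaf ((Scheme.Modules.pullback (f₁ ≫ f)).obj H)}
    {A₂ : Subsheaf ((Scheme.Modules.pullback (f₂ ≫ f)).obj H)}
    (hA : A₁.pullbackOver (rfl : a ≫ f₁ ≫ f = _) = A₂.pullbackOver wb) {U : T.Opens}
    {z : Γ((Scheme.Modules.pullback f).obj H, U)}
    (hz : RelGrass.pullSecOver (rfl : f₁ ≫ f = _) H z ∈ A₁.sec (f₁ ⁻¹ᵁ U)) :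
    RelGrass.pullSecOver wb H (RelGrass.pullSecOver (rfl : f₂ ≫ f = _) H z) ∈
      (A₂.pullbackOver wb).sec (b ⁻¹ᵁ f₂ ⁻¹ᵁ U) := by
  have h3 := pullSecOver_mem (rfl : a ≫ f₁ ≫ f = _) hz
  rw [pullSecOver_comp _ hH _ (Category.assoc _ _ _) (preimage_preimage_le _ _ _)] at h3
  have hle : b ⁻¹ᵁ f₂ ⁻¹ᵁ U ≤ a ⁻¹ᵁ f₁ ⁻¹ᵁ U := by
    change (b ≫ f₂) ⁻¹ᵁ U ≤ (a ≫ f₁) ⁻¹ᵁ U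
    rw [hab]
  have h4 := Subsheaf.res_mem _ hle h3
  have w' : (b ≫ f₂) ≫ f = a ≫ f₁ ≫ f := by rw [Category.assoc, wb]
  have h5 := RelGrass.pullSecOver_congr w' hab.symm (Category.assoc _ _ _) z
  rw [res_res, hA] at h4
  rw [pullSecOver_comp _ hH _ w' (preimage_preimage_le _ _ _), h5, res_res]
  exact h4

/-- A matrix for `A i` near a point descends to `T`, because functions on opens in the range of `𝒰.f
i` pull back bijectively. It describes the glued subsheaf too: the condition on one member of the
cover implies the conditions on the others by compatibility on overlaps. -/
theorem Subsheaf.exists_glue (hH : IsVectorBundle H n) {T : Scheme.{u}} (𝒰 : T.OpenCover)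
    (f : T ⟶ S) {d : ℕ} (A : ∀ i, Subsheaf ((Scheme.Modules.pullback (𝒰.f i ≫ f)).obj H))
    (hA : ∀ i, (A i).IsSubbundle d)
    (hc : ∀ (i j) (Z : Scheme.{u}) (a : Z ⟶ 𝒰.X i) (b : Z ⟶ 𝒰.X j) (h : a ≫ 𝒰.f i = b ≫ 𝒰.f j),
      (A i).pullbackOver (rfl : a ≫ 𝒰.f i ≫ f = _) = (A j).pullbackOver
        (by rw [← Category.assoc, ← h, Category.assoc] : b ≫ 𝒰.f j ≫ f = _)) :
    ∃ B : Subsheaf ((Scheme.Modules.pullback f).obj H), B.IsSubbundle d ∧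
      ∀ i, B.pullbackOver rfl = A i := by
  have key : ∀ i (t : 𝒰.X i), d ≤ n ∧ ∃ (U : S.Opens) (h : Fin n → Γ(H, U)) (hh : IsFrame H U h)
      (W : T.Opens) (k : W ≤ f ⁻¹ᵁ U) (y : GLn n Γ(T, W)), 𝒰.f i t ∈ W ∧
      (glue 𝒰 f A).CutAt h k d y ∧
      (A i).CutAt h (preimage_le_of_comp (rfl : 𝒰.f i ≫ f = _) k) d
        (gmap ((𝒰.f i).app W).hom y) := by
    intro i t
    obtain ⟨U, hU, h, hh⟩ := hH ((𝒰.f i ≫ f) t)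
    obtain ⟨hd, V, k, y, htV, hy⟩ := (hA i).exists_cutAt (f := 𝒰.f i ≫ f) hh (t := t) le_rfl hU
    obtain ⟨W, hWU, hW, rfl⟩ := exists_eq_preimage (𝒰.f i) (U := f ⁻¹ᵁ U) V k
    obtain ⟨y, rfl⟩ : ∃ y', gmap ((𝒰.f i).app W).hom y' = y := by
      let φ := RingEquiv.ofBijective _ (app_bijective (𝒰.f i) hW)
      refine ⟨gmap φ.symm.toRingHom y, ?_⟩
      rw [gmap_gmap]
      have : ((𝒰.f i).app W).hom.comp φ.symm.toRingHom = RingHom.id _ := by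
        ext r
        exact φ.apply_symm_apply r
      rw [this, gmap_id]
    refine ⟨hd, U, h, hh, W, hWU, y, htV, fun W' k' c => ?_, hy⟩
    have h1 : ∀ j, RelGrass.pullSecOver (rfl : 𝒰.f j ≫ f = _) H (lin (fr f h hWU) k' c) =
        lin (fr (𝒰.f j ≫ f) h (preimage_le_of_comp rfl hWU)) (preimage_le _ k')
          (((𝒰.f j).app W').hom ∘ c) := by
      intro j
      rw [pullSecOver_lin]
      simp only [pullSecOver_fr]
    have h2 : lin (fr (𝒰.f i ≫ f) h (preimage_le_of_comp rfl hWU)) (preimage_le _ k')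
          (((𝒰.f i).app W').hom ∘ c) ∈ (A i).sec _ ↔ c ∈ cutMod (gmap (rmap k') y) d := by
      rw [hy (preimage_le _ k'), ← comp_mem_cutMod_iff
        (app_bijective (𝒰.f i) (k'.trans hW)).injective, gmap_gmap, gmap_gmap]
      have : (rmap (preimage_le (𝒰.f i) k')).comp ((𝒰.f i).app W).hom =
          ((𝒰.f i).app W').hom.comp (rmap k') := by
        ext r
        exact (app_rmap _ _ _ r).symm
      rw [this]
    refine ⟨fun hx => h2.mp (by rw [← h1]; exact hx i), fun hc' j => ?_⟩
    rw [← h2, ← h1] at hc'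
    let a := Limits.pullback.fst (𝒰.f i) (𝒰.f j)
    let b := Limits.pullback.snd (𝒰.f i) (𝒰.f j)
    have hab : a ≫ 𝒰.f i = b ≫ 𝒰.f j := Limits.pullback.condition
    have wb : b ≫ 𝒰.f j ≫ f = a ≫ 𝒰.f i ≫ f := by
      rw [← Category.assoc, ← hab, Category.assoc]
    -- Since `W'` lies in the range of `𝒰.f i`, its preimage in the `j`-th member is covered by the
    -- overlap.
    have hr : 𝒰.f j ⁻¹ᵁ W' ≤ b.opensRange := by
      intro z hz
      obtain ⟨z', hz'⟩ := hW (k' hz)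
      obtain ⟨z'', h1, h2⟩ := Scheme.Pullback.exists_preimage_pullback z' z hz'
      exact ⟨z'', h2⟩
    rw [← pullSecOver_mem_iff wb hH (hA j) hr]
    exact pullSecOver_mem_of_comp_eq hH hab wb (hc i j _ a b hab) hc'
  refine ⟨glue 𝒰 f A, isSubbundle_of_cutAt (n := n) fun t => ?_, fun i => ?_⟩
  · obtain ⟨i, t', rfl⟩ := exists_mem_opensRange 𝒰 t
    obtain ⟨hd, U, h, hh, W, k, y, h1, h2, -⟩ := key i t'
    exact ⟨hd, U, h, hh, W, k, y, h1, h2⟩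
  · refine eq_of_cutAt (n := n) fun t => ?_
    obtain ⟨hd, U, h, hh, W, k, y, h1, h2, h3⟩ := key i t
    exact ⟨U, h, hh, _, _, d, _, h1, CutAt.pullbackOver rfl hh h2, h3⟩

/-- The sheaf of flags of subbundles. -/
def flagFunctor (hH : IsVectorBundle H n) (D : Finset ℕ) : LocalFunctor S where
  obj f := BundleFlag ((Scheme.Modules.pullback f).obj H) D
  map _ _ _ w V := V.pullbackOver w hH
  map_id w V := BundleFlag.ext (funext fun d =>
    Subsheaf.pullbackOver_id hH (V.isSubbundle d) w)
  map_comp g' g _ _ _ w w' w'' V := BundleFlag.ext (funext fun d =>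
    Subsheaf.pullbackOver_comp w hH w' w'' (V.isSubbundle d))
  ext 𝒰 f V V' h := BundleFlag.ext (funext fun d =>
    Subsheaf.eq_of_cover hH 𝒰 f (V.isSubbundle d) (V'.isSubbundle d) fun i =>
      congrArg (fun F => BundleFlag.sub F d) (h i))
  glue 𝒰 f V hV := by
    choose B hB hBV using fun d : D => Subsheaf.exists_glue hH 𝒰 f (fun i => (V i).sub d)
      (fun i => (V i).isSubbundle d) fun i j Z a b h =>
        congrArg (fun F => BundleFlag.sub F d) (hV i j Z a b h)
    refine ⟨⟨B, hB, fun d d' h => Subsheaf.le_of_cover hH 𝒰 f (hB d) (hB d') fun i => ?_⟩,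
      fun i => BundleFlag.ext (funext fun d => hBV d i)⟩
    rw [hBV, hBV]
    exact (V i).le d d' h

theorem top_le_preimage (g : T ⟶ Y) : (⊤ : T.Opens) ≤ g ⁻¹ᵁ ⊤ := fun _ _ => trivial

/-- The pullback of a global section. -/
def pullTop (x : Γ((Scheme.Modules.pullback π).obj H, ⊤)) :
    Γ((Scheme.Modules.pullback f).obj H, ⊤) :=
  res _ (top_le_preimage g) (pullSecOver w H x)

theorem res_pullTop (x : Γ((Scheme.Modules.pullback π).obj H, ⊤)) (U : Y.Opens) :
    res _ le_top (pullTop w x) = pullSecOver w H (res _ (le_top : U ≤ ⊤) x) := by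
  rw [pullTop, pullSecOver_res _ _ le_top (preimage_le _ le_top), res_res]

theorem pullTop_id (hH : IsVectorBundle H n) (w : 𝟙 Y ≫ π = π)
    (x : Γ((Scheme.Modules.pullback π).obj H, ⊤)) : pullTop w x = x := by
  rw [pullTop, pullSecOver_id hH]
  exact res_self _ _ _

theorem pullTop_comp (hH : IsVectorBundle H n) {T' : Scheme.{u}} {g' : T' ⟶ T}
    {f' : T' ⟶ S} (w' : g' ≫ f = f') (w'' : (g' ≫ g) ≫ π = f')
    (x : Γ((Scheme.Modules.pullback π).obj H, ⊤)) :
    pullTop w' (pullTop w x) = pullTop w'' x := by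
  rw [pullTop, pullTop, pullTop, pullSecOver_res _ _ _ (preimage_le g' (top_le_preimage g)),
    pullSecOver_comp w hH w' w'' (preimage_preimage_le _ _ _), res_res, res_res]

theorem pullTop_congr {g' : T ⟶ Y} (h : g = g') (w' : g' ≫ π = f)
    (x : Γ((Scheme.Modules.pullback π).obj H, ⊤)) : pullTop w x = pullTop w' x := by
  subst h
  rfl

theorem IsFrame.pullTop {e : Fin n → Γ((Scheme.Modules.pullback π).obj H, ⊤)}
    (he : IsFrame _ ⊤ e) :
    IsFrame ((Scheme.Modules.pullback f).obj H) ⊤ fun i => pullTop w (e i) :=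
  (he.pullSecOver w).res _

theorem section_eq_of_cover {T : Scheme.{u}} (𝒰 : T.OpenCover) (f : T ⟶ S)
    {x y : Γ((Scheme.Modules.pullback f).obj H, ⊤)}
    (h : ∀ i, pullTop (rfl : 𝒰.f i ≫ f = _) x = pullTop rfl y) : x = y := by
  refine sec_ext fun t _ => ?_
  obtain ⟨i, hi⟩ := exists_mem_opensRange 𝒰 t
  refine ⟨_, le_top, hi, (pullSecOver_bijective (rfl : 𝒰.f i ≫ f = _) H le_rfl).injective ?_⟩
  rw [← res_pullTop, ← res_pullTop, h i]

/-- Each `x i` comes from a unique section over the range of `𝒰.f i`. Agreement of these on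
intersections is tested after pulling back to the fibre product of two members, where it is the
hypothesis. -/
theorem exists_glue_section (hH : IsVectorBundle H n) {T : Scheme.{u}} (𝒰 : T.OpenCover)
    (f : T ⟶ S) (x : ∀ i, Γ((Scheme.Modules.pullback (𝒰.f i ≫ f)).obj H, ⊤))
    (hc : ∀ (i j) (Z : Scheme.{u}) (a : Z ⟶ 𝒰.X i) (b : Z ⟶ 𝒰.X j) (h : a ≫ 𝒰.f i = b ≫ 𝒰.f j),
      pullTop (rfl : a ≫ 𝒰.f i ≫ f = _) (x i) = pullTop
        (by rw [← Category.assoc, ← h, Category.assoc] : b ≫ 𝒰.f j ≫ f = _) (x j)) :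
    ∃ y : Γ((Scheme.Modules.pullback f).obj H, ⊤), ∀ i, pullTop rfl y = x i := by
  choose s hs using fun i => (pullSecOver_bijective (rfl : 𝒰.f i ≫ f = _) H
    (le_refl (𝒰.f i).opensRange)).surjective (res _ le_top (x i))
  have key : ∀ (i) (Z : Scheme.{u}) (a : Z ⟶ 𝒰.X i) (c : Z ⟶ T) (e : Z ⟶ S)
      (wc : a ≫ 𝒰.f i = c) (we : c ≫ f = e) (wa : a ≫ 𝒰.f i ≫ f = e) (V : T.Opens)
      (hV : V ≤ (𝒰.f i).opensRange),
      pullSecOver we H (res _ hV (s i)) = res _ le_top (pullTop wa (x i)) := by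
    intro i Z a c e wc we wa V hV
    subst wc
    have h1 : a ⁻¹ᵁ 𝒰.f i ⁻¹ᵁ V ≤ (a ≫ 𝒰.f i) ⁻¹ᵁ V := le_rfl
    have h2 : (a ≫ 𝒰.f i) ⁻¹ᵁ V ≤ a ⁻¹ᵁ 𝒰.f i ⁻¹ᵁ V := le_rfl
    have e1 := pullSecOver_comp (rfl : 𝒰.f i ≫ f = _) hH wa we h1 (res _ hV (s i))
    rw [pullSecOver_res _ _ hV (preimage_le _ hV), hs, res_res, ← res_pullTop] at e1
    have e2 := congrArg (res _ h2) e1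
    rw [res_res, res_res, res_self] at e2
    exact e2.symm
  obtain ⟨y, hy⟩ := sec_glue (M := (Scheme.Modules.pullback f).obj H)
    (fun i => (𝒰.f i).opensRange) ⊤ (fun i => le_top) (fun t _ => by
      obtain ⟨i, hi⟩ := exists_mem_opensRange 𝒰 t
      exact TopologicalSpace.Opens.mem_iSup.mpr ⟨i, hi⟩) s (by
    intro i j
    let a := Limits.pullback.fst (𝒰.f i) (𝒰.f j)
    let b := Limits.pullback.snd (𝒰.f i) (𝒰.f j)
    have hab : a ≫ 𝒰.f i = b ≫ 𝒰.f j := Limits.pullback.condition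
    have wb : b ≫ 𝒰.f j ≫ f = a ≫ 𝒰.f i ≫ f := by
      rw [← Category.assoc, ← hab, Category.assoc]
    have hr : (𝒰.f i).opensRange ⊓ (𝒰.f j).opensRange ≤ (a ≫ 𝒰.f i).opensRange := by
      rintro z ⟨⟨z1, h1⟩, ⟨z2, h2⟩⟩
      obtain ⟨z3, h3, h4⟩ := Scheme.Pullback.exists_preimage_pullback z1 z2 (h1.trans h2.symm)
      refine ⟨z3, ?_⟩
      rw [← h1, ← h3]
      rfl
    refine (pullSecOver_bijective (Category.assoc a (𝒰.f i) f) H hr).injective ?_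
    rw [key i _ a _ _ rfl _ rfl, key j _ b _ _ hab.symm _ wb, hc i j _ a b hab])
  refine ⟨y, fun i => ?_⟩
  have hr : (⊤ : (𝒰.X i).Opens) ≤ 𝒰.f i ⁻¹ᵁ (𝒰.f i).opensRange := fun t _ => ⟨t, rfl⟩
  have h1 := congrArg (res _ hr) (hs i)
  rwa [res_res, res_self, ← hy i, ← res_pullTop, res_res, res_self] at h1

/-- The sheaf of frames. -/
def frameFunctor (hH : IsVectorBundle H n) : LocalFunctor S where
  obj f := {e : Fin n → Γ((Scheme.Modules.pullback f).obj H, ⊤) // IsFrame _ ⊤ e}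
  map _ _ _ w e := ⟨fun i => pullTop w (e.1 i), e.2.pullTop w⟩
  map_id w e := Subtype.ext (funext fun i => pullTop_id hH w (e.1 i))
  map_comp g' g _ _ _ w w' w'' e := Subtype.ext (funext fun i =>
    pullTop_comp w hH w' w'' (e.1 i))
  ext 𝒰 f e e' h := Subtype.ext (funext fun i => section_eq_of_cover 𝒰 f fun j =>
    congrFun (congrArg Subtype.val (h j)) i)
  glue 𝒰 f e he := by
    choose y hy using fun i => exists_glue_section hH 𝒰 f (fun j => (e j).1 i)
      fun j j' Z a b h => congrFun (congrArg Subtype.val (he j j' Z a b h)) i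
    refine ⟨⟨y, isFrame_of_local fun t => ?_⟩, fun j => Subtype.ext (funext fun i => hy i j)⟩
    obtain ⟨j, hj⟩ := exists_mem_opensRange 𝒰 t
    refine ⟨_, hj, ?_⟩
    have h1 := (e j).2.res (le_top : 𝒰.f j ⁻¹ᵁ (𝒰.f j).opensRange ≤ ⊤)
    simp only [← hy, res_pullTop] at h1
    have h3 := h1.map_iso (pullIso (rfl : 𝒰.f j ≫ f = _) H).symm
    refine isFrame_of_pullSec (𝒰.f j) _ le_rfl ?_
    simp only [pullSecOver_eq] at h3
    refine h3.congr fun i => ?_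
    exact (iso_inv_app_hom_app (pullIso (rfl : 𝒰.f j ≫ f = _) H) _)

end

/-! ### Matrices of the standard charts of a Grassmannian -/

section

open Matrix

variable {n : ℕ} {R R' : Type*} [CommRing R] [CommRing R']

/-- The index set of the coordinates of a chart of the Grassmannian. -/
abbrev ChartIndex (n d : ℕ) := {i : Fin n // ¬(i : ℕ) < d} × {j : Fin n // (j : ℕ) < d}

/-- The block matrix with lower left block `X`. -/
def lowerLeft {d : ℕ} (X : ChartIndex n d → R) : Matrix (Fin n) (Fin n) R :=
  of fun i j => if hi : (i : ℕ) < d then 0 else if hj : (j : ℕ) < d then X (⟨i, hi⟩, ⟨j, hj⟩) else 0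

theorem lowerLeft_mul_self {d : ℕ} (X : ChartIndex n d → R) :
    lowerLeft X * lowerLeft X = 0 := by
  ext i j
  rw [mul_apply]
  refine Finset.sum_eq_zero fun k _ => ?_
  by_cases hk : (k : ℕ) < d <;> simp [lowerLeft, hk]

/-- A permutation matrix. -/
def permGL (R : Type*) [CommRing R] (σ : Equiv.Perm (Fin n)) : GLn n R where
  val := (1 : Matrix (Fin n) (Fin n) R).submatrix σ id
  inv := (1 : Matrix (Fin n) (Fin n) R).submatrix id σ
  val_inv := by
    ext i j
    simp [mul_apply, one_apply]
  inv_val := by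
    ext i j
    rw [mul_apply, ← Equiv.sum_comp σ.symm]
    simp [one_apply]

/-- The matrix of the chart of index `σ` with coordinates `X`. -/
def chartMat {d : ℕ} (σ : Equiv.Perm (Fin n)) (X : ChartIndex n d → R) : GLn n R :=
  ⟨1 - lowerLeft X, 1 + lowerLeft X,
    by rw [sub_mul, mul_add, mul_add, lowerLeft_mul_self]; simp,
    by rw [add_mul, mul_sub, mul_sub, lowerLeft_mul_self]; simp⟩ * permGL R σ

theorem chartMat_mulVec {d : ℕ} (σ : Equiv.Perm (Fin n)) (X : ChartIndex n d → R)
    (c : Fin n → R) : (chartMat σ X).1 *ᵥ c = c ∘ σ - lowerLeft X *ᵥ (c ∘ σ) := by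
  change ((1 - lowerLeft X) * (1 : Matrix (Fin n) (Fin n) R).submatrix σ id) *ᵥ c = _
  rw [← mulVec_mulVec]
  have : (1 : Matrix (Fin n) (Fin n) R).submatrix σ id *ᵥ c = c ∘ σ := by
    ext i
    simp [mulVec, dotProduct, one_apply]
  rw [this, sub_mulVec, one_mulVec]

theorem gmap_chartMat {d : ℕ} (φ : R →+* R') (σ : Equiv.Perm (Fin n)) (X : ChartIndex n d → R) :
    gmap φ (chartMat σ X) = chartMat σ (φ ∘ X) := by
  ext i j
  have h1 := congrFun (gmap_mulVec φ (chartMat σ X) (Pi.single j 1)) i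
  have h2 : φ ∘ Pi.single j (1 : R) = Pi.single j 1 := by
    ext k
    simp only [Function.comp, Pi.single_apply]
    split_ifs <;> simp
  have h3 : ∀ (R : Type _) [CommRing R] (y : GLn n R), (y.1 *ᵥ Pi.single j 1) i = y.1 i j :=
    fun R _ y => by rw [mulVec_single_one]; rfl
  rw [h2, h3, Function.comp, chartMat_mulVec] at h1
  rw [h1, ← h3, chartMat_mulVec, ← h2]
  simp only [Pi.sub_apply, map_sub, Function.comp, mulVec, dotProduct, map_sum, map_mul]
  congr 1
  refine Finset.sum_congr rfl fun k _ => ?_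
  congr 1
  simp only [lowerLeft, of_apply]
  split_ifs <;> simp

/-- After reordering coordinates by `σ`, the submodule is the graph of the linear map with matrix
`X` from the first `d` coordinates to the others. -/
theorem mem_cutMod_chartMat {d : ℕ} {σ : Equiv.Perm (Fin n)} {X : ChartIndex n d → R}
    {c : Fin n → R} : c ∈ cutMod (chartMat σ X) d ↔
      ∀ i : {i : Fin n // ¬(i : ℕ) < d}, c (σ i) = ∑ j : {j : Fin n // (j : ℕ) < d},
        X (i, j) * c (σ j) := by
  rw [mem_cutMod, Subtype.forall]
  simp only [not_lt]
  refine forall₂_congr fun i hi => ?_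
  rw [chartMat_mulVec, Pi.sub_apply, sub_eq_zero, Function.comp, mulVec, dotProduct,
    ← Fintype.sum_subtype_add_sum_subtype (fun j : Fin n => (j : ℕ) < d)]
  have h0 : ∀ j : {j : Fin n // ¬(j : ℕ) < d}, lowerLeft X i j * (c ∘ σ) j = 0 := fun j => by
    simp [lowerLeft, j.2]
  rw [Finset.sum_eq_zero fun j _ => h0 j, add_zero]
  refine Eq.congr_right (Finset.sum_congr rfl fun j _ => ?_)
  simp [lowerLeft, not_lt.mpr hi, j.2]

/-- A graph determines its map: test on the point `b` of the graph lying over the `j`-th basis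
vector. -/
theorem chartMat_injective {d : ℕ} {σ : Equiv.Perm (Fin n)} {X X' : ChartIndex n d → R}
    (h : cutMod (chartMat σ X) d = cutMod (chartMat σ X') d) : X = X' := by
  classical
  ext ⟨i, j⟩
  let b : Fin n → R := fun k => if hk : (k : ℕ) < d then if k = j then 1 else 0 else X (⟨k, hk⟩, j)
  have hb : ∀ (k : {i : Fin n // ¬(i : ℕ) < d}) (Y : ChartIndex n d → R),
      ∑ l : {j : Fin n // (j : ℕ) < d}, Y (k, l) * (b ∘ σ.symm) (σ l) = Y (k, j) := by
    intro k Y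
    rw [Finset.sum_eq_single j]
    · simp [b, j.2]
    · intro l _ hl
      simp [b, l.2, Subtype.coe_injective.ne hl]
    · simp
  have h1 : b ∘ σ.symm ∈ cutMod (chartMat σ X) d := mem_cutMod_chartMat.mpr fun k => by
    rw [hb]
    simp [b, k.2]
  rw [h, mem_cutMod_chartMat] at h1
  have h2 := h1 i
  rw [hb] at h2
  rw [← h2]
  simp [b, i.2]

/-- The minor of `y` that has to be invertible for `cutMod y d` to belong to the chart `σ`. -/
def chartMinor (y : GLn n R) (d : ℕ) (σ : Equiv.Perm (Fin n)) :
    Matrix {i : Fin n // ¬(i : ℕ) < d} {i : Fin n // ¬(i : ℕ) < d} R :=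
  of fun i j => y.1 i (σ j)

theorem chartMinor_gmap (φ : R →+* R') (y : GLn n R) (d : ℕ) (σ : Equiv.Perm (Fin n)) :
    chartMinor (gmap φ y) d σ = (chartMinor y d σ).map φ := rfl

theorem forall_mulVec_eq_zero_iff {Y : Matrix (Fin n) (Fin n) R} {d : ℕ} (σ : Equiv.Perm (Fin n))
    {c : Fin n → R} : (∀ i : Fin n, d ≤ i → (Y *ᵥ c) i = 0) ↔
      (of fun i j => Y i (σ j) : Matrix {i : Fin n // ¬(i : ℕ) < d}
        {i : Fin n // ¬(i : ℕ) < d} R) *ᵥ (fun j => c (σ j)) =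
      -((of fun i j => Y i (σ j) : Matrix {i : Fin n // ¬(i : ℕ) < d}
        {j : Fin n // (j : ℕ) < d} R) *ᵥ fun j => c (σ j)) := by
  rw [funext_iff, Subtype.forall]
  simp only [not_lt]
  refine forall₂_congr fun i hi => ?_
  rw [mulVec, dotProduct, ← Equiv.sum_comp σ, Pi.neg_apply, eq_neg_iff_add_eq_zero, add_comm,
    ← Fintype.sum_subtype_add_sum_subtype (fun j : Fin n => (j : ℕ) < d)]
  rfl

theorem mem_cutMod_iff_chartMinor {y : GLn n R} {d : ℕ} (σ : Equiv.Perm (Fin n)) {c : Fin n → R} :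
    c ∈ cutMod y d ↔ chartMinor y d σ *ᵥ (fun j => c (σ j)) =
      -((of fun i j => y.1 i (σ j) : Matrix {i : Fin n // ¬(i : ℕ) < d}
        {j : Fin n // (j : ℕ) < d} R) *ᵥ fun j => c (σ j)) := forall_mulVec_eq_zero_iff σ

/-- With `A`, `B` the columns of the last rows of `Y` selected by `σ`, the system `A x = -B z`
solves to `x = -A⁻¹ B z`, which is a graph. Only `A` has to be invertible, not `Y`; this freedom is
used for intersections of constant rank. -/
theorem exists_forall_mem_cutMod_chartMat_iff {Y : Matrix (Fin n) (Fin n) R} {d : ℕ}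
    {σ : Equiv.Perm (Fin n)} (h : IsUnit (of fun i j => Y i (σ j) :
      Matrix {i : Fin n // ¬(i : ℕ) < d} {i : Fin n // ¬(i : ℕ) < d} R).det) :
    ∃ X : ChartIndex n d → R, ∀ c, (∀ i : Fin n, d ≤ i → (Y *ᵥ c) i = 0) ↔
      c ∈ cutMod (chartMat σ X) d := by
  let A := (of fun i j => Y i (σ j) : Matrix {i : Fin n // ¬(i : ℕ) < d}
        {i : Fin n // ¬(i : ℕ) < d} R)
  let B := (of fun i j => Y i (σ j) : Matrix {i : Fin n // ¬(i : ℕ) < d}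
        {j : Fin n // (j : ℕ) < d} R)
  have hA : IsUnit A.det := h
  refine ⟨fun k => (-(A⁻¹ * B)) k.1 k.2, fun c => ?_⟩
  rw [forall_mulVec_eq_zero_iff σ, mem_cutMod_chartMat]
  have key : (∀ i : {i : Fin n // ¬(i : ℕ) < d}, c (σ i) = ∑ j : {j : Fin n // (j : ℕ) < d},
        (-(A⁻¹ * B)) i j * c (σ j)) ↔
      (fun i : {i : Fin n // ¬(i : ℕ) < d} => c (σ i)) = (-(A⁻¹ * B)) *ᵥ fun j => c (σ j) :=
    funext_iff.symm
  rw [key, neg_mulVec, ← mulVec_mulVec]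
  change A *ᵥ _ = -(B *ᵥ _) ↔ _
  constructor
  · intro h1
    rw [← mulVec_neg, ← h1, mulVec_mulVec, nonsing_inv_mul _ hA, one_mulVec]
  · intro h1
    rw [h1, mulVec_neg, mulVec_mulVec, mul_nonsing_inv _ hA, one_mulVec]

theorem exists_cutMod_eq_chartMat {y : GLn n R} {d : ℕ} {σ : Equiv.Perm (Fin n)}
    (h : IsUnit (chartMinor y d σ).det) :
    ∃ X : ChartIndex n d → R, cutMod y d = cutMod (chartMat σ X) d := by
  obtain ⟨X, hX⟩ := exists_forall_mem_cutMod_chartMat_iff (Y := y.1) h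
  exact ⟨X, Submodule.ext hX⟩

/-- The minor is the lower right block of `y y'⁻¹`, for `y'` the chart matrix. The lower left block
of `y y'⁻¹` vanishes, so the lower right block of `y' y⁻¹` is its inverse. -/
theorem isUnit_det_chartMinor {y : GLn n R} {d : ℕ} {σ : Equiv.Perm (Fin n)}
    {X : ChartIndex n d → R} (h : cutMod y d = cutMod (chartMat σ X) d) :
    IsUnit (chartMinor y d σ).det := by
  let y' := chartMat σ X
  have h1 := cutMod_le_iff.mp h.ge
  have hZ : (y * y'⁻¹).1 * (y' * y⁻¹).1 = 1 := by
    rw [← Units.val_mul]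
    simp
  have hC : chartMinor y d σ = (of fun i j => (y * y'⁻¹).1 i j : Matrix
      {i : Fin n // ¬(i : ℕ) < d} {i : Fin n // ¬(i : ℕ) < d} R) := by
    have hy : y.1 = (y * y'⁻¹).1 * y'.1 := by
      rw [← Units.val_mul]
      simp
    ext i j
    change y.1 i (σ j) = (y * y'⁻¹).1 i j
    have h2 : y'.1 *ᵥ Pi.single (σ j) 1 = Pi.single (j : Fin n) 1 := by
      rw [chartMat_mulVec]
      have : (Pi.single (σ j) (1 : R) : Fin n → R) ∘ σ = Pi.single (j : Fin n) 1 := by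
        ext k
        simp [Pi.single_apply]
      rw [this, sub_eq_self]
      ext k
      rw [mulVec_single_one]
      simp [lowerLeft, j.2]
    have h3 : y.1 *ᵥ Pi.single (σ j) 1 = (y * y'⁻¹).1 *ᵥ Pi.single (j : Fin n) 1 := by
      conv_lhs => rw [hy, ← mulVec_mulVec, h2]
    rw [mulVec_single_one, mulVec_single_one] at h3
    exact congrFun h3 i
  rw [hC]
  refine IsUnit.of_mul_eq_one (of fun i j => (y' * y⁻¹).1 i j : Matrix
      {i : Fin n // ¬(i : ℕ) < d} {i : Fin n // ¬(i : ℕ) < d} R).det ?_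
  rw [← det_mul]
  refine (congrArg det ?_).trans det_one
  ext i j
  have h4 := congrFun (congrFun hZ i) j
  rw [mul_apply, ← Fintype.sum_subtype_add_sum_subtype (fun j : Fin n => (j : ℕ) < d),
    Finset.sum_eq_zero fun k _ => by rw [h1 i k (not_lt.mp i.2) k.2, zero_mul], zero_add] at h4
  rw [mul_apply, one_apply]
  simp only [one_apply, Subtype.coe_inj] at h4
  exact h4

/-- The last rows of an invertible matrix have full rank, so some of their columns form a basis; a
bijection onto these columns extends to a permutation. -/
theorem exists_det_chartMinor_ne_zero {K : Type*} [Field K] (y : GLn n K) (d : ℕ) :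
    ∃ σ : Equiv.Perm (Fin n), (chartMinor y d σ).det ≠ 0 := by
  classical
  let I := {i : Fin n // ¬(i : ℕ) < d}
  let v : Fin n → I → K := fun j i => y.1 i j
  have hv : ⊤ ≤ Submodule.span K (Set.range v) := by
    intro x _
    let x' : Fin n → K := fun i => if hi : (i : ℕ) < d then 0 else x ⟨i, hi⟩
    have hx : x = ∑ j, ((y⁻¹ : GLn n K).1 *ᵥ x') j • v j := by
      ext i
      have := congrFun (mulVec_inv_mulVec y x') i
      simp only [x', i.2, dite_false, Subtype.coe_eta] at this
      rw [← this]
      simp only [Finset.sum_apply, Pi.smul_apply, smul_eq_mul, v, mulVec, dotProduct]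
      exact Finset.sum_congr rfl fun _ _ => mul_comm _ _
    rw [hx]
    exact Submodule.sum_mem _ fun j _ => Submodule.smul_mem _ _ (Submodule.subset_span ⟨j, rfl⟩)
  obtain ⟨κ, a, ha, hspan, hli⟩ := exists_linearIndependent' K v
  let b : Module.Basis κ K (I → K) := Module.Basis.mk hli (by rw [hspan]; exact hv)
  let e : I ≃ κ := (Pi.basisFun K I).indexEquiv b
  let e' : I ≃ {j : Fin n // j ∈ Set.range a} := e.trans (Equiv.ofInjective a ha)
  refine ⟨e'.extendSubtype, ?_⟩
  have hcol : ∀ j : I, e'.extendSubtype j = a (e j) := fun j => by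
    exact e'.extendSubtype_apply_of_mem _ j.2
  have hli' : LinearIndependent K (chartMinor y d e'.extendSubtype).col := by
    have h1 := hli.comp e e.injective
    have h2 : (chartMinor y d e'.extendSubtype).col = (v ∘ a) ∘ e := by
      ext j i
      change y.1 i (e'.extendSubtype j) = y.1 i (a (e j))
      rw [hcol]
    rwa [h2]
  exact isUnit_iff_ne_zero.mp ((isUnit_iff_isUnit_det _).mp
    (linearIndependent_cols_iff_isUnit.mp hli'))

end

/-! ### Representability of the Grassmannian -/

section

variable {T Y S : Scheme.{u}} {H : S.Modules} {n : ℕ}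

/-- The subsheaf given by an invertible matrix with respect to a global frame. -/
theorem IsFrame.exists_cut {X : Scheme.{u}} {M : X.Modules} {e : Fin n → Γ(M, ⊤)}
    (he : IsFrame M ⊤ e) (d : ℕ) (y : GLn n Γ(X, ⊤)) : ∃ A : Subsheaf M, A.Cut e d y := by
  refine ⟨⟨fun W => (cutMod (gmap (rmap le_top) y) d).comap (he.coord le_top).toLinearMap,
    fun {W U} h x hx => ?_, fun {U} x hx i hi => ?_⟩, fun W h c => ?_⟩
  · change he.coord le_top (RelGrass.res M h x) ∈ cutMod (gmap (rmap le_top) y) d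
    rw [he.coord_res h le_top, ← rmap_comp h le_top, ← gmap_gmap]
    exact comp_mem_cutMod _ hx
  · refine fun_ext fun t ht => ?_
    obtain ⟨W, h, htW, hW⟩ := hx t ht
    refine ⟨W, h, htW, ?_⟩
    have h1 : he.coord le_top (RelGrass.res M h x) ∈ cutMod (gmap (rmap le_top) y) d := hW
    rw [he.coord_res h le_top, ← rmap_comp h le_top, ← gmap_gmap] at h1
    have h2 := h1 i hi
    rw [gmap_mulVec] at h2
    exact h2.trans (map_zero _).symm
  · change he.coord le_top (lin e h c) ∈ cutMod (gmap (rmap le_top) y) d ↔ _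
    rw [he.coord_lin]

theorem rmap_app_top (a : T ⟶ Y) (x : Γ(Y, ⊤)) :
    rmap (top_le_preimage a) ((a.app ⊤).hom x) = a.appTop.hom x :=
  DFunLike.congr_fun (rmap_self le_rfl) _

/-- A rank `d` subbundle as a flag. -/
def BundleFlag.single {X : Scheme.{u}} {M : X.Modules} {d : ℕ} (A : Subsheaf M)
    (hA : A.IsSubbundle d) : BundleFlag M {d} where
  sub _ := A
  isSubbundle d' := by rwa [Finset.mem_singleton.mp d'.2]
  le _ _ _ := fun _ => le_rfl

/-- The member of a flag with one member. -/
abbrev BundleFlag.member {X : Scheme.{u}} {M : X.Modules} {d : ℕ} (V : BundleFlag M {d}) :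
    Subsheaf M := V.sub ⟨d, Finset.mem_singleton_self d⟩

theorem BundleFlag.ext_single {X : Scheme.{u}} {M : X.Modules} {d : ℕ} {V V' : BundleFlag M {d}}
    (h : V.member = V'.member) : V = V' := by
  refine BundleFlag.ext (funext fun d' => ?_)
  obtain rfl : d' = ⟨d, Finset.mem_singleton_self d⟩ := Subtype.ext (Finset.mem_singleton.mp d'.2)
  exact h

namespace GrassmannianChart

variable (d : ℕ) (U : S.Opens)

/-- The chart of the Grassmannian over `U`. -/
abbrev scheme (n d : ℕ) (U : S.Opens) : Scheme.{u} :=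
  AffineSpace (ULift.{u} (ChartIndex n d)) (U : Scheme.{u})

/-- The structure morphism of a chart. -/
abbrev π (n d : ℕ) (U : S.Opens) : scheme n d U ⟶ S :=
  (scheme n d U ↘ (U : Scheme.{u})) ≫ U.ι

theorem top_le : (⊤ : (scheme n d U).Opens) ≤ π n d U ⁻¹ᵁ U := by
  intro t _
  exact ((scheme n d U ↘ (U : Scheme.{u})) t).2

/-- The coordinates on a chart. -/
def coord (n d : ℕ) (U : S.Opens) (k : ChartIndex n d) : Γ(scheme n d U, ⊤) :=
  AffineSpace.coord _ ⟨k⟩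

variable {d U}

theorem exists_hom {f : T ⟶ S} (hf : ⊤ ≤ f ⁻¹ᵁ U) (X : ChartIndex n d → Γ(T, ⊤)) :
    ∃ a : T ⟶ scheme n d U, a ≫ π n d U = f ∧ ∀ k, a.appTop.hom (coord n d U k) = X k := by
  let f' : T ⟶ U := IsOpenImmersion.lift U.ι f (by
    rw [Scheme.Opens.range_ι]
    rintro _ ⟨t, rfl⟩
    exact hf trivial)
  refine ⟨AffineSpace.homOfVector f' fun k => X k.down, ?_, fun k => ?_⟩
  · rw [π, ← Category.assoc, AffineSpace.homOfVector_over, IsOpenImmersion.lift_fac]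
  · exact AffineSpace.homOfVector_appTop_coord _ _ _

theorem hom_ext {a b : T ⟶ scheme n d U} (h : a ≫ π n d U = b ≫ π n d U)
    (h' : ∀ k, a.appTop.hom (coord n d U k) = b.appTop.hom (coord n d U k)) : a = b := by
  refine AffineSpace.hom_ext ?_ fun k => h' k.down
  rw [π, ← Category.assoc, ← Category.assoc] at h
  exact (cancel_mono _).mp h

end GrassmannianChart

/-! ### The open locus belonging to a chart of the Grassmannian. -/

namespace Subsheaf

variable {f : T ⟶ S}

/-- The open where a subsheaf of `f^* H` belongs to the chart of index `σ`. -/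
def chartLocus (A : Subsheaf ((Scheme.Modules.pullback f).obj H)) (d : ℕ) {U : S.Opens}
    (h : Fin n → Γ(H, U)) (σ : Equiv.Perm (Fin n)) : T.Opens :=
  sSup {W | ∃ (k : W ≤ f ⁻¹ᵁ U) (X : ChartIndex n d → Γ(T, W)), A.CutAt h k d (chartMat σ X)}

theorem mem_chartLocus {A : Subsheaf ((Scheme.Modules.pullback f).obj H)} {d : ℕ} {U : S.Opens}
    {h : Fin n → Γ(H, U)} {σ : Equiv.Perm (Fin n)} {t : T} : t ∈ A.chartLocus d h σ ↔
      ∃ (W : T.Opens) (k : W ≤ f ⁻¹ᵁ U) (X : ChartIndex n d → Γ(T, W)), t ∈ W ∧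
        A.CutAt h k d (chartMat σ X) := by
  rw [chartLocus, TopologicalSpace.Opens.mem_sSup]
  constructor
  · rintro ⟨W, ⟨k, X, hX⟩, ht⟩
    exact ⟨W, k, X, ht, hX⟩
  · rintro ⟨W, k, X, ht, hX⟩
    exact ⟨W, ⟨k, X, hX⟩, ht⟩

theorem CutAt.cutMod_eq {A : Subsheaf ((Scheme.Modules.pullback f).obj H)} {U : S.Opens}
    {h : Fin n → Γ(H, U)} (hh : IsFrame H U h) {W : T.Opens} {k k' : W ≤ f ⁻¹ᵁ U} {d d' : ℕ}
    {y y' : GLn n Γ(T, W)} (hA : A.CutAt h k d y) (hA' : A.CutAt h k' d' y') :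
    cutMod y d = cutMod y' d' :=
  (Cut.sec_eq_iff (isFrame_fr f hh k) hA hA').mp fun _ _ => rfl

theorem mem_chartLocus_of_mem_basicOpen {A : Subsheaf ((Scheme.Modules.pullback f).obj H)} {d : ℕ}
    {U : S.Opens} {h : Fin n → Γ(H, U)} {σ : Equiv.Perm (Fin n)} {W : T.Opens} {k : W ≤ f ⁻¹ᵁ U}
    {y : GLn n Γ(T, W)} (hA : A.CutAt h k d y) {t : T}
    (ht : t ∈ T.basicOpen (chartMinor y d σ).det) : t ∈ A.chartLocus d h σ := by
  have hle := T.basicOpen_le (chartMinor y d σ).det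
  have hA' := CutAt.res hA hle
  have hu : IsUnit (chartMinor (gmap (rmap hle) y) d σ).det := by
    rw [chartMinor_gmap, ← RingHom.mapMatrix_apply, ← RingHom.map_det]
    exact RingedSpace.isUnit_res_basicOpen _ (chartMinor y d σ).det
  obtain ⟨X, hX⟩ := exists_cutMod_eq_chartMat hu
  exact mem_chartLocus.mpr ⟨_, _, X, ht, hA'.congr hX⟩

/-- Where a matrix `y` of `A` is available, belonging to the chart means that the determinant of
`chartMinor` is invertible, and nonvanishing of a function is compatible with pullback. -/
theorem mem_chartLocus_pullbackOver {g : T ⟶ Y} {π : Y ⟶ S} (w : g ≫ π = f)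
    {A : Subsheaf ((Scheme.Modules.pullback π).obj H)} {d : ℕ} (hA : A.IsSubbundle d)
    {U : S.Opens} {h : Fin n → Γ(H, U)} (hh : IsFrame H U h) {σ : Equiv.Perm (Fin n)} {t : T} :
    t ∈ (A.pullbackOver w).chartLocus d h σ ↔ g t ∈ A.chartLocus d h σ := by
  constructor
  · intro ht
    obtain ⟨W, k, X, htW, hX⟩ := mem_chartLocus.mp ht
    have htU : g t ∈ π ⁻¹ᵁ U := by
      have := k htW
      subst w
      exact this
    obtain ⟨-, V, k', y, htV, hy⟩ := hA.exists_cutAt (f := π) hh (t := g t) le_rfl htU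
    refine mem_chartLocus_of_mem_basicOpen hy ?_
    change t ∈ g ⁻¹ᵁ Y.basicOpen _
    rw [Scheme.preimage_basicOpen]
    have h1 := CutAt.res (CutAt.pullbackOver w hh hy) (inf_le_left : (g ⁻¹ᵁ V) ⊓ W ≤ _)
    have h2 := CutAt.res hX (inf_le_right : (g ⁻¹ᵁ V) ⊓ W ≤ _)
    rw [gmap_chartMat] at h2
    have h3 := isUnit_det_chartMinor (h1.cutMod_eq hh h2)
    rw [gmap_gmap, chartMinor_gmap, ← RingHom.mapMatrix_apply, ← RingHom.map_det] at h3
    have h4 := T.basicOpen_res ((g.app V).hom (chartMinor y d σ).det)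
      (homOfLE (inf_le_left : (g ⁻¹ᵁ V) ⊓ W ≤ _)).op
    have h5 : t ∈ T.basicOpen (T.presheaf.map (homOfLE (inf_le_left : (g ⁻¹ᵁ V) ⊓ W ≤ _)).op
        ((g.app V).hom (chartMinor y d σ).det)) := by
      refine (Scheme.basicOpen_of_isUnit _ ?_ : T.basicOpen _ = _).ge ⟨htV, htW⟩
      exact h3
    rw [h4] at h5
    exact h5.2
  · intro ht
    obtain ⟨W, k, X, htW, hX⟩ := mem_chartLocus.mp ht
    have h1 := CutAt.pullbackOver w hh hX
    rw [gmap_chartMat] at h1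
    exact mem_chartLocus.mpr ⟨_, _, _, htW, h1⟩

/-- The local chart coordinates are unique by `chartMat_injective`, hence glue to global functions.
-/
theorem exists_cutAt_of_chartLocus {A : Subsheaf ((Scheme.Modules.pullback f).obj H)} {d : ℕ}
    {U : S.Opens} {h : Fin n → Γ(H, U)} (hh : IsFrame H U h) {σ : Equiv.Perm (Fin n)}
    (hA : ∀ t, t ∈ A.chartLocus d h σ) : ∃ (k : ⊤ ≤ f ⁻¹ᵁ U) (X : ChartIndex n d → Γ(T, ⊤)),
      A.CutAt h k d (chartMat σ X) := by
  choose W k X ht hX using fun t => mem_chartLocus.mp (hA t)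
  choose Z hZ using fun i => fun_glue W ⊤ (fun _ => le_top)
    (fun t _ => TopologicalSpace.Opens.mem_iSup.mpr ⟨t, ht t⟩) (fun t => X t i) (by
      intro t t'
      have h1 := CutAt.res (hX t) (inf_le_left : W t ⊓ W t' ≤ _)
      have h2 := CutAt.res (hX t') (inf_le_right : W t ⊓ W t' ≤ _)
      rw [gmap_chartMat] at h1 h2
      exact congrFun (chartMat_injective (h1.cutMod_eq hh h2)) i)
  have hk : ⊤ ≤ f ⁻¹ᵁ U := fun t _ => k t (ht t)
  refine ⟨hk, Z, ?_⟩
  obtain ⟨B, hB⟩ := (isFrame_fr f hh hk).exists_cut d (chartMat σ Z)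
  have hAB : A = B := by
    refine eq_of_cutAt (n := n) fun t => ⟨U, h, hh, W t, k t, d, _, ht t, hX t, ?_⟩
    have h1 := CutAt.res (k := hk) hB (le_top : W t ≤ ⊤)
    rw [gmap_chartMat] at h1
    rwa [show rmap le_top ∘ Z = X t from funext fun i => hZ i t] at h1
  rwa [hAB]

/-- Over the residue field at `t` some chart minor is nonzero, and it stays invertible near `t`. -/
theorem exists_mem_chartLocus {A : Subsheaf ((Scheme.Modules.pullback f).obj H)} {d : ℕ}
    (hA : A.IsSubbundle d) {U : S.Opens} {h : Fin n → Γ(H, U)} (hh : IsFrame H U h) {t : T}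
    (ht : f t ∈ U) : ∃ σ, t ∈ A.chartLocus d h σ := by
  obtain ⟨-, V, k', y, htV, hy⟩ := hA.exists_cutAt (f := f) hh (t := t) le_rfl ht
  obtain ⟨σ, hσ⟩ := exists_det_chartMinor_ne_zero (gmap (T.evaluation V t htV).hom y) d
  refine ⟨σ, mem_chartLocus_of_mem_basicOpen hy ?_⟩
  rw [← Scheme.evaluation_ne_zero_iff_mem_basicOpen (hx := htV)]
  rw [chartMinor_gmap, ← RingHom.mapMatrix_apply, ← RingHom.map_det] at hσ
  exact hσ

end Subsheaf

theorem GrassmannianChart.exists_subbundle {d : ℕ} (hd : d ≤ n) {U : S.Opens}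
    {h : Fin n → Γ(H, U)} (hh : IsFrame H U h) (σ : Equiv.Perm (Fin n)) :
    ∃ A : Subsheaf ((Scheme.Modules.pullback (π n d U)).obj H), A.IsSubbundle d ∧
      A.CutAt h (top_le d U) d (chartMat σ (coord n d U)) := by
  obtain ⟨A, hA⟩ := (isFrame_fr (π n d U) hh (top_le d U)).exists_cut d
    (chartMat σ (coord n d U))
  exact ⟨A, Subsheaf.isSubbundle_of_cutAt fun t => ⟨hd, U, h, hh, ⊤, _, _, trivial, hA⟩, hA⟩

theorem Subsheaf.CutAt.pullbackOver_chart {d : ℕ} {U : S.Opens} {h : Fin n → Γ(H, U)}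
    (hh : IsFrame H U h) {σ : Equiv.Perm (Fin n)}
    {A : Subsheaf ((Scheme.Modules.pullback (GrassmannianChart.π n d U)).obj H)}
    (hA : A.CutAt h (GrassmannianChart.top_le d U) d (chartMat σ (GrassmannianChart.coord n d U)))
    {f : T ⟶ S} (a : T ⟶ GrassmannianChart.scheme n d U) (w : a ≫ GrassmannianChart.π n d U = f) :
    (A.pullbackOver w).CutAt h
      ((top_le_preimage a).trans (preimage_le_of_comp w (GrassmannianChart.top_le d U))) d
      (chartMat σ fun k => a.appTop.hom (GrassmannianChart.coord n d U k)) := by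
  have h1 := CutAt.res (CutAt.pullbackOver w hh hA) (top_le_preimage a)
  rw [gmap_chartMat, gmap_chartMat] at h1
  rwa [show (rmap (top_le_preimage a) ∘ ((a.app ⊤).hom ∘ GrassmannianChart.coord n d U)) =
    fun k => a.appTop.hom (GrassmannianChart.coord n d U k) from
      funext fun k => rmap_app_top a _] at h1

/-- The standard atlas of the Grassmannian. -/
def grassmannianAtlas (hH : IsVectorBundle H n) {d : ℕ} (hd : d ≤ n) :
    (flagFunctor hH {d}).Atlas where
  ι := Σ U : S.Opens, {h : Fin n → Γ(H, U) // IsFrame H U h} × Equiv.Perm (Fin n)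
  X i := GrassmannianChart.scheme n d i.1
  π i := GrassmannianChart.π n d i.1
  u i := BundleFlag.single _ (GrassmannianChart.exists_subbundle hd i.2.1.2 i.2.2).choose_spec.1
  locus f V i := (BundleFlag.member V).chartLocus d i.2.1.1 i.2.2
  locus_iff {T} f V i T' g := by
    obtain ⟨U, ⟨h, hh⟩, σ⟩ := i
    have hV : V.member.IsSubbundle d := V.isSubbundle _
    have h1 : (∀ t, g t ∈ V.member.chartLocus d h σ) ↔
        ∀ t, t ∈ (V.member.pullbackOver (rfl : g ≫ f = _)).chartLocus d h σ :=
      forall_congr' fun t => (Subsheaf.mem_chartLocus_pullbackOver rfl hV hh).symm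
    have hA := (GrassmannianChart.exists_subbundle hd hh σ).choose_spec.2
    rw [h1]
    constructor
    · intro h2
      obtain ⟨k, X, hX⟩ := Subsheaf.exists_cutAt_of_chartLocus hh h2
      obtain ⟨a, w, ha⟩ := GrassmannianChart.exists_hom k X
      refine ⟨a, w, BundleFlag.ext_single ?_⟩
      have h3 := Subsheaf.CutAt.pullbackOver_chart hh hA a w
      simp only [ha] at h3
      exact Subsheaf.eq_of_cutAt (n := n) fun t => ⟨U, h, hh, ⊤, k, d, _, trivial, h3, hX⟩
    · rintro ⟨a, w, ha⟩ t
      have h3 := Subsheaf.CutAt.pullbackOver_chart hh hA a w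
      have h4 : (V.member.pullbackOver (rfl : g ≫ f = _)) = _ :=
        (congrArg BundleFlag.member ha).symm
      rw [h4]
      exact Subsheaf.mem_chartLocus.mpr ⟨⊤, _, _, trivial, h3⟩
  inj i T a b w hab := by
    obtain ⟨U, ⟨h, hh⟩, σ⟩ := i
    have hA := (GrassmannianChart.exists_subbundle hd hh σ).choose_spec.2
    refine GrassmannianChart.hom_ext w fun k => ?_
    have h3 := Subsheaf.CutAt.pullbackOver_chart hh hA a w
    have h4 := Subsheaf.CutAt.pullbackOver_chart hh hA b rfl
    have h5 := congrArg BundleFlag.member hab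
    have h6 : Subsheaf.pullbackOver _ (GrassmannianChart.exists_subbundle hd hh σ).choose =
      Subsheaf.pullbackOver _ (GrassmannianChart.exists_subbundle hd hh σ).choose := h5
    rw [h6] at h3
    exact congrFun (chartMat_injective (h3.cutMod_eq hh h4)) k
  cover f V t := by
    obtain ⟨U, hU, h, hh⟩ := hH (f t)
    obtain ⟨σ, hσ⟩ := Subsheaf.exists_mem_chartLocus (V.isSubbundle ⟨d, Finset.mem_singleton_self d⟩)
      hh hU
    exact ⟨⟨U, ⟨h, hh⟩, σ⟩, hσ⟩

theorem nonempty_grassmannianBundle (hH : IsVectorBundle H n) {d : ℕ} (hd : d ≤ n) :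
    Nonempty (GrassmannianBundle H d) := by
  obtain ⟨Y, π, u, hu⟩ := (grassmannianAtlas hH hd).exists_universal
  refine ⟨⟨Y, π, u, fun {T} f V => ?_⟩⟩
  obtain ⟨g, ⟨w, hg⟩, huniq⟩ := hu f V
  refine ⟨g, ⟨w, fun d => congrArg (fun F => BundleFlag.sub F d) hg⟩, ?_⟩
  rintro g' ⟨w', hg'⟩
  exact huniq g' ⟨w', BundleFlag.ext (funext hg')⟩

end

/-! ### Representability of the frame bundle -/

section

variable {T Y S : Scheme.{u}} {H : S.Modules} {n : ℕ}

/-- The family obtained from a frame by an invertible matrix. -/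
def transform {X : Scheme.{u}} {M : X.Modules} {U : X.Opens} (e : Fin n → Γ(M, U))
    (y : GLn n Γ(X, U)) (j : Fin n) : Γ(M, U) := lin e le_rfl (y.1.mulVec (Pi.single j 1))

theorem lin_transform {X : Scheme.{u}} {M : X.Modules} {U : X.Opens} (e : Fin n → Γ(M, U))
    (y : GLn n Γ(X, U)) {W : X.Opens} (h : W ≤ U) (c : Fin n → Γ(X, W)) :
    lin (transform e y) h c = lin e h ((gmap (rmap h) y).1.mulVec c) := by
  have h1 : ∀ j, res M h (transform e y j) =
      lin e h ((gmap (rmap h) y).1.mulVec (Pi.single j 1)) := fun j => by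
    rw [transform, res_lin, ← gmap_mulVec]
    congr 2
    ext k
    simp only [Function.comp, Pi.single_apply]
    split_ifs <;> simp
  rw [lin_apply]
  simp only [h1, ← map_smul, ← map_sum]
  congr 1
  conv_rhs => rw [pi_eq_sum_univ' c, Matrix.mulVec_sum]
  simp only [Matrix.mulVec_smul]

theorem IsFrame.transform {X : Scheme.{u}} {M : X.Modules} {U : X.Opens} {e : Fin n → Γ(M, U)}
    (he : IsFrame M U e) (y : GLn n Γ(X, U)) : IsFrame M U (transform e y) := by
  intro W h
  have h1 : Function.Bijective fun c => (gmap (rmap h) y).1.mulVec c :=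
    Function.bijective_iff_has_inverse.mpr ⟨fun c => ((gmap (rmap h) y)⁻¹ : GLn n _).1.mulVec c,
      inv_mulVec_mulVec _, mulVec_inv_mulVec _⟩
  have h2 := (he.bijective h).comp h1
  convert h2 using 1
  ext c
  exact lin_transform e y h c

theorem IsFrame.exists_eq_transform {X : Scheme.{u}} {M : X.Modules} {U : X.Opens}
    {e e' : Fin n → Γ(M, U)} (he : IsFrame M U e) (he' : IsFrame M U e') :
    ∃ y : GLn n Γ(X, U), e' = RelGrass.transform e y := by
  obtain ⟨y, hy⟩ := he'.exists_transition he
  refine ⟨y, funext fun j => ?_⟩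
  have := hy le_rfl (Pi.single j 1)
  rwa [lin_single, res_self, rmap_self, gmap_id] at this

theorem IsFrame.transform_injective {X : Scheme.{u}} {M : X.Modules} {U : X.Opens}
    {e : Fin n → Γ(M, U)} (he : IsFrame M U e) {y y' : GLn n Γ(X, U)}
    (h : RelGrass.transform e y = RelGrass.transform e y') : y = y' := by
  ext i j
  have h1 := (he.bijective le_rfl).injective (congrFun h j)
  rw [Matrix.mulVec_single_one, Matrix.mulVec_single_one] at h1
  exact congrFun h1 i

theorem pullTop_transform {g : T ⟶ Y} {π : Y ⟶ S} {f : T ⟶ S} (w : g ≫ π = f) {U : S.Opens}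
    {h : Fin n → Γ(H, U)} (k : ⊤ ≤ π ⁻¹ᵁ U) (k' : ⊤ ≤ f ⁻¹ᵁ U) (y : GLn n Γ(Y, ⊤)) (j : Fin n) :
    pullTop w (transform (fr π h k) y j) = transform (fr f h k') (gmap g.appTop.hom y) j := by
  rw [pullTop, transform, pullSecOver_lin]
  simp only [pullSecOver_fr]
  rw [lin_fr, res_lin, lin_fr, transform]
  congr 1
  ext i
  rw [Matrix.mulVec_single_one, Matrix.mulVec_single_one]
  exact rmap_app_top g (y.1 i j)

theorem isUnit_of_basicOpen_eq_top {X : Scheme.{u}} {r : Γ(X, ⊤)} (h : X.basicOpen r = ⊤) :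
    IsUnit r := by
  have h1 : ∀ (V : X.Opens) (k : V ≤ ⊤), V = ⊤ → IsUnit (rmap k r) → IsUnit r := by
    rintro V k rfl hr
    rwa [rmap_self] at hr
  exact h1 _ _ h (RingedSpace.isUnit_res_basicOpen _ r)

namespace FrameChart

variable (U : S.Opens)

/-- The space of matrices over `U`. -/
abbrev space (n : ℕ) (U : S.Opens) : Scheme.{u} :=
  AffineSpace (ULift.{u} (Fin n × Fin n)) (U : Scheme.{u})

/-- The generic matrix. -/
def genericMatrix (n : ℕ) (U : S.Opens) : Matrix (Fin n) (Fin n) Γ(space n U, ⊤) :=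
  .of fun i j => AffineSpace.coord _ ⟨(i, j)⟩

/-- The chart of the frame bundle over `U`. -/
abbrev scheme (n : ℕ) (U : S.Opens) : Scheme.{u} := (space n U).basicOpen (genericMatrix n U).det

/-- The inclusion of a chart in the space of matrices. -/
abbrev ι (n : ℕ) (U : S.Opens) : scheme n U ⟶ space n U :=
  ((space n U).basicOpen (genericMatrix n U).det).ι

/-- The structure morphism of a chart. -/
abbrev π (n : ℕ) (U : S.Opens) : scheme n U ⟶ S :=
  ι n U ≫ (space n U ↘ (U : Scheme.{u})) ≫ U.ι

theorem top_le : (⊤ : (scheme n U).Opens) ≤ π n U ⁻¹ᵁ U := fun t _ =>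
  ((space n U ↘ (U : Scheme.{u})) (ι n U t)).2

/-- The coordinate matrix on a chart. -/
def mat (n : ℕ) (U : S.Opens) : GLn n Γ(scheme n U, ⊤) :=
  Matrix.GeneralLinearGroup.mk'' ((genericMatrix n U).map (ι n U).appTop.hom) (by
    rw [← RingHom.mapMatrix_apply, ← RingHom.map_det]
    refine isUnit_of_basicOpen_eq_top ?_
    refine (Scheme.preimage_basicOpen_top _ _).symm.trans ?_
    exact Scheme.Opens.ι_preimage_self _)

variable {U}

theorem exists_hom {f : T ⟶ S} (hf : ⊤ ≤ f ⁻¹ᵁ U) (y : GLn n Γ(T, ⊤)) :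
    ∃ a : T ⟶ scheme n U, a ≫ π n U = f ∧ gmap a.appTop.hom (mat n U) = y := by
  let f' : T ⟶ U := IsOpenImmersion.lift U.ι f (by
    rw [Scheme.Opens.range_ι]
    rintro _ ⟨t, rfl⟩
    exact hf trivial)
  let b : T ⟶ space n U := AffineSpace.homOfVector f' fun k => y.1 k.down.1 k.down.2
  have hb : (genericMatrix n U).map b.appTop.hom = y.1 := by
    ext i j
    exact AffineSpace.homOfVector_appTop_coord _ _ _
  have hr : Set.range b ⊆ Set.range (ι n U) := by
    rw [Scheme.Opens.range_ι]
    rintro _ ⟨t, rfl⟩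
    change t ∈ b ⁻¹ᵁ (space n U).basicOpen (genericMatrix n U).det
    rw [Scheme.preimage_basicOpen]
    have h1 : IsUnit (b.appTop.hom (genericMatrix n U).det) := by
      rw [RingHom.map_det, RingHom.mapMatrix_apply, hb]
      exact (Matrix.isUnit_iff_isUnit_det _).mp y.isUnit
    exact (Scheme.basicOpen_of_isUnit _ h1 : T.basicOpen _ = _).ge trivial
  refine ⟨IsOpenImmersion.lift (ι n U) b hr, ?_, ?_⟩
  · rw [π, IsOpenImmersion.lift_fac_assoc, AffineSpace.homOfVector_over_assoc,
      IsOpenImmersion.lift_fac]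
  · ext i j
    rw [← hb]
    change (IsOpenImmersion.lift (ι n U) b hr).appTop.hom ((ι n U).appTop.hom (genericMatrix n U i j))
      = b.appTop.hom (genericMatrix n U i j)
    conv_rhs => rw [← IsOpenImmersion.lift_fac (ι n U) b hr, Scheme.Hom.comp_appTop]
    rfl

theorem hom_ext {a b : T ⟶ scheme n U} (h : a ≫ π n U = b ≫ π n U)
    (h' : gmap a.appTop.hom (mat n U) = gmap b.appTop.hom (mat n U)) : a = b := by
  refine (cancel_mono (ι n U)).mp (AffineSpace.hom_ext ?_ fun k => ?_)
  · refine (cancel_mono U.ι).mp ?_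
    simpa only [Category.assoc] using h
  · have h1 : (gmap a.appTop.hom (mat n U)).1 k.down.1 k.down.2 =
        (gmap b.appTop.hom (mat n U)).1 k.down.1 k.down.2 := by rw [h']
    rw [Scheme.Hom.comp_appTop, Scheme.Hom.comp_appTop]
    exact h1

end FrameChart

/-- The universal frame on a chart. -/
def FrameChart.frame (hH : IsVectorBundle H n) {U : S.Opens} {h : Fin n → Γ(H, U)}
    (hh : IsFrame H U h) : (frameFunctor hH).obj (FrameChart.π n U) :=
  ⟨transform (fr (FrameChart.π n U) h (FrameChart.top_le U)) (FrameChart.mat n U),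
    (isFrame_fr _ hh _).transform _⟩

theorem FrameChart.map_frame (hH : IsVectorBundle H n) {U : S.Opens} {h : Fin n → Γ(H, U)}
    (hh : IsFrame H U h) {f : T ⟶ S} (a : T ⟶ FrameChart.scheme n U)
    (w : a ≫ FrameChart.π n U = f) (k : ⊤ ≤ f ⁻¹ᵁ U) :
    ((frameFunctor hH).map a w (FrameChart.frame hH hh)).1 =
      transform (fr f h k) (gmap a.appTop.hom (FrameChart.mat n U)) :=
  funext fun j => pullTop_transform w (FrameChart.top_le U) k (FrameChart.mat n U) j

/-- The standard atlas of the frame bundle. -/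
def frameAtlas (hH : IsVectorBundle H n) : (frameFunctor hH).Atlas where
  ι := Σ U : S.Opens, {h : Fin n → Γ(H, U) // IsFrame H U h}
  X i := FrameChart.scheme n i.1
  π i := FrameChart.π n i.1
  u i := FrameChart.frame hH i.2.2
  -- Once `H` is trivialized, every frame is an invertible matrix, so the chart imposes no condition
  -- on the frame itself.
  locus f _ i := f ⁻¹ᵁ i.1
  locus_iff {T} f x i T' g := by
    obtain ⟨U, h, hh⟩ := i
    constructor
    · intro h1
      have k : ⊤ ≤ (g ≫ f) ⁻¹ᵁ U := fun t _ => h1 t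
      obtain ⟨y, hy⟩ := (isFrame_fr (g ≫ f) hh k).exists_eq_transform
        ((frameFunctor hH).map g rfl x).2
      obtain ⟨a, w, ha⟩ := FrameChart.exists_hom k y
      refine ⟨a, w, Subtype.ext ?_⟩
      rw [hy, FrameChart.map_frame hH hh a w k, ha]
    · rintro ⟨a, w, -⟩ t
      change t ∈ (g ≫ f) ⁻¹ᵁ U
      rw [← w]
      exact FrameChart.top_le U (x := a t) trivial
  inj i T a b w hab := by
    obtain ⟨U, h, hh⟩ := i
    refine FrameChart.hom_ext w ?_
    have k : ⊤ ≤ (b ≫ FrameChart.π n U) ⁻¹ᵁ U := fun t _ =>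
      FrameChart.top_le U (x := b t) trivial
    refine (isFrame_fr _ hh k).transform_injective ?_
    rw [← FrameChart.map_frame hH hh a w k, ← FrameChart.map_frame hH hh b rfl k, hab]
  cover f V t := by
    obtain ⟨U, hU, h, hh⟩ := hH (f t)
    exact ⟨⟨U, h, hh⟩, hU⟩

theorem nonempty_frameBundle (hH : IsVectorBundle H n) : Nonempty (FrameBundle H n) := by
  obtain ⟨Y, π, u, hu⟩ := (frameAtlas hH).exists_universal
  have key : ∀ {T : Scheme.{u}} {f : T ⟶ S} {g : T ⟶ Y} (w : g ≫ π = f) (i),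
    pullTop w (u.1 i) = pullSecOver w H (u.1 i) := fun w i => res_self _ _ _
  refine ⟨⟨Y, π, u.1, u.2, fun {T} f e he => ?_⟩⟩
  obtain ⟨g, ⟨w, hg⟩, huniq⟩ := hu f ⟨e, he⟩
  refine ⟨g, ⟨w, fun i => (key w i).symm.trans (congrFun (congrArg Subtype.val hg) i)⟩, ?_⟩
  rintro g' ⟨w', hg'⟩
  exact huniq g' ⟨w', Subtype.ext (funext fun i => (key w' i).trans (hg' i))⟩

end

/-! ### Minors and determinants of functionals -/

section

open Matrix

variable {n : ℕ} {R R' : Type*} [CommRing R] [CommRing R']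

/-- The ideal generated by the minors of size `d + 1` of the block of `Z` with rows `≥ b` and
columns `< a`. -/
def minorIdeal (Z : Matrix (Fin n) (Fin n) R) (b a d : ℕ) : Ideal R :=
  Ideal.span {x | ∃ ρ κ : Fin (d + 1) → Fin n, (∀ i, b ≤ (ρ i : ℕ)) ∧ (∀ j, (κ j : ℕ) < a) ∧
    x = (Z.submatrix ρ κ).det}

theorem det_submatrix_mem_minorIdeal {Z : Matrix (Fin n) (Fin n) R} {b a d : ℕ}
    {ρ κ : Fin (d + 1) → Fin n} (hρ : ∀ i, b ≤ (ρ i : ℕ)) (hκ : ∀ j, (κ j : ℕ) < a) :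
    (Z.submatrix ρ κ).det ∈ minorIdeal Z b a d := Ideal.subset_span ⟨ρ, κ, hρ, hκ, rfl⟩

theorem minorIdeal_le_iff {Z : Matrix (Fin n) (Fin n) R} {b a d : ℕ} {I : Ideal R} :
    minorIdeal Z b a d ≤ I ↔ ∀ ρ κ : Fin (d + 1) → Fin n, (∀ i, b ≤ (ρ i : ℕ)) →
      (∀ j, (κ j : ℕ) < a) → (Z.submatrix ρ κ).det ∈ I := by
  refine ⟨fun h ρ κ hρ hκ => h (det_submatrix_mem_minorIdeal hρ hκ), fun h => ?_⟩
  refine Ideal.span_le.mpr ?_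
  rintro _ ⟨ρ, κ, hρ, hκ, rfl⟩
  exact h ρ κ hρ hκ

theorem minorIdeal_map (φ : R →+* R') (Z : Matrix (Fin n) (Fin n) R) (b a d : ℕ) :
    (minorIdeal Z b a d).map φ = minorIdeal (Z.map φ) b a d := by
  refine le_antisymm (Ideal.map_le_iff_le_comap.mpr ?_) ?_
  · rw [minorIdeal_le_iff]
    intro ρ κ hρ hκ
    rw [Ideal.mem_comap, RingHom.map_det]
    exact det_submatrix_mem_minorIdeal hρ hκ
  · rw [minorIdeal_le_iff]
    intro ρ κ hρ hκ
    have := Ideal.mem_map_of_mem φ (det_submatrix_mem_minorIdeal (Z := Z) (d := d) hρ hκ)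
    rwa [RingHom.map_det] at this

theorem minorIdeal_zero_le_iff {Z : Matrix (Fin n) (Fin n) R} {b a : ℕ} {I : Ideal R} :
    minorIdeal Z b a 0 ≤ I ↔ ∀ i j : Fin n, b ≤ i → (j : ℕ) < a → Z i j ∈ I := by
  rw [minorIdeal_le_iff]
  refine ⟨fun h i j hi hj => ?_, fun h ρ κ hρ hκ => ?_⟩
  · simpa using h (fun _ => i) (fun _ => j) (fun _ => hi) (fun _ => hj)
  · simpa using h (ρ 0) (κ 0) (hρ 0) (hκ 0)

/-- Multilinearity in the rows. Unlike in the Cauchy–Binet formula, repeated and permuted indices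
are not collected; ideal membership does not need it. -/
theorem det_mul_eq_sum {m : ℕ} {ι : Type*} [Fintype ι] (B : Matrix (Fin m) ι R)
    (N : Matrix ι (Fin m) R) :
    (B * N).det = ∑ ρ : Fin m → ι, (∏ i, B i (ρ i)) * (N.submatrix ρ id).det := by
  classical
  have h : (B * N) = fun i => ∑ k, B i k • N k := by
    ext i j
    simp [Matrix.mul_apply]
  have h2 := (detRowAlternating (n := Fin m) (R := R)).toMultilinearMap.map_sum
    (fun i k => B i k • N k)
  rw [h]
  refine h2.trans (Finset.sum_congr rfl fun ρ _ => ?_)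
  exact (MultilinearMap.map_smul_univ _ (fun i => B i (ρ i)) (fun i => N (ρ i)))

/-- Expand in the rows of `Z`, then, after transposing, in its columns. A term that uses a row `< b`
or a column `≥ a` has a zero coefficient. -/
theorem det_mul_mul_mem {d a b : ℕ} {Z : Matrix (Fin n) (Fin n) R}
    {B : Matrix (Fin (d + 1)) (Fin n) R} {C : Matrix (Fin n) (Fin (d + 1)) R}
    (hB : ∀ (i) (k : Fin n), (k : ℕ) < b → B i k = 0)
    (hC : ∀ (k : Fin n) (j), a ≤ (k : ℕ) → C k j = 0) :
    (B * Z * C).det ∈ minorIdeal Z b a d := by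
  rw [Matrix.mul_assoc, det_mul_eq_sum]
  refine Ideal.sum_mem _ fun ρ _ => ?_
  by_cases hρ : ∀ i, b ≤ (ρ i : ℕ)
  · refine Ideal.mul_mem_left _ _ ?_
    have h1 : ((Z * C).submatrix ρ id).det = (Cᵀ * (Z.submatrix ρ id)ᵀ).det := by
      rw [← det_transpose, transpose_submatrix, transpose_mul]
      rfl
    rw [h1, det_mul_eq_sum]
    refine Ideal.sum_mem _ fun κ _ => ?_
    by_cases hκ : ∀ j, (κ j : ℕ) < a
    · refine Ideal.mul_mem_left _ _ ?_
      rw [← det_transpose]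
      exact det_submatrix_mem_minorIdeal hρ hκ
    · push Not at hκ
      obtain ⟨j, hj⟩ := hκ
      have h0 : ∏ i, Cᵀ i (κ i) = 0 := Finset.prod_eq_zero (Finset.mem_univ j) (hC (κ j) j hj)
      rw [h0, zero_mul]
      exact zero_mem _
  · push Not at hρ
    obtain ⟨i, hi⟩ := hρ
    rw [Finset.prod_eq_zero (Finset.mem_univ i) (hB i (ρ i) hi), zero_mul]
    exact zero_mem _

/-- Determinants of functionals vanishing on `cutMod y' b` on vectors in `cutMod y a`. -/
theorem det_functional_mem_minorIdeal {y y' : GLn n R} {a b d : ℕ}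
    {v : Fin (d + 1) → Fin n → R} (hv : ∀ j, v j ∈ cutMod y a)
    {φ : Fin (d + 1) → (Fin n → R) →ₗ[R] R} (hφ : ∀ i, ∀ c ∈ cutMod y' b, φ i c = 0) :
    (Matrix.of fun i j => φ i (v j)).det ∈ minorIdeal (y' * y⁻¹).1 b a d := by
  -- Expanding `v j` in the columns of `y'⁻¹` factors the matrix through `y' y⁻¹`. The left factor
  -- vanishes in columns `< b`, since `φ i` kills `cutMod y' b`; the right one vanishes in rows `≥
  -- a`, since `v j` lies in `cutMod y a`.
  have h : (Matrix.of fun i j => φ i (v j)) =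
      (Matrix.of fun i k => φ i ((y'⁻¹ : GLn n R).1 *ᵥ Pi.single k 1)) * (y' * y⁻¹).1 *
        (Matrix.of fun k j => (y.1 *ᵥ v j) k) := by
    ext i j
    have h1 : (y' * y⁻¹).1 *ᵥ (y.1 *ᵥ v j) = y'.1 *ᵥ v j := by
      rw [Units.val_mul, ← mulVec_mulVec, inv_mulVec_mulVec]
    have h2 : ∀ k, ((y' * y⁻¹).1 * (Matrix.of fun k j => (y.1 *ᵥ v j) k)) k j =
        (y'.1 *ᵥ v j) k := by
      intro k
      rw [← h1]
      rfl
    rw [Matrix.mul_assoc, Matrix.mul_apply]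
    simp only [h2, Matrix.of_apply]
    conv_lhs => rw [eq_sum_inv_single y' (v j)]
    rw [map_sum]
    refine Finset.sum_congr rfl fun k _ => ?_
    rw [map_smul, smul_eq_mul, mul_comm]
  rw [h]
  exact det_mul_mul_mem (fun i k hk => hφ i _ (inv_single_mem_cutMod y' k hk))
    (fun k j hk => hv j k hk)

/-- Every minor is the determinant of functionals on vectors. -/
theorem det_submatrix_eq_functional (y y' : GLn n R) {d : ℕ} (ρ κ : Fin (d + 1) → Fin n) :
    ((y' * y⁻¹).1.submatrix ρ κ).det = (Matrix.of fun i j =>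
      (y'.1 *ᵥ ((y⁻¹ : GLn n R).1 *ᵥ Pi.single (κ j) 1)) (ρ i)).det := by
  congr 1
  ext i j
  rw [submatrix_apply, of_apply, mulVec_mulVec, mulVec_single_one]
  rfl

end

/-! ### Sheaves with local coordinates -/

section

variable {X : Scheme.{u}}

/-- Clears denominators with one exponent for the whole finite family. The conclusion covers all
larger exponents, so that bounds from several opens can be combined. -/
theorem exists_rmap_eq_pow_mul {U : X.Opens} (hU : IsAffineOpen U) (f : Γ(X, U)) {D : X.Opens}
    (hD : D = X.basicOpen f) (h : D ≤ U) {ι : Type*} [Finite ι] (c : ι → Γ(X, D)) :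
    ∃ N : ℕ, ∀ m, N ≤ m → ∃ c' : ι → Γ(X, U), ∀ i, rmap h (c' i) = rmap h f ^ m * c i := by
  have := hU.isLocalization_basicOpen f
  subst hD
  cases nonempty_fintype ι
  have key : ∀ i, ∃ (N : ℕ) (r : Γ(X, U)), rmap h r = rmap h f ^ N * c i := by
    intro i
    obtain ⟨N, r, hr⟩ := IsLocalization.Away.surj f (c i)
    exact ⟨N, r, by rw [mul_comm]; exact hr.symm⟩
  choose N r hr using key
  refine ⟨Finset.univ.sup N, fun m hm => ⟨fun i => f ^ (m - N i) * r i, fun i => ?_⟩⟩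
  have hi : N i ≤ m := (Finset.le_sup (Finset.mem_univ i)).trans hm
  rw [map_mul, map_pow, hr, ← mul_assoc, ← pow_add, Nat.sub_add_cancel hi]

theorem exists_pow_mul_eq {U : X.Opens} (hU : IsAffineOpen U) (f : Γ(X, U)) {D : X.Opens}
    (hD : D = X.basicOpen f) (h : D ≤ U) {ι : Type*} [Finite ι] {c c' : ι → Γ(X, U)}
    (hc : ∀ i, rmap h (c i) = rmap h (c' i)) :
    ∃ N : ℕ, ∀ m, N ≤ m → ∀ i, f ^ m * c i = f ^ m * c' i := by
  have := hU.isLocalization_basicOpen f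
  subst hD
  cases nonempty_fintype ι
  have key : ∀ i, ∃ N : ℕ, f ^ N * c i = f ^ N * c' i := fun i =>
    IsLocalization.Away.exists_of_eq (S := Γ(X, X.basicOpen f)) f (hc i)
  choose N hN using key
  refine ⟨Finset.univ.sup N, fun m hm i => ?_⟩
  have hi : N i ≤ m := (Finset.le_sup (Finset.mem_univ i)).trans hm
  rw [← Nat.sub_add_cancel hi, pow_add, mul_assoc, hN, mul_assoc]

variable (X) in
/-- A sheaf on `X` with a multiplication by functions that locally has coordinates. -/
structure CoordSheaf where
  /-- the sections -/
  sec : X.Opens → Type u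
  /-- the restrictions -/
  res : ∀ {W V : X.Opens}, W ≤ V → sec V → sec W
  res_res : ∀ {W V U : X.Opens} (h : W ≤ V) (h' : V ≤ U) (x : sec U),
    res h (res h' x) = res (h.trans h') x
  /-- the multiplication by functions -/
  smul : ∀ {W : X.Opens}, Γ(X, W) → sec W → sec W
  res_smul : ∀ {W V : X.Opens} (h : W ≤ V) (r : Γ(X, V)) (x : sec V),
    res h (smul r x) = smul (rmap h r) (res h x)
  smul_smul : ∀ {W : X.Opens} (r s : Γ(X, W)) (x : sec W), smul r (smul s x) = smul (r * s) x
  ext : ∀ {U : X.Opens} {x y : sec U},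
    (∀ t ∈ U, ∃ (W : X.Opens) (h : W ≤ U), t ∈ W ∧ res h x = res h y) → x = y
  glue : ∀ {κ : Type u} (V : κ → X.Opens) (U : X.Opens) (hV : ∀ i, V i ≤ U), U ≤ iSup V →
    ∀ s : ∀ i, sec (V i), (∀ i j, res (inf_le_left : V i ⊓ V j ≤ V i) (s i) =
      res inf_le_right (s j)) → ∃ x : sec U, ∀ i, res (hV i) x = s i
  coords : ∀ t : X, ∃ (B : X.Opens) (_ : t ∈ B) (ι : Type) (_ : Finite ι)
    (κ : ∀ W : X.Opens, W ≤ B → sec W → ι → Γ(X, W)),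
    (∀ W h, Function.Bijective (κ W h)) ∧
    (∀ {V W} (h' : V ≤ W) (h : W ≤ B) x i, κ V (h'.trans h) (res h' x) i = rmap h' (κ W h x i)) ∧
    (∀ {W} (h : W ≤ B) r x i, κ W h (smul r x) i = r * κ W h x i)

namespace CoordSheaf

variable (G : CoordSheaf X)

/-- The opens over which `G` has coordinates. -/
def HasCoords (B : X.Opens) : Prop := ∃ (ι : Type) (_ : Finite ι)
    (κ : ∀ W : X.Opens, W ≤ B → G.sec W → ι → Γ(X, W)),
    (∀ W h, Function.Bijective (κ W h)) ∧
    (∀ {V W} (h' : V ≤ W) (h : W ≤ B) x i,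
      κ V (h'.trans h) (G.res h' x) i = rmap h' (κ W h x i)) ∧
    (∀ {W} (h : W ≤ B) r x i, κ W h (G.smul r x) i = r * κ W h x i)

variable {G}

theorem HasCoords.exists_lift {B V : X.Opens} (hB : G.HasCoords B) (h : V ≤ B)
    (hV : IsAffineOpen V) (f : Γ(X, V)) {D : X.Opens} (hD : D = X.basicOpen f) (hDV : D ≤ V)
    (v : G.sec D) : ∃ N : ℕ, ∀ m, N ≤ m → ∃ x : G.sec V,
      G.res hDV x = G.smul (rmap hDV f ^ m) v := by
  obtain ⟨ι, _, κ, h1, h2, h3⟩ := hB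
  obtain ⟨N, hN⟩ := exists_rmap_eq_pow_mul hV f hD hDV (κ D (hDV.trans h) v)
  refine ⟨N, fun m hm => ?_⟩
  obtain ⟨c, hc⟩ := hN m hm
  obtain ⟨x, rfl⟩ := (h1 V h).surjective c
  refine ⟨x, (h1 D (hDV.trans h)).injective (funext fun i => ?_)⟩
  rw [h2 hDV h, h3, hc]

theorem HasCoords.exists_smul_eq {B V : X.Opens} (hB : G.HasCoords B) (h : V ≤ B)
    (hV : IsAffineOpen V) (f : Γ(X, V)) {D : X.Opens} (hD : D = X.basicOpen f) (hDV : D ≤ V)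
    {x y : G.sec V} (hxy : G.res hDV x = G.res hDV y) :
    ∃ N : ℕ, ∀ m, N ≤ m → G.smul (f ^ m) x = G.smul (f ^ m) y := by
  obtain ⟨ι, _, κ, h1, h2, h3⟩ := hB
  obtain ⟨N, hN⟩ := exists_pow_mul_eq hV f hD hDV (c := κ V h x) (c' := κ V h y) fun i => by
    rw [← h2 hDV h, ← h2 hDV h, hxy]
  refine ⟨N, fun m hm => (h1 V h).injective (funext fun i => ?_)⟩
  rw [h3, h3, hN m hm]

theorem HasCoords.mono {B B' : X.Opens} (hB : G.HasCoords B) (h : B' ≤ B) : G.HasCoords B' := by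
  obtain ⟨ι, hι, κ, h1, h2, h3⟩ := hB
  exact ⟨ι, hι, fun W k => κ W (k.trans h), fun W k => h1 W _, fun h' k => h2 h' _,
    fun k => h3 _⟩

theorem basicOpen_rmap {U V : X.Opens} (h : V ≤ U) (f : Γ(X, U)) :
    X.basicOpen (rmap h f) = V ⊓ X.basicOpen f := X.basicOpen_res f (homOfLE h).op

variable (G) in
/-- Over an affine open, sections over a basic open extend after multiplication by a power. -/
theorem exists_lift {U : X.Opens} (hU : IsAffineOpen U) (f : Γ(X, U)) {D : X.Opens}
    (hD : D = X.basicOpen f) (hDU : D ≤ U) (v : G.sec D) : ∃ N : ℕ, ∀ m, N ≤ m → ∃ x : G.sec U,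
      G.res hDU x = G.smul (rmap hDU f ^ m) v := by
  have cov : ∀ t : U, ∃ g : Γ(X, U), t.1 ∈ X.basicOpen g ∧ G.HasCoords (X.basicOpen g) := by
    intro t
    obtain ⟨B, htB, hB⟩ := G.coords t
    obtain ⟨g, hg, htg⟩ := hU.exists_basicOpen_le (V := B) ⟨t.1, htB⟩ t.2
    exact ⟨g, htg, HasCoords.mono hB hg⟩
  choose g htg hg using cov
  obtain ⟨T, hT⟩ := hU.isCompact.elim_finite_subcover (fun t : U => (X.basicOpen (g t) : Set X))
    (fun t => (X.basicOpen (g t)).2) fun t ht => Set.mem_iUnion.mpr ⟨⟨t, ht⟩, htg ⟨t, ht⟩⟩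
  let V : T → X.Opens := fun i => X.basicOpen (g i)
  have hVU : ∀ i, V i ≤ U := fun i => X.basicOpen_le _
  have hUV : U ≤ iSup V := by
    intro t ht
    obtain ⟨i, hi⟩ := Set.mem_iUnion.mp (hT ht)
    obtain ⟨hiT, hi⟩ := Set.mem_iUnion.mp hi
    exact TopologicalSpace.Opens.mem_iSup.mpr ⟨⟨i, hiT⟩, hi⟩
  have hDi : ∀ i, V i ⊓ D = X.basicOpen (rmap (hVU i) f) := fun i => by
    rw [basicOpen_rmap, hD]
  have l1 : ∀ i : T, ∃ N : ℕ, ∀ m, N ≤ m → ∃ x : G.sec (V i),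
      G.res (inf_le_left : V i ⊓ D ≤ V i) x =
        G.smul (rmap inf_le_left (rmap (hVU i) f) ^ m) (G.res inf_le_right v) := fun i =>
    (hg i).exists_lift le_rfl (hU.basicOpen _) _ (hDi i) inf_le_left _
  choose N hN using l1
  let N₀ := Finset.univ.sup N
  choose w hw using fun i => hN i N₀ (Finset.le_sup (Finset.mem_univ i))
  have hVV : ∀ i j : T, IsAffineOpen (V i ⊓ V j) := fun i j => by
    have := hU.basicOpen (g i * g j)
    rwa [X.basicOpen_mul] at this
  -- The local extensions `w i` are known to agree only over `V i ⊓ V j ⊓ D`; a further power of `f`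
  -- makes them agree on `V i ⊓ V j`, so that they glue.
  have l2 : ∀ i j : T, ∃ M : ℕ, ∀ m, M ≤ m →
      G.smul (rmap (inf_le_left.trans (hVU i) : V i ⊓ V j ≤ U) f ^ m) (G.res inf_le_left (w i)) =
      G.smul (rmap (inf_le_left.trans (hVU i) : V i ⊓ V j ≤ U) f ^ m)
        (G.res inf_le_right (w j)) := by
    intro i j
    refine (hg i).exists_smul_eq inf_le_left (hVV i j) _ (D := V i ⊓ V j ⊓ D) ?_ inf_le_left ?_
    · rw [basicOpen_rmap, hD]
    · have hi := congrArg (G.res (le_inf (inf_le_left.trans inf_le_left) inf_le_right :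
        V i ⊓ V j ⊓ D ≤ V i ⊓ D)) (hw i)
      have hj := congrArg (G.res (le_inf (inf_le_left.trans inf_le_right) inf_le_right :
        V i ⊓ V j ⊓ D ≤ V j ⊓ D)) (hw j)
      simp only [G.res_res, G.res_smul, map_pow, rmap_rmap] at hi hj ⊢
      rw [hi, hj]
  choose M hM using l2
  let M₀ := Finset.univ.sup fun ij : T × T => M ij.1 ij.2
  refine ⟨N₀ + M₀, fun m hm => ?_⟩
  obtain ⟨x, hx⟩ := G.glue V U hVU hUV (fun i => G.smul (rmap (hVU i) f ^ (m - N₀)) (w i)) (by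
    intro i j
    have := hM i j (m - N₀) (le_trans (Finset.le_sup (f := fun ij : T × T => M ij.1 ij.2)
      (Finset.mem_univ (i, j))) (by omega))
    simpa only [G.res_smul, map_pow, rmap_rmap] using this)
  refine ⟨x, G.ext fun t ht => ?_⟩
  obtain ⟨i, hi⟩ := TopologicalSpace.Opens.mem_iSup.mp (hUV (hDU ht))
  refine ⟨V i ⊓ D, inf_le_right, ⟨hi, ht⟩, ?_⟩
  have h1 := congrArg (G.res (inf_le_left : V i ⊓ D ≤ V i)) (hx i)
  simp only [G.res_res, G.res_smul, map_pow, rmap_rmap, hw, G.smul_smul, ← pow_add] at h1 ⊢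
  rw [h1]
  congr 2
  omega

end CoordSheaf

end

/-! ### Quasi-coherence of the degeneracy ideal -/

section

variable {X : Scheme.{u}} {M : X.Modules}

/-- Near every point there is a frame such that a subbundle is spanned by its first members. -/
theorem Subsheaf.IsSubbundle.exists_adapted {A : Subsheaf M} {d : ℕ} (hA : A.IsSubbundle d)
    (t : X) : ∃ (U : X.Opens) (m : ℕ) (e : Fin m → Γ(M, U)), t ∈ U ∧ IsFrame M U e ∧
      ∀ (W : X.Opens) (h : W ≤ U) (c : Fin m → Γ(X, W)),
        lin e h c ∈ A.sec W ↔ ∀ i, d ≤ i.1 → c i = 0 := by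
  obtain ⟨U, ht, m, e, he, hs⟩ := hA t
  refine ⟨U, d + m, e ∘ finSumFinEquiv.symm, ht, he.reindex _, fun W h c => ?_⟩
  rw [hs W h]
  exact span_eq_of_frame he h c

/-- The sheaf of sections of a subbundle. -/
def Subsheaf.coordSheaf {A : Subsheaf M} {d : ℕ} (hA : A.IsSubbundle d) : CoordSheaf X where
  sec U := A.sec U
  res h x := ⟨RelGrass.res M h x.1, A.res_mem h x.2⟩
  res_res h h' x := Subtype.ext (RelGrass.res_res M h h' x.1)
  smul r x := r • x
  res_smul h r x := Subtype.ext (res_smul' h r x.1)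
  smul_smul r s x := by rw [_root_.smul_smul]
  ext {U x y} H := Subtype.ext <| sec_ext fun t ht => by
    obtain ⟨W, h, htW, hW⟩ := H t ht
    exact ⟨W, h, htW, congrArg Subtype.val hW⟩
  glue V U hV hU s hs := by
    obtain ⟨x, hx⟩ := sec_glue V U hV hU (fun i => (s i).1)
      fun i j => congrArg Subtype.val (hs i j)
    refine ⟨⟨x, A.of_local x fun t ht => ?_⟩, fun i => Subtype.ext (hx i)⟩
    obtain ⟨i, hi⟩ := TopologicalSpace.Opens.mem_iSup.mp (hU ht)
    refine ⟨V i, hV i, hi, ?_⟩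
    rw [hx]
    exact (s i).2
  coords t := by
    obtain ⟨B, m, e, ht, he, hs⟩ := hA.exists_adapted t
    refine ⟨B, ht, {i : Fin m // ¬ d ≤ i.1}, inferInstance, fun W h x i => he.coord h x.1 i.1,
      fun W h => ⟨fun x y hxy => Subtype.ext ((he.coord h).injective (funext fun i => ?_)),
        fun c => ?_⟩, fun h' h x i => ?_, fun h r x i => ?_⟩
    · have hz : ∀ x : A.sec W, ∀ i, d ≤ i.1 → he.coord h x.1 i = 0 := fun x => by
        rw [← hs W h, he.lin_coord]
        exact x.2
      by_cases hi : d ≤ i.1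
      · rw [hz x i hi, hz y i hi]
      · exact congrFun hxy ⟨i, hi⟩
    · refine ⟨⟨lin e h fun i => if hi : d ≤ i.1 then 0 else c ⟨i, hi⟩,
        (hs W h _).mpr fun i hi => dif_pos hi⟩, funext fun i => ?_⟩
      exact (congrFun (he.coord_lin h _) i.1).trans (dif_neg i.2)
    · exact congrFun (he.coord_res h' h x.1) i.1
    · exact congrFun (map_smul (he.coord h) r x.1) i.1

/-- Functionals on `M` over `U` that vanish on `P`, compatible with restriction. -/
@[ext]
structure Subsheaf.Functional (P : Subsheaf M) (U : X.Opens) where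
  /-- the values -/
  app : ∀ W : X.Opens, W ≤ U → Γ(M, W) →ₗ[Γ(X, W)] Γ(X, W)
  app_res : ∀ {V W : X.Opens} (h' : V ≤ W) (h : W ≤ U) (x : Γ(M, W)),
    app V (h'.trans h) (RelGrass.res M h' x) = rmap h' (app W h x)
  vanish : ∀ (W : X.Opens) (h : W ≤ U) (x : Γ(M, W)), x ∈ P.sec W → app W h x = 0

theorem fun_ext_of_cover {κ : Type*} {V : κ → X.Opens} {U W : X.Opens} (hU : U ≤ iSup V)
    (hW : W ≤ U) {y y' : Γ(X, W)}
    (h : ∀ i, rmap (inf_le_left : W ⊓ V i ≤ W) y = rmap inf_le_left y') : y = y' := by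
  refine fun_ext fun t ht => ?_
  obtain ⟨i, hi⟩ := TopologicalSpace.Opens.mem_iSup.mp (hU (hW ht))
  exact ⟨_, inf_le_left, ⟨ht, hi⟩, h i⟩

theorem Subsheaf.Functional.glue {P : Subsheaf M} {κ : Type*} (V : κ → X.Opens) (U : X.Opens)
    (hU : U ≤ iSup V) (s : ∀ i, P.Functional (V i))
    (hs : ∀ i j (W : X.Opens) (hi : W ≤ V i) (hj : W ≤ V j), (s i).app W hi = (s j).app W hj) :
    ∃ φ : P.Functional U, ∀ i W (h : W ≤ U) (hi : W ≤ V i), φ.app W h = (s i).app W hi := by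
  have key : ∀ (W : X.Opens) (_ : W ≤ U) (x : Γ(M, W)), ∃ y : Γ(X, W), ∀ i,
      rmap (inf_le_left : W ⊓ V i ≤ W) y = (s i).app _ inf_le_right (RelGrass.res M inf_le_left x) := by
    intro W hW x
    refine fun_glue (fun i => W ⊓ V i) W (fun i => inf_le_left) (fun t ht => ?_) _ fun i j => ?_
    · obtain ⟨i, hi⟩ := TopologicalSpace.Opens.mem_iSup.mp (hU (hW ht))
      exact TopologicalSpace.Opens.mem_iSup.mpr ⟨i, ht, hi⟩
    · rw [← (s i).app_res, ← (s j).app_res, RelGrass.res_res, RelGrass.res_res, hs i j]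
  choose f hf using key
  let φ : P.Functional U :=
    { app := fun W h =>
        { toFun := f W h
          map_add' := fun x y => fun_ext_of_cover hU h fun i => by
            rw [map_add, hf, hf, hf, res_add, map_add]
          map_smul' := fun r x => fun_ext_of_cover hU h fun i => by
            rw [RingHom.id_apply, smul_eq_mul, map_mul, hf, hf, res_smul', map_smul, smul_eq_mul] }
      app_res := fun {V' W} h' h x => fun_ext_of_cover hU (h'.trans h) fun i => by
        change rmap _ (f _ _ _) = rmap _ (rmap _ (f _ _ _))
        have h1 := congrArg (rmap (inf_le_inf_right _ h' : V' ⊓ V i ≤ W ⊓ V i)) (hf W h x i)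
        rw [rmap_rmap, ← (s i).app_res, RelGrass.res_res] at h1
        rw [hf, rmap_rmap, h1, RelGrass.res_res]
      vanish := fun W h x hx => fun_ext_of_cover hU h fun i => by
        change rmap _ (f _ _ _) = _
        rw [hf, map_zero, (s i).vanish _ _ _ (P.res_mem _ hx)] }
  refine ⟨φ, fun i W h hi => LinearMap.ext fun x => ?_⟩
  change f W h x = _
  have h1 := hf W h x i
  rw [(s i).app_res _ hi] at h1
  refine fun_ext fun t ht => ⟨_, inf_le_left, ⟨ht, hi ht⟩, h1⟩

/-- The sheaf of functionals vanishing on a subbundle. -/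
def Subsheaf.functionalSheaf {P : Subsheaf M} {d : ℕ} (hP : P.IsSubbundle d) : CoordSheaf X where
  sec U := P.Functional U
  res h φ := ⟨fun W k => φ.app W (k.trans h), fun h' k => φ.app_res h' _,
    fun W k => φ.vanish W _⟩
  res_res _ _ _ := rfl
  smul r φ := ⟨fun W k => rmap k r • φ.app W k, fun h' k x => by
      rw [LinearMap.smul_apply, LinearMap.smul_apply, φ.app_res h' k, smul_eq_mul, smul_eq_mul,
        map_mul, rmap_rmap],
    fun W k x hx => by rw [LinearMap.smul_apply, φ.vanish W k x hx, smul_zero]⟩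
  res_smul h r φ := by
    ext W k x
    change rmap (k.trans h) r • φ.app W (k.trans h) x = rmap k (rmap h r) • φ.app W (k.trans h) x
    rw [rmap_rmap]
  smul_smul r s φ := by
    ext W k x
    change rmap k r • rmap k s • φ.app W k x = rmap k (r * s) • φ.app W k x
    rw [map_mul, mul_smul]
  ext {U φ ψ} H := by
    ext W k x
    refine fun_ext fun t ht => ?_
    obtain ⟨W', h, htW, hW⟩ := H t (k ht)
    refine ⟨W ⊓ W', inf_le_left, ⟨ht, htW⟩, ?_⟩
    rw [← φ.app_res, ← ψ.app_res]
    exact congrArg (fun χ : P.Functional W' => χ.app (W ⊓ W') inf_le_right _) hW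
  glue V U hV hU s hs := by
    obtain ⟨φ, hφ⟩ := Functional.glue V U hU s fun i j W hi hj => by
      exact congrArg (fun χ : P.Functional _ => χ.app W (le_inf hi hj)) (hs i j)
    refine ⟨φ, fun i => ?_⟩
    ext W k x
    exact congrArg (fun l => l x) (hφ i W (k.trans (hV i)) k)
  coords t := by
    obtain ⟨B, m, e, ht, he, hs⟩ := hP.exists_adapted t
    -- A functional vanishing on `P` kills the first `d` members of an adapted frame; its values on
    -- the remaining ones are its coordinates.
    have hval : ∀ {U : X.Opens} (φ : P.Functional U) (W : X.Opens) (k : W ≤ U) (hW : W ≤ B)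
        (c : Fin m → Γ(X, W)), φ.app W k (lin e hW c) =
          ∑ i : {i : Fin m // d ≤ i.1}, c i * φ.app W k (RelGrass.res M hW (e i)) := by
      intro U φ W k hW c
      rw [lin_apply, map_sum]
      simp only [map_smul, smul_eq_mul]
      rw [← Fintype.sum_subtype_add_sum_subtype (fun i : Fin m => d ≤ i.1), add_eq_left]
      refine Finset.sum_eq_zero fun i _ => ?_
      rw [φ.vanish, mul_zero]
      rw [← lin_single e hW i.1, hs]
      intro j hj
      rw [Pi.single_eq_of_ne]
      rintro rfl
      exact i.2 hj
    refine ⟨B, ht, {i : Fin m // d ≤ i.1}, inferInstance,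
      fun W h φ i => φ.app W le_rfl (RelGrass.res M h (e i.1)),
      fun W h => ⟨fun φ ψ hφψ => ?_, fun c => ?_⟩, fun h' h φ i => ?_, fun {W} h r φ i => ?_⟩
    · ext V k x
      rw [← he.lin_coord (k.trans h) x, hval, hval]
      refine Finset.sum_congr rfl fun i _ => ?_
      have := congrArg (rmap k) (congrFun hφψ i)
      simp only [← Functional.app_res, RelGrass.res_res] at this
      rw [this]
    · refine ⟨⟨fun V k => (∑ i : {i : Fin m // d ≤ i.1}, rmap k (c i) • LinearMap.proj i.1) ∘ₗ
        (he.coord (k.trans h)).toLinearMap, fun {V' V} h' k x => ?_, fun V k x hx => ?_⟩,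
        funext fun i => ?_⟩
      · simp only [LinearMap.comp_apply, LinearMap.sum_apply, LinearMap.smul_apply,
          LinearMap.proj_apply, LinearEquiv.coe_coe, smul_eq_mul]
        rw [map_sum]
        refine Finset.sum_congr rfl fun i _ => ?_
        rw [he.coord_res h' (k.trans h) x, map_mul, rmap_rmap]
        rfl
      · simp only [LinearMap.comp_apply, LinearMap.sum_apply, LinearMap.smul_apply,
          LinearMap.proj_apply, LinearEquiv.coe_coe, smul_eq_mul]
        rw [← he.lin_coord (k.trans h) x, hs] at hx
        exact Finset.sum_eq_zero fun i _ => by rw [hx i.1 i.2, mul_zero]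
      · simp only [LinearMap.comp_apply, LinearMap.sum_apply, LinearMap.smul_apply,
          LinearMap.proj_apply, LinearEquiv.coe_coe, smul_eq_mul]
        rw [← lin_single e h i.1, he.coord_lin, Finset.sum_eq_single i, Pi.single_eq_same,
          mul_one, rmap_self]
        · rfl
        · intro j _ hj
          rw [Pi.single_eq_of_ne, mul_zero]
          exact fun h => hj (Subtype.ext h)
        · exact fun h => absurd (Finset.mem_univ _) h
    · rw [← φ.app_res, RelGrass.res_res]
    · change rmap (le_refl W) r • φ.app W le_rfl (RelGrass.res M h (e i.1)) = _
      rw [rmap_self]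
      rfl

/-- The ideal generated by the determinants of functionals on sections. -/
def functionalIdeal (A P : Subsheaf M) (d : ℕ) (U : X.Opens) : Ideal Γ(X, U) :=
  Ideal.span {x | ∃ (v : Fin (d + 1) → Γ(M, U)) (φ : Fin (d + 1) → P.Functional U),
    (∀ i, v i ∈ A.sec U) ∧ x = (Matrix.of fun i j => (φ i).app U le_rfl (v j)).det}

theorem functionalIdeal_map_le (A P : Subsheaf M) (d : ℕ) {U V : X.Opens} (h : V ≤ U) :
    (functionalIdeal A P d U).map (rmap h) ≤ functionalIdeal A P d V := by
  rw [functionalIdeal, Ideal.map_span, Ideal.span_le]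
  rintro _ ⟨_, ⟨v, φ, hv, rfl⟩, rfl⟩
  refine Ideal.subset_span ⟨fun i => res M h (v i), fun i =>
    ⟨fun W k => (φ i).app W (k.trans h), fun h' k => (φ i).app_res h' _,
      fun W k => (φ i).vanish W _⟩, fun i => A.res_mem h (hv i), ?_⟩
  rw [RingHom.map_det]
  congr 1
  ext i j
  exact ((φ i).app_res h le_rfl (v j)).symm

/-- Vectors and functionals over the basic open extend to `U` after multiplication by a power of
`f`. This multiplies the determinant by a power of `f`, which is a unit on the basic open. -/
theorem functionalIdeal_le_map {A P : Subsheaf M} {a b : ℕ} (hA : A.IsSubbundle a)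
    (hP : P.IsSubbundle b) (d : ℕ) {U : X.Opens} (hU : IsAffineOpen U) (f : Γ(X, U))
    (h : X.basicOpen f ≤ U) :
    functionalIdeal A P d (X.basicOpen f) ≤ (functionalIdeal A P d U).map (rmap h) := by
  refine Ideal.span_le.mpr ?_
  rintro _ ⟨v, φ, hv, rfl⟩
  choose N hN using fun j => (Subsheaf.coordSheaf hA).exists_lift hU f rfl h ⟨v j, hv j⟩
  choose N' hN' using fun i => (Subsheaf.functionalSheaf hP).exists_lift hU f rfl h (φ i)
  let m := Finset.univ.sup N ⊔ Finset.univ.sup N'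
  have hx : ∀ j, ∃ x ∈ A.sec U, res M h x = rmap h f ^ m • v j := fun j => by
    obtain ⟨x, hx⟩ := hN j m ((Finset.le_sup (Finset.mem_univ j)).trans le_sup_left)
    exact ⟨_, Subtype.property (p := fun z => z ∈ A.sec U) x, congrArg Subtype.val hx⟩
  choose x hxA hx using hx
  have hψ : ∀ i, ∃ ψ : P.Functional U, ∀ y, ψ.app _ h y = rmap h f ^ m • (φ i).app _ le_rfl y :=
    fun i => by
      obtain ⟨ψ, hψ⟩ := hN' i m ((Finset.le_sup (Finset.mem_univ i)).trans le_sup_right)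
      refine ⟨ψ, fun y => ?_⟩
      have h4 := congrArg (fun χ : P.Functional (X.basicOpen f) => χ.app _ le_rfl y) hψ
      refine h4.trans ?_
      change rmap le_rfl (rmap h f ^ m) • (φ i).app _ le_rfl y = _
      rw [rmap_self]
      rfl
  choose ψ hψ using hψ
  have hu : IsUnit (rmap h f) := by
    have := hU.isLocalization_basicOpen f
    exact IsLocalization.Away.algebraMap_isUnit (S := Γ(X, X.basicOpen f)) f
  have hmem : (Matrix.of fun i j => (ψ i).app U le_rfl (x j)).det ∈ functionalIdeal A P d U :=
    Ideal.subset_span ⟨x, ψ, hxA, rfl⟩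
  have h1 := Ideal.mem_map_of_mem (rmap h) hmem
  -- Each entry acquires one factor `f ^ m` from the functional and one from the vector, and there
  -- are `d + 1` rows.
  have h2 : rmap h (Matrix.of fun i j => (ψ i).app U le_rfl (x j)).det =
      (rmap h f ^ m * rmap h f ^ m) ^ (d + 1) *
        (Matrix.of fun i j => (φ i).app _ le_rfl (v j)).det := by
    have hd := Matrix.det_smul (Matrix.of fun i j => (φ i).app _ le_rfl (v j))
      (rmap h f ^ m * rmap h f ^ m)
    rw [Fintype.card_fin] at hd
    rw [← hd, RingHom.map_det]
    congr 1
    ext i j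
    change rmap h ((ψ i).app U le_rfl (x j)) =
      (rmap h f ^ m * rmap h f ^ m) • (φ i).app _ le_rfl (v j)
    rw [← Subsheaf.Functional.app_res _ h, hx, hψ, map_smul, smul_smul]
  rw [h2] at h1
  exact ((Ideal.unit_mul_mem_iff_mem _ ((hu.pow m).mul (hu.pow m) |>.pow _)).mp h1)

/-- The ideal sheaf generated by the determinants of functionals on sections. -/
def functionalIdealSheaf {A P : Subsheaf M} {a b : ℕ} (hA : A.IsSubbundle a)
    (hP : P.IsSubbundle b) (d : ℕ) : X.IdealSheafData where
  ideal U := functionalIdeal A P d U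
  map_ideal_basicOpen U f := le_antisymm (functionalIdeal_map_le A P d (X.basicOpen_le f))
    (functionalIdeal_le_map hA hP d U.2 f (X.basicOpen_le f))

/-- `degeneracyIdeal` is the largest ideal sheaf contained in a family of ideals. The functionals in
that family are linear maps over a single open; those compatible with restriction already generate
an ideal sheaf, which is therefore a lower bound. -/
theorem functionalIdealSheaf_le {A P : Subsheaf M} {a b : ℕ} (hA : A.IsSubbundle a)
    (hP : P.IsSubbundle b) (d : ℕ) : functionalIdealSheaf hA hP d ≤ degeneracyIdeal A P d := by
  refine Scheme.IdealSheafData.le_ofIdeals_iff.mpr fun U => Ideal.span_mono ?_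
  rintro _ ⟨v, φ, hv, rfl⟩
  exact ⟨v, fun i => (φ i).app U.1 le_rfl, hv, fun i y hy => (φ i).vanish _ _ y hy, rfl⟩

open Matrix in
/-- The degeneracy ideal is generated by minors wherever the subbundles are given by matrices. -/
theorem degeneracyIdeal_ideal {A P : Subsheaf M} {a b : ℕ} (hA : A.IsSubbundle a)
    (hP : P.IsSubbundle b) (d : ℕ) (U : X.affineOpens) {n : ℕ} {e : Fin n → Γ(M, U.1)}
    (he : IsFrame M U.1 e) {y y' : GLn n Γ(X, U.1)} (hy : A.Cut e a y) (hy' : P.Cut e b y') :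
    (degeneracyIdeal A P d).ideal U = minorIdeal (y' * y⁻¹).1 b a d := by
  have hid : ∀ z : GLn n Γ(X, U.1), gmap (rmap (le_refl U.1)) z = z := fun z => by
    rw [rmap_self]
    exact gmap_id z
  refine le_antisymm ?_ ?_
  · refine (Scheme.IdealSheafData.ideal_ofIdeals_le _ U).trans (Ideal.span_le.mpr ?_)
    rintro _ ⟨v, φ, hv, hφ, rfl⟩
    have h1 := det_functional_mem_minorIdeal (y := y) (y' := y') (a := a) (b := b)
      (v := fun j => he.coord le_rfl (v j)) (φ := fun i => φ i ∘ₗ lin e le_rfl)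
      (fun j => by
        have := hy le_rfl (he.coord le_rfl (v j))
        rw [he.lin_coord, hid] at this
        exact this.mp (hv j))
      (fun i c hc => by
        have := hy' le_rfl c
        rw [hid] at this
        exact hφ i _ (this.mpr hc))
    simp only [LinearMap.comp_apply, he.lin_coord] at h1
    exact h1
  -- Lower bound: a minor is the determinant of row functionals of `y'` on columns of `y⁻¹`, and
  -- these functionals are compatible with restriction.
  · refine le_trans ?_ (functionalIdealSheaf_le hA hP d U)
    rw [minorIdeal_le_iff]
    intro ρ κ hρ hκ
    rw [det_submatrix_eq_functional]
    refine Ideal.subset_span ⟨fun j => lin e le_rfl ((y⁻¹ : GLn n _).1 *ᵥ Pi.single (κ j) 1),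
      fun i => ⟨fun W k => LinearMap.proj (ρ i) ∘ₗ (gmap (rmap k) y').1.mulVecLin ∘ₗ
        (he.coord k).toLinearMap, fun {V W} h' k x => ?_, fun W k x hx => ?_⟩, fun j => ?_, ?_⟩
    · simp only [LinearMap.comp_apply, LinearMap.proj_apply, LinearEquiv.coe_coe, mulVecLin_apply]
      rw [he.coord_res h' k x, ← rmap_comp h' k, ← gmap_gmap, gmap_mulVec]
      rfl
    · simp only [LinearMap.comp_apply, LinearMap.proj_apply, LinearEquiv.coe_coe, mulVecLin_apply]
      rw [← he.lin_coord k x, hy' k] at hx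
      exact hx _ (hρ i)
    · rw [hy, hid]
      exact inv_single_mem_cutMod y _ (hκ j)
    · congr 1
      ext i j
      simp only [of_apply, LinearMap.comp_apply, LinearMap.proj_apply, LinearEquiv.coe_coe,
        mulVecLin_apply]
      rw [he.coord_lin, hid]

end

/-! ### Morphisms into degeneracy loci -/

section

theorem exists_lift_iff_le_ker {T Y : Scheme.{u}} (I : Y.IdealSheafData) (g : T ⟶ Y) :
    (∃ l, l ≫ I.subschemeι = g) ↔ I ≤ g.ker := by
  constructor
  · rintro ⟨l, rfl⟩
    have := Scheme.Hom.le_ker_comp l I.subschemeι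
    rwa [Scheme.IdealSheafData.ker_subschemeι] at this
  · intro h
    refine ⟨IsClosedImmersion.lift I.subschemeι g ?_, IsClosedImmersion.lift_fac _ _ _⟩
    rwa [Scheme.IdealSheafData.ker_subschemeι]

theorem le_ker_of_local {T Y : Scheme.{u}} (I : Y.IdealSheafData) (g : T ⟶ Y)
    (h : ∀ t : T, ∃ W : Y.affineOpens, g t ∈ W.1 ∧ I.ideal W ≤ RingHom.ker (g.app W.1).hom) :
    I ≤ g.ker := by
  refine Scheme.IdealSheafData.le_ofIdeals_iff.mpr fun U x hx => ?_
  rw [RingHom.mem_ker]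
  refine fun_ext fun t ht => ?_
  obtain ⟨W, htW, hW⟩ := h t
  obtain ⟨V, hV, htV, hVW⟩ := exists_isAffineOpen_mem_and_subset (x := g t) (U := U.1 ⊓ W.1)
    ⟨ht, htW⟩
  have hVU : V ≤ U.1 := hVW.trans inf_le_left
  have hVW : V ≤ W.1 := hVW.trans inf_le_right
  refine ⟨g ⁻¹ᵁ V, preimage_le g hVU, htV, ?_⟩
  rw [map_zero, ← app_rmap g hVU]
  have h1 : rmap hVU x ∈ I.ideal ⟨V, hV⟩ := I.ideal_le_comap_ideal (U := ⟨V, hV⟩) hVU hx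
  have h2 : (I.ideal W).map (rmap hVW) = I.ideal ⟨V, hV⟩ := I.map_ideal (U := ⟨V, hV⟩) hVW
  have h3 : I.ideal ⟨V, hV⟩ ≤ RingHom.ker (g.app V).hom := by
    rw [← h2, Ideal.map_le_iff_le_comap]
    intro z hz
    rw [Ideal.mem_comap, RingHom.mem_ker, app_rmap g hVW (preimage_le g hVW), (hW hz : _ = _),
      map_zero]
  exact h3 h1

theorem eq_bot_of_local {T : Scheme.{u}} (I : T.IdealSheafData)
    (h : ∀ t : T, ∃ W : T.affineOpens, t ∈ W.1 ∧ I.ideal W = ⊥) : I = ⊥ := by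
  rw [eq_bot_iff]
  have := le_ker_of_local I (𝟙 T) fun t => by
    obtain ⟨W, htW, hW⟩ := h t
    exact ⟨W, htW, hW ▸ bot_le⟩
  rwa [Scheme.Hom.ker_eq_bot_of_isIso] at this

variable {T Y S : Scheme.{u}} {H : S.Modules} {n : ℕ} {g : T ⟶ Y} {π : Y ⟶ S} {f : T ⟶ S}

/-- Two subbundles of `f^* H` are simultaneously given by matrices near every point. -/
theorem exists_cutAt_pair {A P : Subsheaf ((Scheme.Modules.pullback f).obj H)} {a b : ℕ}
    (hA : A.IsSubbundle a) (hP : P.IsSubbundle b) {U : S.Opens} {h : Fin n → Γ(H, U)}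
    (hh : IsFrame H U h) {t : T} {W : T.Opens} (k : W ≤ f ⁻¹ᵁ U) (ht : t ∈ W) :
    ∃ (V : T.affineOpens) (k' : V.1 ≤ W) (y z : GLn n Γ(T, V.1)), t ∈ V.1 ∧
      A.CutAt h (k'.trans k) a y ∧ P.CutAt h (k'.trans k) b z := by
  obtain ⟨-, V₁, k₁, y, ht₁, hy⟩ := hA.exists_cutAt hh k ht
  obtain ⟨-, V₂, k₂, z, ht₂, hz⟩ := hP.exists_cutAt hh k ht
  obtain ⟨V, hV, htV, hVW⟩ := exists_isAffineOpen_mem_and_subset (x := t) (U := V₁ ⊓ V₂) ⟨ht₁, ht₂⟩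
  have h₁ : V ≤ V₁ := hVW.trans inf_le_left
  have h₂ : V ≤ V₂ := hVW.trans inf_le_right
  exact ⟨⟨V, hV⟩, h₁.trans k₁, _, _, htV, hy.res h₁, hz.res h₂⟩

theorem degeneracyIdeal_eq_bot_of_local {A P : Subsheaf ((Scheme.Modules.pullback f).obj H)}
    {a b : ℕ} (hA : A.IsSubbundle a) (hP : P.IsSubbundle b) {d : ℕ}
    (h : ∀ t : T, ∃ (U : S.Opens) (h : Fin n → Γ(H, U)) (_ : IsFrame H U h) (W : T.Opens)
      (k : W ≤ f ⁻¹ᵁ U) (y z : GLn n Γ(T, W)), t ∈ W ∧ A.CutAt h k a y ∧ P.CutAt h k b z ∧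
      minorIdeal (z * y⁻¹).1 b a d = ⊥) : degeneracyIdeal A P d = ⊥ := by
  refine eq_bot_of_local _ fun t => ?_
  obtain ⟨U, h, hh, W, k, y, z, htW, hy, hz, h0⟩ := h t
  obtain ⟨V, hV, htV, hVW⟩ := exists_isAffineOpen_mem_and_subset (x := t) htW
  have hVW : V ≤ W := hVW
  refine ⟨⟨V, hV⟩, htV, ?_⟩
  rw [degeneracyIdeal_ideal hA hP d ⟨V, hV⟩ (isFrame_fr f hh (hVW.trans k)) (hy.res hVW)
    (hz.res hVW), gmap_mul_inv, gmap_coe, ← minorIdeal_map, h0, Ideal.map_bot]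

theorem minorIdeal_eq_bot {A P : Subsheaf ((Scheme.Modules.pullback f).obj H)}
    {a b : ℕ} (hA : A.IsSubbundle a) (hP : P.IsSubbundle b) {d : ℕ}
    (h0 : degeneracyIdeal A P d = ⊥) {U : S.Opens} {h : Fin n → Γ(H, U)} (hh : IsFrame H U h)
    {W : T.Opens} {k : W ≤ f ⁻¹ᵁ U} {y z : GLn n Γ(T, W)} (hy : A.CutAt h k a y)
    (hz : P.CutAt h k b z) : minorIdeal (z * y⁻¹).1 b a d = ⊥ := by
  rw [eq_bot_iff]
  intro x hx
  refine (Ideal.mem_bot).mpr (fun_ext fun t ht => ?_)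
  obtain ⟨V, hV, htV, hVW⟩ := exists_isAffineOpen_mem_and_subset (x := t) ht
  have hVW : V ≤ W := hVW
  refine ⟨V, hVW, htV, ?_⟩
  have h1 := degeneracyIdeal_ideal hA hP d ⟨V, hV⟩ (isFrame_fr f hh (hVW.trans k)) (hy.res hVW)
    (hz.res hVW)
  rw [h0, gmap_mul_inv, gmap_coe, ← minorIdeal_map] at h1
  have h2 := Ideal.mem_map_of_mem (rmap hVW) hx
  rw [map_zero]
  exact (Ideal.mem_bot).mp (h1.symm.le h2)

variable (w : g ≫ π = f)

/-- A morphism factors through a degeneracy locus if and only if the pullback degenerates. -/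
theorem degeneracyIdeal_le_ker_iff (hH : IsVectorBundle H n)
    {A P : Subsheaf ((Scheme.Modules.pullback π).obj H)} {a b : ℕ} (hA : A.IsSubbundle a)
    (hP : P.IsSubbundle b) (d : ℕ) : degeneracyIdeal A P d ≤ g.ker ↔
      degeneracyIdeal (A.pullbackOver w) (P.pullbackOver w) d = ⊥ := by
  have key : ∀ t : T, ∃ (U : S.Opens) (h : Fin n → Γ(H, U)) (_ : IsFrame H U h)
      (V : Y.affineOpens) (k : V.1 ≤ π ⁻¹ᵁ U) (y z : GLn n Γ(Y, V.1)), g t ∈ V.1 ∧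
      A.CutAt h k a y ∧ P.CutAt h k b z := by
    intro t
    obtain ⟨U, hU, h, hh⟩ := hH (π (g t))
    obtain ⟨V, k, y, z, ht, hy, hz⟩ := exists_cutAt_pair (f := π) hA hP hh (t := g t) le_rfl hU
    exact ⟨U, h, hh, V, k, y, z, ht, hy, hz⟩
  have hm : ∀ (V : Y.affineOpens) (y z : GLn n Γ(Y, V.1)),
      minorIdeal (gmap (g.app V.1).hom z * (gmap (g.app V.1).hom y)⁻¹).1 b a d =
        (minorIdeal (z * y⁻¹).1 b a d).map (g.app V.1).hom := fun V y z => by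
    rw [gmap_mul_inv, gmap_coe, ← minorIdeal_map]
  constructor
  · intro hk
    refine degeneracyIdeal_eq_bot_of_local (n := n) (hA.pullbackOver w hH) (hP.pullbackOver w hH)
      fun t => ?_
    obtain ⟨U, h, hh, V, k, y, z, ht, hy, hz⟩ := key t
    refine ⟨U, h, hh, _, _, _, _, ht, hy.pullbackOver w hh, hz.pullbackOver w hh, ?_⟩
    have h1 : (degeneracyIdeal A P d).ideal V ≤ RingHom.ker (g.app V.1).hom :=
      (hk V).trans (Scheme.Hom.ideal_ker_le g V)
    rw [degeneracyIdeal_ideal hA hP d V (isFrame_fr π hh k) hy hz] at h1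
    rw [hm, eq_bot_iff, Ideal.map_le_iff_le_comap]
    exact h1
  · intro h0
    refine le_ker_of_local _ _ fun t => ?_
    obtain ⟨U, h, hh, V, k, y, z, ht, hy, hz⟩ := key t
    refine ⟨V, ht, ?_⟩
    have h1 := minorIdeal_eq_bot (hA.pullbackOver w hH) (hP.pullbackOver w hH) h0 hh
      (hy.pullbackOver w hh) (hz.pullbackOver w hh)
    rw [degeneracyIdeal_ideal hA hP d V (isFrame_fr π hh k) hy hz]
    rw [hm, eq_bot_iff, Ideal.map_le_iff_le_comap] at h1
    exact h1

/-- The locus where `A ⟶ M / P` vanishes is the locus where `A ≤ P`. -/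
theorem degeneracyIdeal_zero_eq_bot_iff (hH : IsVectorBundle H n)
    {A P : Subsheaf ((Scheme.Modules.pullback f).obj H)} {a b : ℕ} (hA : A.IsSubbundle a)
    (hP : P.IsSubbundle b) : degeneracyIdeal A P 0 = ⊥ ↔ A ≤ P := by
  have hm : ∀ {R : CommRingCat.{u}} (y z : GLn n R),
      minorIdeal (z * y⁻¹).1 b a 0 = ⊥ ↔ cutMod y a ≤ cutMod z b := fun y z => by
    rw [eq_bot_iff, minorIdeal_zero_le_iff, cutMod_le_iff]
    simp only [Ideal.mem_bot]
  constructor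
  · intro h0
    refine Subsheaf.le_of_local fun t => ?_
    obtain ⟨U, hU, h, hh⟩ := hH (f t)
    obtain ⟨V, k, y, z, ht, hy, hz⟩ := exists_cutAt_pair hA hP hh (t := t) le_rfl hU
    refine ⟨V.1, ht, ?_⟩
    rw [hy.le_iff (isFrame_fr f hh _) hz, ← hm]
    exact minorIdeal_eq_bot hA hP h0 hh hy hz
  · intro hle
    refine degeneracyIdeal_eq_bot_of_local (n := n) hA hP fun t => ?_
    obtain ⟨U, hU, h, hh⟩ := hH (f t)
    obtain ⟨V, k, y, z, ht, hy, hz⟩ := exists_cutAt_pair hA hP hh (t := t) le_rfl hU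
    refine ⟨U, h, hh, V.1, _, y, z, ht, hy, hz, ?_⟩
    rw [hm, ← hy.le_iff (isFrame_fr f hh _) hz]
    exact fun W _ => hle W

theorem degeneracyIdeal_zero_le_ker_iff (hH : IsVectorBundle H n)
    {A P : Subsheaf ((Scheme.Modules.pullback π).obj H)} {a b : ℕ} (hA : A.IsSubbundle a)
    (hP : P.IsSubbundle b) :
    degeneracyIdeal A P 0 ≤ g.ker ↔ A.pullbackOver w ≤ P.pullbackOver w := by
  rw [degeneracyIdeal_le_ker_iff w hH hA hP,
    degeneracyIdeal_zero_eq_bot_iff hH (hA.pullbackOver w hH) (hP.pullbackOver w hH)]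

end

/-! ### Chart matrices with entries in a valuation ring -/

section

open Matrix

variable {n : ℕ}

/-- Cramer's rule for the system whose solution is the `j`-th column of `X`: replacing column `i` of
the chart minor by column `σ j` of `y` is the same as composing `σ` with a transposition. -/
theorem det_chartMinor_swap {R : Type*} [CommRing R] {y : GLn n R} {d : ℕ}
    {σ : Equiv.Perm (Fin n)} {X : ChartIndex n d → R} (h : cutMod y d = cutMod (chartMat σ X) d)
    (i : {i : Fin n // ¬(i : ℕ) < d}) (j : {j : Fin n // (j : ℕ) < d}) :
    (chartMinor y d σ).det * X (i, j) = -(chartMinor y d (σ * Equiv.swap i.1 j.1)).det := by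
  let c : Fin n → R := fun k => if hk : (k : ℕ) < d then if k = j then 1 else 0 else X (⟨k, hk⟩, j)
  have hc : c ∘ σ.symm ∈ cutMod y d := by
    rw [h, mem_cutMod_chartMat]
    intro k
    rw [Finset.sum_eq_single j]
    · simp [c, j.2, k.2]
    · intro l _ hl
      simp [c, l.2, Subtype.coe_injective.ne hl]
    · simp
  rw [mem_cutMod_iff_chartMinor σ] at hc
  have hl : (fun k : {i : Fin n // ¬(i : ℕ) < d} => (c ∘ σ.symm) (σ k)) = fun k => X (k, j) := by
    ext k
    simp [c, k.2]
  have hr : (of fun i j => y.1 i (σ j) : Matrix {i : Fin n // ¬(i : ℕ) < d}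
      {j : Fin n // (j : ℕ) < d} R) *ᵥ (fun k => (c ∘ σ.symm) (σ k)) =
      fun k : {i : Fin n // ¬(i : ℕ) < d} => y.1 k (σ j) := by
    ext k
    rw [mulVec, dotProduct, Finset.sum_eq_single j]
    · simp [c, j.2]
    · intro l _ hl
      simp [c, l.2, Subtype.coe_injective.ne hl]
    · simp
  rw [hl, hr] at hc
  have h1 := congrArg (fun v => (chartMinor y d σ).adjugate *ᵥ v) hc
  simp only [mulVec_mulVec, adjugate_mul, smul_mulVec, one_mulVec, mulVec_neg,
    ← cramer_eq_adjugate_mulVec] at h1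
  have h2 := congrFun h1 i
  rw [Pi.smul_apply, smul_eq_mul, Pi.neg_apply, cramer_apply] at h2
  rw [h2]
  congr 2
  ext k l
  rw [updateCol_apply]
  change _ = y.1 k (σ (Equiv.swap i.1 j.1 l.1))
  split_ifs with hli
  · rw [hli, Equiv.swap_apply_left]
  · rw [Equiv.swap_apply_of_ne_of_ne]
    · rfl
    · exact fun h => hli (Subtype.ext h)
    · exact fun h => l.2 (h ▸ j.2)

/-- Subspaces over the fraction field of a valuation ring extend to the valuation ring. -/
theorem exists_cutMod_gmap_eq {R K : Type*} [CommRing R] [Field K] (φ : R →+* K)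
    (hφ : ∀ x : K, (∃ r, φ r = x) ∨ ∃ r, φ r = x⁻¹) (y : GLn n K) (d : ℕ) :
    ∃ y' : GLn n R, cutMod (gmap φ y') d = cutMod y d := by
  let m : Equiv.Perm (Fin n) → K := fun σ => (chartMinor y d σ).det
  -- Divisibility over a valuation ring is total, so among finitely many minors one divides all the
  -- others. It is nonzero, because some minor is.
  obtain ⟨σ, hσ⟩ : ∃ σ, ∀ τ, ∃ r, m τ = φ r * m σ := by
    let rel : K → K → Prop := fun a b => ∃ r, a = φ r * b
    have htr : IsTrans K rel := ⟨by
      rintro a b c ⟨r, rfl⟩ ⟨s, rfl⟩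
      exact ⟨r * s, by rw [map_mul, mul_assoc]⟩⟩
    have hdir : Directed rel m := by
      intro σ τ
      by_cases h0 : m τ = 0
      · exact ⟨σ, ⟨1, by rw [map_one, one_mul]⟩, ⟨0, by rw [map_zero, zero_mul, h0]⟩⟩
      obtain ⟨r, hr⟩ | ⟨r, hr⟩ := hφ (m σ / m τ)
      · exact ⟨τ, ⟨r, by rw [hr, div_mul_cancel₀ _ h0]⟩, ⟨1, by rw [map_one, one_mul]⟩⟩
      · by_cases h1 : m σ = 0
        · exact ⟨τ, ⟨0, by rw [map_zero, zero_mul, h1]⟩, ⟨1, by rw [map_one, one_mul]⟩⟩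
        · exact ⟨σ, ⟨1, by rw [map_one, one_mul]⟩,
            ⟨r, by rw [hr, inv_div, div_mul_cancel₀ _ h1]⟩⟩
    obtain ⟨σ, hσ⟩ := hdir.finset_le Finset.univ
    exact ⟨σ, fun τ => hσ τ (Finset.mem_univ τ)⟩
  have h0 : m σ ≠ 0 := by
    obtain ⟨τ, hτ⟩ := exists_det_chartMinor_ne_zero y d
    obtain ⟨r, hr⟩ := hσ τ
    intro h0
    rw [h0, mul_zero] at hr
    exact hτ hr
  obtain ⟨X, hX⟩ := exists_cutMod_eq_chartMat (y := y) (d := d) (σ := σ) (isUnit_iff_ne_zero.mpr h0)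
  -- By `det_chartMinor_swap` the chart coordinates are, up to sign, quotients of minors by `m σ`,
  -- hence integral by the choice of `σ`.
  have key : ∀ k, ∃ r, φ r = X k := by
    rintro ⟨i, j⟩
    obtain ⟨r, hr⟩ := hσ (σ * Equiv.swap i.1 j.1)
    have h1 := det_chartMinor_swap hX i j
    refine ⟨-r, mul_left_cancel₀ h0 ?_⟩
    refine Eq.trans ?_ h1.symm
    change _ = -m _
    rw [hr, map_neg]
    ring
  choose X' hX' using key
  refine ⟨chartMat σ X', ?_⟩
  rw [gmap_chartMat, hX]
  congr 2
  exact funext hX'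

end

/-! ### Local rings -/

section

variable {T Y S : Scheme.{u}} {H : S.Modules} {n : ℕ} {g : T ⟶ Y} {π : Y ⟶ S} {f : T ⟶ S}

theorem opens_eq_top_of_closedPoint_mem {C : CommRingCat.{u}} [IsLocalRing C] {V : (Spec C).Opens}
    (h : IsLocalRing.closedPoint C ∈ V) : V = ⊤ :=
  top_le_iff.mp fun x _ =>
    (IsLocalRing.specializes_closedPoint x).mem_open V.isOpen h

/-- Over a local ring, pullbacks of vector bundles are trivial. -/
theorem exists_frame_of_isLocalRing {C : CommRingCat.{u}} [IsLocalRing C] (hH : IsVectorBundle H n)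
    (f : Spec C ⟶ S) : ∃ (U : S.Opens) (h : Fin n → Γ(H, U)) (_ : IsFrame H U h), ⊤ ≤ f ⁻¹ᵁ U := by
  obtain ⟨U, hU, h, hh⟩ := hH (f (IsLocalRing.closedPoint C))
  exact ⟨U, h, hh, (opens_eq_top_of_closedPoint_mem hU).ge⟩

theorem Subsheaf.IsSubbundle.exists_cutAt_top {C : CommRingCat.{u}} [IsLocalRing C]
    {f : Spec C ⟶ S} {A : Subsheaf ((Scheme.Modules.pullback f).obj H)} {d : ℕ}
    (hA : A.IsSubbundle d) {U : S.Opens} {h : Fin n → Γ(H, U)} (hh : IsFrame H U h)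
    (k : ⊤ ≤ f ⁻¹ᵁ U) : d ≤ n ∧ ∃ y : GLn n Γ(Spec C, ⊤), A.CutAt h k d y := by
  obtain ⟨hd, V, k', y, ht, hy⟩ := hA.exists_cutAt hh k (t := IsLocalRing.closedPoint C) trivial
  obtain rfl := opens_eq_top_of_closedPoint_mem ht
  exact ⟨hd, y, hy⟩

theorem Subsheaf.CutAt.pullbackOver_top (w : g ≫ π = f)
    {A : Subsheaf ((Scheme.Modules.pullback π).obj H)} {U : S.Opens} {h : Fin n → Γ(H, U)}
    (hh : IsFrame H U h) {k : ⊤ ≤ π ⁻¹ᵁ U} {d : ℕ} {y : GLn n Γ(Y, ⊤)} (hA : A.CutAt h k d y)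
    (k' : ⊤ ≤ f ⁻¹ᵁ U) : (A.pullbackOver w).CutAt h k' d (gmap g.appTop.hom y) := by
  have h1 := (CutAt.pullbackOver w hh hA).res (top_le_preimage g)
  have h2 : gmap (rmap (top_le_preimage g)) (gmap (g.app ⊤).hom y) = gmap g.appTop.hom y := by
    rw [gmap_gmap]
    congr 1
    ext x
    exact rmap_app_top g x
  rwa [h2] at h1

/-- Every invertible matrix defines a subbundle. -/
theorem exists_subbundle_cutAt {U : S.Opens} {h : Fin n → Γ(H, U)} (hh : IsFrame H U h)
    (k : ⊤ ≤ f ⁻¹ᵁ U) {d : ℕ} (hd : d ≤ n) (y : GLn n Γ(T, ⊤)) :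
    ∃ A : Subsheaf ((Scheme.Modules.pullback f).obj H), A.IsSubbundle d ∧ A.CutAt h k d y := by
  obtain ⟨A, hA⟩ := (isFrame_fr f hh k).exists_cut d y
  exact ⟨A, Subsheaf.isSubbundle_of_cutAt fun t => ⟨hd, U, h, hh, ⊤, _, _, trivial, hA⟩, hA⟩

theorem Subsheaf.eq_of_le (hH : IsVectorBundle H n)
    {A B : Subsheaf ((Scheme.Modules.pullback f).obj H)} {d : ℕ} (hA : A.IsSubbundle d)
    (hB : B.IsSubbundle d) (hAB : A ≤ B) : A = B := by
  refine eq_of_local fun t => ?_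
  obtain ⟨U, hU, h, hh⟩ := hH (f t)
  obtain ⟨V, k, y, z, ht, hy, hz⟩ := exists_cutAt_pair hA hB hh (t := t) le_rfl hU
  have hf := isFrame_fr f hh (k.trans le_rfl)
  exact ⟨V.1, ht, (hy.sec_eq_iff hf hz).mpr (cutMod_eq_of_le ((hy.le_iff hf hz).mp
    fun W _ => hAB W))⟩

/-! ### The universal property of flag bundles -/

theorem FlagBundle.exists_hom {D : Finset ℕ} (W : FlagBundle H D) (f : T ⟶ S)
    (V : BundleFlag ((Scheme.Modules.pullback f).obj H) D) :
    ∃ (g : T ⟶ W.scheme) (w : g ≫ W.π = f), ∀ d, (W.taut.sub d).pullbackOver w = V.sub d := by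
  obtain ⟨g, ⟨w, h⟩, -⟩ := W.existsUnique f V
  exact ⟨g, w, h⟩

theorem FlagBundle.hom_ext {D : Finset ℕ} (hH : IsVectorBundle H n) (W : FlagBundle H D)
    {g g' : T ⟶ W.scheme} (w : g ≫ W.π = f) (w' : g' ≫ W.π = f)
    (h : ∀ d, (W.taut.sub d).pullbackOver w = (W.taut.sub d).pullbackOver w') : g = g' :=
  (W.existsUnique f (W.taut.pullbackOver w' hH)).unique ⟨w, h⟩ ⟨w', fun _ => rfl⟩

theorem GrassmannianBundle.exists_hom {d : ℕ} (G : GrassmannianBundle H d) (f : T ⟶ S)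
    {A : Subsheaf ((Scheme.Modules.pullback f).obj H)} (hA : A.IsSubbundle d) :
    ∃ (g : T ⟶ G.scheme) (w : g ≫ G.π = f), G.taut.member.pullbackOver w = A := by
  obtain ⟨g, w, h⟩ := FlagBundle.exists_hom G f (BundleFlag.single A hA)
  exact ⟨g, w, h _⟩

theorem GrassmannianBundle.hom_ext {d : ℕ} (hH : IsVectorBundle H n) (G : GrassmannianBundle H d)
    {g g' : T ⟶ G.scheme} (w : g ≫ G.π = f) (w' : g' ≫ G.π = f)
    (h : G.taut.member.pullbackOver w = G.taut.member.pullbackOver w') : g = g' :=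
  FlagBundle.hom_ext hH G w w' fun d' => by
    obtain rfl : d' = ⟨d, Finset.mem_singleton_self d⟩ :=
      Subtype.ext (Finset.mem_singleton.mp d'.2)
    exact h

theorem GrassmannianBundle.isSubbundle {d : ℕ} (G : GrassmannianBundle H d) :
    G.taut.member.IsSubbundle d := G.taut.isSubbundle _

end

/-! ### Grassmannian bundles are proper -/

section

variable {T Y S : Scheme.{u}} {H : S.Modules} {n d : ℕ}

/-- Over the valuation ring the bundle is trivial, and a subspace over the fraction field extends in
the chart whose minor divides all others (`exists_cutMod_gmap_eq`). -/
theorem GrassmannianBundle.valuativeCriterion (hH : IsVectorBundle H n)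
    (G : GrassmannianBundle H d) : ValuativeCriterion.Existence G.π := by
  rintro ⟨R, K, i₁, i₂, ⟨w⟩⟩
  obtain ⟨U, h, hh, k⟩ := exists_frame_of_isLocalRing (C := .of R) hH i₂
  let ι := Spec.map (CommRingCat.ofHom (algebraMap R K))
  have k' : ⊤ ≤ (ι ≫ i₂) ⁻¹ᵁ U := (top_le_preimage ι).trans (preimage_le ι k)
  have : IsLocalRing (CommRingCat.of K) := inferInstanceAs (IsLocalRing K)
  obtain ⟨hd, y, hy⟩ := Subsheaf.IsSubbundle.exists_cutAt_top
    (G.isSubbundle.pullbackOver w hH) hh k'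
  let φ : Γ(Spec (.of R), ⊤) →+* Γ(Spec (.of K), ⊤) := ι.appTop.hom
  let eR := (Scheme.ΓSpecIso (CommRingCat.of R)).commRingCatIsoToRingEquiv
  let eK := (Scheme.ΓSpecIso (CommRingCat.of K)).commRingCatIsoToRingEquiv
  have hφe : ∀ r, eK (φ r) = algebraMap R K (eR r) := fun r =>
    congrArg (fun a => a.hom r) (Scheme.ΓSpecIso_naturality (CommRingCat.ofHom (algebraMap R K)))
  let _ : Field Γ(Spec (.of K), ⊤) := (eK.toMulEquiv.isField (Field.toIsField K)).toField
  obtain ⟨y', hy'⟩ := exists_cutMod_gmap_eq φ (fun x => by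
    have key : ∀ x : K, (∃ r, φ r = eK.symm x) ∨ ∃ r, φ r = eK.symm x⁻¹ := by
      intro x
      obtain h | h := ValuationRing.isInteger_or_isInteger R x
      · obtain ⟨r, hr⟩ := h
        exact Or.inl ⟨eR.symm r, eK.injective (by
          rw [hφe, RingEquiv.apply_symm_apply, RingEquiv.apply_symm_apply, hr])⟩
      · obtain ⟨r, hr⟩ := h
        exact Or.inr ⟨eR.symm r, eK.injective (by
          rw [hφe, RingEquiv.apply_symm_apply, RingEquiv.apply_symm_apply, hr])⟩
    have := key (eK x)
    rwa [map_inv₀, RingEquiv.symm_apply_apply] at this) y d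
  obtain ⟨A, hA, hAy⟩ := exists_subbundle_cutAt (f := i₂) hh k hd y'
  obtain ⟨l, wl, hl⟩ := G.exists_hom i₂ hA
  have wl' : (ι ≫ l) ≫ G.π = ι ≫ i₂ := by rw [Category.assoc, wl]
  refine ⟨⟨l, G.hom_ext hH wl' w ?_, wl⟩⟩
  rw [← Subsheaf.pullbackOver_comp wl hH (rfl : ι ≫ i₂ = _) wl' G.isSubbundle, hl]
  have h1 := hAy.pullbackOver_top (rfl : ι ≫ i₂ = _) hh k'
  exact Subsheaf.eq_of_cutAt fun t => ⟨U, h, hh, ⊤, k', d, y, trivial, h1.congr hy', hy⟩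

/-- The diagonal is the closed locus on the product where one tautological subbundle lies in the
other: equal ranks turn inclusion into equality, and equality of the subbundles forces the two
projections to agree. -/
theorem GrassmannianBundle.isSeparated (hH : IsVectorBundle H n) (G : GrassmannianBundle H d) :
    IsSeparated G.π := by
  refine ⟨?_⟩
  let p₁ := Limits.pullback.fst G.π G.π
  let p₂ := Limits.pullback.snd G.π G.π
  have w₂ : p₂ ≫ G.π = p₁ ≫ G.π := Limits.pullback.condition.symm
  let A₁ := G.taut.member.pullbackOver (rfl : p₁ ≫ G.π = _)
  let A₂ := G.taut.member.pullbackOver w₂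
  have hA₁ : A₁.IsSubbundle d := G.isSubbundle.pullbackOver _ hH
  have hA₂ : A₂.IsSubbundle d := G.isSubbundle.pullbackOver _ hH
  let I := degeneracyIdeal A₁ A₂ 0
  let δ := Limits.pullback.diagonal G.π
  have hδ₁ : δ ≫ p₁ = 𝟙 _ := Limits.pullback.diagonal_fst _
  have hδ₂ : δ ≫ p₂ = 𝟙 _ := Limits.pullback.diagonal_snd _
  have hδ : δ ≫ p₁ ≫ G.π = G.π := by rw [← Category.assoc, hδ₁, Category.id_comp]
  have c₁ : A₁.pullbackOver hδ = G.taut.member.pullbackOver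
      (show (δ ≫ p₁) ≫ G.π = G.π by rw [hδ₁, Category.id_comp]) :=
    Subsheaf.pullbackOver_comp _ hH _ _ G.isSubbundle
  have c₂ : A₂.pullbackOver hδ = G.taut.member.pullbackOver
      (show (δ ≫ p₂) ≫ G.π = G.π by rw [hδ₂, Category.id_comp]) :=
    Subsheaf.pullbackOver_comp _ hH _ _ G.isSubbundle
  have hcongr : ∀ {a b : G.scheme ⟶ G.scheme} (wa : a ≫ G.π = G.π) (wb : b ≫ G.π = G.π),
      a = b → G.taut.member.pullbackOver wa = G.taut.member.pullbackOver wb := by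
    rintro a b wa wb rfl
    rfl
  obtain ⟨e, he⟩ := (exists_lift_iff_le_ker I δ).mpr
    ((degeneracyIdeal_zero_le_ker_iff hδ hH hA₁ hA₂).mpr (by
      rw [c₁, c₂, hcongr _ _ (hδ₁.trans hδ₂.symm)]
      exact fun _ _ hx => hx))
  have hι : I.subschemeι ≫ p₁ = I.subschemeι ≫ p₂ := by
    have h1 := (degeneracyIdeal_zero_le_ker_iff (rfl : I.subschemeι ≫ p₁ ≫ G.π = _) hH hA₁
      hA₂).mp ((exists_lift_iff_le_ker I I.subschemeι).mp ⟨𝟙 _, Category.id_comp _⟩)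
    have h2 := Subsheaf.eq_of_le hH (hA₁.pullbackOver _ hH) (hA₂.pullbackOver _ hH) h1
    refine G.hom_ext hH (f := I.subschemeι ≫ p₁ ≫ G.π) (Category.assoc _ _ _)
      (by rw [Category.assoc, w₂]) ?_
    rw [← Subsheaf.pullbackOver_comp rfl hH rfl _ G.isSubbundle,
      ← Subsheaf.pullbackOver_comp w₂ hH rfl _ G.isSubbundle]
    exact h2
  have hiso : IsIso e := by
    refine ⟨I.subschemeι ≫ p₁, ?_, ?_⟩
    · rw [← Category.assoc, he, hδ₁]
    · rw [← cancel_mono I.subschemeι, Category.assoc, he, Category.id_comp]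
      refine Limits.pullback.hom_ext ?_ ?_
      · change ((I.subschemeι ≫ p₁) ≫ δ) ≫ p₁ = _
        rw [Category.assoc, hδ₁, Category.comp_id]
      · change ((I.subschemeι ≫ p₁) ≫ δ) ≫ p₂ = _
        rw [Category.assoc, hδ₂, Category.comp_id, hι]
  change IsClosedImmersion δ
  rw [← he]
  infer_instance

/-- The charts of a Grassmannian bundle. -/
theorem GrassmannianBundle.exists_chart (hH : IsVectorBundle H n) (hd : d ≤ n)
    (G : GrassmannianBundle H d) {U : S.Opens} {h : Fin n → Γ(H, U)} (hh : IsFrame H U h)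
    (σ : Equiv.Perm (Fin n)) : ∃ (L : G.scheme.Opens)
      (a : (L : Scheme.{u}) ⟶ GrassmannianChart.scheme n d U)
      (c : GrassmannianChart.scheme n d U ⟶ G.scheme), L = G.taut.member.chartLocus d h σ ∧
      a ≫ GrassmannianChart.π n d U = L.ι ≫ G.π ∧ c ≫ G.π = GrassmannianChart.π n d U ∧ a ≫ c = L.ι := by
  let L := G.taut.member.chartLocus d h σ
  obtain ⟨k, X, hX⟩ := Subsheaf.exists_cutAt_of_chartLocus hh (σ := σ)
    (A := G.taut.member.pullbackOver (rfl : L.ι ≫ G.π = _)) (d := d) fun t => by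
      rw [Subsheaf.mem_chartLocus_pullbackOver rfl G.isSubbundle hh]
      exact t.2
  obtain ⟨a, wa, ha⟩ := GrassmannianChart.exists_hom k X
  obtain ⟨A, hA, hAc⟩ := GrassmannianChart.exists_subbundle hd hh σ
  obtain ⟨c, wc, hc⟩ := G.exists_hom _ hA
  have wac : (a ≫ c) ≫ G.π = L.ι ≫ G.π := by rw [Category.assoc, wc, wa]
  refine ⟨L, a, c, rfl, wa, wc, G.hom_ext hH wac rfl ?_⟩
  rw [← Subsheaf.pullbackOver_comp wc hH wa wac G.isSubbundle, hc]
  have h1 := Subsheaf.CutAt.pullbackOver_chart hh hAc a wa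
  rw [funext ha] at h1
  exact Subsheaf.eq_of_cutAt fun t => ⟨U, h, hh, ⊤, k, d, _, trivial, h1, hX⟩

/-- On a chart locus the open immersion factors as `a ≫ c`, so `a` is locally of finite type, and
the structure morphism there is `a` followed by that of an affine space over an open of `S`. -/
theorem GrassmannianBundle.locallyOfFiniteType (hH : IsVectorBundle H n) (hd : d ≤ n)
    (G : GrassmannianBundle H d) : LocallyOfFiniteType G.π := by
  have key : ∀ x : G.scheme, ∃ L : G.scheme.Opens, x ∈ L ∧ LocallyOfFiniteType (L.ι ≫ G.π) := by
    intro x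
    obtain ⟨U, hU, h, hh⟩ := hH (G.π x)
    obtain ⟨σ, hσ⟩ := Subsheaf.exists_mem_chartLocus G.isSubbundle hh hU
    obtain ⟨L, a, c, hL, hac, -, hc⟩ := G.exists_chart hH hd hh σ
    refine ⟨L, hL ▸ hσ, ?_⟩
    have h1 : LocallyOfFiniteType (a ≫ c) := by
      rw [hc]
      infer_instance
    have h2 : LocallyOfFiniteType a := locallyOfFiniteType_of_comp a c
    rw [← hac]
    infer_instance
  choose L hxL hL using key
  have hP : IsZariskiLocalAtSource (@LocallyOfFiniteType.{u} : MorphismProperty Scheme.{u}) :=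
    HasRingHomProperty.instIsZariskiLocalAtSource
  exact @IsZariskiLocalAtSource.of_iSup_eq_top _ hP _ _ _ _ L
    (top_le_iff.mp fun x _ => TopologicalSpace.Opens.mem_iSup.mpr ⟨x, hxL x⟩) hL

/-- Over an affine open that trivializes `H`, the preimage is the union of the images of finitely
many affine spaces, one for each permutation. -/
theorem GrassmannianBundle.quasiCompact (hH : IsVectorBundle H n) (hd : d ≤ n)
    (G : GrassmannianBundle H d) : QuasiCompact G.π := by
  have key : ∀ s : S, ∃ U : S.affineOpens, s ∈ U.1 ∧ ∃ h : Fin n → Γ(H, U.1), IsFrame H U.1 h := by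
    intro s
    obtain ⟨U, hU, h, hh⟩ := hH s
    obtain ⟨V, hV, hsV, hVU⟩ := exists_isAffineOpen_mem_and_subset (x := s) hU
    exact ⟨⟨V, hV⟩, hsV, _, hh.res hVU⟩
  choose U hsU h hh using key
  refine (@HasAffineProperty.iff_of_iSup_eq_top @QuasiCompact.{u} (fun X _ _ _ => CompactSpace X)
    instHasAffinePropertyQuasiCompactCompactSpaceCarrierCarrierCommRingCat _ _ _ _ U (top_le_iff.mp fun x _ => TopologicalSpace.Opens.mem_iSup.mpr ⟨x, hsU x⟩)).mpr fun s => ?_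
  choose L a c hL hac hcπ hc using fun σ => G.exists_chart hH hd (hh s) σ
  have hU : IsAffine (U s).1 := (U s).2
  have hC : IsCompact (⋃ σ, Set.range (c σ)) := by
    refine isCompact_iUnion fun σ => isCompact_range (c σ).continuous
  have hcov : ((G.π ⁻¹ᵁ (U s).1 : G.scheme.Opens) : Set G.scheme) = ⋃ σ, Set.range (c σ) := by
    ext x
    rw [Set.mem_iUnion]
    constructor
    · intro hx
      obtain ⟨σ, hσ⟩ := Subsheaf.exists_mem_chartLocus G.isSubbundle (hh s) hx
      rw [← hL] at hσ
      let y : (L σ : Scheme.{u}) := ⟨x, hσ⟩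
      exact ⟨σ, a σ y, (Scheme.Hom.comp_apply _ _ _).symm.trans
        (congrArg (fun m : (L σ : Scheme.{u}) ⟶ G.scheme => m y) (hc σ))⟩
    · rintro ⟨σ, y, rfl⟩
      change G.π (c σ y) ∈ (U s).1
      rw [← Scheme.Hom.comp_apply, hcπ]
      exact GrassmannianChart.top_le d (U s).1 (x := y) trivial
  rw [← hcov] at hC
  exact isCompact_iff_compactSpace.mp hC

end

/-! ### Existence and properness of flag bundles -/

section

variable {T Y S : Scheme.{u}} {H : S.Modules} {n : ℕ}

theorem GrassmannianBundle.isProper (hH : IsVectorBundle H n) {d : ℕ} (hd : d ≤ n)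
    (G : GrassmannianBundle H d) : IsProper G.π := by
  have := G.isSeparated hH
  have := G.quasiCompact hH hd
  have := G.locallyOfFiniteType hH hd
  have := UniversallyClosed.of_valuativeCriterion G.π (G.valuativeCriterion hH)
  exact { }

/-- The structure morphism of a flag bundle is unique up to isomorphism. -/
theorem FlagBundle.exists_iso (hH : IsVectorBundle H n) {D : Finset ℕ} (W W' : FlagBundle H D) :
    ∃ e : W.scheme ≅ W'.scheme, e.hom ≫ W'.π = W.π := by
  obtain ⟨a, wa, ha⟩ := W'.exists_hom W.π W.taut
  obtain ⟨b, wb, hb⟩ := W.exists_hom W'.π W'.taut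
  refine ⟨⟨a, b, ?_, ?_⟩, wa⟩
  · have w : (a ≫ b) ≫ W.π = W.π := by rw [Category.assoc, wb, wa]
    refine W.hom_ext hH w (Category.id_comp _) fun d => ?_
    rw [← Subsheaf.pullbackOver_comp wb hH wa w (W.taut.isSubbundle d), hb, ha,
      Subsheaf.pullbackOver_id hH (W.taut.isSubbundle d)]
  · have w : (b ≫ a) ≫ W'.π = W'.π := by rw [Category.assoc, wa, wb]
    refine W'.hom_ext hH w (Category.id_comp _) fun d => ?_
    rw [← Subsheaf.pullbackOver_comp wa hH wb w (W'.taut.isSubbundle d), ha, hb,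
      Subsheaf.pullbackOver_id hH (W'.taut.isSubbundle d)]

theorem FlagBundle.exists_empty (H : S.Modules) :
    ∃ W : FlagBundle H ∅, IsProper W.π := by
  refine ⟨⟨S, 𝟙 S, ⟨fun d => (Finset.notMem_empty _ d.2).elim,
    fun d => (Finset.notMem_empty _ d.2).elim, fun d => (Finset.notMem_empty _ d.2).elim⟩,
    fun {T} f V => ⟨f, ⟨Category.comp_id f, fun d => (Finset.notMem_empty _ d.2).elim⟩, ?_⟩⟩, ?_⟩
  · rintro g ⟨w, -⟩
    rw [← w, Category.comp_id]
  · change IsProper (𝟙 S)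
    infer_instance

theorem Subsheaf.pullbackOver_congr {π : Y ⟶ S} {f : T ⟶ S} {g g' : T ⟶ Y} (h : g = g')
    (w : g ≫ π = f) (w' : g' ≫ π = f) (A : Subsheaf ((Scheme.Modules.pullback π).obj H)) :
    A.pullbackOver w = A.pullbackOver w' := by
  subst h
  rfl

/-- Adding a member to a flag. -/
def BundleFlag.insert {X : Scheme.{u}} {M : X.Modules} {D : Finset ℕ} {d : ℕ} (V : BundleFlag M D)
    (B : Subsheaf M) (hB : B.IsSubbundle d) (h₁ : ∀ e : D, e ≤ d → V.sub e ≤ B)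
    (h₂ : ∀ e : D, d ≤ e → B ≤ V.sub e) : BundleFlag M (Insert.insert d D) where
  sub e := if h : e.1 ∈ D then V.sub ⟨e.1, h⟩ else B
  isSubbundle e := by
    split_ifs with h
    · exact V.isSubbundle ⟨e.1, h⟩
    · rw [(Finset.mem_insert.mp e.2).resolve_right h]
      exact hB
  le e e' hee := by
    have hee' : e.1 ≤ e'.1 := hee
    split_ifs with h h' h'
    · exact V.le _ _ hee
    · rw [(Finset.mem_insert.mp e'.2).resolve_right h'] at hee'
      exact h₁ ⟨e.1, h⟩ hee'
    · rw [(Finset.mem_insert.mp e.2).resolve_right h] at hee'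
      exact h₂ ⟨e'.1, h'⟩ hee'
    · exact fun _ _ hx => hx

/-- Inside the product of the flag bundle with the Grassmannian bundle, one imposes that the new
member contains those of smaller rank and lies in those of larger rank. These are closed conditions
of type `degeneracyIdeal _ _ 0`, so properness persists. -/
theorem FlagBundle.exists_insert (hH : IsVectorBundle H n) {D : Finset ℕ} {d : ℕ} (hd : d ≤ n)
    (hdD : d ∉ D) (F : FlagBundle H D) (hF : IsProper F.π) :
    ∃ W : FlagBundle H (insert d D), IsProper W.π := by
  obtain ⟨G⟩ := nonempty_grassmannianBundle hH hd
  have hG := G.isProper hH hd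
  let Y := Limits.pullback F.π G.π
  let p₁ : Y ⟶ F.scheme := Limits.pullback.fst F.π G.π
  let p₂ : Y ⟶ G.scheme := Limits.pullback.snd F.π G.π
  let π : Y ⟶ S := p₁ ≫ F.π
  have w₁ : p₁ ≫ F.π = π := rfl
  have w₂ : p₂ ≫ G.π = π := Limits.pullback.condition.symm
  let A : {e // e ∈ D} → Subsheaf ((Scheme.Modules.pullback π).obj H) := fun e =>
    (F.taut.sub e).pullbackOver w₁
  let B : Subsheaf ((Scheme.Modules.pullback π).obj H) := G.taut.member.pullbackOver w₂
  have hA : ∀ e, (A e).IsSubbundle e := fun e => (F.taut.isSubbundle e).pullbackOver w₁ hH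
  have hB : B.IsSubbundle d := G.isSubbundle.pullbackOver w₂ hH
  let I := (⨆ e : {e : {e // e ∈ D} // e.1 ≤ d}, degeneracyIdeal (A e.1) B 0) ⊔
    ⨆ e : {e : {e // e ∈ D} // d ≤ e.1}, degeneracyIdeal B (A e.1) 0
  have hI : ∀ {T : Scheme.{u}} {f : T ⟶ S} {g : T ⟶ Y} (w : g ≫ π = f), I ≤ g.ker ↔
      (∀ e : {e // e ∈ D}, e.1 ≤ d → (A e).pullbackOver w ≤ B.pullbackOver w) ∧
      ∀ e : {e // e ∈ D}, d ≤ e.1 → B.pullbackOver w ≤ (A e).pullbackOver w := by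
    intro T f g w
    simp only [I, sup_le_iff, iSup_le_iff, Subtype.forall (p := fun e : {e // e ∈ D} => e.1 ≤ d),
      Subtype.forall (p := fun e : {e // e ∈ D} => d ≤ e.1)]
    simp only [degeneracyIdeal_zero_le_ker_iff w hH (hA _) hB,
      degeneracyIdeal_zero_le_ker_iff w hH hB (hA _)]
  let ι := I.subschemeι
  have wι : ι ≫ π = ι ≫ π := rfl
  obtain ⟨l₁, l₂⟩ := (hI wι).mp ((exists_lift_iff_le_ker I ι).mp ⟨𝟙 _, Category.id_comp _⟩)
  let V₀ : BundleFlag ((Scheme.Modules.pullback (ι ≫ π)).obj H) D :=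
    (F.taut.pullbackOver w₁ hH).pullbackOver wι hH
  let taut : BundleFlag ((Scheme.Modules.pullback (ι ≫ π)).obj H) (Insert.insert d D) :=
    V₀.insert (B.pullbackOver wι) (hB.pullbackOver wι hH) l₁ l₂
  have ht₁ : ∀ (e : {e // e ∈ D}), taut.sub ⟨e.1, Finset.mem_insert_of_mem e.2⟩ =
      (A e).pullbackOver wι := fun e => dif_pos e.2
  have ht₂ : taut.sub ⟨d, Finset.mem_insert_self d D⟩ = B.pullbackOver wι := dif_neg hdD
  refine ⟨⟨I.subscheme, ι ≫ π, taut, fun {T} f V => ?_⟩, ?_⟩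
  · obtain ⟨a, wa, ha⟩ := F.exists_hom f
      { sub := fun e => V.sub ⟨e.1, Finset.mem_insert_of_mem e.2⟩
        isSubbundle := fun e => V.isSubbundle ⟨e.1, Finset.mem_insert_of_mem e.2⟩
        le := fun e e' h => V.le _ _ h }
    obtain ⟨b, wb, hb⟩ := G.exists_hom f (V.isSubbundle ⟨d, Finset.mem_insert_self d D⟩)
    let l : T ⟶ Y := Limits.pullback.lift a b (wa.trans wb.symm)
    have hl₁ : l ≫ p₁ = a := Limits.pullback.lift_fst _ _ _
    have hl₂ : l ≫ p₂ = b := Limits.pullback.lift_snd _ _ _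
    have wl : l ≫ π = f := by rw [← w₁, ← Category.assoc, hl₁, wa]
    have hlA : ∀ e, (A e).pullbackOver wl = V.sub ⟨e.1, Finset.mem_insert_of_mem e.2⟩ := by
      intro e
      rw [← ha e, Subsheaf.pullbackOver_comp w₁ hH wl (by rw [hl₁, wa]) (F.taut.isSubbundle e)]
      exact Subsheaf.pullbackOver_congr hl₁ _ _ _
    have hlB : B.pullbackOver wl = V.sub ⟨d, Finset.mem_insert_self d D⟩ := by
      rw [← hb, Subsheaf.pullbackOver_comp w₂ hH wl (by rw [hl₂, wb]) G.isSubbundle]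
      exact Subsheaf.pullbackOver_congr hl₂ _ _ _
    obtain ⟨m, hm⟩ := (exists_lift_iff_le_ker I l).mpr ((hI wl).mpr ⟨fun e he => by
      rw [hlA, hlB]
      exact V.le _ _ he, fun e he => by
      rw [hlA, hlB]
      exact V.le _ _ he⟩)
    have wm : m ≫ ι ≫ π = f := by rw [← Category.assoc, hm, wl]
    refine ⟨m, ⟨wm, ?_⟩, ?_⟩
    · rintro ⟨e, he⟩
      obtain rfl | he' := Finset.mem_insert.mp he
      · rw [ht₂, Subsheaf.pullbackOver_comp wι hH wm (by rw [hm, wl]) hB, ← hlB]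
        exact Subsheaf.pullbackOver_congr hm _ _ _
      · rw [ht₁ ⟨e, he'⟩, Subsheaf.pullbackOver_comp wι hH wm (by rw [hm, wl]) (hA _),
          ← hlA ⟨e, he'⟩]
        exact Subsheaf.pullbackOver_congr hm _ _ _
    · rintro m' ⟨wm', hm'⟩
      have wm'' : (m' ≫ ι) ≫ π = f := by rw [Category.assoc, wm']
      rw [← cancel_mono ι]
      refine Eq.trans (Limits.pullback.hom_ext ?_ ?_) hm.symm
      · refine Eq.trans (F.hom_ext hH (by rw [Category.assoc, Category.assoc, w₁, wm']) wa
          fun e => ?_) hl₁.symm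
        rw [ha, ← Subsheaf.pullbackOver_comp w₁ hH wm'' _ (F.taut.isSubbundle e),
          ← Subsheaf.pullbackOver_comp wι hH wm' wm'' (hA e), ← hm', ht₁]
      · refine Eq.trans (G.hom_ext hH (by rw [Category.assoc, Category.assoc, w₂, wm']) wb
          ?_) hl₂.symm
        rw [hb, ← Subsheaf.pullbackOver_comp w₂ hH wm'' _ G.isSubbundle,
          ← Subsheaf.pullbackOver_comp wι hH wm' wm'' hB, ← hm', ht₂]
  · change IsProper (I.subschemeι ≫ Limits.pullback.fst F.π G.π ≫ F.π)
    infer_instance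

theorem FlagBundle.exists_isProper (hH : IsVectorBundle H n) {D : Finset ℕ}
    (hD : ∀ d ∈ D, d ≤ n) : ∃ W : FlagBundle H D, IsProper W.π := by
  induction D using Finset.induction_on with
  | empty => exact FlagBundle.exists_empty H
  | insert d D hd ih =>
    obtain ⟨F, hF⟩ := ih fun e he => hD e (Finset.mem_insert_of_mem he)
    exact FlagBundle.exists_insert hH (hD d (Finset.mem_insert_self d D)) hd F hF

theorem FlagBundle.isProper (hH : IsVectorBundle H n) {D : Finset ℕ} (hD : ∀ d ∈ D, d ≤ n)
    (W : FlagBundle H D) : IsProper W.π := by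
  obtain ⟨W', hW'⟩ := FlagBundle.exists_isProper hH hD
  obtain ⟨e, he⟩ := W.exists_iso hH W'
  rw [← he]
  infer_instance

end

/-! ### The functor represented by the product of two resolutions -/

section

variable {T Y S : Scheme.{u}} {H : S.Modules} {r n : ℕ} {f : T ⟶ S}

/-- The member of rank `r` of a flag with ranks the corners of a partition. -/
abbrev BundleFlag.top {X : Scheme.{u}} {M : X.Modules} {lam : AdmissiblePartition r n}
    (V : BundleFlag M lam.corners) (hr : 1 ≤ r) : Subsheaf M := V.sub ⟨r, lam.self_mem_corners hr⟩

/-- The member of a complete flag occurring in the condition of index `a`. -/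
abbrev CompleteFlag.bound (hrn : r ≤ n) (p : CompleteFlag H n) (lam : AdmissiblePartition r n)
    (a : lam.corners) : Subsheaf H :=
  p.sub ⟨lam.index a, lam.index_mem hrn (lam.corners_subset a.2)⟩

/-- A pair of flags `V ⊆ p`, `V' ⊆ q` of `f^* H` with the same member of rank `r`. -/
structure FlagPair (hr : 1 ≤ r) (hrn : r ≤ n) (p q : CompleteFlag H n)
    (lam lam' : AdmissiblePartition r n) (f : T ⟶ S) where
  /-- the first flag -/
  V : BundleFlag ((Scheme.Modules.pullback f).obj H) lam.corners
  /-- the second flag -/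
  V' : BundleFlag ((Scheme.Modules.pullback f).obj H) lam'.corners
  top_eq : V.top hr = V'.top hr
  le : ∀ a, V.sub a ≤ (CompleteFlag.bound hrn p lam a).pullback f
  le' : ∀ a, V'.sub a ≤ (CompleteFlag.bound hrn q lam' a).pullback f

variable {hr : 1 ≤ r} {hrn : r ≤ n} {p q : CompleteFlag H n} {lam lam' : AdmissiblePartition r n}

/-- `u` is the universal pair of flags. -/
def FlagPair.IsUniversal {π : Y ⟶ S} (u : FlagPair hr hrn p q lam lam' π) : Prop :=
  ∀ {T : Scheme.{u}} (f : T ⟶ S) (D : FlagPair hr hrn p q lam lam' f),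
    ∃! g : T ⟶ Y, ∃ w : g ≫ π = f, (∀ a, (u.V.sub a).pullbackOver w = D.V.sub a) ∧
      ∀ a, (u.V'.sub a).pullbackOver w = D.V'.sub a

theorem FlagBundle.toGrassmannian_spec {D : Finset ℕ} (W : FlagBundle H D) (hD : r ∈ D)
    (G : GrassmannianBundle H r) : ∃ w : W.toGrassmannian hD G ≫ G.π = W.π,
      G.taut.member.pullbackOver w = W.taut.sub ⟨r, hD⟩ := by
  obtain ⟨w, h⟩ := (G.existsUnique W.π
    { sub := fun _ => W.taut.sub ⟨r, hD⟩
      isSubbundle := fun d => by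
        have hd : (d : ℕ) = r := Finset.mem_singleton.mp d.2
        rw [hd]
        exact W.taut.isSubbundle ⟨r, hD⟩
      le := fun _ _ _ _ => le_rfl }).choose_spec.1
  exact ⟨w, h _⟩

theorem resolutionIdeal_le_ker_iff (hH : IsVectorBundle H n) (hrn : r ≤ n) (p : CompleteFlag H n)
    (lam : AdmissiblePartition r n) (W : FlagBundle H lam.corners) {g : T ⟶ W.scheme}
    (w : g ≫ W.π = f) : resolutionIdeal hrn p lam W ≤ g.ker ↔
      ∀ a, (W.taut.sub a).pullbackOver w ≤ (CompleteFlag.bound hrn p lam a).pullback f := by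
  rw [resolutionIdeal, iSup_le_iff]
  refine forall_congr' fun a => ?_
  rw [degeneracyIdeal_zero_le_ker_iff w hH (W.taut.isSubbundle a)
    ((p.isSubbundle _).pullback hH W.π), Subsheaf.pullback_pullbackOver w hH (p.isSubbundle _)]

/-- A morphism to a resolution is a flag satisfying the incidence conditions, and two such morphisms
agree in the Grassmannian bundle exactly when the members of rank `r` coincide. -/
theorem exists_universal_flagPair (hH : IsVectorBundle H n) (hr : 1 ≤ r) (hrn : r ≤ n)
    (p q : CompleteFlag H n) (lam lam' : AdmissiblePartition r n) (W : FlagBundle H lam.corners)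
    (W' : FlagBundle H lam'.corners) (G : GrassmannianBundle H r) :
    ∃ u : FlagPair hr hrn p q lam lam'
        (ResolutionProduct.toGrassmannian hr hrn p q lam lam' W W' G ≫ G.π),
      u.IsUniversal ∧ G.taut.member.pullbackOver rfl = u.V.top hr := by
  let ι := (resolutionIdeal hrn p lam W).subschemeι
  let ι' := (resolutionIdeal hrn q lam' W').subschemeι
  let t : (resolutionIdeal hrn p lam W).subscheme ⟶ G.scheme :=
    ι ≫ W.toGrassmannian (lam.self_mem_corners hr) G
  let t' : (resolutionIdeal hrn q lam' W').subscheme ⟶ G.scheme :=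
    ι' ≫ W'.toGrassmannian (lam'.self_mem_corners hr) G
  let P₁ := Limits.pullback.fst t t'
  let P₂ := Limits.pullback.snd t t'
  have hcond : P₁ ≫ t = P₂ ≫ t' := Limits.pullback.condition
  obtain ⟨wg, hg⟩ := W.toGrassmannian_spec (lam.self_mem_corners hr) G
  obtain ⟨wg', hg'⟩ := W'.toGrassmannian_spec (lam'.self_mem_corners hr) G
  have ht : t = ι ≫ W.toGrassmannian (lam.self_mem_corners hr) G := rfl
  have ht' : t' = ι' ≫ W'.toGrassmannian (lam'.self_mem_corners hr) G := rfl
  let π : Limits.pullback t t' ⟶ S := (P₁ ≫ t) ≫ G.π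
  have hπ : π = (P₁ ≫ t) ≫ G.π := rfl
  have wt : t ≫ G.π = ι ≫ W.π := by rw [ht, Category.assoc, wg]
  have wt' : t' ≫ G.π = ι' ≫ W'.π := by rw [ht', Category.assoc, wg']
  have w₁ : (P₁ ≫ ι) ≫ W.π = π := by rw [hπ, Category.assoc, Category.assoc, wt]
  have w₂ : (P₂ ≫ ι') ≫ W'.π = π := by rw [hπ, hcond, Category.assoc, Category.assoc, wt']
  have wG : (P₁ ≫ t) ≫ G.π = π := rfl
  have k₁ := (resolutionIdeal_le_ker_iff hH hrn p lam W w₁).mp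
    ((exists_lift_iff_le_ker _ _).mp ⟨P₁, rfl⟩)
  have k₂ := (resolutionIdeal_le_ker_iff hH hrn q lam' W' w₂).mp
    ((exists_lift_iff_le_ker _ _).mp ⟨P₂, rfl⟩)
  have e₁ : G.taut.member.pullbackOver wG =
      (W.taut.sub ⟨r, lam.self_mem_corners hr⟩).pullbackOver w₁ := by
    rw [← hg]
    refine Eq.trans ?_ (Subsheaf.pullbackOver_comp wg hH w₁ (by
      rw [Category.assoc, wg, w₁]) G.isSubbundle).symm
    exact Subsheaf.pullbackOver_congr (Category.assoc _ _ _).symm _ _ _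
  have e₂ : G.taut.member.pullbackOver wG =
      (W'.taut.sub ⟨r, lam'.self_mem_corners hr⟩).pullbackOver w₂ := by
    rw [← hg']
    refine Eq.trans ?_ (Subsheaf.pullbackOver_comp wg' hH w₂ (by
      rw [Category.assoc, wg', w₂]) G.isSubbundle).symm
    exact Subsheaf.pullbackOver_congr (hcond.trans (Category.assoc _ _ _).symm) _ _ _
  let u : FlagPair hr hrn p q lam lam' π :=
    { V := W.taut.pullbackOver w₁ hH
      V' := W'.taut.pullbackOver w₂ hH
      top_eq := e₁.symm.trans e₂
      le := k₁
      le' := k₂ }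
  refine ⟨u, fun {T} f D => ?_, e₁⟩
  obtain ⟨a, wa, ha⟩ := W.exists_hom f D.V
  obtain ⟨b, wb, hb⟩ := W'.exists_hom f D.V'
  obtain ⟨a', ha'⟩ := (exists_lift_iff_le_ker _ a).mpr
    ((resolutionIdeal_le_ker_iff hH hrn p lam W wa).mpr fun i => by rw [ha]; exact D.le i)
  obtain ⟨b', hb'⟩ := (exists_lift_iff_le_ker _ b).mpr
    ((resolutionIdeal_le_ker_iff hH hrn q lam' W' wb).mpr fun i => by rw [hb]; exact D.le' i)
  have hab : a' ≫ t = b' ≫ t' := by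
    have wa' : (a' ≫ t) ≫ G.π = f := by rw [Category.assoc, wt, ← Category.assoc, ha', wa]
    have wb' : (b' ≫ t') ≫ G.π = f := by rw [Category.assoc, wt', ← Category.assoc, hb', wb]
    refine G.hom_ext hH wa' wb' ?_
    have h1 := D.top_eq
    change D.V.sub _ = D.V'.sub _ at h1
    rw [← ha, ← hb, ← hg, ← hg', Subsheaf.pullbackOver_comp wg hH wa
      (by rw [Category.assoc, wg, wa]) G.isSubbundle, Subsheaf.pullbackOver_comp wg' hH wb
      (by rw [Category.assoc, wg', wb]) G.isSubbundle] at h1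
    refine (Subsheaf.pullbackOver_congr ?_ _ _ _).trans (h1.trans
      (Subsheaf.pullbackOver_congr ?_ _ _ _))
    · rw [ht, ← Category.assoc, ha']
    · rw [ht', ← Category.assoc, hb']
  let g : T ⟶ Limits.pullback t t' := Limits.pullback.lift a' b' hab
  have hg₁ : g ≫ P₁ = a' := Limits.pullback.lift_fst _ _ _
  have hg₂ : g ≫ P₂ = b' := Limits.pullback.lift_snd _ _ _
  have hga : g ≫ P₁ ≫ ι = a := by rw [← Category.assoc, hg₁, ha']
  have hgb : g ≫ P₂ ≫ ι' = b := by rw [← Category.assoc, hg₂, hb']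
  have w : g ≫ π = f := by rw [← w₁, ← Category.assoc, hga, wa]
  refine ⟨g, ⟨w, fun i => ?_, fun i => ?_⟩, ?_⟩
  · rw [← ha]
    refine (Subsheaf.pullbackOver_comp w₁ hH w (by rw [hga, wa]) (W.taut.isSubbundle i)).trans ?_
    exact Subsheaf.pullbackOver_congr hga _ _ _
  · rw [← hb]
    refine (Subsheaf.pullbackOver_comp w₂ hH w (by rw [hgb, wb]) (W'.taut.isSubbundle i)).trans ?_
    exact Subsheaf.pullbackOver_congr hgb _ _ _
  · intro g₀ hg₀
    let g' : T ⟶ Limits.pullback t t' := g₀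
    obtain ⟨w', h₁, h₂⟩ : ∃ w : g' ≫ π = f, (∀ a, (u.V.sub a).pullbackOver w = D.V.sub a) ∧
      ∀ a, (u.V'.sub a).pullbackOver w = D.V'.sub a := hg₀
    change g' = g
    refine Limits.pullback.hom_ext ?_ ?_
    · change g' ≫ P₁ = g ≫ P₁
      rw [hg₁, ← cancel_mono ι, Category.assoc]
      refine Eq.trans (W.hom_ext hH (by rw [Category.assoc, w₁, w']) wa fun i => ?_) ha'.symm
      rw [ha, ← h₁]
      exact (Subsheaf.pullbackOver_comp w₁ hH w' _ (W.taut.isSubbundle i)).symm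
    · change g' ≫ P₂ = g ≫ P₂
      rw [hg₂, ← cancel_mono ι', Category.assoc]
      refine Eq.trans (W'.hom_ext hH (by rw [Category.assoc, w₂, w']) wb fun i => ?_) hb'.symm
      rw [hb, ← h₂]
      exact (Subsheaf.pullbackOver_comp w₂ hH w' _ (W'.taut.isSubbundle i)).symm

/-- The pullback of a pair of flags. -/
def FlagPair.pullbackOver (hH : IsVectorBundle H n) {π : Y ⟶ S}
    (u : FlagPair hr hrn p q lam lam' π) {g : T ⟶ Y} (w : g ≫ π = f) :
    FlagPair hr hrn p q lam lam' f where
  V := u.V.pullbackOver w hH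
  V' := u.V'.pullbackOver w hH
  top_eq := congrArg (fun A => Subsheaf.pullbackOver w A) u.top_eq
  le a := (Subsheaf.pullback_pullbackOver w hH (p.isSubbundle _)) ▸
    Subsheaf.pullbackOver_mono w (u.le a)
  le' a := (Subsheaf.pullback_pullbackOver w hH (q.isSubbundle _)) ▸
    Subsheaf.pullbackOver_mono w (u.le' a)

theorem FlagPair.IsUniversal.hom_ext (hH : IsVectorBundle H n) {π : Y ⟶ S}
    {u : FlagPair hr hrn p q lam lam' π} (hu : u.IsUniversal) {g g' : T ⟶ Y} (w : g ≫ π = f)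
    (w' : g' ≫ π = f) (h : ∀ a, (u.V.sub a).pullbackOver w = (u.V.sub a).pullbackOver w')
    (h' : ∀ a, (u.V'.sub a).pullbackOver w = (u.V'.sub a).pullbackOver w') : g = g' :=
  (hu f (u.pullbackOver hH w')).unique ⟨w, h, h'⟩ ⟨w', fun _ => rfl, fun _ => rfl⟩

end

/-! ### Matrices adapted to flags over local rings -/

section
open Matrix

variable {n r : ℕ} {R R' : Type*} [CommRing R] [CommRing R']

theorem cutMod_mono (y : GLn n R) {d d' : ℕ} (h : d ≤ d') : cutMod y d ≤ cutMod y d' :=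
  fun _ hc i hi => hc i (h.trans hi)

theorem chartMat_apply_of_lt {d : ℕ} (σ : Equiv.Perm (Fin n)) (X : ChartIndex n d → R) {i : Fin n}
    (hi : (i : ℕ) < d) (j : Fin n) : (chartMat σ X).1 i j = if σ i = j then 1 else 0 := by
  have h := congrFun (chartMat_mulVec σ X (Pi.single j 1)) i
  rw [mulVec_single_one] at h
  refine h.trans ?_
  have h0 : (lowerLeft X *ᵥ ((Pi.single j 1 : Fin n → R) ∘ σ)) i = 0 :=
    by simp [mulVec, dotProduct, lowerLeft, hi]
  rw [Pi.sub_apply, h0, sub_zero, Function.comp_apply, Pi.single_apply]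

theorem cutMod_mul_congr {y y' : GLn n R} {d : ℕ} (h : cutMod y d = cutMod y' d) (v : GLn n R) :
    cutMod (y * v) d = cutMod (y' * v) d := by
  ext c
  rw [mem_cutMod, mem_cutMod]
  simp only [Units.val_mul, ← mulVec_mulVec]
  rw [← mem_cutMod, ← mem_cutMod, h]

theorem isUnit_det_chartMinor_iff [IsLocalRing R] (y : GLn n R) (d : ℕ) (σ : Equiv.Perm (Fin n)) :
    IsUnit (chartMinor y d σ).det ↔ (chartMinor (gmap (IsLocalRing.residue R) y) d σ).det ≠ 0 := by
  rw [chartMinor_gmap, ← RingHom.mapMatrix_apply, ← RingHom.map_det,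
    IsLocalRing.residue_ne_zero_iff_isUnit]

/-- Put `cutMod z d`, with `z = y' y⁻¹`, in a chart whose permutation fixes the first `m` indices.
Multiplying `y` by this chart matrix produces the member of rank `d` and leaves those of rank at
most `m` unchanged. -/
theorem exists_cutMod_eq_of_le [IsLocalRing R] {y y' : GLn n R} {m d : ℕ} (hmd : m ≤ d)
    (h : cutMod y m ≤ cutMod y' d) : ∃ v : GLn n R, (∀ e ≤ m, cutMod v e = cutMod y e) ∧
      cutMod v d = cutMod y' d := by
  classical
  let z := y' * y⁻¹
  have hz : ∀ i j : Fin n, d ≤ i → (j : ℕ) < m → z.1 i j = 0 := cutMod_le_iff.mp h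
  obtain ⟨σ₀, h₀⟩ := exists_det_chartMinor_ne_zero (gmap (IsLocalRing.residue R) z) d
  -- The columns `< m` of the last rows of `z` vanish, so a nonzero minor cannot use them.
  have hm : ∀ j : Fin n, d ≤ j → m ≤ σ₀ j := by
    intro j hj
    by_contra hlt
    refine h₀ (det_eq_zero_of_column_eq_zero ⟨j, not_lt.mpr hj⟩ fun i => ?_)
    change IsLocalRing.residue R (z.1 i (σ₀ j)) = 0
    rw [hz _ _ (not_lt.mp i.2) (not_le.mp hlt), map_zero]
  -- The permutation is prescribed to be the identity below `m` and `σ₀` from `d` on. This is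
  -- injective by `hm` and extends arbitrarily in between.
  let f : {i : Fin n // (i : ℕ) < m ∨ d ≤ i} → Fin n := fun i => if d ≤ i.1 then σ₀ i else i
  have hf : Function.Injective f := by
    rintro ⟨i, hi⟩ ⟨j, hj⟩ hij
    simp only [f] at hij
    refine Subtype.ext ?_
    split_ifs at hij with h1 h2 h2
    · exact σ₀.injective hij
    · exact absurd (hj.resolve_right h2) (not_lt.mpr (hij ▸ hm i h1))
    · exact absurd (hi.resolve_right h1) (not_lt.mpr (hij ▸ hm j h2))
    · exact hij
  let σ : Equiv.Perm (Fin n) := (Equiv.ofInjective f hf).extendSubtype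
  have hσ₁ : ∀ i : Fin n, (i : ℕ) < m → σ i = i := fun i hi => by
    rw [Equiv.extendSubtype_apply_of_mem _ i (Or.inl hi), Equiv.ofInjective_apply]
    exact if_neg (not_le.mpr (hi.trans_le hmd))
  have hσ₂ : ∀ i : Fin n, d ≤ i → σ i = σ₀ i := fun i hi => by
    rw [Equiv.extendSubtype_apply_of_mem _ i (Or.inr hi), Equiv.ofInjective_apply]
    exact if_pos hi
  have hu : IsUnit (chartMinor z d σ).det := by
    rw [isUnit_det_chartMinor_iff]
    have hc : chartMinor (gmap (IsLocalRing.residue R) z) d σ =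
        chartMinor (gmap (IsLocalRing.residue R) z) d σ₀ := by
      ext i j
      exact congrArg (fun k => (gmap (IsLocalRing.residue R) z).1 i k) (hσ₂ j (not_lt.mp j.2))
    rw [hc]
    exact h₀
  obtain ⟨X, hX⟩ := exists_cutMod_eq_chartMat hu
  have hv : cutMod (chartMat σ X * y) d = cutMod y' d := by
    rw [← cutMod_mul_congr hX y]
    simp only [z, inv_mul_cancel_right]
  refine ⟨chartMat σ X * y, fun e he => (cutMod_eq_of_le ?_).symm, hv⟩
  rw [cutMod_le_iff]
  intro i j hi hj
  have h1 := cutMod_le_iff.mp (h.trans hv.ge)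
  rw [mul_inv_cancel_right] at h1 ⊢
  by_cases hid : d ≤ i
  · exact h1 i j hid (hj.trans_le he)
  · rw [chartMat_apply_of_lt σ X (not_le.mp hid), if_neg]
    intro hij
    rw [← hσ₁ j (hj.trans_le he)] at hij
    exact absurd (σ.injective hij) (fun h => absurd hj (not_lt.mpr (h ▸ hi)))

/-- Over a local ring, a flag is given by a single matrix. -/
theorem exists_adapted [IsLocalRing R] (D : Finset ℕ) (y : ℕ → GLn n R)
    (h : ∀ d ∈ D, ∀ d' ∈ D, d ≤ d' → cutMod (y d) d ≤ cutMod (y d') d') :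
    ∃ v : GLn n R, ∀ d ∈ D, cutMod v d = cutMod (y d) d := by
  induction D using Finset.induction_on_max with
  | empty => exact ⟨1, fun d hd => absurd hd (Finset.notMem_empty d)⟩
  | insert a D hD ih =>
    obtain ⟨v, hv⟩ := ih fun d hd d' hd' => h d (Finset.mem_insert_of_mem hd) d'
      (Finset.mem_insert_of_mem hd')
    obtain rfl | hne := D.eq_empty_or_nonempty
    · exact ⟨y a, fun d hd => by rw [Finset.mem_singleton.mp hd]⟩
    let m := D.max' hne
    have hm : m ∈ D := D.max'_mem hne
    obtain ⟨v', h₁, h₂⟩ := exists_cutMod_eq_of_le (hD m hm).le ((hv m hm).trans_le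
      (h m (Finset.mem_insert_of_mem hm) a (Finset.mem_insert_self a D) (hD m hm).le))
    refine ⟨v', fun d hd => ?_⟩
    obtain rfl | hd := Finset.mem_insert.mp hd
    · exact h₂
    · rw [h₁ d (D.le_max' d hd), hv d hd]

/-- Lift entry by entry, choosing `0` as the lift of `0`; the determinant is a unit because `φ` is
local. Keeping the zeros is the point, since incidence conditions are vanishing of entries. -/
theorem exists_gmap_eq (φ : R →+* R') (hφ : Function.Surjective φ) [IsLocalHom φ] (z : GLn n R') :
    ∃ y : GLn n R, gmap φ y = z ∧ ∀ i j, z.1 i j = 0 → y.1 i j = 0 := by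
  classical
  let g : R' → R := fun x => if x = 0 then 0 else Function.surjInv hφ x
  have hg : ∀ x, φ (g x) = x := fun x => by
    by_cases hx : x = 0
    · simp [g, hx]
    · simp [g, hx, Function.surjInv_eq hφ]
  let M : Matrix (Fin n) (Fin n) R := z.1.map g
  have hM : M.map φ = z.1 := by
    ext i j
    exact hg _
  have hu : IsUnit M.det := by
    refine IsUnit.of_map φ _ ?_
    rw [RingHom.map_det, RingHom.mapMatrix_apply, hM]
    exact (isUnit_iff_isUnit_det _).mp z.isUnit
  refine ⟨M.nonsingInvUnit hu, Units.ext hM, fun i j h => ?_⟩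
  exact if_pos h

/-- Matrices `v`, `v'`, `y`, `y'` describing flags `V`, `V'`, `p`, `q` with `V ⊆ p`, `V' ⊆ q` in the
positions prescribed by two partitions, and such that `V` and `V'` have the same top member. -/
structure IsAdapted (lam lam' : AdmissiblePartition r n) (v v' y y' : GLn n R) : Prop where
  top_eq : cutMod v r = cutMod v' r
  le : ∀ a ∈ lam.corners, cutMod v a ≤ cutMod y (lam.index a)
  le' : ∀ a ∈ lam'.corners, cutMod v' a ≤ cutMod y' (lam'.index a)

variable {lam lam' : AdmissiblePartition r n}

theorem IsAdapted.map (φ : R →+* R') {v v' y y' : GLn n R} (h : IsAdapted lam lam' v v' y y') :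
    IsAdapted lam lam' (gmap φ v) (gmap φ v') (gmap φ y) (gmap φ y') :=
  ⟨cutMod_eq_of_le (cutMod_gmap_le φ h.top_eq.le), fun a ha => cutMod_gmap_le φ (h.le a ha),
    fun a ha => cutMod_gmap_le φ (h.le' a ha)⟩

/-- Lift `v` and the transition matrices `v' v⁻¹`, `y v⁻¹`, `y' v'⁻¹` rather than the matrices
themselves: the conditions are zero patterns of these transitions, which `exists_gmap_eq` preserves.
-/
theorem IsAdapted.exists_lift (φ : R →+* R') (hφ : Function.Surjective φ) [IsLocalHom φ]
    {v v' y y' : GLn n R'} (h : IsAdapted lam lam' v v' y y') :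
    ∃ w w' z z' : GLn n R, IsAdapted lam lam' w w' z z' ∧ gmap φ w = v ∧ gmap φ w' = v' ∧
      gmap φ z = y ∧ gmap φ z' = y' := by
  obtain ⟨w, hw, -⟩ := exists_gmap_eq φ hφ v
  obtain ⟨b, hb, hb₀⟩ := exists_gmap_eq φ hφ (v' * v⁻¹)
  obtain ⟨z, hz, hz₀⟩ := exists_gmap_eq φ hφ (y * v⁻¹)
  obtain ⟨z', hz', hz₀'⟩ := exists_gmap_eq φ hφ (y' * v'⁻¹)
  have hw' : gmap φ (b * w) = v' := by rw [gmap_mul, hb, hw, inv_mul_cancel_right]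
  refine ⟨w, b * w, z * w, z' * (b * w), ⟨cutMod_eq_of_le ?_, fun a ha => ?_, fun a ha => ?_⟩, hw,
    hw', ?_, ?_⟩
  · rw [cutMod_le_iff, mul_inv_cancel_right]
    exact fun i j hi hj => hb₀ i j (cutMod_le_iff.mp h.top_eq.le i j hi hj)
  · rw [cutMod_le_iff, mul_inv_cancel_right]
    exact fun i j hi hj => hz₀ i j (cutMod_le_iff.mp (h.le a ha) i j hi hj)
  · rw [cutMod_le_iff, mul_inv_cancel_right]
    exact fun i j hi hj => hz₀' i j (cutMod_le_iff.mp (h.le' a ha) i j hi hj)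
  · rw [gmap_mul, hz, hw, inv_mul_cancel_right]
  · rw [gmap_mul, hz', hw', inv_mul_cancel_right]

end

/-! ### Flags in a global frame -/

section

variable {X : Scheme.{u}} {M N : X.Modules} {n : ℕ}

theorem Subsheaf.Cut.eq_iff {A B : Subsheaf M} {e : Fin n → Γ(M, ⊤)} (he : IsFrame M ⊤ e)
    {d d' : ℕ} {y y' : GLn n Γ(X, ⊤)} (hA : A.Cut e d y) (hB : B.Cut e d' y') :
    A = B ↔ cutMod y d = cutMod y' d' := by
  rw [← hA.sec_eq_iff he hB]
  refine ⟨fun h W _ => by rw [h], fun h => ?_⟩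
  ext W : 2
  exact h W le_top

theorem Subsheaf.Cut.le_iff_top {A B : Subsheaf M} {e : Fin n → Γ(M, ⊤)} (he : IsFrame M ⊤ e)
    {d d' : ℕ} {y y' : GLn n Γ(X, ⊤)} (hA : A.Cut e d y) (hB : B.Cut e d' y') :
    A ≤ B ↔ cutMod y d ≤ cutMod y' d' := by
  rw [← hA.le_iff he hB]
  exact ⟨fun h W _ => h W, fun h W => h W le_top⟩

theorem IsFrame.exists_subbundle_cut {e : Fin n → Γ(M, ⊤)} (he : IsFrame M ⊤ e) {d : ℕ}
    (hd : d ≤ n) (y : GLn n Γ(X, ⊤)) : ∃ A : Subsheaf M, A.IsSubbundle d ∧ A.Cut e d y := by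
  obtain ⟨A, hA⟩ := he.exists_cut d y
  exact ⟨A, Subsheaf.isSubbundle_of_cut fun t => ⟨n, ⊤, e, y, hd, trivial, he, hA⟩, hA⟩

/-- The flag with members of rank `d` given by a matrix. -/
theorem IsFrame.exists_bundleFlag {e : Fin n → Γ(M, ⊤)} (he : IsFrame M ⊤ e) {D : Finset ℕ}
    (hD : ∀ d ∈ D, d ≤ n) (y : GLn n Γ(X, ⊤)) :
    ∃ V : BundleFlag M D, ∀ d, (V.sub d).Cut e d y := by
  choose A hA hA' using fun d : D => he.exists_subbundle_cut (hD d d.2) y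
  exact ⟨⟨A, hA, fun d d' h => ((hA' d).le_iff_top he (hA' d')).mpr (cutMod_mono y h)⟩, hA'⟩

theorem Subsheaf.IsSubbundle.exists_cut_top {C : CommRingCat.{u}} [IsLocalRing C]
    {M : (Spec C).Modules} {A : Subsheaf M} {d : ℕ} (hA : A.IsSubbundle d)
    {e : Fin n → Γ(M, ⊤)} (he : IsFrame M ⊤ e) : ∃ y : GLn n Γ(Spec C, ⊤), A.Cut e d y := by
  obtain ⟨-, W, k, y, ht, hy⟩ := hA.exists_cut he (t := IsLocalRing.closedPoint C) trivial
  obtain rfl := opens_eq_top_of_closedPoint_mem ht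
  simp only [res_self] at hy
  exact ⟨y, hy⟩

instance {C : CommRingCat.{u}} [IsLocalRing C] : IsLocalRing Γ(Spec C, ⊤) :=
  (Scheme.ΓSpecIso C).symm.commRingCatIsoToRingEquiv.isLocalRing

theorem BundleFlag.exists_cut {C : CommRingCat.{u}} [IsLocalRing C]
    {M : (Spec C).Modules} {D : Finset ℕ} (V : BundleFlag M D)
    {e : Fin n → Γ(M, ⊤)} (he : IsFrame M ⊤ e) :
    ∃ y : GLn n Γ(Spec C, ⊤), ∀ d, (V.sub d).Cut e d y := by
  choose y hy using fun d : D => (V.isSubbundle d).exists_cut_top he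
  obtain ⟨v, hv⟩ := exists_adapted D (fun d => if hd : d ∈ D then y ⟨d, hd⟩ else 1)
    (fun d hd d' hd' h => by
      simp only [dif_pos hd, dif_pos hd']
      exact ((hy ⟨d, hd⟩).le_iff_top he (hy ⟨d', hd'⟩)).mp (V.le _ _ h))
  refine ⟨v, fun d => (hy d).congr ?_⟩
  rw [hv d d.2, dif_pos d.2]

end

/-! ### Subsheaves with the same coordinates -/

section

variable {X : Scheme.{u}} {M N : X.Modules} {n : ℕ}

/-- The sections of `A` and of `A'` have the same coordinates in the frames `e` and `e'`. -/
def SameCoord (A : Subsheaf M) (e : Fin n → Γ(M, ⊤)) (A' : Subsheaf N) (e' : Fin n → Γ(N, ⊤)) :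
    Prop :=
  ∀ (U : X.Opens) (c : Fin n → Γ(X, U)), lin e le_top c ∈ A.sec U ↔ lin e' le_top c ∈ A'.sec U

variable {A B : Subsheaf M} {e : Fin n → Γ(M, ⊤)} {A' B' : Subsheaf N} {e' : Fin n → Γ(N, ⊤)}

theorem SameCoord.symm (h : SameCoord A e A' e') : SameCoord A' e' A e := fun U c => (h U c).symm

theorem SameCoord.cut (h : SameCoord A e A' e') {U : X.Opens} (k : U ≤ ⊤) {d : ℕ}
    {y : GLn n Γ(X, U)} (hA : A.Cut (fun i => res M k (e i)) d y) :
    A'.Cut (fun i => res N k (e' i)) d y := by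
  intro W hW c
  rw [← hA hW c, lin_res, lin_res]
  exact (h W c).symm

theorem SameCoord.cut_top (h : SameCoord A e A' e') {d : ℕ} {y : GLn n Γ(X, ⊤)}
    (hA : A.Cut e d y) : A'.Cut e' d y := fun W hW c => (h W c).symm.trans (hA hW c)

theorem SameCoord.of_local (h : ∀ t : X, ∃ (W : X.Opens) (_ : t ∈ W) (d : ℕ) (y : GLn n Γ(X, W)),
    A.Cut (fun i => res M le_top (e i)) d y ∧ A'.Cut (fun i => res N le_top (e' i)) d y) :
    SameCoord A e A' e' := by
  have aux : ∀ (U : X.Opens) (c : Fin n → Γ(X, U)) (W : X.Opens) (d : ℕ) (y : GLn n Γ(X, W)),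
      A.Cut (fun i => res M le_top (e i)) d y → A'.Cut (fun i => res N le_top (e' i)) d y →
      (res M (inf_le_left : U ⊓ W ≤ U) (lin e le_top c) ∈ A.sec (U ⊓ W) ↔
        res N (inf_le_left : U ⊓ W ≤ U) (lin e' le_top c) ∈ A'.sec (U ⊓ W)) := by
    intro U c W d y hA hA'
    rw [res_lin, res_lin]
    have h1 := hA inf_le_right (rmap (inf_le_left : U ⊓ W ≤ U) ∘ c)
    have h2 := hA' inf_le_right (rmap (inf_le_left : U ⊓ W ≤ U) ∘ c)
    rw [lin_res] at h1 h2
    exact h1.trans h2.symm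
  intro U c
  refine ⟨fun hx => A'.of_local _ fun t ht => ?_, fun hx => A.of_local _ fun t ht => ?_⟩
  · obtain ⟨W, htW, d, y, hA, hA'⟩ := h t
    exact ⟨U ⊓ W, inf_le_left, ⟨ht, htW⟩, (aux U c W d y hA hA').mp (A.res_mem _ hx)⟩
  · obtain ⟨W, htW, d, y, hA, hA'⟩ := h t
    exact ⟨U ⊓ W, inf_le_left, ⟨ht, htW⟩, (aux U c W d y hA hA').mpr (A'.res_mem _ hx)⟩

theorem SameCoord.isSubbundle (h : SameCoord A e A' e') (he : IsFrame M ⊤ e)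
    (he' : IsFrame N ⊤ e') {d : ℕ} (hA : A.IsSubbundle d) : A'.IsSubbundle d := by
  refine Subsheaf.isSubbundle_of_cut fun t => ?_
  obtain ⟨hd, W, k, y, ht, hy⟩ := hA.exists_cut he (t := t) trivial
  exact ⟨n, W, _, y, hd, ht, he'.res k, h.cut k hy⟩

theorem SameCoord.le (h : SameCoord A e A' e') (h' : SameCoord B e B' e') (he' : IsFrame N ⊤ e')
    (hAB : A ≤ B) : A' ≤ B' := by
  intro U x hx
  rw [← he'.lin_coord le_top x] at hx ⊢
  exact (h' U _).mp (hAB U ((h U _).mpr hx))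

theorem exists_iso_of_isFrame (he : IsFrame M ⊤ e) (he' : IsFrame N ⊤ e') :
    ∃ θ : M ≅ N, ∀ i, θ.hom.app ⊤ (e i) = e' i := by
  obtain ⟨φ, hφ⟩ := exists_hom_of_isFrame he e'
  obtain ⟨ψ, hψ⟩ := exists_hom_of_isFrame he' e
  refine ⟨⟨φ, ψ, hom_ext_of_isFrame he fun i => ?_, hom_ext_of_isFrame he' fun i => ?_⟩, hφ⟩
  · exact (congrArg (ψ.app ⊤) (hφ i)).trans (hψ i)
  · exact (congrArg (φ.app ⊤) (hψ i)).trans (hφ i)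

theorem exists_sameCoord (he : IsFrame M ⊤ e) (he' : IsFrame N ⊤ e') (A : Subsheaf M) :
    ∃ A' : Subsheaf N, SameCoord A e A' e' := by
  obtain ⟨θ, hθ⟩ := exists_iso_of_isFrame he' he
  refine ⟨A.comap θ.hom, fun U c => ?_⟩
  change _ ↔ θ.hom.app U (lin e' le_top c) ∈ A.sec U
  rw [hom_app_lin]
  simp only [hθ]

end

/-! ### Base change of coordinates in global frames. -/

section

variable {T Y S S' : Scheme.{u}} {H : S.Modules} {H' : S'.Modules} {n : ℕ}
  {g : T ⟶ Y} {π : Y ⟶ S} {f : T ⟶ S} {π' : Y ⟶ S'} {f' : T ⟶ S'}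

theorem Subsheaf.Cut.pullTop (w : g ≫ π = f) {A : Subsheaf ((Scheme.Modules.pullback π).obj H)}
    {e : Fin n → Γ((Scheme.Modules.pullback π).obj H, ⊤)} (he : IsFrame _ ⊤ e) {d : ℕ}
    {y : GLn n Γ(Y, ⊤)} (hA : A.Cut e d y) :
    (A.pullbackOver w).Cut (fun i => RelGrass.pullTop w (e i)) d (gmap g.appTop.hom y) := by
  have h1 := (hA.pullbackOver w he).res (top_le_preimage g)
  have h2 : gmap (rmap (top_le_preimage g)) (gmap (g.app ⊤).hom y) = gmap g.appTop.hom y := by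
    rw [gmap_gmap]
    congr 1
    ext x
    exact rmap_app_top g x
  rwa [h2] at h1

theorem SameCoord.pullbackOver (w : g ≫ π = f) (w' : g ≫ π' = f')
    {A : Subsheaf ((Scheme.Modules.pullback π).obj H)}
    {e : Fin n → Γ((Scheme.Modules.pullback π).obj H, ⊤)}
    {A' : Subsheaf ((Scheme.Modules.pullback π').obj H')}
    {e' : Fin n → Γ((Scheme.Modules.pullback π').obj H', ⊤)} (he : IsFrame _ ⊤ e)
    (he' : IsFrame _ ⊤ e') {d : ℕ} (hA : A.IsSubbundle d) (h : SameCoord A e A' e') :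
    SameCoord (A.pullbackOver w) (fun i => pullTop w (e i)) (A'.pullbackOver w')
      (fun i => pullTop w' (e' i)) := by
  refine SameCoord.of_local fun t => ?_
  obtain ⟨-, W, k, y, ht, hy⟩ := hA.exists_cut he (t := g t) trivial
  refine ⟨g ⁻¹ᵁ W, ht, d, gmap (g.app W).hom y, ?_, ?_⟩
  · simp only [res_pullTop]
    exact hy.pullbackOver w (he.res k)
  · simp only [res_pullTop]
    exact (h.cut k hy).pullbackOver w' (he'.res k)

theorem pullTop_fr (w : g ≫ π = f) {U : S.Opens} (h : Fin n → Γ(H, U)) (k : ⊤ ≤ π ⁻¹ᵁ U)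
    (k' : ⊤ ≤ f ⁻¹ᵁ U) (i : Fin n) : pullTop w (fr π h k i) = fr f h k' i := by
  rw [pullTop, pullSecOver_fr]
  exact congrFun (res_fr f h _ _) i

end

/-! ### The morphisms from the frame bundle to the flag variety -/

section

variable {B S T : Scheme.{u}} {s : S ⟶ B} {n : ℕ} {H : S.Modules} {p : CompleteFlag H n}
  {F : FrameBundle H n} {Fl : FlagBundle (trivialBundle B n) (Finset.range (n + 1))}

theorem isInducedBy_iff {φ : F.scheme ⟶ Fl.scheme} (k : ⊤ ≤ (F.π ≫ s) ⁻¹ᵁ ⊤) :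
    IsInducedBy s p F Fl φ ↔ ∃ w : φ ≫ Fl.π = F.π ≫ s, ∀ d,
      SameCoord ((Fl.taut.sub d).pullbackOver w) (fr (F.π ≫ s) (standardFrame B n) k)
        ((p.sub d).pullback F.π) F.frame := by
  refine exists_congr fun w => forall_congr' fun d => forall_congr' fun U => forall_congr' fun c => ?_
  rw [lin_apply, lin_apply]
  simp only [fr, res_res]
  exact Iff.rfl

theorem exists_isInducedBy (hH : IsVectorBundle H n) (s : S ⟶ B) (p : CompleteFlag H n)
    (F : FrameBundle H n) (Fl : FlagBundle (trivialBundle B n) (Finset.range (n + 1))) :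
    ∃ φ, IsInducedBy s p F Fl φ := by
  have k : ⊤ ≤ (F.π ≫ s) ⁻¹ᵁ ⊤ := fun _ _ => trivial
  have he := isFrame_fr (F.π ≫ s) (isFrame_standardFrame B n) k
  choose A hA using fun d => exists_sameCoord F.isFrame he ((p.sub d).pullback F.π)
  obtain ⟨φ, w, hφ⟩ := Fl.exists_hom (F.π ≫ s)
    ⟨A, fun d => (hA d).isSubbundle F.isFrame he ((p.isSubbundle d).pullback hH F.π),
      fun d d' h => (hA d).le (hA d') he (Subsheaf.pullback_mono _ (p.le d d' h))⟩
  exact ⟨φ, (isInducedBy_iff k).mpr ⟨w, fun d => (hφ d) ▸ (hA d).symm⟩⟩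

theorem IsInducedBy.sameCoord (hH : IsVectorBundle H n) {φ : F.scheme ⟶ Fl.scheme}
    (hφ : IsInducedBy s p F Fl φ) {a : T ⟶ F.scheme} {f : T ⟶ S} (w : a ≫ F.π = f) {c : T ⟶ B}
    (w' : (a ≫ φ) ≫ Fl.π = c) (k : ⊤ ≤ c ⁻¹ᵁ ⊤) (d : Finset.range (n + 1)) :
    SameCoord ((Fl.taut.sub d).pullbackOver w') (fr c (standardFrame B n) k)
      ((p.sub d).pullback f) (fun i => pullTop w (F.frame i)) := by
  have hB := isVectorBundle_trivialBundle B n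
  have k₀ : ⊤ ≤ (F.π ≫ s) ⁻¹ᵁ ⊤ := fun _ _ => trivial
  obtain ⟨wφ, h⟩ := (isInducedBy_iff k₀).mp hφ
  have w₁ : a ≫ F.π ≫ s = c := by rw [← w', Category.assoc, wφ]
  have h1 := (h d).pullbackOver w₁ w (isFrame_fr _ (isFrame_standardFrame B n) k₀) F.isFrame
    ((Fl.taut.isSubbundle d).pullbackOver wφ hB)
  rw [Subsheaf.pullbackOver_comp wφ hB w₁ w' (Fl.taut.isSubbundle d),
    Subsheaf.pullback_pullbackOver w hH (p.isSubbundle d)] at h1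
  have h2 : (fun i => pullTop w₁ (fr (F.π ≫ s) (standardFrame B n) k₀ i)) =
    fr c (standardFrame B n) k := funext fun i => pullTop_fr w₁ _ k₀ k i
  rwa [h2] at h1

end

/-! ### Pairs of flags given by matrices -/

section

variable {T Y S : Scheme.{u}} {H : S.Modules} {r n : ℕ} {f : T ⟶ S} {hr : 1 ≤ r} {hrn : r ≤ n}
  {p q : CompleteFlag H n} {lam lam' : AdmissiblePartition r n}

/-- The flags of the pair and the reference flags are given by matrices in the frame `e`. -/
structure FlagPair.Cut (D : FlagPair hr hrn p q lam lam' f)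
    (e : Fin n → Γ((Scheme.Modules.pullback f).obj H, ⊤)) (v v' y y' : GLn n Γ(T, ⊤)) : Prop where
  V : ∀ a, (D.V.sub a).Cut e a v
  V' : ∀ a, (D.V'.sub a).Cut e a v'
  p : ∀ d, ((p.sub d).pullback f).Cut e d y
  q : ∀ d, ((q.sub d).pullback f).Cut e d y'

variable {D D' : FlagPair hr hrn p q lam lam' f}
  {e : Fin n → Γ((Scheme.Modules.pullback f).obj H, ⊤)} {v v' y y' : GLn n Γ(T, ⊤)}

theorem FlagPair.Cut.isAdapted (h : D.Cut e v v' y y') (he : IsFrame _ ⊤ e) :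
    IsAdapted lam lam' v v' y y' :=
  ⟨((h.V ⟨r, lam.self_mem_corners hr⟩).eq_iff he (h.V' ⟨r, lam'.self_mem_corners hr⟩)).mp D.top_eq,
    fun a ha => ((h.V ⟨a, ha⟩).le_iff_top he (h.p _)).mp (D.le ⟨a, ha⟩),
    fun a ha => ((h.V' ⟨a, ha⟩).le_iff_top he (h.q _)).mp (D.le' ⟨a, ha⟩)⟩

theorem FlagPair.exists_cut_of_isLocalRing {C : CommRingCat.{u}} [IsLocalRing C] {f : Spec C ⟶ S}
    (hH : IsVectorBundle H n) (D : FlagPair hr hrn p q lam lam' f)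
    {e : Fin n → Γ((Scheme.Modules.pullback f).obj H, ⊤)} (he : IsFrame _ ⊤ e) :
    ∃ v v' y y', D.Cut e v v' y y' := by
  obtain ⟨v, hv⟩ := D.V.exists_cut he
  obtain ⟨v', hv'⟩ := D.V'.exists_cut he
  obtain ⟨y, hy⟩ := (p.pullback hH f).exists_cut he
  obtain ⟨y', hy'⟩ := (q.pullback hH f).exists_cut he
  exact ⟨v, v', y, y', hv, hv', hy, hy'⟩

theorem FlagPair.exists_of_isAdapted (hr : 1 ≤ r) (hrn : r ≤ n) (he : IsFrame _ ⊤ e)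
    (h : IsAdapted lam lam' v v' y y') (hp : ∀ d, ((p.sub d).pullback f).Cut e d y)
    (hq : ∀ d, ((q.sub d).pullback f).Cut e d y') :
    ∃ D : FlagPair hr hrn p q lam lam' f, D.Cut e v v' y y' := by
  obtain ⟨V, hV⟩ := he.exists_bundleFlag (D := lam.corners)
    (fun a ha => (Finset.mem_Icc.mp (lam.corners_subset ha)).2.trans hrn) v
  obtain ⟨V', hV'⟩ := he.exists_bundleFlag (D := lam'.corners)
    (fun a ha => (Finset.mem_Icc.mp (lam'.corners_subset ha)).2.trans hrn) v'
  exact ⟨⟨V, V', ((hV _).eq_iff he (hV' _)).mpr h.top_eq,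
    fun a => ((hV a).le_iff_top he (hp _)).mpr (h.le a a.2),
    fun a => ((hV' a).le_iff_top he (hq _)).mpr (h.le' a a.2)⟩, hV, hV', hp, hq⟩

theorem FlagPair.Cut.pullbackOver (hH : IsVectorBundle H n) {π : Y ⟶ S} {g : T ⟶ Y} (w : g ≫ π = f)
    {D : FlagPair hr hrn p q lam lam' π} {e : Fin n → Γ((Scheme.Modules.pullback π).obj H, ⊤)}
    {v v' y y' : GLn n Γ(Y, ⊤)} (he : IsFrame _ ⊤ e) (h : D.Cut e v v' y y') :
    (D.pullbackOver hH w).Cut (fun i => pullTop w (e i)) (gmap g.appTop.hom v)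
      (gmap g.appTop.hom v') (gmap g.appTop.hom y) (gmap g.appTop.hom y') where
  V a := (h.V a).pullTop w he
  V' a := (h.V' a).pullTop w he
  p d := Subsheaf.pullback_pullbackOver w hH (p.isSubbundle d) ▸ (h.p d).pullTop w he
  q d := Subsheaf.pullback_pullbackOver w hH (q.isSubbundle d) ▸ (h.q d).pullTop w he

theorem gmap_appTop_comp {T' : Scheme.{u}} (g' : T' ⟶ T) (g : T ⟶ Y) (y : GLn n Γ(Y, ⊤)) :
    gmap (g' ≫ g).appTop.hom y = gmap g'.appTop.hom (gmap g.appTop.hom y) := by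
  rw [gmap_gmap]
  congr 1

end

/-! ### Deformations of points of the universal pair of flags -/

section

variable {B S P T₀ T : Scheme.{u}} {s : S ⟶ B} {H : S.Modules} {r n : ℕ} {hr : 1 ≤ r} {hrn : r ≤ n}
  {p q : CompleteFlag H n} {lam lam' : AdmissiblePartition r n} {π : P ⟶ S}
  {u : FlagPair hr hrn p q lam lam' π}

/-- Versality is used here. The matrices `y`, `y'` define a morphism `β` from `T` to `Fl × Fl`, and
`Y` is its fibre product with the frame bundle, hence smooth over `T`. In the tautological frame
over `Y` the flags `p`, `q` have matrices `y`, `y'`, so `v`, `v'` define a pair of flags there, that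
is, a morphism to `P`. The frame `e₀` provides the point `j` of `Y` over `T₀`. -/
theorem exists_smooth_family (hH : IsVectorBundle H n) (hpq : IsVersal s p q)
    (hu : u.IsUniversal) (ι : T₀ ⟶ T) (x : T₀ ⟶ P) (c : T ⟶ B) (hc : ι ≫ c = x ≫ π ≫ s)
    {e₀ : Fin n → Γ((Scheme.Modules.pullback (x ≫ π)).obj H, ⊤)} (he₀ : IsFrame _ ⊤ e₀)
    {v v' y y' : GLn n Γ(T, ⊤)} (ad : IsAdapted lam lam' v v' y y')
    (h₀ : (u.pullbackOver hH (rfl : x ≫ π = _)).Cut e₀ (gmap ι.appTop.hom v)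
      (gmap ι.appTop.hom v') (gmap ι.appTop.hom y) (gmap ι.appTop.hom y')) :
    ∃ (Y : Scheme.{u}) (τ : Y ⟶ T) (j : T₀ ⟶ Y) (g : Y ⟶ P) (f : Y ⟶ S) (w : g ≫ π = f)
      (e : Fin n → Γ((Scheme.Modules.pullback f).obj H, ⊤)), Smooth τ ∧ j ≫ τ = ι ∧ j ≫ g = x ∧
      f ≫ s = τ ≫ c ∧ IsFrame _ ⊤ e ∧ (u.pullbackOver hH w).Cut e (gmap τ.appTop.hom v)
        (gmap τ.appTop.hom v') (gmap τ.appTop.hom y) (gmap τ.appTop.hom y') := by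
  obtain ⟨F⟩ := nonempty_frameBundle hH
  have hB := isVectorBundle_trivialBundle B n
  have hD : ∀ d ∈ Finset.range (n + 1), d ≤ n := fun d hd => Nat.lt_succ_iff.mp
    (Finset.mem_range.mp hd)
  obtain ⟨Fl, -⟩ := FlagBundle.exists_isProper hB hD
  have hst := isFrame_standardFrame B n
  obtain ⟨φ, hφ⟩ := exists_isInducedBy hH s p F Fl
  obtain ⟨ψ, hψ⟩ := exists_isInducedBy hH s q F Fl
  have wφ : φ ≫ Fl.π = F.π ≫ s := hφ.choose
  have wψ : ψ ≫ Fl.π = F.π ≫ s := hψ.choose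
  have hsm := hpq F Fl φ ψ hφ hψ (wφ.trans wψ.symm)
  let α := Limits.pullback.lift φ ψ (wφ.trans wψ.symm)
  have kc : ⊤ ≤ c ⁻¹ᵁ ⊤ := fun _ _ => trivial
  have hfr := isFrame_fr c hst kc
  obtain ⟨Vp, hVp⟩ := hfr.exists_bundleFlag hD y
  obtain ⟨Vq, hVq⟩ := hfr.exists_bundleFlag hD y'
  obtain ⟨b, wb, hb⟩ := Fl.exists_hom c Vp
  obtain ⟨b', wb', hb'⟩ := Fl.exists_hom c Vq
  let β := Limits.pullback.lift b b' (wb.trans wb'.symm)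
  obtain ⟨a, ⟨wa, ha⟩, -⟩ := F.existsUnique (x ≫ π) e₀ he₀
  have ha' : ∀ i, pullTop wa (F.frame i) = e₀ i := fun i => (res_self _ _ _).trans (ha i)
  -- Both composites classify the flag on the trivial bundle over `T₀` whose matrix is the pullback
  -- of `z`: one because the reference flag has this matrix in the frame `e₀`, the other by the
  -- choice of `b₀`.
  have key : ∀ {p₀ : CompleteFlag H n} {φ₀ : F.scheme ⟶ Fl.scheme} {b₀ : T ⟶ Fl.scheme}
      {z : GLn n Γ(T, ⊤)} (_ : IsInducedBy s p₀ F Fl φ₀) (w₀ : b₀ ≫ Fl.π = c)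
      (_ : ∀ d, ((Fl.taut.sub d).pullbackOver w₀).Cut (fr c (standardFrame B n) kc) d z)
      (_ : ∀ d, ((p₀.sub d).pullback (x ≫ π)).Cut e₀ d (gmap ι.appTop.hom z)),
      a ≫ φ₀ = ι ≫ b₀ := by
    intro p₀ φ₀ b₀ z hφ₀ w₀ hz hz₀
    have w₁ : (ι ≫ b₀) ≫ Fl.π = ι ≫ c := by rw [Category.assoc, w₀]
    have w₂ : (a ≫ φ₀) ≫ Fl.π = ι ≫ c := by
      rw [Category.assoc, hφ₀.choose, ← Category.assoc, wa, hc, Category.assoc]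
    have k : ⊤ ≤ (ι ≫ c) ⁻¹ᵁ ⊤ := fun _ _ => trivial
    refine Fl.hom_ext hB w₂ w₁ fun d => ?_
    have h1 := (hφ₀.sameCoord hH wa w₂ k d).symm
    simp only [ha'] at h1
    have h2 := Subsheaf.CutAt.pullbackOver_top (rfl : ι ≫ c = _) hst (hz d) k
    rw [Subsheaf.pullbackOver_comp w₀ hB rfl w₁ (Fl.taut.isSubbundle d)] at h2
    exact ((h1.cut_top (hz₀ d)).eq_iff (isFrame_fr _ hst k) h2).mpr rfl
  have hab : a ≫ α = ι ≫ β := by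
    refine Limits.pullback.hom_ext ?_ ?_
    · rw [Category.assoc, Category.assoc, Limits.pullback.lift_fst, Limits.pullback.lift_fst]
      exact key hφ wb (fun d => (hb d).symm ▸ hVp d) h₀.p
    · rw [Category.assoc, Category.assoc, Limits.pullback.lift_snd, Limits.pullback.lift_snd]
      exact key hψ wb' (fun d => (hb' d).symm ▸ hVq d) h₀.q
  let Y := Limits.pullback α β
  let aY : Y ⟶ F.scheme := Limits.pullback.fst α β
  let τ : Y ⟶ T := Limits.pullback.snd α β
  have hcond : aY ≫ α = τ ≫ β := Limits.pullback.condition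
  have hcφ : aY ≫ φ = τ ≫ b := by
    have := congrArg (· ≫ Limits.pullback.fst Fl.π Fl.π) hcond
    simpa only [Category.assoc, α, β, Limits.pullback.lift_fst] using this
  have hcψ : aY ≫ ψ = τ ≫ b' := by
    have := congrArg (· ≫ Limits.pullback.snd Fl.π Fl.π) hcond
    simpa only [Category.assoc, α, β, Limits.pullback.lift_snd] using this
  let j : T₀ ⟶ Y := Limits.pullback.lift a ι hab
  have hj₁ : j ≫ aY = a := Limits.pullback.lift_fst _ _ _
  have hj₂ : j ≫ τ = ι := Limits.pullback.lift_snd _ _ _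
  let f : Y ⟶ S := aY ≫ F.π
  let e : Fin n → Γ((Scheme.Modules.pullback f).obj H, ⊤) :=
    fun i => pullTop (rfl : aY ≫ F.π = f) (F.frame i)
  have he : IsFrame _ ⊤ e := F.isFrame.pullTop rfl
  have wf : f ≫ s = τ ≫ c := by
    rw [← wb, ← Category.assoc, ← hcφ, Category.assoc, Category.assoc, wφ]
  have kτ : ⊤ ≤ (τ ≫ c) ⁻¹ᵁ ⊤ := fun _ _ => trivial
  -- The equality `aY ≫ φ₀ = τ ≫ b₀` built into the fibre product says that in the frame `e` the
  -- reference flag has the matrix pulled back from `T`.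
  have keyY : ∀ {p₀ : CompleteFlag H n} {φ₀ : F.scheme ⟶ Fl.scheme} {b₀ : T ⟶ Fl.scheme}
      {z : GLn n Γ(T, ⊤)} (_ : IsInducedBy s p₀ F Fl φ₀) (w₀ : b₀ ≫ Fl.π = c)
      (_ : ∀ d, ((Fl.taut.sub d).pullbackOver w₀).Cut (fr c (standardFrame B n) kc) d z)
      (_ : aY ≫ φ₀ = τ ≫ b₀) (d : Finset.range (n + 1)),
      ((p₀.sub d).pullback f).Cut e d (gmap τ.appTop.hom z) := by
    intro p₀ φ₀ b₀ z hφ₀ w₀ hz hab d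
    have w₁ : (τ ≫ b₀) ≫ Fl.π = τ ≫ c := by rw [Category.assoc, w₀]
    have w₂ : (aY ≫ φ₀) ≫ Fl.π = τ ≫ c := by rw [hab, w₁]
    have h1 := hφ₀.sameCoord hH (rfl : aY ≫ F.π = f) w₂ kτ d
    refine h1.cut_top ?_
    have h2 := Subsheaf.CutAt.pullbackOver_top (rfl : τ ≫ c = _) hst (hz d) kτ
    rw [Subsheaf.pullbackOver_comp w₀ hB rfl w₁ (Fl.taut.isSubbundle d)] at h2
    rw [Subsheaf.pullbackOver_congr hab w₂ w₁]
    exact h2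
  obtain ⟨D, hDc⟩ := FlagPair.exists_of_isAdapted hr hrn he (ad.map τ.appTop.hom)
    (keyY hφ wb (fun d => (hb d).symm ▸ hVp d) hcφ) (keyY hψ wb' (fun d => (hb' d).symm ▸ hVq d) hcψ)
  obtain ⟨g, ⟨w, hg, hg'⟩, -⟩ := hu f D
  have wj : j ≫ f = x ≫ π := by rw [← wa, ← hj₁, Category.assoc]
  have wjg : (j ≫ g) ≫ π = x ≫ π := by rw [Category.assoc, w, wj]
  have hje : ∀ i, pullTop wj (e i) = e₀ i := fun i => by
    rw [← ha' i]
    refine (pullTop_comp rfl hH wj (by rw [hj₁, wa]) (F.frame i)).trans ?_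
    exact pullTop_congr _ hj₁ _ _
  have hjD := hDc.pullbackOver hH wj he
  simp only [hje, ← gmap_appTop_comp, hj₂] at hjD
  have hsm' : Smooth τ :=
    have : Smooth α := hsm
    inferInstanceAs (Smooth (Limits.pullback.snd α β))
  refine ⟨Y, τ, j, g, f, w, e, hsm', hj₂, ?_, wf, he, ?_⟩
  · refine hu.hom_ext hH wjg rfl (fun a => ?_) (fun a => ?_)
    · rw [← Subsheaf.pullbackOver_comp w hH wj wjg (u.V.isSubbundle a), hg]
      exact ((hjD.V a).eq_iff he₀ (h₀.V a)).mpr rfl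
    · rw [← Subsheaf.pullbackOver_comp w hH wj wjg (u.V'.isSubbundle a), hg']
      exact ((hjD.V' a).eq_iff he₀ (h₀.V' a)).mpr rfl
  · have hV : ∀ a, ((u.V.sub a).pullbackOver w).Cut e a (gmap τ.appTop.hom v) := fun a => by
      rw [hg]
      exact hDc.V a
    have hV' : ∀ a, ((u.V'.sub a).pullbackOver w).Cut e a (gmap τ.appTop.hom v') := fun a => by
      rw [hg']
      exact hDc.V' a
    exact ⟨hV, hV', hDc.p, hDc.q⟩

end

/-! ### Smoothness from infinitesimal liftings of local rings -/

section

theorem isLocalHom_of_ker_sq {R R' : Type*} [CommRing R] [CommRing R'] (φ : R →+* R')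
    (hφ : Function.Surjective φ) (h : ∀ a b, φ a = 0 → φ b = 0 → a * b = 0) : IsLocalHom φ := by
  refine ⟨fun a ha => ?_⟩
  obtain ⟨b', hb'⟩ := ha.exists_right_inv
  obtain ⟨b, rfl⟩ := hφ b'
  have h1 : φ (a * b - 1) = 0 := by rw [map_sub, map_mul, hb', map_one, sub_self]
  have h2 := h _ _ h1 h1
  -- One Newton step: `a b (2 - a b) = 1 - (a b - 1) ^ 2`, and the square vanishes.
  exact IsUnit.of_mul_eq_one (b * (2 - a * b)) (by linear_combination -h2)

variable {P B Y : Scheme.{u}}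

theorem exists_stalk_hom {C : CommRingCat.{u}} [IsLocalRing C] (g : Spec C ⟶ P) (x : P)
    (hx : g (IsLocalRing.closedPoint C) = x) :
    ∃ φ : P.presheaf.stalk x ⟶ C, Spec.map φ ≫ P.fromSpecStalk x = g := by
  subst hx
  exact ⟨_, Scheme.Spec_stalkClosedPointTo_fromSpecStalk g⟩

/-- Smoothness is formal smoothness of the local rings `R₀ → A`. For a polynomial ring `Q`
surjecting onto `A` with kernel `I`, the latter amounts to splitting `Q / I ^ 2 → A`. The ring `Q /
I ^ 2` is local, since the kernel of that map has square zero, and lifting the canonical morphism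
from `Spec A` to `P` gives the splitting. -/
theorem smooth_of_exists_lift (f : P ⟶ B) [LocallyOfFinitePresentation f]
    (h : ∀ (A C : CommRingCat.{u}) [IsLocalRing A] [IsLocalRing C] (κ : C ⟶ A),
      Function.Surjective κ.hom → (∀ a b, κ.hom a = 0 → κ.hom b = 0 → a * b = 0) →
      ∀ (x : Spec A ⟶ P) (c : Spec C ⟶ B), Spec.map κ ≫ c = x ≫ f →
        ∃ g : Spec C ⟶ P, Spec.map κ ≫ g = x ∧ g ≫ f = c) : Smooth f := by
  refine Scheme.Hom.smoothLocus_eq_top_iff.mp (top_le_iff.mp fun x _ => ?_)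
  change (f.stalkMap x).hom.FormallySmooth
  let R₀ := B.presheaf.stalk (f x)
  let A := P.presheaf.stalk x
  let ρ : R₀ ⟶ A := f.stalkMap x
  let := ρ.hom.toAlgebra
  change Algebra.FormallySmooth R₀ A
  let Q := MvPolynomial A R₀
  let t : Q →ₐ[R₀] A := MvPolynomial.aeval id
  have ht : Function.Surjective t := fun a => ⟨MvPolynomial.X a, MvPolynomial.aeval_X _ _⟩
  rw [Algebra.FormallySmooth.iff_split_surjection t ht]
  let C : CommRingCat.{u} := CommRingCat.of (Q ⧸ RingHom.ker t.toRingHom ^ 2)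
  let κ : C ⟶ A := CommRingCat.ofHom t.kerSquareLift.toRingHom
  have hκ : Function.Surjective κ.hom := fun a => by
    obtain ⟨b, hb⟩ := ht a
    exact ⟨Ideal.Quotient.mk _ b, hb⟩
  have hsq : ∀ a b, κ.hom a = 0 → κ.hom b = 0 → a * b = 0 := by
    intro a b ha hb
    obtain ⟨a, rfl⟩ := Ideal.Quotient.mk_surjective a
    obtain ⟨b, rfl⟩ := Ideal.Quotient.mk_surjective b
    rw [← map_mul, Ideal.Quotient.eq_zero_iff_mem, pow_two]
    exact Ideal.mul_mem_mul ha hb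
  have hloc : IsLocalHom κ.hom := isLocalHom_of_ker_sq κ.hom hκ hsq
  have : IsLocalRing C := RingHom.domain_isLocalRing κ.hom
  let γ : R₀ ⟶ C := CommRingCat.ofHom (algebraMap R₀ (Q ⧸ RingHom.ker t.toRingHom ^ 2))
  have hγ : γ ≫ κ = ρ := by
    ext a
    exact t.kerSquareLift.commutes a
  obtain ⟨g, hg, hg'⟩ := h A C κ hκ hsq (P.fromSpecStalk x) (Spec.map γ ≫ B.fromSpecStalk (f x)) (by
    rw [← Category.assoc, ← Spec.map_comp, hγ]
    exact Scheme.SpecMap_stalkMap_fromSpecStalk f)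
  have hcp : g (IsLocalRing.closedPoint C) = x := by
    have h1 : (Spec.map κ) (IsLocalRing.closedPoint A) = IsLocalRing.closedPoint C :=
      IsLocalRing.comap_closedPoint κ.hom
    have h2 : (Spec.map κ ≫ g) (IsLocalRing.closedPoint A) = x := by
      rw [hg]
      exact Scheme.fromSpecStalk_closedPoint
    exact (congrArg g h1).symm.trans h2
  obtain ⟨φ, hφ⟩ := exists_stalk_hom g x hcp
  have h1 : φ ≫ κ = 𝟙 A := by
    refine Spec.map_injective ?_
    rw [← cancel_mono (P.fromSpecStalk x), Spec.map_comp, Category.assoc, hφ, hg, Spec.map_id,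
      Category.id_comp]
  have h2 : ρ ≫ φ = γ := by
    refine Spec.map_injective ?_
    rw [← cancel_mono (B.fromSpecStalk (f x)), Spec.map_comp, Category.assoc, ← hg', ← hφ,
      Category.assoc]
    exact congrArg (Spec.map φ ≫ ·) (Scheme.SpecMap_stalkMap_fromSpecStalk f)
  refine ⟨⟨φ.hom, fun a => ?_⟩, ?_⟩
  · exact congrArg (fun ψ : R₀ ⟶ C => ψ.hom a) h2
  · ext a
    exact congrArg (fun ψ : A ⟶ A => ψ.hom a) h1

/-- Since `A` is local, `j` factors through an affine open of `Y`, and there the lifting property of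
a smooth algebra against the square-zero kernel applies. -/
theorem exists_section_of_smooth {A C : CommRingCat.{u}} [IsLocalRing A] (κ : C ⟶ A)
    (hκ : Function.Surjective κ.hom) (hsq : ∀ a b, κ.hom a = 0 → κ.hom b = 0 → a * b = 0)
    (τ : Y ⟶ Spec C) [Smooth τ] (j : Spec A ⟶ Y) (hj : j ≫ τ = Spec.map κ) :
    ∃ σ : Spec C ⟶ Y, σ ≫ τ = 𝟙 _ ∧ Spec.map κ ≫ σ = j := by
  obtain ⟨_, ⟨V, hV, rfl⟩, hxV, -⟩ := Y.isBasis_affineOpens.exists_subset_of_mem_open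
    (Set.mem_univ (j (IsLocalRing.closedPoint A))) isOpen_univ
  have htop : j ⁻¹ᵁ V = ⊤ := opens_eq_top_of_closedPoint_mem hxV
  let ι : Spec Γ(Y, V) ⟶ Y := hV.fromSpec
  have : IsOpenImmersion ι := hV.isOpenImmersion_fromSpec
  let l : Spec A ⟶ Spec Γ(Y, V) := IsOpenImmersion.lift ι j (by
    rintro _ ⟨t, rfl⟩
    change j t ∈ Set.range hV.fromSpec
    rw [hV.range_fromSpec]
    change t ∈ j ⁻¹ᵁ V
    rw [htop]
    trivial)
  have hl : l ≫ ι = j := IsOpenImmersion.lift_fac _ _ _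
  obtain ⟨θ, hθ⟩ := Spec.map_surjective l
  obtain ⟨ρ, hρ⟩ := Spec.map_surjective (ι ≫ τ)
  have hρs : ρ.hom.Smooth := by
    rw [← HasRingHomProperty.Spec_iff (P := @Smooth), hρ]
    infer_instance
  have hρθ : ρ ≫ θ = κ := by
    refine Spec.map_injective ?_
    rw [Spec.map_comp, hθ, hρ, ← Category.assoc, hl, hj]
  let := ρ.hom.toAlgebra
  let := κ.hom.toAlgebra
  have : Algebra.Smooth C Γ(Y, V) := hρs
  let θ' : Γ(Y, V) →ₐ[C] A := ⟨θ.hom, fun a => congrArg (fun ψ : C ⟶ A => ψ.hom a) hρθ⟩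
  have hnil : IsNilpotent (RingHom.ker (Algebra.ofId C A : C →ₐ[C] A)) := by
    refine ⟨2, le_bot_iff.mp ?_⟩
    rw [pow_two, Ideal.mul_le]
    exact fun a ha b hb => hsq a b ha hb
  let χ := Algebra.FormallySmooth.liftOfSurjective θ' (Algebra.ofId C A) hκ hnil
  have hχ : ∀ a, κ.hom (χ a) = θ.hom a :=
    Algebra.FormallySmooth.liftOfSurjective_apply θ' (Algebra.ofId C A) hκ hnil
  let χ' : Γ(Y, V) ⟶ C := CommRingCat.ofHom χ.toRingHom
  refine ⟨Spec.map χ' ≫ ι, ?_, ?_⟩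
  · rw [Category.assoc, ← hρ, ← Spec.map_comp, ← Spec.map_id]
    congr 1
    ext a
    exact χ.commutes a
  · rw [← Category.assoc, ← Spec.map_comp, ← hl, ← hθ]
    congr 2
    ext a
    exact hχ a

end

/-! ### Smoothness of the universal pair of flags -/

section

variable {B S P : Scheme.{u}} {s : S ⟶ B} {H : S.Modules} {r n : ℕ} {hr : 1 ≤ r} {hrn : r ≤ n}
  {p q : CompleteFlag H n} {lam lam' : AdmissiblePartition r n} {π : P ⟶ S}
  {u : FlagPair hr hrn p q lam lam' π}

theorem exists_frame_top {C : CommRingCat.{u}} [IsLocalRing C] (hH : IsVectorBundle H n)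
    (f : Spec C ⟶ S) : ∃ e : Fin n → Γ((Scheme.Modules.pullback f).obj H, ⊤), IsFrame _ ⊤ e := by
  obtain ⟨U, h, hh, k⟩ := exists_frame_of_isLocalRing hH f
  exact ⟨fr f h k, isFrame_fr f hh k⟩

theorem surjective_appTop {A C : CommRingCat.{u}} {κ : C ⟶ A}
    (hκ : Function.Surjective κ.hom) : Function.Surjective (Spec.map κ).appTop.hom := by
  intro a
  obtain ⟨b, hb⟩ := hκ ((Scheme.ΓSpecIso A).hom.hom a)
  refine ⟨(Scheme.ΓSpecIso C).inv.hom b, ?_⟩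
  have h := congrArg (fun ψ : C ⟶ Γ(Spec A, ⊤) => ψ.hom b) (Scheme.ΓSpecIso_inv_naturality κ)
  refine h.symm.trans ?_
  change (Scheme.ΓSpecIso A).inv.hom (κ.hom b) = a
  rw [hb]
  exact congrArg (fun ψ : Γ(Spec A, ⊤) ⟶ Γ(Spec A, ⊤) => ψ.hom a) (Scheme.ΓSpecIso A).hom_inv_id

/-- Lift the adapted matrices along the thickening, realize them on a smooth family `Y`, and compose
a section of `Y` extending the given point with the morphism to `P`. -/
theorem FlagPair.IsUniversal.smooth (hH : IsVectorBundle H n) (hpq : IsVersal s p q)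
    (hu : u.IsUniversal) [LocallyOfFinitePresentation (π ≫ s)] : Smooth (π ≫ s) := by
  refine smooth_of_exists_lift _ fun A C _ _ κ hκ hsq x c hc => ?_
  obtain ⟨e₀, he₀⟩ := exists_frame_top hH (x ≫ π)
  obtain ⟨v, v', y, y', h₀⟩ := (u.pullbackOver hH (rfl : x ≫ π = _)).exists_cut_of_isLocalRing hH he₀
  have hκ' := surjective_appTop hκ
  have := IsLocalHom.of_surjective _ hκ'
  obtain ⟨w, w', z, z', ad, rfl, rfl, rfl, rfl⟩ := (h₀.isAdapted he₀).exists_lift _ hκ'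
  obtain ⟨Y, τ, j, g, f, wg, -, hτ, hj, hg, hf, -, -⟩ :=
    exists_smooth_family hH hpq hu (Spec.map κ) x c hc he₀ ad h₀
  obtain ⟨σ, hσ, hσ'⟩ := exists_section_of_smooth κ hκ hsq τ j hj
  refine ⟨σ ≫ g, ?_, ?_⟩
  · rw [← Category.assoc, hσ', hg]
  · rw [Category.assoc, ← Category.assoc g, wg, hf, ← Category.assoc, hσ, Category.id_comp]

end

/-! ### Linear algebra of Schubert conditions -/

/-- As `i` increases, `n - r + i` grows while the parts do not; the bound `n - r` on the parts keeps
the truncated subtraction exact. -/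
theorem AdmissiblePartition.index_lt {r n : ℕ} (lam : AdmissiblePartition r n) {i j : ℕ}
    (hi : 1 ≤ i) (hij : i < j) (hj : j ≤ r) : lam.index i < lam.index j := by
  have h1 := lam.antitone i j hi hij.le hj
  have h2 := lam.part_le i hi (hij.le.trans hj)
  unfold AdmissiblePartition.index
  omega

theorem AdmissiblePartition.index_le {r n : ℕ} (lam : AdmissiblePartition r n) {i j : ℕ}
    (hi : 1 ≤ i) (hij : i ≤ j) (hj : j ≤ r) : lam.index i ≤ lam.index j := by
  obtain rfl | h := hij.eq_or_lt
  · exact le_rfl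
  · exact (lam.index_lt hi h hj).le

theorem AdmissiblePartition.index_le_self {r n : ℕ} (lam : AdmissiblePartition r n) (hrn : r ≤ n)
    {i : ℕ} (hir : i ≤ r) : lam.index i ≤ n := by
  unfold AdmissiblePartition.index
  omega

/-- The end of the block of a partition containing a given position. -/
theorem AdmissiblePartition.exists_corner {r n : ℕ} (lam : AdmissiblePartition r n) {i : ℕ}
    (hi : 1 ≤ i) (hir : i ≤ r) : ∃ a ∈ lam.corners, i ≤ a ∧ lam.part a = lam.part i := by
  obtain ⟨k, hk⟩ := Nat.exists_eq_add_of_le hir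
  induction k generalizing i with
  | zero =>
    have : i = r := by omega
    subst this
    exact ⟨i, lam.self_mem_corners hi, le_rfl, rfl⟩
  | succ k ih =>
    by_cases h : lam.part (i + 1) = lam.part i
    · obtain ⟨a, ha, hia, hpa⟩ := ih (i := i + 1) (by omega) (by omega) (by omega)
      exact ⟨a, ha, by omega, hpa.trans h⟩
    · exact ⟨i, Finset.mem_filter.mpr ⟨Finset.mem_Icc.mpr ⟨hi, hir⟩, Or.inr h⟩, le_rfl, rfl⟩

section
open Matrix

variable {n r : ℕ} {R : Type*} [CommRing R]

/-- Every term of the Leibniz expansion meets the block of zeros. Otherwise the chosen columns `< a`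
would be matched injectively with rows in `[b, b')`, while at most `r - a` chosen columns are `≥ a`,
giving fewer than `d + 1` columns. Repeated rows or columns make the minor zero anyway. -/
theorem minorIdeal_eq_bot_of_zero_block {Z : Matrix (Fin n) (Fin n) R} {b b' a r d : ℕ}
    (hZ : ∀ i j : Fin n, b' ≤ i → (j : ℕ) < a → Z i j = 0) (hd : (b' - b) + (r - a) < d + 1) :
    minorIdeal Z b r d = ⊥ := by
  classical
  rw [eq_bot_iff, minorIdeal_le_iff]
  intro ρ κ hρ hκ
  rw [Ideal.mem_bot]
  by_cases hρi : Function.Injective ρ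
  swap
  · obtain ⟨i, i', h, hne⟩ : ∃ i i', ρ i = ρ i' ∧ i ≠ i' := by
      simpa [Function.Injective] using hρi
    exact det_zero_of_row_eq hne (by ext j; simp [h])
  by_cases hκi : Function.Injective κ
  swap
  · obtain ⟨i, i', h, hne⟩ : ∃ i i', κ i = κ i' ∧ i ≠ i' := by
      simpa [Function.Injective] using hκi
    exact det_zero_of_column_eq hne (by intro j; simp [h])
  rw [det_apply]
  refine Finset.sum_eq_zero fun σ _ => ?_
  suffices h : ∃ i, (κ i : ℕ) < a ∧ b' ≤ (ρ (σ i) : ℕ) by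
    obtain ⟨i, hi, hi'⟩ := h
    rw [Finset.prod_eq_zero (Finset.mem_univ i) (hZ _ _ hi' hi), smul_zero]
  by_contra! hcon
  have h1 : (Finset.univ.filter fun i : Fin (d + 1) => (κ i : ℕ) < a).card ≤ b' - b := by
    rw [← Nat.card_Ico]
    refine Finset.card_le_card_of_injOn (fun i => (ρ (σ i) : ℕ)) (fun i hi => ?_) fun i _ i' _ h =>
      σ.injective (hρi (Fin.ext h))
    exact Finset.mem_coe.mpr (Finset.mem_Ico.mpr ⟨hρ _, hcon i (Finset.mem_filter.mp hi).2⟩)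
  have h2 : (Finset.univ.filter fun i : Fin (d + 1) => ¬(κ i : ℕ) < a).card ≤ r - a := by
    rw [← Nat.card_Ico]
    refine Finset.card_le_card_of_injOn (fun i => (κ i : ℕ)) (fun i hi => ?_) fun i _ i' _ h =>
      hκi (Fin.ext h)
    exact Finset.mem_coe.mpr (Finset.mem_Ico.mpr ⟨not_lt.mp (Finset.mem_filter.mp hi).2, hκ i⟩)
  have h3 := Finset.card_filter_add_card_filter_not (s := Finset.univ)
    (fun i : Fin (d + 1) => (κ i : ℕ) < a)
  rw [Finset.card_univ, Fintype.card_fin] at h3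
  omega

/-- The Schubert conditions follow from the incidence conditions at the corners. -/
theorem IsAdapted.minorIdeal_eq_bot {lam : AdmissiblePartition r n} {v y : GLn n R}
    (h : ∀ a ∈ lam.corners, cutMod v a ≤ cutMod y (lam.index a)) {i : ℕ} (hi : 1 ≤ i)
    (hir : i ≤ r) : minorIdeal (y * v⁻¹).1 (lam.index i) r (r - i) = ⊥ := by
  obtain ⟨a, ha, hia, hpa⟩ := lam.exists_corner hi hir
  -- Positions `i` and `a` have equal parts, so the two indices differ by `a - i`, and `(a - i) + (r
  -- - a) = r - i` is one less than the size of the minors.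
  refine minorIdeal_eq_bot_of_zero_block (cutMod_le_iff.mp (h a ha)) ?_
  have har := (Finset.mem_Icc.mp (lam.corners_subset ha)).2
  have h2 := lam.part_le i hi hir
  unfold AdmissiblePartition.index
  rw [hpa]
  omega

variable {K : Type*} [Field K]

theorem linearIndependent_inv_single (v : GLn n K) :
    LinearIndependent K fun j : Fin n => (v⁻¹ : GLn n K).1 *ᵥ Pi.single j 1 := by
  have h : LinearIndependent K (v⁻¹ : GLn n K).1.col :=
    linearIndependent_cols_iff_isUnit.mpr (v⁻¹ : GLn n K).isUnit
  have h2 : (v⁻¹ : GLn n K).1.col = fun j : Fin n => (v⁻¹ : GLn n K).1 *ᵥ Pi.single j 1 := by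
    ext j i
    rw [mulVec_single_one]
  rwa [h2] at h

theorem le_finrank_cutMod (v : GLn n K) {r : ℕ} (hr : r ≤ n) :
    r ≤ Module.finrank K (cutMod v r) := by
  let w : Fin r → cutMod v r := fun j => ⟨_, inv_single_mem_cutMod v (Fin.castLE hr j) j.2⟩
  have hw : LinearIndependent K w := by
    refine LinearIndependent.of_comp (cutMod v r).subtype ?_
    exact (linearIndependent_inv_single v).comp (Fin.castLE hr) (Fin.castLE_injective hr)
  simpa using hw.fintype_card_le_finrank

/-- Were the intersection smaller, the map from `cutMod v r` to the quotient by `cutMod y b` would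
have rank above `r - i`. Choosing `r - i + 1` vectors with independent images and functionals dual
to them exhibits `1` as an element of the vanishing minor ideal. -/
theorem le_finrank_inf {v y : GLn n K} {b r i : ℕ} (hr : r ≤ n) (hir : i ≤ r)
    (h : minorIdeal (y * v⁻¹).1 b r (r - i) = ⊥) :
    i ≤ Module.finrank K ↥(cutMod v r ⊓ cutMod y b) := by
  by_contra! hlt
  set P := cutMod y b
  let f : cutMod v r →ₗ[K] (Fin n → K) ⧸ P := P.mkQ ∘ₗ (cutMod v r).subtype
  have hker : Module.finrank K (LinearMap.ker f) ≤ Module.finrank K ↥(cutMod v r ⊓ P) := by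
    have h1 : ∀ x : LinearMap.ker f, x.1.1 ∈ cutMod v r ⊓ P := fun x => ⟨x.1.2, by
      have := x.2
      rw [LinearMap.mem_ker] at this
      exact (Submodule.Quotient.mk_eq_zero P).mp this⟩
    let g : LinearMap.ker f →ₗ[K] ↥(cutMod v r ⊓ P) :=
      LinearMap.codRestrict _ ((cutMod v r).subtype ∘ₗ (LinearMap.ker f).subtype) h1
    refine LinearMap.finrank_le_finrank_of_injective (f := g) fun x x' hx => ?_
    exact Subtype.ext (Subtype.ext (show x.1.1 = x'.1.1 from
      congrArg (fun z : ↥(cutMod v r ⊓ P) => z.1) hx))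
  have hrk := LinearMap.finrank_range_add_finrank_ker f
  have hv := le_finrank_cutMod v hr
  obtain ⟨w, hw⟩ := exists_linearIndependent_of_le_finrank (R := K) (M := LinearMap.range f)
    (n := r - i + 1) (by omega)
  have hw' : LinearIndependent K fun j => (w j).1 :=
    hw.map' (LinearMap.range f).subtype (Submodule.ker_subtype _)
  choose x hx using fun j => (w j).2
  obtain ⟨g, hg⟩ := LinearMap.exists_leftInverse_of_injective
    (Fintype.linearCombination K fun j => (w j).1)
    (LinearMap.ker_eq_bot.mpr (linearIndependent_iff_injective_fintypeLinearCombination.mp hw'))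
  have hmem := det_functional_mem_minorIdeal (y := v) (y' := y) (a := r) (b := b)
    (v := fun j => (x j).1) (φ := fun j => LinearMap.proj j ∘ₗ g ∘ₗ P.mkQ) (fun j => (x j).2)
    (fun j c hc => by
      have : P.mkQ c = 0 := (Submodule.Quotient.mk_eq_zero P).mpr hc
      simp only [LinearMap.comp_apply, this, map_zero])
  have hone : (Matrix.of fun i j => (LinearMap.proj i ∘ₗ g ∘ₗ P.mkQ : (Fin n → K) →ₗ[K] K)
      (x j).1) = (1 : Matrix (Fin (r - i + 1)) (Fin (r - i + 1)) K) := by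
    ext i j
    have h1 : P.mkQ (x j).1 = (w j).1 := hx j
    have h2 := LinearMap.congr_fun hg (Pi.single j 1)
    rw [LinearMap.comp_apply, Fintype.linearCombination_apply_single, one_smul] at h2
    simp only [of_apply, LinearMap.comp_apply, h1, h2, LinearMap.id_apply, LinearMap.proj_apply,
      Pi.single_apply, one_apply]
  rw [hone, det_one, h, Ideal.mem_bot] at hmem
  exact one_ne_zero hmem

/-- Greedy choice: the span of `m` vectors is too small to contain `N (m + 1)`. -/
theorem exists_linearIndependent_mem (N : ℕ → Submodule K (Fin n → K))
    (hN : ∀ i < n, i + 1 ≤ Module.finrank K (N (i + 1))) (m : ℕ) (hm : m ≤ n) :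
    ∃ w : Fin m → Fin n → K, LinearIndependent K w ∧ ∀ j : Fin m, w j ∈ N ((j : ℕ) + 1) := by
  induction m with
  | zero => exact ⟨Fin.elim0, linearIndependent_empty_type, fun j => j.elim0⟩
  | succ m ih =>
    obtain ⟨w, hw, hwN⟩ := ih (by omega)
    have h1 : ¬N (m + 1) ≤ Submodule.span K (Set.range w) := fun hle => by
      have h2 := Submodule.finrank_mono hle
      rw [finrank_span_eq_card hw, Fintype.card_fin] at h2
      have := hN m (by omega)
      omega
    obtain ⟨x, hx, hxw⟩ := SetLike.not_le_iff_exists.mp h1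
    refine ⟨Fin.snoc w x, linearIndependent_finSnoc.mpr ⟨hw, hxw⟩, fun j => ?_⟩
    refine Fin.lastCases ?_ (fun j => ?_) j
    · simpa using hx
    · simpa using hwN j

theorem exists_cutMod_le (N : ℕ → Submodule K (Fin n → K))
    (hN : ∀ i < n, i + 1 ≤ Module.finrank K (N (i + 1))) :
    ∃ g : GLn n K, ∀ a, (∀ j < a, N (j + 1) ≤ N a) → cutMod g a ≤ N a := by
  obtain ⟨w, hw, hwN⟩ := exists_linearIndependent_mem N hN n le_rfl
  let M : Matrix (Fin n) (Fin n) K := (Matrix.of w)ᵀ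
  have hM : IsUnit M := linearIndependent_cols_iff_isUnit.mp hw
  obtain ⟨g, hg⟩ := hM
  refine ⟨g⁻¹, fun a ha c hc => ?_⟩
  rw [eq_sum_inv_single g⁻¹ c]
  refine Submodule.sum_mem _ fun j _ => ?_
  by_cases hj : (j : ℕ) < a
  · refine Submodule.smul_mem _ _ (ha j hj ?_)
    rw [inv_inv, mulVec_single_one, hg]
    exact hwN j
  · rw [hc j (not_lt.mp hj), zero_smul]
    exact zero_mem _

/-- Over a field, the Schubert conditions imply the existence of a flag satisfying the incidence
conditions. -/
theorem exists_cutMod_le_of_minorIdeal_eq_bot {lam : AdmissiblePartition r n}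
    (hrn : r ≤ n) {v y : GLn n K}
    (h : ∀ i ∈ Finset.Icc 1 r, minorIdeal (y * v⁻¹).1 (lam.index i) r (r - i) = ⊥) :
    ∃ g : GLn n K, cutMod g r = cutMod v r ∧
      ∀ a ∈ lam.corners, cutMod g a ≤ cutMod y (lam.index a) := by
  -- Beyond `r` nothing is required; the value `⊤` serves to complete the chosen vectors to a basis
  -- of the whole space.
  let N : ℕ → Submodule K (Fin n → K) := fun i =>
    if i ≤ r then cutMod v r ⊓ cutMod y (lam.index i) else ⊤
  have hN : ∀ {i}, i ≤ r → N i = cutMod v r ⊓ cutMod y (lam.index i) := fun hi => if_pos hi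
  obtain ⟨g, hg⟩ := exists_cutMod_le N fun i hi => by
    by_cases hir : i + 1 ≤ r
    · rw [hN hir]
      exact le_finrank_inf hrn hir (h _ (Finset.mem_Icc.mpr ⟨by omega, hir⟩))
    · rw [show N (i + 1) = ⊤ from if_neg hir, finrank_top, Module.finrank_fin_fun]
      omega
  have hg' : ∀ a ≤ r, cutMod g a ≤ cutMod v r ⊓ cutMod y (lam.index a) := fun a ha => by
    rw [← hN ha]
    refine hg a fun j hj => ?_
    rw [hN ha, hN (hj.trans_le ha : j + 1 ≤ r)]
    exact inf_le_inf_left _ (cutMod_mono y (lam.index_le (by omega) hj ha))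
  exact ⟨g, cutMod_eq_of_le ((hg' r le_rfl).trans inf_le_left), fun a ha =>
    (hg' a (Finset.mem_Icc.mp (lam.corners_subset ha)).2).trans inf_le_right⟩

end

/-! ### Intersections of constant rank -/

section
open Matrix

variable {n r : ℕ} {R : Type*} [CommRing R]

/-- Bordering the invertible minor `M` by row `i` and column `l` gives a vanishing minor of the next
size. Its Schur complement is zero, so `Z i l = C M⁻¹ B`, where `C M⁻¹` does not depend on `l`. -/
theorem exists_eq_sum_mul_of_minorIdeal_eq_bot {Z : Matrix (Fin n) (Fin n) R} {b r d : ℕ}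
    {ρ κ : Fin (d + 1) → Fin n} (hρ : ∀ i, b ≤ (ρ i : ℕ)) (hκ : ∀ j, (κ j : ℕ) < r)
    (hu : IsUnit (Z.submatrix ρ κ).det) (h : minorIdeal Z b r (d + 1) = ⊥) {i : Fin n}
    (hi : b ≤ i) : ∃ γ : Fin (d + 1) → R, ∀ l : Fin n, (l : ℕ) < r →
      Z i l = ∑ k, γ k * Z (ρ k) l := by
  let M := Z.submatrix ρ κ
  let _ : Invertible M := Matrix.invertibleOfIsUnitDet M hu
  let C : Matrix (Fin 1) (Fin (d + 1)) R := Z.submatrix (fun _ => i) κ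
  refine ⟨(C * ⅟M) 0, fun l hl => ?_⟩
  let B : Matrix (Fin (d + 1)) (Fin 1) R := Z.submatrix ρ fun _ => l
  let E : Matrix (Fin 1) (Fin 1) R := Z.submatrix (fun _ => i) fun _ => l
  have h1 : (fromBlocks M B C E).det = 0 := by
    rw [← det_submatrix_equiv_self (finSumFinEquiv (m := d + 1) (n := 1)).symm]
    have h2 : (fromBlocks M B C E).submatrix (finSumFinEquiv (m := d + 1) (n := 1)).symm
        (finSumFinEquiv (m := d + 1) (n := 1)).symm =
        Z.submatrix (Sum.elim ρ (fun _ => i) ∘ (finSumFinEquiv (m := d + 1) (n := 1)).symm)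
          (Sum.elim κ (fun _ => l) ∘ (finSumFinEquiv (m := d + 1) (n := 1)).symm) := by
      ext x y
      simp only [submatrix_apply, Function.comp]
      rcases (finSumFinEquiv (m := d + 1) (n := 1)).symm x with x | x <;>
        rcases (finSumFinEquiv (m := d + 1) (n := 1)).symm y with y | y <;> rfl
    rw [h2, ← Ideal.mem_bot, ← h]
    refine det_submatrix_mem_minorIdeal (fun x => ?_) fun x => ?_
    · simp only [Function.comp]
      rcases (finSumFinEquiv (m := d + 1) (n := 1)).symm x with x | x
      exacts [hρ x, hi]
    · simp only [Function.comp]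
      rcases (finSumFinEquiv (m := d + 1) (n := 1)).symm x with x | x
      exacts [hκ x, hl]
  rw [det_fromBlocks₁₁, hu.mul_right_eq_zero, det_unique, Matrix.sub_apply, sub_eq_zero] at h1
  exact h1

/-- If `cutMod v r` and the quotient by `cutMod y b` are related by a matrix of constant rank, then
`cutMod v r ⊓ cutMod y b` is the member of rank `a` of a flag. -/
theorem exists_cutMod_eq_inf (v y : GLn n R) {a r b d : ℕ} (had : a + (d + 1) = r) (hrn : r ≤ n)
    {ρ κ : Fin (d + 1) → Fin n} (hρ : ∀ i, b ≤ (ρ i : ℕ)) (hκ : ∀ j, (κ j : ℕ) < r)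
    (hu : IsUnit ((y * v⁻¹).1.submatrix ρ κ).det) (h : minorIdeal (y * v⁻¹).1 b r (d + 1) = ⊥) :
    ∃ L : GLn n R, cutMod L a = cutMod v r ⊓ cutMod y b := by
  classical
  obtain hR | hR := subsingleton_or_nontrivial R
  · exact ⟨1, Submodule.ext fun c => by simp [Subsingleton.elim c 0]⟩
  let Z := (y * v⁻¹).1
  have hκi : Function.Injective κ := fun j j' hj => by
    by_contra hne
    exact hu.ne_zero (det_zero_of_column_eq hne fun i => by simp [hj])
  -- The `d + 1` positions from `a` to `r - 1` receive the pivot columns `κ`, all `< r`, and the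
  -- positions from `r` on stay fixed.
  let f : {i : Fin n // a ≤ (i : ℕ)} → Fin n := fun i =>
    if hi : (i : ℕ) < r then κ ⟨i - a, by omega⟩ else i
  have hf₁ : ∀ i (hi : (i.1 : ℕ) < r), f i = κ ⟨i - a, by omega⟩ := fun i hi => dif_pos hi
  have hf₂ : ∀ i, ¬(i.1 : ℕ) < r → f i = i := fun i hi => dif_neg hi
  have hf : Function.Injective f := by
    intro i j hij
    by_cases hi : (i.1 : ℕ) < r <;> by_cases hj : (j.1 : ℕ) < r
    · rw [hf₁ i hi, hf₁ j hj] at hij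
      have h1 := Fin.mk.inj (hκi hij)
      exact Subtype.ext (Fin.ext (by have := i.2; have := j.2; omega))
    · rw [hf₁ i hi, hf₂ j hj] at hij
      exact absurd (hij ▸ hκ _) hj
    · rw [hf₂ i hi, hf₁ j hj] at hij
      exact absurd (hij ▸ hκ _) hi
    · rw [hf₂ i hi, hf₂ j hj] at hij
      exact Subtype.ext hij
  let σ : Equiv.Perm (Fin n) := (Equiv.ofInjective f hf).extendSubtype
  have hσ : ∀ (i : Fin n) (hi : a ≤ (i : ℕ)), σ i = f ⟨i, hi⟩ := fun i hi => by
    rw [Equiv.extendSubtype_apply_of_mem _ i hi, Equiv.ofInjective_apply]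
  -- In the coordinates `v c`, the rows `≥ r` of `Y` express membership in `cutMod v r`, and the
  -- rows from `a` to `r - 1` are the pivot rows of `Z`. The rows `< a` play no role and are set to
  -- zero.
  let Y : Matrix (Fin n) (Fin n) R := of fun i =>
    if r ≤ (i : ℕ) then Pi.single i 1 else
      if hi : a ≤ (i : ℕ) ∧ (i : ℕ) < r then Z (ρ ⟨i - a, by omega⟩) else 0
  have hY₁ : ∀ i : Fin n, r ≤ (i : ℕ) → Y i = Pi.single i 1 := fun i hi => if_pos hi
  have hY₂ : ∀ (i : Fin n) (h1 : a ≤ (i : ℕ)) (h2 : (i : ℕ) < r), Y i = Z (ρ ⟨i - a, by omega⟩) :=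
    fun i h1 h2 => (if_neg (not_le.mpr h2)).trans (dif_pos ⟨h1, h2⟩)
  have hdet : IsUnit (of fun i j => Y i (σ j) :
      Matrix {i : Fin n // ¬(i : ℕ) < a} {i : Fin n // ¬(i : ℕ) < a} R).det := by
    -- The diagonal blocks are the given invertible minor and an identity matrix.
    rw [twoBlockTriangular_det _ (fun i => (i.1 : ℕ) < r)]
    · let e : Fin (d + 1) ≃ {i : {i : Fin n // ¬(i : ℕ) < a} // (i.1 : ℕ) < r} :=
        { toFun := fun k => ⟨⟨⟨a + k, by omega⟩, by simp⟩, by simp; omega⟩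
          invFun := fun i => ⟨i.1.1 - a, by have := i.2; have := i.1.2; omega⟩
          left_inv := fun k => by simp
          right_inv := fun i => Subtype.ext (Subtype.ext (Fin.ext (by
            have := i.1.2
            simp only
            omega))) }
      refine IsUnit.mul ?_ ?_
      · rw [← det_submatrix_equiv_self e]
        convert hu using 2
        ext k l
        have h1 : σ (e l).1.1 = κ l := by
          rw [hσ _ (not_lt.mp (e l).1.2), hf₁ _ (e l).2]
          congr 1
          exact Fin.ext (by simp [e])
        have h2 : Y (e k).1.1 = Z (ρ k) := by
          rw [hY₂ _ (not_lt.mp (e k).1.2) (e k).2]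
          congr 2
          exact Fin.ext (by simp [e])
        change Y (e k).1.1 (σ (e l).1.1) = Z (ρ k) (κ l)
        rw [h1, h2]
      · refine (congrArg IsUnit ((congrArg det ?_).trans det_one)).mpr isUnit_one
        ext k l
        change Y k.1.1 (σ l.1.1) = _
        rw [hY₁ _ (not_lt.mp k.2), hσ _ (not_lt.mp l.1.2), hf₂ _ l.2, Pi.single_apply, one_apply]
        simp only [Subtype.ext_iff, eq_comm]
    · intro i hi j hj
      change Y i.1 (σ j.1) = 0
      rw [hY₁ _ (not_lt.mp hi), hσ _ (not_lt.mp j.2), hf₁ _ hj, Pi.single_eq_of_ne]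
      intro h1
      exact hi (h1 ▸ hκ _)
  obtain ⟨X, hX⟩ := exists_forall_mem_cutMod_chartMat_iff hdet
  refine ⟨chartMat σ X * v, Submodule.ext fun c => ?_⟩
  have hy : y.1 *ᵥ c = Z *ᵥ (v.1 *ᵥ c) := by
    rw [mulVec_mulVec, ← Units.val_mul, inv_mul_cancel_right]
  have h1 : c ∈ cutMod (chartMat σ X * v) a ↔ v.1 *ᵥ c ∈ cutMod (chartMat σ X) a := by
    rw [mem_cutMod, mem_cutMod, Units.val_mul, mulVec_mulVec]
  rw [h1, ← hX, Submodule.mem_inf, mem_cutMod, mem_cutMod, hy]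
  generalize v.1 *ᵥ c = x
  have hr : ∀ i : Fin n, r ≤ (i : ℕ) → (Y *ᵥ x) i = x i := fun i hi => by
    rw [mulVec, hY₁ i hi, single_one_dotProduct]
  constructor
  · intro hc
    have hx : ∀ i : Fin n, r ≤ (i : ℕ) → x i = 0 := fun i hi => by
      rw [← hr i hi]
      exact hc i (by omega)
    refine ⟨hx, fun i hi => ?_⟩
    -- On columns `< r`, every row `≥ b` of `Z` is a combination of the pivot rows, so the pivot
    -- equations imply all equations of `cutMod y b`.
    obtain ⟨γ, hγ⟩ := exists_eq_sum_mul_of_minorIdeal_eq_bot hρ hκ hu h hi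
    have h2 : (Z *ᵥ x) i = ∑ k, γ k * (Z *ᵥ x) (ρ k) := by
      simp only [mulVec, dotProduct, Finset.mul_sum]
      rw [Finset.sum_comm]
      refine Finset.sum_congr rfl fun l _ => ?_
      by_cases hl : (l : ℕ) < r
      · rw [show Z i l = _ from hγ l hl, Finset.sum_mul]
        exact Finset.sum_congr rfl fun k _ => mul_assoc _ _ _
      · simp [hx l (not_lt.mp hl)]
    rw [h2]
    refine Finset.sum_eq_zero fun k _ => ?_
    have h3 := hc ⟨a + k, by omega⟩ (by simp)
    rw [mulVec, hY₂ _ (by simp) (by simp; omega)] at h3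
    have h4 : (⟨(⟨a + k, by omega⟩ : Fin n) - a, by simp; omega⟩ : Fin (d + 1)) = k := Fin.ext (by simp)
    rw [h4] at h3
    rw [mulVec, h3, mul_zero]
  · rintro ⟨hx, hz⟩ i hi
    by_cases hir : (i : ℕ) < r
    · rw [mulVec, hY₂ i hi hir]
      exact hz _ (hρ _)
    · rw [hr i (not_lt.mp hir)]
      exact hx i (not_lt.mp hir)

end

/-! ### Deforming into general position -/

section
open Matrix

variable {n r : ℕ} {K C : Type*} [Field K] [CommRing C]

/-- The determinant is a monic polynomial evaluated at `t`, hence nonzero when `t` is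
transcendental, whatever `A` is. -/
theorem det_map_add_scalar (σ : K →+* C) (t : C) {m : ℕ} (A : Matrix (Fin m) (Fin m) K) :
    (A.map σ + scalar (Fin m) t).det = (-A).charpoly.eval₂ σ t := by
  rw [charpoly, ← Polynomial.coe_eval₂RingHom, RingHom.map_det]
  congr 1
  ext i j
  obtain rfl | h := eq_or_ne i j
  · simp [charmatrix_apply_eq, add_comm]
  · simp [charmatrix_apply_ne, h]

/-- A matrix satisfying the incidence conditions of a partition deforms to one for which the ranks
in the Schubert conditions are as large as possible. -/
theorem exists_generic_deformation (hrn : r ≤ n) (lam : AdmissiblePartition r n) [IsLocalRing C]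
    (φ : C →+* K) [IsLocalHom φ] (σ : K →+* C) (hσ : φ.comp σ = RingHom.id K) {t : C}
    (ht : φ t = 0) (ht' : ∀ f : Polynomial K, f ≠ 0 → f.eval₂ σ t ≠ 0) (v y : GLn n K)
    (h : ∀ a ∈ lam.corners, cutMod v a ≤ cutMod y (lam.index a)) :
    ∃ z : GLn n C, gmap φ z = y ∧
      (∀ a ∈ lam.corners, cutMod (gmap σ v) a ≤ cutMod z (lam.index a)) ∧
      ∀ a ∈ lam.corners, a < r →
        minorIdeal (z * (gmap σ v)⁻¹).1 (lam.index a) r (r - a - 1) ≠ ⊥ := by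
  classical
  let A := (y * v⁻¹).1
  -- Column `j` belongs to the vector number `j + 1`. The perturbation `t` sits in row `index (j +
  -- 1) - 1`, just inside the reference subspace prescribed for that vector, so the zeros required
  -- at the corners survive.
  let E : Matrix (Fin n) (Fin n) C :=
    of fun i j => if (j : ℕ) < r ∧ (i : ℕ) + 1 = lam.index (j + 1) then t else 0
  let Z : Matrix (Fin n) (Fin n) C := A.map σ + E
  have hφσ : ∀ x, φ (σ x) = x := fun x => congrArg (fun f : K →+* K => f x) hσ
  have hZφ : Z.map φ = A := by
    ext i j
    have hE : φ (E i j) = 0 := by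
      simp only [E, of_apply]
      split_ifs <;> simp [ht]
    simp only [Z, map_apply, Matrix.add_apply, map_add, hφσ, hE, add_zero]
  have hu : IsUnit Z.det := by
    refine IsUnit.of_map φ _ ?_
    rw [RingHom.map_det, RingHom.mapMatrix_apply, hZφ]
    exact (isUnit_iff_isUnit_det _).mp (y * v⁻¹).isUnit
  let Z' : GLn n C := Z.nonsingInvUnit hu
  have hZ' : Z'.1 = Z := rfl
  have hφ : gmap φ Z' = y * v⁻¹ := Units.ext hZφ
  have hv : gmap φ (gmap σ v) = v := by rw [gmap_gmap, hσ, gmap_id]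
  refine ⟨Z' * gmap σ v, by rw [gmap_mul, hφ, hv, inv_mul_cancel_right], fun a ha => ?_,
    fun a ha har => ?_⟩
  · rw [cutMod_le_iff, mul_inv_cancel_right, hZ']
    intro i j hi hj
    have har := (Finset.mem_Icc.mp (lam.corners_subset ha)).2
    have h1 : E i j = 0 := if_neg fun h2 => by
      have := lam.index_le (i := j + 1) (j := a) (by omega) hj har
      omega
    have h2 : A i j = 0 := cutMod_le_iff.mp (h a ha) i j hi hj
    change σ (A i j) + E i j = 0
    rw [h1, h2, map_zero, add_zero]
  · have ha1 := (Finset.mem_Icc.mp (lam.corners_subset ha)).1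
    rw [mul_inv_cancel_right, hZ']
    have hidx : ∀ k : Fin (r - a - 1 + 1), lam.index a < lam.index (a + k + 1) ∧
        lam.index (a + k + 1) ≤ n := fun k =>
      ⟨lam.index_lt ha1 (by omega) (by omega), lam.index_le_self hrn (by omega)⟩
    let ρ : Fin (r - a - 1 + 1) → Fin n := fun k =>
      ⟨lam.index (a + k + 1) - 1, by have := hidx k; omega⟩
    let κ : Fin (r - a - 1 + 1) → Fin n := fun k => ⟨a + k, by omega⟩
    -- The columns are those of the vectors `a + 1, …, r`, and the rows are where they are
    -- perturbed. Strict monotonicity of `index` puts the `t`'s exactly on the diagonal and all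
    -- these rows at or beyond `index a`.
    have hρκ : Z.submatrix ρ κ = (A.submatrix ρ κ).map σ + scalar _ t := by
      ext k l
      have h1 : E (ρ k) (κ l) = if k = l then t else 0 := by
        have := hidx k
        simp only [E, of_apply, ρ, κ]
        refine if_congr ⟨fun h2 => ?_, fun h2 => ?_⟩ rfl rfl
        · by_contra hne
          obtain hlt | hlt := lt_or_gt_of_ne hne
          · have := lam.index_lt (i := a + k + 1) (j := a + l + 1) (by omega)
              (by simpa using hlt) (by omega)
            omega
          · have := lam.index_lt (i := a + l + 1) (j := a + k + 1) (by omega)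
              (by simpa using hlt) (by omega)
            omega
        · subst h2
          omega
      simp only [Z, submatrix_apply, Matrix.add_apply, h1, map_apply, scalar_apply, diagonal_apply]
    intro hbot
    have hmem := det_submatrix_mem_minorIdeal (Z := Z) (ρ := ρ) (κ := κ) (b := lam.index a)
      (a := r) (fun k => by have := hidx k; simp only [ρ]; omega)
      (fun k => by simp only [κ]; omega)
    rw [hbot, Ideal.mem_bot, hρκ, det_map_add_scalar] at hmem
    exact ht' _ (charpoly_monic _).ne_zero hmem

/-- The two flags are kept constant and the two reference flags are deformed independently, so the
equality of the top members is not disturbed. -/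
theorem IsAdapted.exists_generic_lift (hrn : r ≤ n) {lam lam' : AdmissiblePartition r n}
    [IsLocalRing C] (φ : C →+* K) [IsLocalHom φ] (σ : K →+* C) (hσ : φ.comp σ = RingHom.id K)
    {t : C} (ht : φ t = 0) (ht' : ∀ f : Polynomial K, f ≠ 0 → f.eval₂ σ t ≠ 0)
    {v v' y y' : GLn n K} (h : IsAdapted lam lam' v v' y y') :
    ∃ w w' z z' : GLn n C, IsAdapted lam lam' w w' z z' ∧ gmap φ w = v ∧ gmap φ w' = v' ∧
      gmap φ z = y ∧ gmap φ z' = y' ∧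
      (∀ a ∈ lam.corners, a < r → minorIdeal (z * w⁻¹).1 (lam.index a) r (r - a - 1) ≠ ⊥) ∧
      ∀ a ∈ lam'.corners, a < r → minorIdeal (z' * w'⁻¹).1 (lam'.index a) r (r - a - 1) ≠ ⊥ := by
  obtain ⟨z, h₁, h₂, h₃⟩ := exists_generic_deformation hrn lam φ σ hσ ht ht' v y h.le
  obtain ⟨z', h₁', h₂', h₃'⟩ := exists_generic_deformation hrn lam' φ σ hσ ht ht' v' y' h.le'
  have hv : ∀ v : GLn n K, gmap φ (gmap σ v) = v := fun v => by rw [gmap_gmap, hσ, gmap_id]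
  exact ⟨gmap σ v, gmap σ v', z, z', ⟨cutMod_eq_of_le (cutMod_gmap_le σ h.top_eq.le), h₂, h₂'⟩,
    hv v, hv v', h₁, h₁', h₃, h₃'⟩

end

/-! ### Ideal sheaves and points -/

section

variable {T Y : Scheme.{u}}

theorem le_ker_iff_comap_eq_bot (I : Y.IdealSheafData) (g : T ⟶ Y) :
    I ≤ g.ker ↔ I.comap g = ⊥ := by
  rw [← le_bot_iff, ← Scheme.IdealSheafData.le_map_iff_comap_le, Scheme.IdealSheafData.map,
    Scheme.Hom.ker_comp_of_isIso]

theorem le_ker_iff_forall_mem_support [IsReduced T] (I : Y.IdealSheafData) (g : T ⟶ Y) :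
    I ≤ g.ker ↔ ∀ t, g t ∈ I.support := by
  rw [le_ker_iff_comap_eq_bot, ← Scheme.IdealSheafData.support_eq_top_iff,
    Scheme.IdealSheafData.support_comap, SetLike.ext_iff]
  exact forall_congr' fun t => ⟨fun h => h.mpr trivial, fun h => ⟨fun _ => trivial, fun _ => h⟩⟩

theorem le_ker_iff_mem_support [IsReduced T] [Subsingleton T] (I : Y.IdealSheafData) (g : T ⟶ Y)
    (t : T) : I ≤ g.ker ↔ g t ∈ I.support := by
  rw [le_ker_iff_forall_mem_support]
  exact ⟨fun h => h t, fun h t' => Subsingleton.elim t t' ▸ h⟩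

/-- A section with vanishing germs is zero, so factorization through a closed subscheme can be
tested on local rings, where flags have matrices. -/
theorem le_ker_of_fromSpecStalk (I : Y.IdealSheafData) (g : T ⟶ Y)
    (h : ∀ t : T, I ≤ (T.fromSpecStalk t ≫ g).ker) : I ≤ g.ker := by
  rw [le_ker_iff_comap_eq_bot]
  refine eq_bot_of_local _ fun t => ?_
  obtain ⟨_, ⟨V, hV, rfl⟩, htV, -⟩ := T.isBasis_affineOpens.exists_subset_of_mem_open
    (Set.mem_univ t) isOpen_univ
  refine ⟨⟨V, hV⟩, htV, ?_⟩
  rw [eq_bot_iff]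
  intro x hx
  refine Ideal.mem_bot.mpr (TopCat.Presheaf.section_ext T.sheaf V x 0 fun t' ht' => ?_)
  have h1 := h t'
  rw [le_ker_iff_comap_eq_bot, Scheme.IdealSheafData.comap_comp, ← le_ker_iff_comap_eq_bot] at h1
  have h2 : (T.fromSpecStalk t').app V x = 0 :=
    RingHom.mem_ker.mp (Scheme.Hom.ideal_ker_le _ ⟨V, hV⟩ (h1 ⟨V, hV⟩ hx))
  rw [Scheme.fromSpecStalk_app ht'] at h2
  have h3 : ∀ (V' : (Spec (T.presheaf.stalk t')).Opens), V' = ⊤ →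
      Function.Injective (rmap (le_top : V' ≤ ⊤)) := by
    rintro _ rfl
    rw [rmap_self]
    exact fun _ _ h => h
  have htop : T.fromSpecStalk t' ⁻¹ᵁ V = ⊤ := opens_eq_top_of_closedPoint_mem (by
    change T.fromSpecStalk t' (IsLocalRing.closedPoint _) ∈ V
    rwa [Scheme.fromSpecStalk_closedPoint])
  have h4 := h3 _ htop (h2.trans (map_zero _).symm)
  have h5 := (ConcreteCategory.bijective_of_isIso
    (Scheme.ΓSpecIso (T.presheaf.stalk t')).inv).1 (h4.trans (map_zero _).symm)
  exact h5.trans (map_zero _).symm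

end

/-! ### Degeneracy loci in a global frame -/

section

variable {T Y S : Scheme.{u}} {π : Y ⟶ S} {H : S.Modules} {r n : ℕ} {g : T ⟶ Y} {f : T ⟶ S}

theorem degeneracyIdeal_le_ker_iff_minorIdeal_eq_bot [IsAffine T] (w : g ≫ π = f)
    (hH : IsVectorBundle H n) {A P : Subsheaf ((Scheme.Modules.pullback π).obj H)} {a b : ℕ}
    (hA : A.IsSubbundle a) (hP : P.IsSubbundle b) (d : ℕ)
    {e : Fin n → Γ((Scheme.Modules.pullback f).obj H, ⊤)} (he : IsFrame _ ⊤ e)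
    {y z : GLn n Γ(T, ⊤)} (hy : (A.pullbackOver w).Cut e a y) (hz : (P.pullbackOver w).Cut e b z) :
    degeneracyIdeal A P d ≤ g.ker ↔ minorIdeal (z * y⁻¹).1 b a d = ⊥ := by
  rw [degeneracyIdeal_le_ker_iff w hH hA hP]
  have h1 := degeneracyIdeal_ideal (hA.pullbackOver w hH) (hP.pullbackOver w hH) d
    ⟨⊤, isAffineOpen_top T⟩ he hy hz
  refine ⟨fun h => ?_, fun h => Scheme.IdealSheafData.ext_of_isAffine ?_⟩
  · rw [← h1, h]
    rfl
  · rw [h1, h]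
    rfl

variable {p q : CompleteFlag H n} {lam lam' : AdmissiblePartition r n}

theorem schubertIdeal_le_ker_iff [IsAffine T] (hH : IsVectorBundle H n) (hrn : r ≤ n)
    (G : GrassmannianBundle H r) {g : T ⟶ G.scheme} (w : g ≫ G.π = f)
    {e : Fin n → Γ((Scheme.Modules.pullback f).obj H, ⊤)} (he : IsFrame _ ⊤ e)
    {v y : GLn n Γ(T, ⊤)} (hv : (G.taut.member.pullbackOver w).Cut e r v)
    (hy : ∀ d, ((p.sub d).pullback f).Cut e d y) : schubertIdeal hrn p lam G ≤ g.ker ↔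
      ∀ i ∈ Finset.Icc 1 r, minorIdeal (y * v⁻¹).1 (lam.index i) r (r - i) = ⊥ := by
  rw [schubertIdeal, iSup_le_iff, Subtype.forall]
  refine forall₂_congr fun i hi => ?_
  refine degeneracyIdeal_le_ker_iff_minorIdeal_eq_bot w hH G.isSubbundle
    ((p.isSubbundle _).pullback hH G.π) _ he hv ?_
  rw [Subsheaf.pullback_pullbackOver w hH (p.isSubbundle _)]
  exact hy _

/-- The open subset of the Grassmannian bundle where the intersections with the members of a flag
prescribed by a partition are as small as possible. -/
def genericLocus (hrn : r ≤ n) (p : CompleteFlag H n) (lam : AdmissiblePartition r n)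
    (G : GrassmannianBundle H r) : G.scheme.Opens where
  carrier := ⋂ a : {a : lam.corners // (a : ℕ) < r},
    ((degeneracyIdeal G.taut.member ((CompleteFlag.bound hrn p lam a.1).pullback G.π)
      (r - a.1 - 1)).support : Set G.scheme)ᶜ
  is_open' := isOpen_iInter_of_finite fun _ => (Scheme.IdealSheafData.support _).isClosed.isOpen_compl

theorem mem_genericLocus_iff [IsAffine T] [IsReduced T] [Subsingleton T] (hH : IsVectorBundle H n)
    (hrn : r ≤ n) (G : GrassmannianBundle H r) {g : T ⟶ G.scheme} (w : g ≫ G.π = f)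
    {e : Fin n → Γ((Scheme.Modules.pullback f).obj H, ⊤)} (he : IsFrame _ ⊤ e)
    {v y : GLn n Γ(T, ⊤)} (hv : (G.taut.member.pullbackOver w).Cut e r v)
    (hy : ∀ d, ((p.sub d).pullback f).Cut e d y) (t : T) : g t ∈ genericLocus hrn p lam G ↔
      ∀ a ∈ lam.corners, a < r → minorIdeal (y * v⁻¹).1 (lam.index a) r (r - a - 1) ≠ ⊥ := by
  have h1 : g t ∈ genericLocus hrn p lam G ↔ ∀ (a : lam.corners) (_ : (a : ℕ) < r), g t ∉
      (degeneracyIdeal G.taut.member ((CompleteFlag.bound hrn p lam a).pullback G.π)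
        (r - a - 1)).support := by
    change g t ∈ ⋂ a, _ ↔ _
    rw [Set.mem_iInter, Subtype.forall]
    rfl
  rw [h1, Subtype.forall]
  refine forall₃_congr fun a ha har => not_congr ?_
  rw [← le_ker_iff_mem_support]
  refine degeneracyIdeal_le_ker_iff_minorIdeal_eq_bot w hH G.isSubbundle
    ((p.isSubbundle _).pullback hH G.π) _ he hv ?_
  rw [Subsheaf.pullback_pullbackOver w hH (p.isSubbundle _)]
  exact hy _

end

/-! ### The projection onto the Richardson variety -/

section

variable {P T S : Scheme.{u}} {H : S.Modules} {r n : ℕ} {hr : 1 ≤ r} {hrn : r ≤ n}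
  {p q : CompleteFlag H n} {lam lam' : AdmissiblePartition r n} {G : GrassmannianBundle H r}
  {t : P ⟶ G.scheme} {u : FlagPair hr hrn p q lam lam' (t ≫ G.π)}

theorem GrassmannianBundle.pullbackOver_eq (hH : IsVectorBundle H n)
    (htop : G.taut.member.pullbackOver rfl = u.V.top hr) {f : T ⟶ S} {l : T ⟶ P}
    (w : l ≫ t ≫ G.π = f) (w' : (l ≫ t) ≫ G.π = f) :
    G.taut.member.pullbackOver w' = (u.V.top hr).pullbackOver w := by
  rw [← htop, Subsheaf.pullbackOver_comp rfl hH w w' G.isSubbundle]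

theorem FlagPair.Cut.taut (hH : IsVectorBundle H n)
    (htop : G.taut.member.pullbackOver rfl = u.V.top hr) {f : T ⟶ S} {l : T ⟶ P}
    (w : l ≫ t ≫ G.π = f) (w' : (l ≫ t) ≫ G.π = f)
    {e : Fin n → Γ((Scheme.Modules.pullback f).obj H, ⊤)} {v v' y y' : GLn n Γ(T, ⊤)}
    (h : (u.pullbackOver hH w).Cut e v v' y y') :
    (G.taut.member.pullbackOver w').Cut e r v := by
  rw [G.pullbackOver_eq hH htop w w']
  exact h.V _

/-- On each local ring the flags are given by adapted matrices, and the zero blocks at the corners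
kill all Schubert minors as elements of the ring. The factorization therefore holds without any
reducedness. -/
theorem richardsonIdeal_le_ker (hH : IsVectorBundle H n)
    (htop : G.taut.member.pullbackOver rfl = u.V.top hr) :
    richardsonIdeal hrn p q lam lam' G ≤ t.ker := by
  refine le_ker_of_fromSpecStalk _ _ fun z => ?_
  let g := P.fromSpecStalk z
  obtain ⟨e, he⟩ := exists_frame_top hH (g ≫ t ≫ G.π)
  obtain ⟨v, v', y, y', h⟩ :=
    (u.pullbackOver hH (rfl : g ≫ t ≫ G.π = _)).exists_cut_of_isLocalRing hH he
  have ad := h.isAdapted he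
  have w : (g ≫ t) ≫ G.π = g ≫ t ≫ G.π := Category.assoc _ _ _
  have hv := h.taut hH htop rfl w
  refine sup_le ((schubertIdeal_le_ker_iff hH hrn G w he hv h.p).mpr fun i hi => ?_)
    ((schubertIdeal_le_ker_iff hH hrn G w he (hv.congr ad.top_eq) h.q).mpr fun i hi => ?_)
  · exact IsAdapted.minorIdeal_eq_bot ad.le (Finset.mem_Icc.mp hi).1 (Finset.mem_Icc.mp hi).2
  · exact IsAdapted.minorIdeal_eq_bot ad.le' (Finset.mem_Icc.mp hi).1 (Finset.mem_Icc.mp hi).2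

theorem IsAdapted.exists_of_isField {R : Type*} [CommRing R] (hR : IsField R) (hrn : r ≤ n)
    {v y y' : GLn n R}
    (h : ∀ i ∈ Finset.Icc 1 r, minorIdeal (y * v⁻¹).1 (lam.index i) r (r - i) = ⊥)
    (h' : ∀ i ∈ Finset.Icc 1 r, minorIdeal (y' * v⁻¹).1 (lam'.index i) r (r - i) = ⊥) :
    ∃ w w' : GLn n R, IsAdapted lam lam' w w' y y' ∧ cutMod w r = cutMod v r := by
  let := hR.toField
  obtain ⟨w, hw, hw'⟩ := exists_cutMod_le_of_minorIdeal_eq_bot (K := R) hrn h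
  obtain ⟨z, hz, hz'⟩ := exists_cutMod_le_of_minorIdeal_eq_bot (K := R) hrn h'
  exact ⟨w, z, ⟨hw.trans hz.symm, hw', hz'⟩, hw⟩

theorem isField_ΓSpec {C : CommRingCat.{u}} (hC : IsField C) : IsField Γ(Spec C, ⊤) :=
  (Scheme.ΓSpecIso C).commRingCatIsoToRingEquiv.toMulEquiv.isField hC

/-- Points of the Richardson variety with values in a field lift. -/
theorem FlagPair.IsUniversal.exists_lift_of_isField (hH : IsVectorBundle H n) (hu : u.IsUniversal)
    (htop : G.taut.member.pullbackOver rfl = u.V.top hr) {C : CommRingCat.{u}} (hC : IsField C)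
    (x : Spec C ⟶ G.scheme) (hx : richardsonIdeal hrn p q lam lam' G ≤ x.ker) :
    ∃ l : Spec C ⟶ P, l ≫ t = x := by
  have : IsLocalRing C := let := hC.toField; inferInstanceAs (IsLocalRing C)
  obtain ⟨e, he⟩ := exists_frame_top hH (x ≫ G.π)
  obtain ⟨y, hy⟩ := (p.pullback hH (x ≫ G.π)).exists_cut he
  obtain ⟨y', hy'⟩ := (q.pullback hH (x ≫ G.π)).exists_cut he
  obtain ⟨v, hv⟩ := (G.taut.pullbackOver rfl hH).exists_cut he
  have hv := hv ⟨r, Finset.mem_singleton_self r⟩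
  obtain ⟨w, w', ad, hw⟩ := IsAdapted.exists_of_isField (isField_ΓSpec hC) hrn
    ((schubertIdeal_le_ker_iff hH hrn G rfl he hv hy).mp (le_sup_left.trans hx))
    ((schubertIdeal_le_ker_iff hH hrn G rfl he hv hy').mp (le_sup_right.trans hx))
  obtain ⟨D, hD⟩ := FlagPair.exists_of_isAdapted hr hrn he ad hy hy'
  obtain ⟨l, ⟨hl, hV, -⟩, -⟩ := hu _ D
  have hl' : (l ≫ t) ≫ G.π = x ≫ G.π := by rw [Category.assoc, hl]
  refine ⟨l, G.hom_ext hH hl' rfl ?_⟩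
  rw [G.pullbackOver_eq hH htop hl hl', hV]
  exact ((hD.V _).eq_iff he hv).mpr hw

theorem FlagPair.IsUniversal.surjective (hH : IsVectorBundle H n) (hu : u.IsUniversal)
    (htop : G.taut.member.pullbackOver rfl = u.V.top hr)
    {f : P ⟶ (richardsonIdeal hrn p q lam lam' G).subscheme}
    (hf : f ≫ (richardsonIdeal hrn p q lam lam' G).subschemeι = t) : Function.Surjective f := by
  intro x
  let X := (richardsonIdeal hrn p q lam lam' G).subscheme
  let ξ := X.fromSpecResidueField x
  obtain ⟨l, hl⟩ := hu.exists_lift_of_isField hH htop (Field.toIsField (X.residueField x))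
    (ξ ≫ (richardsonIdeal hrn p q lam lam' G).subschemeι) ((exists_lift_iff_le_ker _ _).mp ⟨ξ, rfl⟩)
  have h1 : l ≫ f = ξ := by
    rw [← cancel_mono (richardsonIdeal hrn p q lam lam' G).subschemeι, Category.assoc, hf, hl]
  have h2 : (l ≫ f) (IsLocalRing.closedPoint (X.residueField x)) = x := by
    rw [h1]
    exact X.fromSpecResidueField_apply x _
  exact ⟨_, h2⟩

end

/-! ### Intersections of subbundles -/

section

/-- The intersection of two subsheaves. -/
def Subsheaf.inf {X : Scheme.{u}} {M : X.Modules} (A B : Subsheaf M) : Subsheaf M where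
  sec U := A.sec U ⊓ B.sec U
  res_mem h _ hx := ⟨A.res_mem h hx.1, B.res_mem h hx.2⟩
  of_local x hx := ⟨A.of_local x fun t ht => by
      obtain ⟨W, h, htW, hW⟩ := hx t ht
      exact ⟨W, h, htW, hW.1⟩, B.of_local x fun t ht => by
      obtain ⟨W, h, htW, hW⟩ := hx t ht
      exact ⟨W, h, htW, hW.2⟩⟩

theorem Subsheaf.inf_eq_left {X : Scheme.{u}} {M : X.Modules} {A B : Subsheaf M} (h : A ≤ B) :
    A.inf B = A := by
  ext U : 2
  exact inf_of_le_left (h U)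

theorem Subsheaf.inf_mono {X : Scheme.{u}} {M : X.Modules} {A A' B B' : Subsheaf M} (h : A ≤ A')
    (h' : B ≤ B') : A.inf B ≤ A'.inf B' := fun U => inf_le_inf (h U) (h' U)

theorem exists_minor_of_notMem_support {X : Scheme.{u}} {M : X.Modules} {n a b d : ℕ}
    {A P : Subsheaf M} (hA : A.IsSubbundle a) (hP : P.IsSubbundle b) (U : X.affineOpens)
    {e : Fin n → Γ(M, U.1)} (he : IsFrame M U.1 e) {y y' : GLn n Γ(X, U.1)} (hy : A.Cut e a y)
    (hy' : P.Cut e b y') {x : X} (hxU : x ∈ U.1) (hx : x ∉ (degeneracyIdeal A P d).support) :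
    ∃ ρ κ : Fin (d + 1) → Fin n, (∀ i, b ≤ (ρ i : ℕ)) ∧ (∀ j, (κ j : ℕ) < a) ∧
      x ∈ X.basicOpen ((y' * y⁻¹).1.submatrix ρ κ).det := by
  by_contra! hcon
  refine hx ((Scheme.IdealSheafData.mem_support_iff_of_mem hxU).mpr ?_)
  rw [degeneracyIdeal_ideal hA hP d U he hy hy', Scheme.mem_zeroLocus_iff]
  have h1 : minorIdeal (y' * y⁻¹).1 b a d ≤
      (IsLocalRing.maximalIdeal _).comap (X.presheaf.germ U.1 x hxU).hom := by
    rw [minorIdeal_le_iff]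
    intro ρ κ hρ hκ
    have h2 := hcon ρ κ hρ hκ
    rwa [Scheme.mem_basicOpen _ _ _ hxU] at h2
  intro f hf
  rw [Scheme.mem_basicOpen _ _ _ hxU]
  exact h1 hf

variable {T Y S : Scheme.{u}} {π : Y ⟶ S} {H : S.Modules} {r n : ℕ} {g : T ⟶ Y} {f : T ⟶ S}

/-- The intersection of two subbundles is a subbundle if its rank is constant. -/
theorem isSubbundle_inf (w : g ≫ π = f) (hH : IsVectorBundle H n)
    {A P : Subsheaf ((Scheme.Modules.pullback π).obj H)} {a b d : ℕ}
    (hA : A.IsSubbundle r) (hP : P.IsSubbundle b) (had : a + (d + 1) = r)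
    (h : degeneracyIdeal A P (d + 1) ≤ g.ker)
    (h' : ∀ t, g t ∉ (degeneracyIdeal A P d).support) :
    ((A.pullbackOver w).inf (P.pullbackOver w)).IsSubbundle a := by
  refine Subsheaf.isSubbundle_of_cutAt (n := n) fun t => ?_
  obtain ⟨U, hU, e, he⟩ := hH (π (g t))
  have hrn := (hA.exists_cutAt (f := π) he (t := g t) le_rfl hU).1
  obtain ⟨V, k, v, y, ht, hv, hy⟩ := exists_cutAt_pair (f := π) hA hP he (t := g t) le_rfl hU
  obtain ⟨ρ, κ, hρ, hκ, hmem⟩ := exists_minor_of_notMem_support hA hP V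
    (isFrame_fr π he (k.trans le_rfl)) hv hy ht (h' t)
  let m := ((y * v⁻¹).1.submatrix ρ κ).det
  let W := Y.basicOpen m
  have hWV : W ≤ V.1 := Y.basicOpen_le m
  have hv₁ := (hv.res hWV).pullbackOver w he
  have hy₁ := (hy.res hWV).pullbackOver w he
  have hmin := minorIdeal_eq_bot (hA.pullbackOver w hH) (hP.pullbackOver w hH)
    ((degeneracyIdeal_le_ker_iff w hH hA hP _).mp h) he hv₁ hy₁
  let φ : Γ(Y, V.1) →+* Γ(T, g ⁻¹ᵁ W) := (g.app W).hom.comp (rmap hWV)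
  have hu : IsUnit ((gmap φ y * (gmap φ v)⁻¹).1.submatrix ρ κ).det := by
    have h1 : IsUnit (rmap hWV m) := RingedSpace.isUnit_res_basicOpen _ m
    have h2 := h1.map (g.app W).hom
    have h3 : ((gmap φ y * (gmap φ v)⁻¹).1.submatrix ρ κ).det = φ m := by
      rw [RingHom.map_det, gmap_mul_inv]
      rfl
    rw [h3]
    exact h2
  have hv₂ : (A.pullbackOver w).CutAt e _ r (gmap φ v) := hv₁
  have hy₂ : (P.pullbackOver w).CutAt e _ b (gmap φ y) := hy₁
  have hmin' : minorIdeal (gmap φ y * (gmap φ v)⁻¹).1 b r (d + 1) = ⊥ := hmin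
  obtain ⟨L, hL⟩ := exists_cutMod_eq_inf (gmap φ v) (gmap φ y) had hrn hρ hκ hu hmin'
  refine ⟨by omega, U, e, he, g ⁻¹ᵁ W, preimage_le_of_comp w (hWV.trans (k.trans le_rfl)), L, hmem,
    fun W' hW' c => ?_⟩
  change _ ∈ (A.pullbackOver w).sec W' ∧ _ ∈ (P.pullbackOver w).sec W' ↔ _
  rw [hv₂ hW' c, hy₂ hW' c, ← Submodule.mem_inf]
  -- Over a smaller open the intersection is computed by its own matrix `L'`. The restriction of `L`
  -- describes a submodule of it of the same rank, hence the same one.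
  obtain ⟨L', hL'⟩ := exists_cutMod_eq_inf (gmap (rmap hW') (gmap φ v))
    (gmap (rmap hW') (gmap φ y)) had hrn hρ hκ (by
      have h1 := hu.map (rmap hW')
      rw [RingHom.map_det] at h1
      rw [gmap_mul_inv]
      exact h1) (by
      rw [gmap_mul_inv, gmap_coe, ← minorIdeal_map, hmin', Ideal.map_bot])
  rw [← hL', cutMod_eq_of_le (y := gmap (rmap hW') L) (y' := L') (d := a)]
  rw [hL']
  exact le_inf (cutMod_gmap_le _ (hL.le.trans inf_le_left))
    (cutMod_gmap_le _ (hL.le.trans inf_le_right))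

end

/-! ### The projection is an isomorphism over the generic locus -/

section

variable {P T S : Scheme.{u}} {H : S.Modules} {r n : ℕ} {hr : 1 ≤ r} {hrn : r ≤ n}
  {p q : CompleteFlag H n} {lam lam' : AdmissiblePartition r n} {G : GrassmannianBundle H r}
  {f : T ⟶ S}

theorem notMem_support_of_mem_genericLocus {x : G.scheme} (hx : x ∈ genericLocus hrn p lam G)
    (a : lam.corners) (ha : (a : ℕ) < r) :
    x ∉ (degeneracyIdeal G.taut.member ((CompleteFlag.bound hrn p lam a).pullback G.π)
      (r - a - 1)).support := Set.mem_iInter.mp hx ⟨a, ha⟩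

/-- For `a < r` the Schubert condition kills the minors of size `r - a + 1`, and genericity makes
some minor of size `r - a` invertible near each point, so the intersection has constant rank `a`.
For `a = r` the intersection is the tautological bundle itself. -/
theorem isSubbundle_inf_bound (hH : IsVectorBundle H n) {g : T ⟶ G.scheme} (w : g ≫ G.π = f)
    (h : schubertIdeal hrn p lam G ≤ g.ker) (h' : ∀ t, g t ∈ genericLocus hrn p lam G)
    (a : lam.corners) : ((G.taut.member.pullbackOver w).inf
      ((CompleteFlag.bound hrn p lam a).pullback f)).IsSubbundle a := by
  have hb := (p.isSubbundle ⟨lam.index a, lam.index_mem hrn (lam.corners_subset a.2)⟩).pullback hH G.π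
  have h1 : degeneracyIdeal G.taut.member ((CompleteFlag.bound hrn p lam a).pullback G.π) (r - a) ≤
      g.ker := (le_iSup (fun i : Finset.Icc 1 r => degeneracyIdeal G.taut.member
      ((p.sub ⟨lam.index i, lam.index_mem hrn i.2⟩).pullback G.π) (r - i))
      ⟨a, lam.corners_subset a.2⟩).trans h
  have har := (Finset.mem_Icc.mp (lam.corners_subset a.2)).2
  rw [← Subsheaf.pullback_pullbackOver w hH (p.isSubbundle _)]
  obtain har | har := har.lt_or_eq
  · refine isSubbundle_inf (d := r - a - 1) w hH G.isSubbundle hb (by omega) ?_ fun t =>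
      notMem_support_of_mem_genericLocus (h' t) a har
    rwa [show r - a - 1 + 1 = r - a by omega]
  · rw [har, Nat.sub_self] at h1
    rw [Subsheaf.inf_eq_left ((degeneracyIdeal_zero_le_ker_iff w hH G.isSubbundle hb).mp h1), har]
    exact G.isSubbundle.pullbackOver w hH

/-- The flag cut out on the tautological bundle by a complete flag. -/
theorem exists_bundleFlag_inf_bound (hH : IsVectorBundle H n) {g : T ⟶ G.scheme} (w : g ≫ G.π = f)
    (h : schubertIdeal hrn p lam G ≤ g.ker) (h' : ∀ t, g t ∈ genericLocus hrn p lam G) :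
    ∃ V : BundleFlag ((Scheme.Modules.pullback f).obj H) lam.corners, ∀ a, V.sub a =
      (G.taut.member.pullbackOver w).inf ((CompleteFlag.bound hrn p lam a).pullback f) := by
  refine ⟨⟨_, isSubbundle_inf_bound hH w h h', fun a a' haa' => ?_⟩, fun a => rfl⟩
  refine Subsheaf.inf_mono (fun _ => le_rfl) (Subsheaf.pullback_mono f (p.le _ _ ?_))
  exact lam.index_le (Finset.mem_Icc.mp (lam.corners_subset a.2)).1 haa'
    (Finset.mem_Icc.mp (lam.corners_subset a'.2)).2

theorem inf_bound_top (hH : IsVectorBundle H n) {g : T ⟶ G.scheme} (w : g ≫ G.π = f)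
    {V : BundleFlag ((Scheme.Modules.pullback f).obj H) lam.corners} (hV : ∀ a, V.sub a =
      (G.taut.member.pullbackOver w).inf ((CompleteFlag.bound hrn p lam a).pullback f)) :
    V.top hr = G.taut.member.pullbackOver w := by
  refine Subsheaf.eq_of_le hH (V.isSubbundle _) (G.isSubbundle.pullbackOver w hH) ?_
  change V.sub _ ≤ _
  rw [hV]
  exact fun _ => inf_le_left

variable {t : P ⟶ G.scheme} {u : FlagPair hr hrn p q lam lam' (t ≫ G.π)}

/-- Over the generic loci, intersecting the tautological bundle with the reference subbundles at the
corners produces the two flags. -/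
theorem FlagPair.IsUniversal.exists_lift (hH : IsVectorBundle H n) (hu : u.IsUniversal)
    (htop : G.taut.member.pullbackOver rfl = u.V.top hr) (g : T ⟶ G.scheme)
    (h : richardsonIdeal hrn p q lam lam' G ≤ g.ker)
    (h' : ∀ t, g t ∈ genericLocus hrn p lam G ⊓ genericLocus hrn q lam' G) :
    ∃ l : T ⟶ P, l ≫ t = g := by
  obtain ⟨V, hV⟩ := exists_bundleFlag_inf_bound hH (rfl : g ≫ G.π = _) (le_sup_left.trans h)
    fun t => (h' t).1
  obtain ⟨V', hV'⟩ := exists_bundleFlag_inf_bound hH (rfl : g ≫ G.π = _) (le_sup_right.trans h)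
    fun t => (h' t).2
  have hVt := inf_bound_top (hr := hr) hH rfl hV
  let D : FlagPair hr hrn p q lam lam' (g ≫ G.π) :=
    { V := V
      V' := V'
      top_eq := hVt.trans (inf_bound_top hH rfl hV').symm
      le := fun a => by
        rw [hV]
        exact fun _ => inf_le_right
      le' := fun a => by
        rw [hV']
        exact fun _ => inf_le_right }
  obtain ⟨l, ⟨w, hl, -⟩, -⟩ := hu _ D
  have w' : (l ≫ t) ≫ G.π = g ≫ G.π := by rw [Category.assoc, w]
  refine ⟨l, G.hom_ext hH w' rfl ?_⟩
  rw [G.pullbackOver_eq hH htop w w', hl]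
  exact hVt

/-- Each member of a flag lies in the corresponding intersection, which over the generic locus is a
subbundle of the same rank; so the flags are determined by their top member. -/
theorem FlagPair.IsUniversal.hom_ext_of_genericLocus (hH : IsVectorBundle H n) (hu : u.IsUniversal)
    (htop : G.taut.member.pullbackOver rfl = u.V.top hr) {l l' : T ⟶ P} (hl : l ≫ t = l' ≫ t)
    (h' : ∀ z, (l ≫ t) z ∈ genericLocus hrn p lam G ⊓ genericLocus hrn q lam' G) : l = l' := by
  have hk := (richardsonIdeal_le_ker hH htop).trans (Scheme.Hom.le_ker_comp l t)
  have w' : (l' ≫ t) ≫ G.π = (l ≫ t) ≫ G.π := by rw [hl]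
  have key : ∀ (m : T ⟶ P) (w : m ≫ t ≫ G.π = (l ≫ t) ≫ G.π) (wm : m ≫ t = l ≫ t),
      (∀ a, (u.V.sub a).pullbackOver w = (G.taut.member.pullbackOver rfl).inf
        ((CompleteFlag.bound hrn p lam a).pullback ((l ≫ t) ≫ G.π))) ∧
      ∀ a, (u.V'.sub a).pullbackOver w = (G.taut.member.pullbackOver rfl).inf
        ((CompleteFlag.bound hrn q lam' a).pullback ((l ≫ t) ≫ G.π)) := by
    intro m w wm
    have wm' : (m ≫ t) ≫ G.π = (l ≫ t) ≫ G.π := by rw [wm]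
    have h1 : G.taut.member.pullbackOver (rfl : (l ≫ t) ≫ G.π = _) =
        (u.V.top hr).pullbackOver w :=
      (Subsheaf.pullbackOver_congr wm.symm _ wm' _).trans (G.pullbackOver_eq hH htop w wm')
    have h1' : G.taut.member.pullbackOver (rfl : (l ≫ t) ≫ G.π = _) =
        (u.V'.top hr).pullbackOver w := h1.trans (congrArg (fun A => A.pullbackOver w) u.top_eq)
    refine ⟨fun a => Subsheaf.eq_of_le hH ((u.V.isSubbundle a).pullbackOver w hH)
      (isSubbundle_inf_bound hH rfl (le_sup_left.trans hk) (fun z => (h' z).1) a) ?_,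
      fun a => Subsheaf.eq_of_le hH ((u.V'.isSubbundle a).pullbackOver w hH)
      (isSubbundle_inf_bound hH rfl (le_sup_right.trans hk) (fun z => (h' z).2) a) ?_⟩
    · rw [h1]
      have h2 := (u.pullbackOver hH w).le a
      have h3 := (u.V.pullbackOver w hH).le a ⟨r, lam.self_mem_corners hr⟩
        (Finset.mem_Icc.mp (lam.corners_subset a.2)).2
      exact fun U => le_inf (h3 U) (h2 U)
    · rw [h1']
      have h2 := (u.pullbackOver hH w).le' a
      have h3 := (u.V'.pullbackOver w hH).le a ⟨r, lam'.self_mem_corners hr⟩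
        (Finset.mem_Icc.mp (lam'.corners_subset a.2)).2
      exact fun U => le_inf (h3 U) (h2 U)
  have w₁ : l ≫ t ≫ G.π = (l ≫ t) ≫ G.π := (Category.assoc _ _ _).symm
  have w₂ : l' ≫ t ≫ G.π = (l ≫ t) ≫ G.π := by rw [hl, Category.assoc]
  exact hu.hom_ext hH w₁ w₂ (fun a => ((key l w₁ rfl).1 a).trans ((key l' w₂ hl.symm).1 a).symm)
    fun a => ((key l w₁ rfl).2 a).trans ((key l' w₂ hl.symm).2 a).symm

theorem FlagPair.IsUniversal.isIso_morphismRestrict (hH : IsVectorBundle H n) (hu : u.IsUniversal)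
    (htop : G.taut.member.pullbackOver rfl = u.V.top hr)
    {f : P ⟶ (richardsonIdeal hrn p q lam lam' G).subscheme}
    (hf : f ≫ (richardsonIdeal hrn p q lam lam' G).subschemeι = t) :
    IsIso (f ∣_ ((richardsonIdeal hrn p q lam lam' G).subschemeι ⁻¹ᵁ
      (genericLocus hrn p lam G ⊓ genericLocus hrn q lam' G))) := by
  let I := richardsonIdeal hrn p q lam lam' G
  let Ω := genericLocus hrn p lam G ⊓ genericLocus hrn q lam' G
  let U : I.subscheme.Opens := I.subschemeι ⁻¹ᵁ Ω
  change IsIso (f ∣_ U)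
  obtain ⟨l, hl⟩ := hu.exists_lift hH htop (U.ι ≫ I.subschemeι)
    ((exists_lift_iff_le_ker _ _).mp ⟨U.ι, rfl⟩) fun z => z.2
  have hlf : l ≫ f = U.ι := by
    rw [← cancel_mono I.subschemeι, Category.assoc, hf, hl]
  let m : U.toScheme ⟶ (f ⁻¹ᵁ U).toScheme := IsOpenImmersion.lift (f ⁻¹ᵁ U).ι l (by
    rw [Scheme.Opens.range_ι]
    rintro _ ⟨z, rfl⟩
    change (l ≫ f) z ∈ U
    rw [hlf]
    exact z.2)
  have hm : m ≫ (f ⁻¹ᵁ U).ι = l := IsOpenImmersion.lift_fac _ _ _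
  refine ⟨m, ?_, ?_⟩
  · rw [← cancel_mono (f ⁻¹ᵁ U).ι, Category.assoc, hm, Category.id_comp]
    have h1 : ((f ∣_ U) ≫ l) ≫ t = (f ⁻¹ᵁ U).ι ≫ t := by
      rw [Category.assoc, hl, ← Category.assoc, morphismRestrict_ι, Category.assoc, hf]
    refine hu.hom_ext_of_genericLocus hH htop h1 fun z => ?_
    rw [h1, ← hf]
    exact z.2
  · rw [← cancel_mono U.ι, Category.assoc, morphismRestrict_ι, ← Category.assoc, hm, hlf,
      Category.id_comp]

end

/-! ### Density of the generic locus -/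

section

theorem IsAdapted.exists_generic_lift_of_isField {n r : ℕ} {K C : Type*} [CommRing K] [CommRing C]
    (hK : IsField K) (hrn : r ≤ n) {lam lam' : AdmissiblePartition r n}
    [IsLocalRing C] (φ : C →+* K) [IsLocalHom φ] (σ : K →+* C) (hσ : φ.comp σ = RingHom.id K)
    {t : C} (ht : φ t = 0) (ht' : ∀ f : Polynomial K, f ≠ 0 → f.eval₂ σ t ≠ 0)
    {v v' y y' : GLn n K} (h : IsAdapted lam lam' v v' y y') :
    ∃ w w' z z' : GLn n C, IsAdapted lam lam' w w' z z' ∧ gmap φ w = v ∧ gmap φ w' = v' ∧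
      gmap φ z = y ∧ gmap φ z' = y' ∧
      (∀ a ∈ lam.corners, a < r → minorIdeal (z * w⁻¹).1 (lam.index a) r (r - a - 1) ≠ ⊥) ∧
      ∀ a ∈ lam'.corners, a < r → minorIdeal (z' * w'⁻¹).1 (lam'.index a) r (r - a - 1) ≠ ⊥ := by
  let := hK.toField
  exact IsAdapted.exists_generic_lift (K := K) hrn φ σ hσ ht ht' h

theorem minorIdeal_gmap_ne_bot {n a b d : ℕ} {R R' : Type*} [CommRing R] [CommRing R'] {φ : R →+* R'}
    (hφ : Function.Injective φ) {v z : GLn n R} (h : minorIdeal (z * v⁻¹).1 b a d ≠ ⊥) :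
    minorIdeal (gmap φ z * (gmap φ v)⁻¹).1 b a d ≠ ⊥ := by
  rw [gmap_mul_inv, gmap_coe, ← minorIdeal_map, Ne, Ideal.map_eq_bot_iff_of_injective hφ]
  exact h

theorem ΓSpecIso_appTop {A C : CommRingCat.{u}} (κ : C ⟶ A) (x : Γ(Spec C, ⊤)) :
    (Scheme.ΓSpecIso A).hom.hom ((Spec.map κ).appTop.hom x) =
      κ.hom ((Scheme.ΓSpecIso C).hom.hom x) :=
  congrArg (fun ψ : Γ(Spec C, ⊤) ⟶ A => ψ.hom x) (Scheme.ΓSpecIso_naturality κ)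

theorem injective_ΓSpecIso (C : CommRingCat.{u}) :
    Function.Injective (Scheme.ΓSpecIso C).hom.hom :=
  (ConcreteCategory.bijective_of_isIso (Scheme.ΓSpecIso C).hom).1

theorem injective_appTop {A C : CommRingCat.{u}} {κ : C ⟶ A}
    (hκ : Function.Injective κ.hom) : Function.Injective (Spec.map κ).appTop.hom := by
  intro x y hxy
  refine injective_ΓSpecIso C (hκ ?_)
  rw [← ΓSpecIso_appTop, hxy, ΓSpecIso_appTop]

/-- A point of a flat scheme over the spectrum of a local domain that lies over the closed point
specializes from a point over the generic point. -/
theorem exists_specializes_injective {Y : Scheme.{u}} {C : CommRingCat.{u}} [IsLocalRing C]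
    [IsDomain C] (τ : Y ⟶ Spec C) [Flat τ] (y : Y) : ∃ y₁ : Y, y₁ ⤳ y ∧
      Function.Injective (Y.fromSpecResidueField y₁ ≫ τ).appTop.hom := by
  let η : PrimeSpectrum C := ⊥
  have hη : (show ↥(Spec C) from η) ⤳ τ y := by
    change (show PrimeSpectrum C from η) ⤳ (show PrimeSpectrum C from τ y)
    rw [← PrimeSpectrum.le_iff_specializes]
    exact bot_le
  obtain ⟨y₁, hy₁, hτ⟩ := Flat.generalizingMap τ hη
  refine ⟨y₁, hy₁, ?_⟩
  obtain ⟨θ, hθ⟩ := Spec.map_surjective (Y.fromSpecResidueField y₁ ≫ τ)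
  rw [← hθ]
  refine injective_appTop ((RingHom.injective_iff_ker_eq_bot _).mpr ?_)
  let pt : PrimeSpectrum (Y.residueField y₁) := IsLocalRing.closedPoint _
  have h1 : (Y.fromSpecResidueField y₁ ≫ τ) pt = (show ↥(Spec C) from η) := by
    rw [← hτ]
    exact congrArg τ (Y.fromSpecResidueField_apply y₁ _)
  rw [← hθ] at h1
  have h2 : (PrimeSpectrum.comap θ.hom pt).asIdeal = ⊥ := congrArg PrimeSpectrum.asIdeal h1
  have h3 : pt.asIdeal = ⊥ := IsLocalRing.maximalIdeal_eq_bot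
  rw [PrimeSpectrum.comap_asIdeal, h3] at h2
  exact h2

variable {P S : Scheme.{u}} {B : Scheme.{u}} {s : S ⟶ B} {H : S.Modules} {r n : ℕ} {hr : 1 ≤ r}
  {hrn : r ≤ n} {p q : CompleteFlag H n} {lam lam' : AdmissiblePartition r n}
  {G : GrassmannianBundle H r} {t : P ⟶ G.scheme} {u : FlagPair hr hrn p q lam lam' (t ≫ G.π)}

/-- Deform the matrices at `z` generically over the power series ring of its residue field and
realize the deformation by a smooth family `Y` through `z`. By flatness, the point of `Y` over `z`
is a specialization of a point over the generic point of the base. There the minors remain nonzero,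
so the image in `P` lies in the preimage of the generic locus and specializes to `z`. -/
theorem FlagPair.IsUniversal.dense_preimage (hH : IsVectorBundle H n) (hpq : IsVersal s p q)
    (hu : u.IsUniversal) (htop : G.taut.member.pullbackOver rfl = u.V.top hr) :
    Dense ((t ⁻¹ᵁ (genericLocus hrn p lam G ⊓ genericLocus hrn q lam' G) : P.Opens) : Set P) := by
  intro z
  let K : CommRingCat.{u} := P.residueField z
  have hK : IsField K := Field.toIsField (P.residueField z)
  have : IsLocalRing K := inferInstanceAs (IsLocalRing (P.residueField z))
  have : IsDomain K := hK.isDomain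
  let C : CommRingCat.{u} := CommRingCat.of (PowerSeries K)
  have hC : IsLocalRing C := by
    let := hK.toField
    exact inferInstanceAs (IsLocalRing (PowerSeries K))
  have : IsDomain C := inferInstanceAs (IsDomain (PowerSeries K))
  let σ : K ⟶ C := CommRingCat.ofHom PowerSeries.C
  let φ : C ⟶ K := CommRingCat.ofHom PowerSeries.constantCoeff
  have hσφ : σ ≫ φ = 𝟙 K := by
    ext x
    exact PowerSeries.constantCoeff_C x
  have hφ : Function.Surjective φ.hom := fun x => ⟨σ.hom x, PowerSeries.constantCoeff_C x⟩
  let ι := Spec.map φ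
  let x := P.fromSpecResidueField z
  -- Over `B` the deformation is constant; only the matrices of the reference flags move.
  let c : Spec C ⟶ B := Spec.map σ ≫ x ≫ (t ≫ G.π) ≫ s
  have hισ : ι ≫ Spec.map σ = 𝟙 _ := by
    rw [← Spec.map_comp, hσφ, Spec.map_id]
  have hc : ι ≫ c = x ≫ (t ≫ G.π) ≫ s := by
    rw [← Category.assoc, hισ, Category.id_comp]
  obtain ⟨e₀, he₀⟩ := exists_frame_top hH (x ≫ t ≫ G.π)
  obtain ⟨v, v', y, y', h₀⟩ :=
    (u.pullbackOver hH (rfl : x ≫ t ≫ G.π = _)).exists_cut_of_isLocalRing hH he₀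
  have hφ' := surjective_appTop hφ
  have : IsLocalHom ι.appTop.hom := IsLocalHom.of_surjective _ hφ'
  let X : Γ(Spec C, ⊤) := (Scheme.ΓSpecIso C).inv.hom PowerSeries.X
  have hXC : (Scheme.ΓSpecIso C).hom.hom X = PowerSeries.X :=
    congrArg (fun ψ : C ⟶ C => ψ.hom PowerSeries.X) (Scheme.ΓSpecIso C).inv_hom_id
  have hX : ι.appTop.hom X = 0 := by
    refine injective_ΓSpecIso K ?_
    rw [ΓSpecIso_appTop, hXC, map_zero]
    exact PowerSeries.constantCoeff_X
  -- The power series variable satisfies no polynomial equation over `K`, since polynomials embed in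
  -- power series.
  have hX' : ∀ f : Polynomial Γ(Spec K, ⊤), f ≠ 0 → f.eval₂ (Spec.map σ).appTop.hom X ≠ 0 := by
    intro f hf h0
    let α := (Scheme.ΓSpecIso K).hom.hom
    let β := (Scheme.ΓSpecIso C).hom.hom
    have h1 : β.comp (Spec.map σ).appTop.hom = PowerSeries.C.comp α :=
      RingHom.ext fun a => ΓSpecIso_appTop σ a
    have h2 := congrArg β h0
    rw [Polynomial.hom_eval₂, h1, show β X = PowerSeries.X from hXC, map_zero,
      ← Polynomial.eval₂_map, Polynomial.eval₂_C_X_eq_coe] at h2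
    have h3 := (Polynomial.coe_eq_zero_iff (R := K)).mp h2
    exact hf (Polynomial.map_injective α (injective_ΓSpecIso K) (h3.trans (by simp)))
  have hσ' : ι.appTop.hom.comp (Spec.map σ).appTop.hom = RingHom.id _ := by
    refine RingHom.ext fun a => ?_
    have h1 := congrArg (fun ψ : Spec K ⟶ Spec K => ψ.appTop.hom a) hισ
    exact h1
  obtain ⟨w, w', m, m', ad, rfl, rfl, rfl, rfl, h₁, h₂⟩ :=
    (h₀.isAdapted he₀).exists_generic_lift_of_isField (isField_ΓSpec hK) hrn ι.appTop.hom
      (Spec.map σ).appTop.hom hσ' hX hX'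
  obtain ⟨Y, τ, j, g, f, wg, e, hτ, hj, hg, hf, he, hcut⟩ :=
    exists_smooth_family hH hpq hu ι x c hc he₀ ad h₀
  let pt : PrimeSpectrum K := IsLocalRing.closedPoint _
  obtain ⟨y₁, hy₁, hinj⟩ := exists_specializes_injective τ (j pt)
  have hgz : g (j pt) = z := by
    have h3 : (j ≫ g) pt = z := by
      rw [hg]
      exact P.fromSpecResidueField_apply z _
    exact h3
  have hspec : g y₁ ⤳ z := hgz ▸ hy₁.map g.continuous
  refine closure_mono (Set.singleton_subset_iff.mpr ?_) (specializes_iff_mem_closure.mp hspec)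
  let ξ := Y.fromSpecResidueField y₁
  let pt₁ : PrimeSpectrum (Y.residueField y₁) := IsLocalRing.closedPoint _
  have hpt : ((ξ ≫ g) ≫ t) pt₁ = t (g y₁) :=
    congrArg (fun y => t (g y)) (Y.fromSpecResidueField_apply y₁ _)
  change t (g y₁) ∈ genericLocus hrn p lam G ⊓ genericLocus hrn q lam' G
  rw [← hpt]
  have hcut₁ := hcut.pullbackOver hH (rfl : ξ ≫ f = _) he
  have he₁ := he.pullTop (rfl : ξ ≫ f = _)
  have w₁ : (ξ ≫ g) ≫ t ≫ G.π = ξ ≫ f := by rw [Category.assoc, wg]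
  have w₂ : ((ξ ≫ g) ≫ t) ≫ G.π = ξ ≫ f := by rw [Category.assoc, w₁]
  have hv : (G.taut.member.pullbackOver w₂).Cut (fun i => pullTop (rfl : ξ ≫ f = _) (e i)) r
      (gmap ξ.appTop.hom (gmap τ.appTop.hom w)) := by
    rw [G.pullbackOver_eq hH htop w₁ w₂, ← Subsheaf.pullbackOver_comp wg hH rfl w₁
      (u.V.isSubbundle _)]
    exact hcut₁.V _
  have ad₁ := hcut₁.isAdapted he₁
  -- The residue field of `y₁` contains the power series ring, so nonzero minors stay nonzero there.
  have hne : ∀ {a b d : ℕ} {v z : GLn n Γ(Spec C, ⊤)}, minorIdeal (z * v⁻¹).1 b a d ≠ ⊥ →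
      minorIdeal (gmap ξ.appTop.hom (gmap τ.appTop.hom z) *
        (gmap ξ.appTop.hom (gmap τ.appTop.hom v))⁻¹).1 b a d ≠ ⊥ := fun h => by
    rw [← gmap_appTop_comp, ← gmap_appTop_comp]
    exact minorIdeal_gmap_ne_bot hinj h
  have hred : IsReduced (Spec (Y.residueField y₁)) := inferInstance
  have hsub : Subsingleton (Spec (Y.residueField y₁)) :=
    inferInstanceAs (Subsingleton (PrimeSpectrum (Y.residueField y₁)))
  exact ⟨(mem_genericLocus_iff hH hrn G w₂ he₁ hv hcut₁.p _).mpr fun a ha har => hne (h₁ a ha har),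
    (mem_genericLocus_iff hH hrn G w₂ he₁ (hv.congr ad₁.top_eq) hcut₁.q _).mpr
      fun a ha har => hne (h₂ a ha har)⟩

end

/-! ### Resolution of Richardson varieties -/

section

variable {S : Scheme.{u}} {H : S.Modules} {r n : ℕ}

theorem AdmissiblePartition.le_of_mem_corners (lam : AdmissiblePartition r n) (hrn : r ≤ n) :
    ∀ d ∈ lam.corners, d ≤ n :=
  fun _ hd => (Finset.mem_Icc.mp (lam.corners_subset hd)).2.trans hrn

theorem Resolution.toGrassmannian_comp (hr : 1 ≤ r) (hrn : r ≤ n) (p : CompleteFlag H n)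
    (lam : AdmissiblePartition r n) (W : FlagBundle H lam.corners) (G : GrassmannianBundle H r) :
    Resolution.toGrassmannian hr hrn p lam W G ≫ G.π =
      (resolutionIdeal hrn p lam W).subschemeι ≫ W.π := by
  rw [← (W.toGrassmannian_spec (lam.self_mem_corners hr) G).choose, ← Category.assoc]
  rfl

theorem Resolution.isProper_toGrassmannian_comp (hH : IsVectorBundle H n) (hr : 1 ≤ r) (hrn : r ≤ n)
    (p : CompleteFlag H n) (lam : AdmissiblePartition r n) (W : FlagBundle H lam.corners)
    (G : GrassmannianBundle H r) :
    IsProper (Resolution.toGrassmannian hr hrn p lam W G ≫ G.π) := by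
  rw [Resolution.toGrassmannian_comp]
  have := FlagBundle.isProper hH (lam.le_of_mem_corners hrn) W
  exact inferInstanceAs (IsProper ((resolutionIdeal hrn p lam W).subschemeι ≫ W.π))

theorem Resolution.isProper_toGrassmannian (hH : IsVectorBundle H n) (hr : 1 ≤ r) (hrn : r ≤ n)
    (p : CompleteFlag H n) (lam : AdmissiblePartition r n) (W : FlagBundle H lam.corners)
    (G : GrassmannianBundle H r) : IsProper (Resolution.toGrassmannian hr hrn p lam W G) := by
  have := G.isSeparated hH
  have := Resolution.isProper_toGrassmannian_comp hH hr hrn p lam W G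
  exact IsProper.of_comp _ G.π

theorem ResolutionProduct.isProper_toGrassmannian (hH : IsVectorBundle H n) (hr : 1 ≤ r)
    (hrn : r ≤ n) (p q : CompleteFlag H n) (lam lam' : AdmissiblePartition r n)
    (W : FlagBundle H lam.corners) (W' : FlagBundle H lam'.corners) (G : GrassmannianBundle H r) :
    IsProper (ResolutionProduct.toGrassmannian hr hrn p q lam lam' W W' G) := by
  have := Resolution.isProper_toGrassmannian hH hr hrn p lam W G
  have := Resolution.isProper_toGrassmannian hH hr hrn q lam' W' G
  unfold ResolutionProduct.toGrassmannian
  infer_instance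

/-- Proper and smooth morphisms are locally of finite type, and over a field, which is Noetherian,
finite type implies finite presentation. -/
theorem locallyOfFinitePresentation_comp {k : Type u} [Field k] {P Y : Scheme.{u}}
    (s : S ⟶ Spec (CommRingCat.of k)) [Smooth s] (t : P ⟶ Y) [IsProper t] (π : Y ⟶ S) [IsProper π] :
    LocallyOfFinitePresentation ((t ≫ π) ≫ s) := by
  have : LocallyOfFiniteType ((t ≫ π) ≫ s) := inferInstance
  infer_instance

end

end

end RelGrass

theorem mainTheorem2 {k : Type u} [Field k] {S : Scheme.{u}} (s : S ⟶ Spec (CommRingCat.of k))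
    (hs : Smooth s) {n r : ℕ} (hr : 1 ≤ r) (hrn : r ≤ n)
    (H : S.Modules) (hH : RelGrass.IsVectorBundle H n)
    (p q : RelGrass.CompleteFlag H n) (hpq : RelGrass.IsVersal s p q)
    (lam lam' : RelGrass.AdmissiblePartition r n) :
    (Nonempty (RelGrass.GrassmannianBundle H r) ∧
      Nonempty (RelGrass.FlagBundle H lam.corners) ∧
      Nonempty (RelGrass.FlagBundle H lam'.corners)) ∧
    ∀ (G : RelGrass.GrassmannianBundle H r)
      (W : RelGrass.FlagBundle H lam.corners) (W' : RelGrass.FlagBundle H lam'.corners),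
      ∃ f : RelGrass.ResolutionProduct hr hrn p q lam lam' W W' G ⟶
          (RelGrass.richardsonIdeal hrn p q lam lam' G).subscheme,
        f ≫ (RelGrass.richardsonIdeal hrn p q lam lam' G).subschemeι =
          RelGrass.ResolutionProduct.toGrassmannian hr hrn p q lam lam' W W' G ∧
        RelGrass.IsResolution
          (RelGrass.ResolutionProduct.toGrassmannian hr hrn p q lam lam' W W' G ≫ G.π ≫ s) f := by
  refine ⟨⟨RelGrass.nonempty_grassmannianBundle hH hrn,
    ⟨(RelGrass.FlagBundle.exists_isProper hH (lam.le_of_mem_corners hrn)).choose⟩,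
    ⟨(RelGrass.FlagBundle.exists_isProper hH (lam'.le_of_mem_corners hrn)).choose⟩⟩,
    fun G W W' => ?_⟩
  obtain ⟨u, hu, htop⟩ := RelGrass.exists_universal_flagPair hH hr hrn p q lam lam' W W' G
  have := RelGrass.GrassmannianBundle.isProper hH hrn G
  have := RelGrass.ResolutionProduct.isProper_toGrassmannian hH hr hrn p q lam lam' W W' G
  generalize RelGrass.ResolutionProduct.toGrassmannian hr hrn p q lam lam' W W' G = t at *
  obtain ⟨f, hf⟩ := (RelGrass.exists_lift_iff_le_ker _ t).mpr
    (RelGrass.richardsonIdeal_le_ker hH htop)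
  have hdense := hu.dense_preimage hH hpq htop
  have hiso := hu.isIso_morphismRestrict hH htop hf
  have hsurj := hu.surjective hH htop hf
  refine ⟨f, hf, ?_, ?_, _, ?_, ?_, hiso⟩
  · have := RelGrass.locallyOfFinitePresentation_comp s t G.π
    rw [← Category.assoc]
    exact hu.smooth hH hpq
  · have : IsProper (f ≫ (RelGrass.richardsonIdeal hrn p q lam lam' G).subschemeι) := by rwa [hf]
    exact IsProper.of_comp f (RelGrass.richardsonIdeal hrn p q lam lam' G).subschemeι
  -- Density in the target: by surjectivity the open set is the image of its preimage, and a
  -- continuous surjection carries dense sets to dense sets.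
  · subst hf
    have h1 := hsurj.denseRange.dense_image f.continuous hdense
    rwa [Scheme.Hom.comp_preimage, TopologicalSpace.Opens.map_coe,
      Set.image_preimage_eq _ hsurj] at h1
  · subst hf
    exact hdense
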